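/- **Setting.** Let $\mathbb X$ be $\mathbb R$ or a subinterval of it, and let $\mathcal L=\bigcup_{k\in\mathbb Z}\mathcal L_k$ be a lattice of intervals: each generation $\mathcal L_k$ is a disjoint covering of $\mathbb X$ by bounded intervals $[\alpha,\beta)$, and every $I\in\mathcal L_k$ is a finite union of intervals of $\mathcal L_{k+1}$ (possibly only of $I$ itself). The rank $\operatorname{rk}(I)$ is the largest $k$ with $I\in\mathcal L_k$; the children of $I$ are the $J\in\mathcal L_{\operatorname{rk}(I)+1}$ with $J\subset I$ (an interval that is never divided has no children), and $I$ is the parent of its children. Put $\mathbb E_I f=\bigl(|I|^{-1}\int_I f\bigr)\mathbf 1_I$ and $\Delta_I f=\sum_{J\in\operatorname{child}(I)}\mathbb E_J f-\mathbb E_I f$ ($\Delta_I=0$ if $I$ has no children), and let $D_I$ be the space of functions supported on $I$, constant on the children of $I$, with integral $0$ ($D_I=\{0\}$ if $I$ has no children). Let $\mathfrak A^{0,\mathrm{fin}}_{-\infty}$ be the set of intervals of finite length of the form $\bigcup_{k\in\mathbb Z}I_k$ with $I_k\in\mathcal L_k$, $I_k\subset I_{k-1}$. All functions are real valued, or all are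 complex valued, and they are measurable with respect to the $\sigma$-algebra $\mathfrak A_\infty$ generated by $\mathcal L$; a function is locally integrable if it is integrable on every $I\in\mathcal L$. A martingale transform $T$ is given by linear blocks $T_I:D_I\to D_I$, $I\in\mathcal L$, through $T f=\sum_{I\in\mathcal L}T_I\Delta_I f$, with $T\mathbf 1_I=0$ for $I\in\mathfrak A^{0,\mathrm{fin}}_{-\infty}$. It is defined on finite martingale sums, i.e. finite sums of elements of the $D_I$ ($I\in\mathcal L$) and of multiples of $\mathbf 1_I$ ($I\in\mathfrak A^{0,\mathrm{fin}}_{-\infty}$); these are dense in $L^p$ for $1<p<\infty$, and norms of operators in $L^p$ are computed on them. For a locally integrable $h$, $u=Th$ means that $u$ is locally integrable, $\Delta_I u=T_I\Delta_I h$ for all $I\in\mathcal L$, and $u$ is integrable with integral $0$ over every $I\in\mathfrak A^{0,\mathrm{fin}}_{-\infty}$; the commutator is $[M_b,T]f=b\,(Tf)-T(bf)$. Adjoints $T_I^*$ are taken with respect to the linear duality $\int fg$. Let $(\Lambda_b^1)_I h=\Delta_I\bigl[(\Delta_I b)h\bigr]$ for $h\in D_I$. For a locally integrable $b$ consider the formal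 sum $\widetilde b_0=\sum_{I\in\mathcal L\setminus\mathfrak A^{0,\mathrm{fin}}_{-\infty}}\Delta_I b$. For $J\in\mathcal L$ with parent $I$ let $x_J$ be the value of $\Delta_I b$ on $J$ if $I\notin\mathfrak A^{0,\mathrm{fin}}_{-\infty}$, and $x_J=0$ otherwise (also if $J$ has no parent); put $$\|\widetilde b_0\|_{\mathrm{BMO}}=\sup_{J\in\mathcal L}\Bigl(\frac1{|J|}\int_J\sum_{I\in\mathcal L,\ I\subset J}|x_I|^2\mathbf 1_I\,dx\Bigr)^{1/2},$$ and say $\widetilde b_0\in\mathrm{BMO}$ if this is finite. Let $1<p<\infty$, $1/p+1/p'=1$, and consider the conditions 1. $\widetilde b_0\in\mathrm{BMO}$; 2. for every $I\in\mathcal L\cap\mathfrak A^{0,\mathrm{fin}}_{-\infty}$, $\ \|T_I\Delta_I b\|_p\le C_1|I|^{1/p}$ and $\|T_I^*\Delta_I b\|_{p'}\le C_1|I|^{1/p'}$; 3. for every $I\in\mathcal L\cap\mathfrak A^{0,\mathrm{fin}}_{-\infty}$, $\ \bigl\|[(\Lambda_b^1)_I,T_I]\bigr\|_{L^p\to L^p}\le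 C_2$ on $D_I$. **Proposition.** (a) There is a constant $C=C(p)$ such that for every lattice, every martingale transform $T$ bounded in $L^p$ and every locally integrable $b$ for which (1), (2), (3) hold with some $0\le C_1,C_2<\infty$, the commutator $[M_b,T]$ is bounded in $L^p$ and $$\|[M_b,T]\|_{L^p\to L^p}\le C\bigl(\|T\|_{L^p\to L^p}\|\widetilde b_0\|_{\mathrm{BMO}}+C_1+C_2\bigr).$$ (b) Conversely, let $T$ be a martingale transform (not necessarily bounded) whose blocks $T_I$ are uniformly bounded in $L^p$, and suppose that for some $\varepsilon,K>0$ it is strongly $(p,\varepsilon,K)$ mixing or, in the case $p=2$, weakly $(2,\varepsilon,K)$ mixing. If $b$ is locally integrable and $[M_b,T]$ is bounded in $L^p$, then (1) holds, and (2) and (3) hold with some finite $C_1,C_2$. Hence for $T$ bounded in $L^p$ and mixing in this sense, (1)–(3) are necessary and sufficient for the boundedness of $[M_b,T]$ in $L^p$. Here a child $I$ of $I'$ is $(p,\varepsilon,K)$ non-degenerate for $T$ if there is $h\in D_{I'}$ with $\|h\|_p=1$, $h|_I=0$, $\|\mathbf 1_I T_{I'}h\|_p\ge\varepsilon$ and,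 if $|I|<|I'|/K$, also $\|h\|_\infty\le K|I'|^{-1/p}$. $T$ is strongly $(p,\varepsilon,K)$ mixing if every interval with a parent is $(p,\varepsilon,K)$ non-degenerate for $T$, and weakly $(p,\varepsilon,K)$ mixing if every interval with a parent is $(p,\varepsilon,K)$ non-degenerate for $T$ or $(p',\varepsilon,K)$ non-degenerate for $T^*$. -/

import Mathlib

open MeasureTheory Set
open scoped NNReal ENNReal

noncomputable section

/-- A lattice of intervals on `carrier`, which is the real line or one of its subintervals.
`gen k` is the generation of index `k`: a disjoint covering of the carrier by bounded intervals
`[a, b)`; every interval of generation `k` is a finite union of intervals of generation `k + 1`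
(possibly of only one). -/
structure IntervalLattice where
  carrier : Set ℝ
  ordConnected : carrier.OrdConnected
  gen : ℤ → Set (Set ℝ)
  isInterval : ∀ k, ∀ I ∈ gen k, ∃ a b : ℝ, a < b ∧ I = Set.Ico a b
  pairwiseDisjoint : ∀ k, (gen k).PairwiseDisjoint id
  covers : ∀ k, ⋃₀ gen k = carrier
  refines : ∀ k, ∀ I ∈ gen k, ∃ F : Finset (Set ℝ), (F : Set (Set ℝ)) ⊆ gen (k + 1) ∧
    I = ⋃₀ (F : Set (Set ℝ))

namespace IntervalLattice

variable (L : IntervalLattice)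

/-- The intervals of the lattice (the union of all generations). -/
def Interval : Type := {I : Set ℝ // ∃ k, I ∈ L.gen k}

instance : CoeOut L.Interval (Set ℝ) := ⟨Subtype.val⟩

/-- `k` is the rank of `I`: the largest index of a generation that contains `I`. -/
def IsRank (I : L.Interval) (k : ℤ) : Prop := IsGreatest {j : ℤ | (I : Set ℝ) ∈ L.gen j} k

/-- The children of `I`: the intervals `J ⊆ I` of generation `rk I + 1`. An interval that belongs
to generations of arbitrarily large index is never divided and has no children. -/
def child (I : L.Interval) : Set L.Interval :=
  {J | ∃ k, L.IsRank I k ∧ (J : Set ℝ) ∈ L.gen (k + 1) ∧ (J : Set ℝ) ⊆ I}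

/-- The intervals `⋃ k, I k` with `I k` in generation `k` and `I k ⊆ I (k - 1)`. -/
def limitIntervals : Set (Set ℝ) :=
  {I | ∃ J : ℤ → Set ℝ, (∀ k, J k ∈ L.gen k ∧ J k ⊆ J (k - 1)) ∧ I = ⋃ k, J k}

/-- The limit intervals of finite length. -/
def finLimitIntervals : Set (Set ℝ) := {I ∈ L.limitIntervals | volume I < ∞}

/-- The smallest σ-algebra that contains all generations. -/
abbrev sigmaInf : MeasurableSpace ℝ := MeasurableSpace.generateFrom (⋃ k, L.gen k)

/-- Lebesgue measure on the carrier. -/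
def measure : Measure ℝ := volume.restrict L.carrier

/-! ### Elementary facts about children -/

variable {L}

lemma Interval.exists_Ico (I : L.Interval) :
    ∃ a b : ℝ, a < b ∧ (I : Set ℝ) = Set.Ico a b := by
  obtain ⟨k, hk⟩ := I.2
  exact L.isInterval k _ hk

lemma Interval.measurableSet (I : L.Interval) : MeasurableSet (I : Set ℝ) := by
  obtain ⟨a, b, -, h⟩ := I.exists_Ico
  rw [h]; exact measurableSet_Ico

lemma Interval.volume_ne_top (I : L.Interval) : volume (I : Set ℝ) ≠ ∞ := by
  obtain ⟨a, b, -, h⟩ := I.exists_Ico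
  rw [h]; simp

lemma Interval.volume_ne_zero (I : L.Interval) : volume (I : Set ℝ) ≠ 0 := by
  obtain ⟨a, b, hab, h⟩ := I.exists_Ico
  rw [h]; simpa using hab

lemma Interval.nonempty (I : L.Interval) : (I : Set ℝ).Nonempty := by
  obtain ⟨a, b, hab, h⟩ := I.exists_Ico
  rw [h]; exact Set.nonempty_Ico.2 hab

lemma child_subset {I J : L.Interval} (h : J ∈ L.child I) : (J : Set ℝ) ⊆ I := by
  obtain ⟨k, -, -, h⟩ := h
  exact h

lemma child_eq_of_mem {I J J' : L.Interval} (h : J ∈ L.child I) (h' : J' ∈ L.child I) {x : ℝ}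
    (hx : x ∈ (J : Set ℝ)) (hx' : x ∈ (J' : Set ℝ)) : J = J' := by
  obtain ⟨k, hk, hJ, -⟩ := h
  obtain ⟨k', hk', hJ', -⟩ := h'
  obtain rfl := hk.unique hk'
  apply Subtype.ext
  by_contra hne
  exact Set.disjoint_left.1 (L.pairwiseDisjoint _ hJ hJ' hne) hx hx'

lemma exists_child_of_mem {I : L.Interval} (h : (L.child I).Nonempty) {x : ℝ}
    (hx : x ∈ (I : Set ℝ)) : ∃ J ∈ L.child I, x ∈ (J : Set ℝ) := by
  obtain ⟨-, k, hk, -, -⟩ := h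
  obtain ⟨F, hF, hI⟩ := L.refines k _ hk.1
  rw [hI] at hx
  obtain ⟨J, hJF, hxJ⟩ := hx
  exact ⟨⟨J, _, hF hJF⟩, ⟨k, hk, hF hJF, by rw [hI]; exact Set.subset_sUnion_of_mem hJF⟩, hxJ⟩

lemma finite_child (I : L.Interval) : (L.child I).Finite := by
  by_cases h : ∃ k, L.IsRank I k
  · obtain ⟨k, hk⟩ := h
    obtain ⟨F, hF, hI⟩ := L.refines k _ hk.1
    refine Set.Finite.of_finite_image (f := Subtype.val)
      (F.finite_toSet.subset ?_) Subtype.val_injective.injOn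
    rintro _ ⟨J, ⟨k', hk', hJ, hJI⟩, rfl⟩
    obtain rfl := hk.unique hk'
    obtain ⟨x, hx⟩ := J.nonempty
    have hxI := hJI hx
    rw [hI] at hxI
    obtain ⟨J', hJ'F, hxJ'⟩ := hxI
    by_cases hne : J.1 = J'
    · rw [hne]; exact hJ'F
    · exact absurd hxJ' (Set.disjoint_left.1 (L.pairwiseDisjoint _ hJ (hF hJ'F) hne) hx)
  · have : L.child I = ∅ := by
      ext J
      simp only [Set.mem_empty_iff_false, iff_false]
      rintro ⟨k, hk, -⟩
      exact h ⟨k, hk⟩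
    rw [this]; exact Set.finite_empty

/-! ### Averages and martingale differences -/

variable {𝕜 : Type*} [RCLike 𝕜]

/-- The averaging operator `f ↦ ⟨f⟩_I 1_I`. -/
def expect (I : Set ℝ) (f : ℝ → 𝕜) : ℝ → 𝕜 := I.indicator fun _ => ⨍ x in I, f x

variable (L) in
/-- A function is locally integrable if it is integrable on every interval of the lattice. -/
def LocIntegrable (f : ℝ → 𝕜) : Prop := ∀ I : L.Interval, IntegrableOn f (I : Set ℝ)

lemma integrable_of_step {I : L.Interval} {f : ℝ → 𝕜}
    (h0 : ∀ x, (∀ J ∈ L.child I, x ∉ (J : Set ℝ)) → f x = 0)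
    (hc : ∀ J ∈ L.child I, ∀ x ∈ (J : Set ℝ), ∀ y ∈ (J : Set ℝ), f x = f y) :
    Integrable f := by
  classical
  have hf : f = fun x => ∑ J ∈ (finite_child I).toFinset,
      (J : Set ℝ).indicator (fun _ => f J.nonempty.some) x := by
    funext x
    by_cases hx : ∃ J ∈ L.child I, x ∈ (J : Set ℝ)
    · obtain ⟨J, hJ, hxJ⟩ := hx
      rw [Finset.sum_eq_single J]
      · rw [Set.indicator_of_mem hxJ]
        exact hc J hJ x hxJ _ J.nonempty.some_mem
      · intro J' hJ' hne
        refine Set.indicator_of_notMem (fun hx' => hne ?_) _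
        exact child_eq_of_mem ((finite_child I).mem_toFinset.1 hJ') hJ hx' hxJ
      · intro hn
        exact absurd ((finite_child I).mem_toFinset.2 hJ) hn
    · push Not at hx
      rw [h0 x hx, Finset.sum_eq_zero]
      intro J hJ
      exact Set.indicator_of_notMem (hx J ((finite_child I).mem_toFinset.1 hJ)) _
  rw [hf]
  refine integrable_finsetSum _ fun J _ => ?_
  rw [integrable_indicator_iff J.measurableSet]
  exact integrableOn_const J.volume_ne_top

variable (L 𝕜) in
/-- The martingale difference space of `I`: the functions that vanish off the children of `I`, are
constant on every child of `I` and have integral zero. -/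
def D (I : L.Interval) : Submodule 𝕜 (ℝ → 𝕜) where
  carrier := {f | (∀ x, (∀ J ∈ L.child I, x ∉ (J : Set ℝ)) → f x = 0) ∧
    (∀ J ∈ L.child I, ∀ x ∈ (J : Set ℝ), ∀ y ∈ (J : Set ℝ), f x = f y) ∧ ∫ x, f x = 0}
  add_mem' := by
    rintro f g ⟨hf0, hfc, hfi⟩ ⟨hg0, hgc, hgi⟩
    refine ⟨fun x hx => by simp [hf0 x hx, hg0 x hx], fun J hJ x hx y hy => ?_, ?_⟩
    · simp [hfc J hJ x hx y hy, hgc J hJ x hx y hy]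
    · simp only [Pi.add_apply]
      rw [integral_add (integrable_of_step hf0 hfc) (integrable_of_step hg0 hgc), hfi, hgi,
        add_zero]
  zero_mem' := by simp
  smul_mem' := by
    rintro c f ⟨hf0, hfc, hfi⟩
    refine ⟨fun x hx => by simp [hf0 x hx], fun J hJ x hx y hy => ?_, ?_⟩
    · simp [hfc J hJ x hx y hy]
    · simp only [Pi.smul_apply]
      rw [integral_smul, hfi, smul_zero]

open Classical in
/-- The function `(∑ J ∈ child I, E_J f) - E_I f`, understood as `0` if `I` is never divided. -/
def diffFun (I : L.Interval) (f : ℝ → 𝕜) : ℝ → 𝕜 :=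
  if (L.child I).Nonempty then
    (∑ J ∈ (finite_child I).toFinset, expect (J : Set ℝ) f) - expect (I : Set ℝ) f
  else 0

lemma integral_expect (I : L.Interval) (f : ℝ → 𝕜) :
    ∫ x, expect (I : Set ℝ) f x = ∫ x in (I : Set ℝ), f x := by
  unfold expect
  rw [integral_indicator I.measurableSet, setIntegral_const, setAverage_eq, smul_smul,
    mul_inv_cancel₀, one_smul]
  rw [Measure.real, ENNReal.toReal_ne_zero]
  exact ⟨I.volume_ne_zero, I.volume_ne_top⟩

lemma integrable_expect (I : L.Interval) (f : ℝ → 𝕜) : Integrable (expect (I : Set ℝ) f) := by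
  unfold expect
  rw [integrable_indicator_iff I.measurableSet]
  exact integrableOn_const I.volume_ne_top

lemma diffFun_mem (I : L.Interval) {f : ℝ → 𝕜} (hf : IntegrableOn f (I : Set ℝ)) :
    diffFun I f ∈ L.D 𝕜 I := by
  classical
  by_cases hI : (L.child I).Nonempty
  swap
  · rw [diffFun, if_neg hI]; exact Submodule.zero_mem _
  rw [diffFun, if_pos hI]
  refine ⟨fun x hx => ?_, fun J hJ x hx y hy => ?_, ?_⟩
  · have hxI : x ∉ (I : Set ℝ) := fun h => by
      obtain ⟨J, hJ, hxJ⟩ := exists_child_of_mem hI h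
      exact hx J hJ hxJ
    have h1 : ∀ J ∈ (finite_child I).toFinset, expect (J : Set ℝ) f x = 0 := fun J hJ =>
      Set.indicator_of_notMem (hx J ((finite_child I).mem_toFinset.1 hJ)) _
    rw [Pi.sub_apply, Finset.sum_apply, Finset.sum_eq_zero h1, expect,
      Set.indicator_of_notMem hxI, sub_zero]
  · have key : ∀ J' ∈ (finite_child I).toFinset,
        expect (J' : Set ℝ) f x = expect (J' : Set ℝ) f y := by
      intro J' hJ'
      have hJ'c := (finite_child I).mem_toFinset.1 hJ'
      by_cases h : J' = J
      · subst h; simp [expect, hx, hy]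
      · have hx' : x ∉ (J' : Set ℝ) := fun hx' => h (child_eq_of_mem hJ'c hJ hx' hx)
        have hy' : y ∉ (J' : Set ℝ) := fun hy' => h (child_eq_of_mem hJ'c hJ hy' hy)
        simp [expect, hx', hy']
    have hI' : expect (I : Set ℝ) f x = expect (I : Set ℝ) f y := by
      simp [expect, child_subset hJ hx, child_subset hJ hy]
    simp [Finset.sum_congr rfl key, hI']
  · have hU : (I : Set ℝ) = ⋃ J ∈ (finite_child I).toFinset, (J : Set ℝ) := by
      ext x
      simp only [Set.mem_iUnion, Set.Finite.mem_toFinset, exists_prop]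
      exact ⟨fun h => exists_child_of_mem hI h, fun ⟨J, hJ, hx⟩ => child_subset hJ hx⟩
    have hsum : ∫ x in (I : Set ℝ), f x =
        ∑ J ∈ (finite_child I).toFinset, ∫ x in (J : Set ℝ), f x := by
      conv_lhs => rw [hU]
      refine integral_biUnion_finset _ (fun J _ => J.measurableSet) ?_ fun J hJ =>
        hf.mono_set (child_subset ((finite_child I).mem_toFinset.1 hJ))
      intro J hJ J' hJ' hne
      refine Set.disjoint_left.2 fun x hx hx' => hne ?_
      exact child_eq_of_mem ((finite_child I).mem_toFinset.1 hJ)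
        ((finite_child I).mem_toFinset.1 hJ') hx hx'
    simp only [Pi.sub_apply, Finset.sum_apply]
    rw [integral_sub (integrable_finsetSum _ fun J _ => integrable_expect J f)
      (integrable_expect I f), integral_finsetSum _ fun J _ => integrable_expect J f,
      integral_expect, hsum, sub_eq_zero]
    exact Finset.sum_congr rfl fun J _ => integral_expect J f

open Classical in
/-- The martingale difference `Δ_I f`, for `f` integrable on `I`, as an element of `D I`. -/
def diff (I : L.Interval) (f : ℝ → 𝕜) : L.D 𝕜 I :=
  if hf : IntegrableOn f (I : Set ℝ) then ⟨diffFun I f, diffFun_mem I hf⟩ else 0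

/-! ### The bilinear duality on a martingale difference space -/

lemma integrable_mul (I : L.Interval) (f g : L.D 𝕜 I) :
    Integrable fun x => (f : ℝ → 𝕜) x * (g : ℝ → 𝕜) x := by
  refine integrable_of_step (I := I) (fun x hx => ?_) fun J hJ x hx y hy => ?_
  · rw [f.2.1 x hx, zero_mul]
  · rw [f.2.2.1 J hJ x hx y hy, g.2.2.1 J hJ x hx y hy]

/-- The bilinear (not sesquilinear) pairing `⟨f, g⟩ = ∫ f g` on `D I`. -/
def pairing (I : L.Interval) : LinearMap.BilinForm 𝕜 (L.D 𝕜 I) :=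
  LinearMap.mk₂ 𝕜 (fun f g => ∫ x, (f : ℝ → 𝕜) x * (g : ℝ → 𝕜) x)
    (fun f f' g => by
      simp only [Submodule.coe_add, Pi.add_apply, add_mul]
      exact integral_add (integrable_mul I f g) (integrable_mul I f' g))
    (fun c f g => by
      simp only [Submodule.coe_smul, Pi.smul_apply, smul_eq_mul, mul_assoc]
      exact integral_const_mul c _)
    (fun f g g' => by
      simp only [Submodule.coe_add, Pi.add_apply, mul_add]
      exact integral_add (integrable_mul I f g) (integrable_mul I f g'))
    (fun c f g => by
      simp only [Submodule.coe_smul, Pi.smul_apply, smul_eq_mul, mul_left_comm _ c]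
      exact integral_const_mul c _)

lemma pairing_comm (I : L.Interval) (f g : L.D 𝕜 I) : pairing I f g = pairing I g f := by
  simp only [pairing, LinearMap.mk₂_apply, mul_comm]

lemma separatingLeft_pairing (I : L.Interval) :
    (pairing I : LinearMap.BilinForm 𝕜 (L.D 𝕜 I)).SeparatingLeft := by
  intro f hf
  have hmem : (fun x => (starRingEnd 𝕜) ((f : ℝ → 𝕜) x)) ∈ L.D 𝕜 I := by
    refine ⟨fun x hx => by simp [f.2.1 x hx], fun J hJ x hx y hy => ?_, ?_⟩
    · simp only [f.2.2.1 J hJ x hx y hy]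
    · rw [integral_conj, f.2.2.2, map_zero]
  have h0 := hf ⟨_, hmem⟩
  simp only [pairing, LinearMap.mk₂_apply, RCLike.mul_conj] at h0
  have h1 : ∫ x, ‖(f : ℝ → 𝕜) x‖ ^ 2 = 0 := by
    have : (∫ x, ((‖(f : ℝ → 𝕜) x‖ ^ 2 : ℝ) : 𝕜)) = 0 := by simpa using h0
    rw [integral_ofReal] at this
    exact_mod_cast this
  have hint : Integrable fun x => ‖(f : ℝ → 𝕜) x‖ ^ 2 := by
    have h2 : Integrable fun x => ((‖(f : ℝ → 𝕜) x‖ ^ 2 : ℝ) : 𝕜) := by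
      have := integrable_mul I f ⟨_, hmem⟩
      simpa [RCLike.mul_conj] using this
    simpa using h2.re
  rw [integral_eq_zero_iff_of_nonneg (fun x => by positivity) hint] at h1
  apply Subtype.ext
  funext x
  by_cases hx : ∃ J ∈ L.child I, x ∈ (J : Set ℝ)
  · obtain ⟨J, hJ, hxJ⟩ := hx
    by_contra hne
    refine J.volume_ne_zero (measure_mono_null ?_ (ae_iff.1 h1))
    intro y hy
    simp only [Set.mem_ofPred_eq, Pi.zero_apply]
    rw [f.2.2.1 J hJ y hy x hxJ]
    simpa using hne
  · push Not at hx
    exact f.2.1 x hx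

lemma nondegenerate_pairing (I : L.Interval) :
    (pairing I : LinearMap.BilinForm 𝕜 (L.D 𝕜 I)).Nondegenerate := by
  refine ⟨separatingLeft_pairing I, fun f hf => separatingLeft_pairing I f fun g => ?_⟩
  rw [pairing_comm]; exact hf g

instance finiteDimensional_D (I : L.Interval) : FiniteDimensional 𝕜 (L.D 𝕜 I) := by
  have : Finite (L.child I) := finite_child I
  let φ : L.D 𝕜 I →ₗ[𝕜] (L.child I → 𝕜) :=
    { toFun := fun f J => (f : ℝ → 𝕜) J.1.nonempty.some
      map_add' := fun f g => by funext J; simp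
      map_smul' := fun c f => by funext J; simp }
  refine FiniteDimensional.of_injective φ fun f g hfg => ?_
  apply Subtype.ext
  funext x
  by_cases hx : ∃ J ∈ L.child I, x ∈ (J : Set ℝ)
  · obtain ⟨J, hJ, hxJ⟩ := hx
    rw [f.2.2.1 J hJ x hxJ _ J.nonempty.some_mem, g.2.2.1 J hJ x hxJ _ J.nonempty.some_mem]
    exact congrFun hfg ⟨J, hJ⟩
  · push Not at hx
    rw [f.2.1 x hx, g.2.1 x hx]

/-! ### Martingale transforms -/

variable (L 𝕜) in
/-- A martingale transform, given by its blocks `T_I : D_I → D_I`. -/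
structure MartingaleTransform where
  block : ∀ I : L.Interval, L.D 𝕜 I →ₗ[𝕜] L.D 𝕜 I

variable (L 𝕜) in
/-- The functions with a finite martingale decomposition: finite sums of elements of the spaces
`D I` and of multiples of `1_I`, where `I` runs over the limit intervals of finite length. -/
def finSums : Submodule 𝕜 (ℝ → 𝕜) :=
  Submodule.span 𝕜 ((⋃ I : L.Interval, (L.D 𝕜 I : Set (ℝ → 𝕜))) ∪
    ((fun I : Set ℝ => I.indicator fun _ => (1 : 𝕜)) '' L.finLimitIntervals))

/-- The block `h ↦ Δ_I ((Δ_I b) h)` of the operator `Λ_b^1` on `D_I`. -/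
def lambdaBlock (b : ℝ → 𝕜) (I : L.Interval) (h : L.D 𝕜 I) : L.D 𝕜 I :=
  diff I fun x => (diff I b : ℝ → 𝕜) x * (h : ℝ → 𝕜) x

namespace MartingaleTransform

variable (T : MartingaleTransform L 𝕜)

/-- The adjoint with respect to the linear duality `∫ f g`. -/
def adjoint : MartingaleTransform L 𝕜 where
  block I := (pairing I).leftAdjointOfNondegenerate (nondegenerate_pairing I) (T.block I)

lemma integral_adjoint_mul (I : L.Interval) (f g : L.D 𝕜 I) :
    ∫ x, (T.adjoint.block I f : ℝ → 𝕜) x * (g : ℝ → 𝕜) x =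
      ∫ x, (f : ℝ → 𝕜) x * (T.block I g : ℝ → 𝕜) x :=
  (pairing I).isAdjointPairLeftAdjointOfNondegenerate (nondegenerate_pairing I) (T.block I) f g

/-- The action `T f = ∑ I, T_I (Δ_I f)` on functions with a finite martingale decomposition, where
the sum has finitely many nonzero terms; in particular `T 1_I = 0` for the limit intervals `I` of
finite length. -/
def apply (f : ℝ → 𝕜) : ℝ → 𝕜 := ∑ᶠ I : L.Interval, (T.block I (diff I f) : ℝ → 𝕜)

/-- The norm of `T` as an operator in `L^p`, computed on the dense subspace of functions with a
finite martingale decomposition. -/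
def opNorm (p : ℝ) : ℝ≥0∞ :=
  ⨆ f ∈ L.finSums 𝕜, eLpNorm (T.apply f) (ENNReal.ofReal p) L.measure /
    eLpNorm f (ENNReal.ofReal p) L.measure

/-- The blocks of `T` are uniformly bounded in `L^p`. -/
def BlocksBounded (p : ℝ) : Prop :=
  ∃ N : ℝ≥0, ∀ (I : L.Interval) (h : L.D 𝕜 I),
    eLpNorm (T.block I h : ℝ → 𝕜) (ENNReal.ofReal p) L.measure ≤
      N * eLpNorm (h : ℝ → 𝕜) (ENNReal.ofReal p) L.measure

/-- `u = T h` for a locally integrable `h`, in the sense of martingale difference decompositions: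
`Δ_I u = T_I (Δ_I h)` for all intervals of the lattice, and `E_I u = 0` for the limit intervals of
finite length. -/
structure IsImage (h u : ℝ → 𝕜) : Prop where
  measurable : AEStronglyMeasurable[L.sigmaInf] u L.measure
  locIntegrable : L.LocIntegrable u
  diff_eq : ∀ I : L.Interval, diff I u = T.block I (diff I h)
  integrableOn : ∀ I ∈ L.finLimitIntervals, IntegrableOn u I
  integral_eq : ∀ I ∈ L.finLimitIntervals, ∫ x in I, u x = 0

/-- The commutator `[M_b, T] f = b (T f) - T (b f)`, defined on functions with a finite martingale
decomposition (a dense subspace), has norm at most `A` in `L^p`. -/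
def CommutatorBoundedBy (b : ℝ → 𝕜) (p : ℝ) (A : ℝ≥0∞) : Prop :=
  ∀ f ∈ L.finSums 𝕜, ∃ u : ℝ → 𝕜, T.IsImage (fun x => b x * f x) u ∧
    eLpNorm (fun x => b x * T.apply f x - u x) (ENNReal.ofReal p) L.measure ≤
      A * eLpNorm f (ENNReal.ofReal p) L.measure

/-- For every interval `I` of the lattice that is a limit interval of finite length,
`‖T_I Δ_I b‖_p ≤ C₁ |I|^(1/p)` and `‖T_I^* Δ_I b‖_q ≤ C₁ |I|^(1/q)`. -/
def TestingCondition (b : ℝ → 𝕜) (p q : ℝ) (C₁ : ℝ≥0) : Prop :=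
  ∀ I : L.Interval, (I : Set ℝ) ∈ L.finLimitIntervals →
    eLpNorm (T.block I (diff I b) : ℝ → 𝕜) (ENNReal.ofReal p) L.measure ≤
      C₁ * volume (I : Set ℝ) ^ (1 / p) ∧
    eLpNorm (T.adjoint.block I (diff I b) : ℝ → 𝕜) (ENNReal.ofReal q) L.measure ≤
      C₁ * volume (I : Set ℝ) ^ (1 / q)

/-- For every interval `I` of the lattice that is a limit interval of finite length, the commutator
`[(Λ_b^1)_I, T_I]` has norm at most `C₂` on `D_I` with the `L^p` norm. -/
def BlockCommutatorCondition (b : ℝ → 𝕜) (p : ℝ) (C₂ : ℝ≥0) : Prop :=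
  ∀ I : L.Interval, (I : Set ℝ) ∈ L.finLimitIntervals → ∀ h : L.D 𝕜 I,
    eLpNorm ((lambdaBlock b I (T.block I h) - T.block I (lambdaBlock b I h) : L.D 𝕜 I) : ℝ → 𝕜)
      (ENNReal.ofReal p) L.measure ≤
      C₂ * eLpNorm (h : ℝ → 𝕜) (ENNReal.ofReal p) L.measure

/-- The child `J` of `I` is `(p, ε, K)` non-degenerate for `T`. -/
def NonDegenerate (p : ℝ) (ε K : ℝ≥0) (I J : L.Interval) : Prop :=
  ∃ h : L.D 𝕜 I,
    eLpNorm (h : ℝ → 𝕜) (ENNReal.ofReal p) L.measure = 1 ∧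
    (∀ x ∈ (J : Set ℝ), (h : ℝ → 𝕜) x = 0) ∧
    (ε : ℝ≥0∞) ≤ eLpNorm ((J : Set ℝ).indicator (T.block I h : ℝ → 𝕜))
      (ENNReal.ofReal p) L.measure ∧
    (volume (J : Set ℝ) < volume (I : Set ℝ) / K →
      eLpNorm (h : ℝ → 𝕜) ∞ L.measure ≤ K * volume (I : Set ℝ) ^ (-(1 / p)))

/-- Every interval with a parent is `(p, ε, K)` non-degenerate for `T`. -/
def StronglyMixing (p : ℝ) (ε K : ℝ≥0) : Prop :=
  ∀ I : L.Interval, ∀ J ∈ L.child I, T.NonDegenerate p ε K I J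

/-- Every interval with a parent is `(p, ε, K)` non-degenerate for `T` or `(q, ε, K)`
non-degenerate for the adjoint of `T`, where `q` is the exponent conjugate to `p`. -/
def WeaklyMixing (p q : ℝ) (ε K : ℝ≥0) : Prop :=
  ∀ I : L.Interval, ∀ J ∈ L.child I,
    T.NonDegenerate p ε K I J ∨ T.adjoint.NonDegenerate q ε K I J

end MartingaleTransform

/-! ### BMO -/

/-- The number that a formal martingale difference sequence `δ` assigns to an interval `J`: the
(constant) value of `δ I` on `J`, where `I` is the parent of `J`; it is `0` if `J` has no parent. -/
def coeff (δ : ∀ I : L.Interval, L.D 𝕜 I) (J : L.Interval) : 𝕜 :=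
  ∑ᶠ I ∈ {I : L.Interval | J ∈ L.child I}, ⨍ x in (J : Set ℝ), (δ I : ℝ → 𝕜) x

/-- The `BMO` norm of a formal martingale difference sequence with coefficients `x_I`:
`sup_J (|J|⁻¹ ∫_J ∑_{I ⊆ J} |x_I|² 1_I)^(1/2)`. -/
def bmoNorm (δ : ∀ I : L.Interval, L.D 𝕜 I) : ℝ≥0∞ :=
  ⨆ J : L.Interval, ((volume (J : Set ℝ))⁻¹ * ∫⁻ x in (J : Set ℝ),
    ∑' I : {I : L.Interval // (I : Set ℝ) ⊆ J},
      (I.1 : Set ℝ).indicator (fun _ => ‖coeff δ I.1‖ₑ ^ 2) x) ^ (1 / 2 : ℝ)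

open Classical in
/-- The formal sum of the `Δ_I b` over the intervals `I` of the lattice that are not limit intervals
of finite length. -/
def tildeDiff (b : ℝ → 𝕜) (I : L.Interval) : L.D 𝕜 I :=
  if (I : Set ℝ) ∈ L.finLimitIntervals then 0 else diff I b

end IntervalLattice

end

/-! Sufficiency. Write b = b₀ + `topJump b`, where the second summand collects Δ_I b over the
lattice intervals that are finite limit intervals; these are exactly the intervals without a parent.
The differences of b₀ are those of the formal sum b̃₀.

For b₀, subtract from multiplication by b₀ the diagonal operator that multiplies each Δ_I f by the
average of b₀ over I. The diagonal operator is a scalar on each D_I and so commutes with T. If P is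
the remainder, then [M_{b₀}, T] = P T - T P, and only the L^p boundedness of P matters. On an
indicator 1_S of a finite limit interval the scalar is a subsequential limit of the averages of b₀
over intervals growing to S; T kills 1_S, so this term does not disturb the commutation. Abel
summation over generations identifies P with the transform f ↦ ∑ (b_{k+1} - b_k) f_{k+1}, where
subscripts denote averages over generations.

The transform is estimated on finitely many generations, where everything is a martingale on a
finite weighted set. By duality one bounds ∑_k E (b_{k+1} - b_k) f_{k+1} g_{k+1}. Orthogonality
permits replacing f_{k+1} g_{k+1} by f_{k+1} g_{k+1} - f_k g_k. With the running maxima f*, g*,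
there are two kinds of steps. If one maximum more than doubles, the growth of f* g* pays for the
step and telescopes. Otherwise the inequality between means separates |db|² f* g*, handled by the
Carleson condition against the increasing weight f* g* (`IsCarleson.sum_mul_le`), from the weighted
squares (g*/f*) |df|² and (f*/g*) |dg|², whose sums are controlled by f* g*
(`IsMart.sum_weighted_square_le`). The total is at most 19 B E f* g*, and Hölder and Doob finish. No
comparability of parents and children is used: the jumps of b₀ are bounded because the BMO sum over
J contains the coefficient of J itself. Density of finite martingale sums extends T to the functions
P f.

The jump is constant on every interval other than the parentless ones, so its commutator lives on
each parentless J separately. There it splits into the block commutator applied to Δ_J f, the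
average of f times T_J Δ_J b, and a mean that T_J^* Δ_J b controls: these are conditions (3) and
(2).

Necessity. Conditions (2) and (3) come from testing the commutator on 1_I and on D_I and projecting
to D_I or integrating over I. For (1), take a child J of I and h in D_I that vanishes on J while T_I
h equals a constant t on J. Since b h = 0 on J, the function T(b h) has constant averages inside J,
so there the commutator shows t times the oscillation of b (`mul_eLpNorm_oscillation_le`). The
adjoint version pairs the commutator with h and returns the same exponent when p = 2. This bounds
the L^p oscillation of b on every interval with a parent. The supremum bound for h on small children
then bounds the single differences (`mul_enorm_diff_apply_le`), and a John–Nirenberg argument turns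
oscillation and jump bounds into the quadratic bound defining BMO. -/

noncomputable section

/-! ### Martingales on finite weighted sets -/

namespace FiniteMartingale

variable {α : Type*} {𝕜 : Type*} [RCLike 𝕜]

/-- `φ` is constant on the classes of the relation of index `k`. -/
def Adapted (r : ℕ → α → α → Prop) {β : Type*} (k : ℕ) (φ : α → β) : Prop :=
  ∀ x y, r k x y → φ x = φ y

/-- `f 0, …, f n` is a martingale for the weight `w` and the partitions `r`. -/
structure IsMart [Fintype α] (w : α → ℝ) (r : ℕ → α → α → Prop) (n : ℕ) (f : ℕ → α → 𝕜) : Prop where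
  adapted : ∀ k ≤ n, Adapted r k (f k)
  orth : ∀ k < n, ∀ φ : α → 𝕜, Adapted r k φ →
    ∑ x, (w x : 𝕜) * (φ x * (f (k + 1) x - f k x)) = 0

/-- The running maximum of `‖f 0‖, …, ‖f k‖`. -/
def runMax (f : ℕ → α → 𝕜) : ℕ → α → ℝ
  | 0, x => ‖f 0 x‖
  | k + 1, x => max (runMax f k x) ‖f (k + 1) x‖

lemma runMax_nonneg (f : ℕ → α → 𝕜) (k : ℕ) (x : α) : 0 ≤ runMax f k x := by
  cases k with
  | zero => exact norm_nonneg _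
  | succ k => exact le_max_of_le_right (norm_nonneg _)

lemma norm_le_runMax (f : ℕ → α → 𝕜) (k : ℕ) (x : α) : ‖f k x‖ ≤ runMax f k x := by
  cases k with
  | zero => exact le_rfl
  | succ k => exact le_max_right _ _

lemma runMax_le_succ (f : ℕ → α → 𝕜) (k : ℕ) (x : α) : runMax f k x ≤ runMax f (k + 1) x :=
  le_max_left _ _

lemma adapted_mono {r : ℕ → α → α → Prop} (hr : ∀ k x y, r (k + 1) x y → r k x y)
    {β : Type*} {k l : ℕ} (hkl : k ≤ l) {φ : α → β} (h : Adapted r k φ) : Adapted r l φ := by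
  induction l, hkl using Nat.le_induction with
  | base => exact h
  | succ l _ ih => exact fun x y hxy => ih x y (hr l x y hxy)

lemma runMax_adapted {r : ℕ → α → α → Prop} (hr : ∀ k x y, r (k + 1) x y → r k x y)
    {f : ℕ → α → 𝕜} {k : ℕ} (hf : ∀ j ≤ k, Adapted r j (f j)) : Adapted r k (runMax f k) := by
  induction k with
  | zero => intro x y h; simp [runMax, hf 0 le_rfl x y h]
  | succ k ih =>
    intro x y h
    simp [runMax, hf (k + 1) le_rfl x y h, ih (fun j hj => hf j (by omega)) x y (hr _ _ _ h)]

section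

variable [Fintype α] {w : α → ℝ} {r : ℕ → α → α → Prop} {n : ℕ} {f g : ℕ → α → 𝕜}

lemma IsMart.re_orth (hf : IsMart w r n f) {k : ℕ} (hk : k < n) {φ : α → 𝕜}
    (hφ : Adapted r k φ) : ∑ x, w x * RCLike.re (φ x * (f (k + 1) x - f k x)) = 0 := by
  have h := congrArg RCLike.re (hf.orth k hk φ hφ)
  rw [map_sum, map_zero] at h
  rw [← h]
  exact Finset.sum_congr rfl fun x _ => by rw [RCLike.re_ofReal_mul]

/-- The norm is convex and the conjugate phase of a is a subgradient at a. For a = 0 the quotient is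
0 by the division convention, which is again a subgradient. -/
lemma norm_add_re_le (a b : 𝕜) :
    ‖a‖ + RCLike.re ((starRingEnd 𝕜 a / (‖a‖ : 𝕜)) * (b - a)) ≤ ‖b‖ := by
  by_cases ha : a = 0
  · simp [ha]
  have hn : ‖a‖ ≠ 0 := by simpa using ha
  have hn' : (‖a‖ : 𝕜) ≠ 0 := by exact_mod_cast hn
  have h1 : (starRingEnd 𝕜 a / (‖a‖ : 𝕜)) * a = (‖a‖ : 𝕜) := by
    rw [div_mul_eq_mul_div, RCLike.conj_mul, pow_two, mul_div_assoc, div_self hn', mul_one]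
  rw [mul_sub, map_sub, h1, RCLike.ofReal_re]
  have h2 : RCLike.re ((starRingEnd 𝕜 a / (‖a‖ : 𝕜)) * b) ≤ ‖b‖ := by
    refine (RCLike.re_le_norm _).trans ?_
    rw [norm_mul, norm_div, RCLike.norm_conj, RCLike.norm_ofReal, abs_norm, div_self hn, one_mul]
  linarith

/-- The absolute value of a martingale is a submartingale. -/
lemma IsMart.sum_norm_le (hw : ∀ x, 0 ≤ w x) (hf : IsMart w r n f) {k : ℕ} (hk : k < n)
    {φ : α → ℝ} (hφ : Adapted r k φ) (h0 : ∀ x, 0 ≤ φ x) :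
    ∑ x, w x * (φ x * ‖f k x‖) ≤ ∑ x, w x * (φ x * ‖f (k + 1) x‖) := by
  have h1 := hf.re_orth hk
    (φ := fun x => (φ x : 𝕜) * (starRingEnd 𝕜 (f k x) / (‖f k x‖ : 𝕜)))
    (fun x y h => by simp [hφ x y h, hf.adapted k hk.le x y h])
  rw [← add_zero (∑ x, w x * (φ x * ‖f k x‖)), ← h1, ← Finset.sum_add_distrib]
  refine Finset.sum_le_sum fun x _ => ?_
  rw [mul_assoc, RCLike.re_ofReal_mul, ← mul_add, ← mul_add]
  exact mul_le_mul_of_nonneg_left (mul_le_mul_of_nonneg_left (norm_add_re_le _ _) (h0 x)) (hw x)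

/-- Since q (p - 1) = p, the function s ↦ s^p - q s^(p-1) x has derivative p s^(p-2) (s - x), so
raising s up to x can only decrease it. Young's inequality gives this without differentiation. -/
lemma doob_step {p q : ℝ} (hpq : p.HolderConjugate q) {s x : ℝ} (hs : 0 ≤ s) (hx : 0 ≤ x) :
    (max s x) ^ p - q * (max s x) ^ (p - 1) * x ≤ s ^ p - q * s ^ (p - 1) * x := by
  rcases le_total x s with h | h
  · rw [max_eq_left h]
  rw [max_eq_right h]
  have hq := hpq.symm.pos
  have hp := hpq.pos
  have hy := Real.young_inequality_of_nonneg (Real.rpow_nonneg hs (p - 1)) hx hpq.symm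
  rw [← Real.rpow_mul hs, hpq.sub_one_mul_conj] at hy
  have h1 : x ^ (p - 1) * x = x ^ p := by
    rcases hx.eq_or_lt with rfl | hx
    · rw [mul_zero, Real.zero_rpow hp.ne']
    · rw [← Real.rpow_add_one hx.ne', sub_add_cancel]
  have h2 : q * (s ^ (p - 1) * x) ≤ s ^ p + (q - 1) * x ^ p := by
    have h3 : q / p = q - 1 := by
      have := hpq.mul_eq_add
      field_simp; linarith
    calc q * (s ^ (p - 1) * x) ≤ q * (s ^ p / q + x ^ p / p) := by gcongr
      _ = s ^ p + (q / p) * x ^ p := by field_simp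
      _ = _ := by rw [h3]
  rw [mul_assoc, h1]
  linarith

/-- An absorption inequality: where s ≥ 2cx half of s^p already dominates, and otherwise s is
bounded by 2cx. -/
lemma mul_rpow_sub_one_le {p c s x : ℝ} (hp : 1 < p) (hc : 1 ≤ c) (hs : 0 ≤ s) (hx : 0 ≤ x) :
    c * s ^ (p - 1) * x ≤ s ^ p / 2 + (2 * c) ^ p * x ^ p := by
  have e : ∀ y : ℝ, 0 ≤ y → y ^ p = y ^ (p - 1) * y := fun y hy => by
    rcases hy.eq_or_lt with rfl | hy
    · rw [mul_zero, Real.zero_rpow (by linarith)]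
    · rw [← Real.rpow_add_one hy.ne', sub_add_cancel]
  rcases le_total s (2 * c * x) with h | h
  · have h1 : s ^ (p - 1) ≤ (2 * c * x) ^ (p - 1) :=
      Real.rpow_le_rpow hs h (by linarith)
    have h2 : 0 ≤ (2 * c * x) ^ (p - 1) := by positivity
    have h3 : c * s ^ (p - 1) * x ≤ (2 * c * x) ^ (p - 1) * (2 * c * x) := by
      calc c * s ^ (p - 1) * x ≤ c * (2 * c * x) ^ (p - 1) * x := by gcongr
        _ ≤ (2 * c * x) ^ (p - 1) * (2 * c * x) := by
          nlinarith [mul_nonneg h2 (mul_nonneg (by linarith : (0:ℝ) ≤ c) hx)]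
    rw [← e _ (by positivity), Real.mul_rpow (by positivity) hx] at h3
    have : 0 ≤ s ^ p := by positivity
    linarith
  · have h1 : c * s ^ (p - 1) * x ≤ s ^ (p - 1) * s / 2 := by
      have h2 : 0 ≤ s ^ (p - 1) := by positivity
      nlinarith
    rw [← e s hs] at h1
    have : 0 ≤ (2 * c) ^ p * x ^ p := by positivity
    linarith

/-- Doob's maximal inequality. -/
theorem IsMart.sum_runMax_rpow_le (hw : ∀ x, 0 ≤ w x)
    (hr : ∀ k x y, r (k + 1) x y → r k x y) (hf : IsMart w r n f)
    {p q : ℝ} (hpq : p.HolderConjugate q) :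
    ∑ x, w x * runMax f n x ^ p ≤ 2 * (2 * q) ^ p * ∑ x, w x * ‖f n x‖ ^ p := by
  -- For k = n this says E M^p ≤ q E M^(p-1) |f|. Both changes from k to k + 1 decrease the sum: |f
  -- k| becomes |f (k+1)| by the submartingale property with weight q M_k^(p-1), then the maximum is
  -- updated by `doob_step`.
  have hstep : ∀ k ≤ n, ∑ x, w x * (runMax f k x ^ p - q * runMax f k x ^ (p - 1) * ‖f k x‖)
      ≤ 0 := by
    intro k
    induction k with
    | zero =>
      intro _
      refine Finset.sum_nonpos fun x _ => mul_nonpos_of_nonneg_of_nonpos (hw x) ?_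
      have h := doob_step hpq le_rfl (norm_nonneg (f 0 x))
      rw [max_eq_right (norm_nonneg _), Real.zero_rpow hpq.pos.ne',
        Real.zero_rpow hpq.sub_one_pos.ne'] at h
      simpa [runMax] using h
    | succ k ih =>
      intro hk
      have hk' : k < n := by omega
      refine le_trans ?_ (ih hk'.le)
      have h1 := hf.sum_norm_le hw hk' (φ := fun x => q * runMax f k x ^ (p - 1))
        (fun x y h => by
          simp [runMax_adapted hr (fun j hj => hf.adapted j (by omega)) x y h])
        (fun x => mul_nonneg hpq.symm.nonneg (Real.rpow_nonneg (runMax_nonneg f k x) _))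
      have h2 : ∑ x, w x * (runMax f (k + 1) x ^ p -
          q * runMax f (k + 1) x ^ (p - 1) * ‖f (k + 1) x‖) ≤
          ∑ x, w x * (runMax f k x ^ p - q * runMax f k x ^ (p - 1) * ‖f (k + 1) x‖) :=
        Finset.sum_le_sum fun x _ => mul_le_mul_of_nonneg_left
          (doob_step hpq (runMax_nonneg f k x) (norm_nonneg _)) (hw x)
      simp only [mul_sub, Finset.sum_sub_distrib] at h2 ⊢
      linarith
  have h0 := hstep n le_rfl
  have h1 : ∑ x, w x * (q * runMax f n x ^ (p - 1) * ‖f n x‖) ≤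
      ∑ x, w x * (runMax f n x ^ p / 2 + (2 * q) ^ p * ‖f n x‖ ^ p) :=
    Finset.sum_le_sum fun x _ => mul_le_mul_of_nonneg_left
      (mul_rpow_sub_one_le hpq.lt hpq.symm.lt.le (runMax_nonneg f n x) (norm_nonneg _)) (hw x)
  simp only [mul_sub, mul_add, Finset.sum_sub_distrib, Finset.sum_add_distrib] at h0 h1
  have h2 : ∑ x, w x * (runMax f n x ^ p / 2) = (∑ x, w x * runMax f n x ^ p) / 2 := by
    rw [Finset.sum_div]; exact Finset.sum_congr rfl fun x _ => by ring
  have h3 : ∑ x, w x * ((2 * q) ^ p * ‖f n x‖ ^ p) =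
      (2 * q) ^ p * ∑ x, w x * ‖f n x‖ ^ p := by
    rw [Finset.mul_sum]; exact Finset.sum_congr rfl fun x _ => by ring
  rw [h2, h3] at h1
  linarith

end

end FiniteMartingale

end

/-! ### Weighted square functions, Carleson embedding and the trilinear bound -/

noncomputable section

namespace FiniteMartingale

variable {α : Type*} {𝕜 : Type*} [RCLike 𝕜]

lemma normSq_sub_eq (a c : 𝕜) :
    ‖c - a‖ ^ 2 + 2 * RCLike.re (starRingEnd 𝕜 a * (c - a)) = ‖c‖ ^ 2 - ‖a‖ ^ 2 := by
  have h1 : ‖c‖ ^ 2 = RCLike.re (starRingEnd 𝕜 c * c) := by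
    rw [RCLike.conj_mul]; norm_cast
  have h2 : ‖a‖ ^ 2 = RCLike.re (starRingEnd 𝕜 a * a) := by
    rw [RCLike.conj_mul]; norm_cast
  have h3 : ‖c - a‖ ^ 2 = RCLike.re (starRingEnd 𝕜 (c - a) * (c - a)) := by
    rw [RCLike.conj_mul]; norm_cast
  have h4 : RCLike.re (starRingEnd 𝕜 c * a) = RCLike.re (starRingEnd 𝕜 a * c) := by
    rw [← RCLike.conj_re, map_mul, RCLike.conj_conj, mul_comm]
  rw [h1, h2, h3]
  simp only [map_sub, mul_sub, sub_mul, h4]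
  ring

lemma norm_sub_sq_ge (a c : 𝕜) : ‖c‖ ^ 2 - ‖a‖ ^ 2 - ‖c - a‖ ^ 2 ≤ 2 * ‖a‖ * ‖c‖ - 2 * ‖a‖ ^ 2 := by
  have h := abs_norm_sub_norm_le c a
  have h2 := sq_le_sq' (by linarith [abs_nonneg (‖c‖ - ‖a‖), norm_nonneg (c - a)]) h
  rw [sq_abs] at h2
  nlinarith

/-- The one-step inequality behind the square function estimate with weight `t / s`, where `s` is
the running maximum of `f` and `t` is increasing. -/
lemma weighted_square_step {a c : 𝕜} {s t t' : ℝ} (ha : ‖a‖ ≤ s) (ht : 0 ≤ t) (htt : t ≤ t') :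
    (if max s ‖c‖ ≤ 2 * s ∧ t' ≤ 2 * t then t / s * ‖c - a‖ ^ 2 else 0)
      + 2 * (t / s * RCLike.re (starRingEnd 𝕜 a * (c - a))) ≤
    t' / max s ‖c‖ * ‖c‖ ^ 2 - t / s * ‖a‖ ^ 2 + 6 * (max s ‖c‖ * t' - s * t) := by
  have hs : 0 ≤ s := (norm_nonneg a).trans ha
  have heq := normSq_sub_eq a c
  have hle := norm_sub_sq_ge a c
  set s' := max s ‖c‖ with hs'
  have hss : s ≤ s' := le_max_left _ _
  have hcs : ‖c‖ ≤ s' := le_max_right _ _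
  have hc0 := norm_nonneg c
  have ha0 := norm_nonneg a
  have ht' : 0 ≤ t' := ht.trans htt
  have hW : s * t ≤ s' * t' := mul_le_mul hss htt ht (hs.trans hss)
  have hψ : 0 ≤ t / s := div_nonneg ht hs
  have hψ' : 0 ≤ t' / s' := div_nonneg ht' (hs.trans hss)
  split_ifs with h
  -- Quiet step: with the weight t / s frozen the left side is an exact increment of the squared
  -- norm. Moving the weight to t' / s' costs at most 2 t (s' - s), because ‖c‖² ≤ s'² ≤ 2 s s'.
  · have h1 : t / s * ‖c - a‖ ^ 2 + 2 * (t / s * RCLike.re (starRingEnd 𝕜 a * (c - a))) =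
        t / s * ‖c‖ ^ 2 - t / s * ‖a‖ ^ 2 := by rw [← mul_sub, ← heq]; ring
    rw [h1]
    suffices t / s * ‖c‖ ^ 2 ≤ t' / s' * ‖c‖ ^ 2 + 6 * (s' * t' - s * t) by linarith
    rcases hs.eq_or_lt with hs0 | hs0
    · have : ‖c‖ = 0 := le_antisymm (by linarith [h.1]) hc0
      rw [this]; nlinarith
    have hs'0 : 0 < s' := hs0.trans_le hss
    have h2 : t / s' * ‖c‖ ^ 2 ≤ t' / s' * ‖c‖ ^ 2 := by gcongr
    have h3 : t / s * ‖c‖ ^ 2 - t / s' * ‖c‖ ^ 2 ≤ 2 * (t * (s' - s)) := by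
      have h4 : t / s * ‖c‖ ^ 2 - t / s' * ‖c‖ ^ 2 = t * (s' - s) * (‖c‖ ^ 2 / (s * s')) := by
        field_simp
      have h5 : ‖c‖ ^ 2 / (s * s') ≤ 2 := by
        rw [div_le_iff₀ (by positivity)]
        nlinarith [h.1]
      rw [h4]
      nlinarith [mul_nonneg ht (sub_nonneg.2 hss)]
    nlinarith [mul_nonneg (sub_nonneg.2 htt) (hs.trans hss), mul_nonneg ht (sub_nonneg.2 hss)]
  -- One of the maxima more than doubles, so the increment of their product is at least half of s'
  -- t'. It pays for the linear term; the square is absent here.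
  · have h1 : s' * t' ≤ 2 * (s' * t' - s * t) := by
      rcases not_and_or.1 h with h | h
      · push Not at h
        nlinarith [mul_nonneg ht (sub_nonneg.2 hss), mul_nonneg ht' (sub_nonneg.2 hss)]
      · push Not at h
        nlinarith [mul_nonneg hs ht]
    have h2 : 2 * (t / s * RCLike.re (starRingEnd 𝕜 a * (c - a))) =
        t / s * (‖c‖ ^ 2 - ‖a‖ ^ 2 - ‖c - a‖ ^ 2) := by rw [← heq]; ring
    have h3 : t / s * (2 * ‖a‖ * ‖c‖) ≤ 2 * (s' * t') := by
      rcases hs.eq_or_lt with hs0 | hs0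
      · rw [← hs0]; simp; positivity
      calc t / s * (2 * ‖a‖ * ‖c‖) ≤ t / s * (2 * s * s') := by gcongr
        _ = 2 * (s' * t) := by field_simp
        _ ≤ 2 * (s' * t') := by gcongr
    have h4 := mul_le_mul_of_nonneg_left hle hψ
    have h5 : 0 ≤ t / s * ‖a‖ ^ 2 := by positivity
    have h6 : 0 ≤ t' / s' * ‖c‖ ^ 2 := by positivity
    rw [h2]
    nlinarith

variable [Fintype α] {w : α → ℝ} {r : ℕ → α → α → Prop} {n : ℕ} {b f g : ℕ → α → 𝕜}

/-- The weighted square function estimate on the steps where neither running maximum jumps. -/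
lemma IsMart.sum_weighted_square_le (hw : ∀ x, 0 ≤ w x)
    (hr : ∀ k x y, r (k + 1) x y → r k x y) (hf : IsMart w r n f) (hg : IsMart w r n g) :
    ∑ k ∈ Finset.range n, ∑ x, w x *
      (if runMax f (k + 1) x ≤ 2 * runMax f k x ∧ runMax g (k + 1) x ≤ 2 * runMax g k x then
        runMax g k x / runMax f k x * ‖f (k + 1) x - f k x‖ ^ 2 else 0) ≤
    7 * ∑ x, w x * (runMax f n x * runMax g n x) := by
  -- The potential (g*/f*) |f|² + 6 f* g* grows on average by at least the quiet squares. The linear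
  -- term has mean zero, since its coefficient is known at time k; at time n the potential is at
  -- most 7 f* g*.
  have hstep : ∀ k ≤ n, ∑ k ∈ Finset.range k, ∑ x, w x *
      (if runMax f (k + 1) x ≤ 2 * runMax f k x ∧ runMax g (k + 1) x ≤ 2 * runMax g k x then
        runMax g k x / runMax f k x * ‖f (k + 1) x - f k x‖ ^ 2 else 0) ≤
      ∑ x, w x * (runMax g k x / runMax f k x * ‖f k x‖ ^ 2 +
        6 * (runMax f k x * runMax g k x)) := by
    intro k
    induction k with
    | zero =>
      intro _
      simp only [Finset.range_zero, Finset.sum_empty]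
      refine Finset.sum_nonneg fun x _ => mul_nonneg (hw x) ?_
      have h1 := runMax_nonneg f 0 x
      have h2 := runMax_nonneg g 0 x
      positivity
    | succ k ih =>
      intro hk
      rw [Finset.sum_range_succ]
      have hk' : k < n := by omega
      have h0 := hf.re_orth hk'
        (φ := fun x => ((runMax g k x / runMax f k x : ℝ) : 𝕜) * starRingEnd 𝕜 (f k x))
        (fun x y h => by
          simp [runMax_adapted hr (fun j hj => hf.adapted j (by omega)) x y h,
            runMax_adapted hr (fun j hj => hg.adapted j (by omega)) x y h,
            hf.adapted k hk'.le x y h])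
      have h1 : ∑ x, w x * ((if runMax f (k + 1) x ≤ 2 * runMax f k x ∧
            runMax g (k + 1) x ≤ 2 * runMax g k x then
          runMax g k x / runMax f k x * ‖f (k + 1) x - f k x‖ ^ 2 else 0)
          + 2 * (runMax g k x / runMax f k x *
            RCLike.re (starRingEnd 𝕜 (f k x) * (f (k + 1) x - f k x)))) ≤
        ∑ x, w x * (runMax g (k + 1) x / runMax f (k + 1) x * ‖f (k + 1) x‖ ^ 2 -
          runMax g k x / runMax f k x * ‖f k x‖ ^ 2 +
          6 * (runMax f (k + 1) x * runMax g (k + 1) x - runMax f k x * runMax g k x)) :=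
        Finset.sum_le_sum fun x _ => mul_le_mul_of_nonneg_left
          (weighted_square_step (norm_le_runMax f k x) (runMax_nonneg g k x)
            (runMax_le_succ g k x)) (hw x)
      have h2 : ∑ x, w x * (2 * (runMax g k x / runMax f k x *
            RCLike.re (starRingEnd 𝕜 (f k x) * (f (k + 1) x - f k x)))) = 0 := by
        rw [← mul_zero (2 : ℝ), ← h0, Finset.mul_sum]
        refine Finset.sum_congr rfl fun x _ => ?_
        rw [mul_assoc ((runMax g k x / runMax f k x : ℝ) : 𝕜), RCLike.re_ofReal_mul]
        ring
      have h3 := ih hk'.le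
      simp only [mul_add, mul_sub, Finset.sum_add_distrib, Finset.sum_sub_distrib] at h1 h2 h3 ⊢
      linarith
  refine (hstep n le_rfl).trans ?_
  rw [Finset.mul_sum]
  refine Finset.sum_le_sum fun x _ => ?_
  rw [mul_left_comm 7 (w x)]
  refine mul_le_mul_of_nonneg_left ?_ (hw x)
  have h1 := norm_le_runMax f n x
  have h2 := runMax_nonneg g n x
  have h4 := norm_nonneg (f n x)
  have h3 : runMax g n x / runMax f n x * ‖f n x‖ ^ 2 ≤ runMax f n x * runMax g n x := by
    rcases (runMax_nonneg f n x).eq_or_lt with h | h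
    · rw [← h]; simp
    calc runMax g n x / runMax f n x * ‖f n x‖ ^ 2
        ≤ runMax g n x / runMax f n x * runMax f n x ^ 2 := by gcongr
      _ = _ := by field_simp
  linarith

/-- The Carleson condition on the differences of `b`. -/
def IsCarleson (w : α → ℝ) (r : ℕ → α → α → Prop) (n : ℕ) (b : ℕ → α → 𝕜) (B : ℝ) : Prop :=
  ∀ j ≤ n, ∀ φ : α → ℝ, Adapted r j φ → (∀ x, 0 ≤ φ x) →
    ∑ x, w x * (φ x * ∑ k ∈ Finset.Ico (j - 1) n, ‖b (k + 1) x - b k x‖ ^ 2) ≤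
      B ^ 2 * ∑ x, w x * φ x

/-- Carleson embedding, by decomposing the increasing weight W into its increments. The increment W
(m+1) - W m is adapted at m + 1 and multiplies the squares with k ≥ m, including the jump into
generation m + 1. Hence the inner sum of `IsCarleson` at level j has to start at j - 1. -/
lemma IsCarleson.sum_mul_le {B : ℝ} (hb : IsCarleson w r n b B) {W : ℕ → α → ℝ}
    (hW : ∀ k ≤ n, Adapted r k (W k)) (hW0 : ∀ x, 0 ≤ W 0 x) (hWm : ∀ k x, W k x ≤ W (k + 1) x)
    (hr : ∀ k x y, r (k + 1) x y → r k x y) :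
    ∑ k ∈ Finset.range n, ∑ x, w x * (‖b (k + 1) x - b k x‖ ^ 2 * W (k + 1) x) ≤
      B ^ 2 * ∑ x, w x * W n x := by
  -- Induction on the time m at which the weight is frozen: from m to m + 1 only the terms with k ≥
  -- m change.
  have key : ∀ m ≤ n, ∑ x, w x * ∑ k ∈ Finset.range n,
      (‖b (k + 1) x - b k x‖ ^ 2 * W (min m (k + 1)) x) ≤ B ^ 2 * ∑ x, w x * W m x := by
    intro m
    induction m with
    | zero =>
      intro _
      have h := hb 0 (Nat.zero_le n) (W 0) (hW 0 (Nat.zero_le n)) hW0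
      refine le_trans (le_of_eq ?_) h
      refine Finset.sum_congr rfl fun x _ => ?_
      simp only [Nat.zero_min, zero_tsub, Nat.Ico_zero_eq_range]
      rw [← Finset.sum_mul, mul_comm (W 0 x)]
    | succ m ih =>
      intro hm
      have h := hb (m + 1) hm (fun x => W (m + 1) x - W m x)
        (fun x y hxy => by simp only [hW (m + 1) hm x y hxy, hW m (by omega) x y (hr _ _ _ hxy)])
        (fun x => sub_nonneg.2 (hWm m x))
      have h' := add_le_add (ih (by omega)) h
      rw [← mul_add, ← Finset.sum_add_distrib, ← Finset.sum_add_distrib] at h'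
      refine le_trans (le_of_eq ?_) (h'.trans (le_of_eq ?_))
      · refine Finset.sum_congr rfl fun x _ => ?_
        rw [← mul_add]
        congr 1
        have hI : Finset.Ico (m + 1 - 1) n = (Finset.range n).filter (m ≤ ·) := by
          ext k; simp; omega
        rw [hI, Finset.mul_sum, Finset.sum_filter, ← Finset.sum_add_distrib]
        refine Finset.sum_congr rfl fun k _ => ?_
        split_ifs with hk
        · rw [min_eq_left (by omega : m + 1 ≤ k + 1), min_eq_left (by omega : m ≤ k + 1)]; ring
        · rw [min_eq_right (by omega : k + 1 ≤ m + 1), min_eq_right (by omega : k + 1 ≤ m)]; ring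
      · congr 1
        refine Finset.sum_congr rfl fun x _ => by ring
  have h := key n le_rfl
  rw [Finset.sum_comm]
  refine le_trans (le_of_eq ?_) h
  refine Finset.sum_congr rfl fun x _ => ?_
  rw [Finset.mul_sum]
  refine Finset.sum_congr rfl fun k hk => ?_
  rw [min_eq_right (by simpa using hk)]

/-- The pointwise bound for a product of martingale increments. -/
lemma increment_le {B : ℝ} (hB : 0 < B) {β : ℝ} (hβ0 : 0 ≤ β) (hβ : β ≤ B) {a c a' c' : 𝕜}
    {s t : ℝ} (ha : ‖a‖ ≤ s) (ha' : ‖a'‖ ≤ t) :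
    β * ‖c * c' - a * a'‖ ≤
      4 * B * (max s ‖c‖ * max t ‖c'‖ - s * t) + (β ^ 2 * (max s ‖c‖ * max t ‖c'‖)) / B +
      B * (if max s ‖c‖ ≤ 2 * s ∧ max t ‖c'‖ ≤ 2 * t then t / s * ‖c - a‖ ^ 2 else 0) +
      B * (if max t ‖c'‖ ≤ 2 * t ∧ max s ‖c‖ ≤ 2 * s then s / t * ‖c' - a'‖ ^ 2 else 0) := by
  have hs : 0 ≤ s := (norm_nonneg a).trans ha
  have ht : 0 ≤ t := (norm_nonneg a').trans ha'
  set s' := max s ‖c‖ with hs'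
  set t' := max t ‖c'‖ with ht'
  have hss : s ≤ s' := le_max_left _ _
  have htt : t ≤ t' := le_max_left _ _
  have hcs : ‖c‖ ≤ s' := le_max_right _ _
  have hct : ‖c'‖ ≤ t' := le_max_right _ _
  have hs'0 := hs.trans hss
  have ht'0 := ht.trans htt
  have hW : s * t ≤ s' * t' := mul_le_mul hss htt ht hs'0
  have hβW : 0 ≤ β ^ 2 * (s' * t') / B := by positivity
  -- Quiet step: the product rule and the inequality between means, balanced by t' / s' ≤ 2 (t / s).
  -- Otherwise the product is bounded by 2 s' t', which the growth of the product of the maxima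
  -- absorbs together with β ≤ B.
  by_cases h : s' ≤ 2 * s ∧ t' ≤ 2 * t
  · rw [if_pos h, if_pos h.symm]
    have aux : ∀ {s t s' t' : ℝ} {a c : 𝕜}, 0 ≤ s → 0 ≤ t → s ≤ s' → t ≤ t' → ‖c‖ ≤ s' →
        ‖a‖ ≤ s → s' ≤ 2 * s → t' ≤ 2 * t →
        β * (‖c - a‖ * t') ≤ β ^ 2 * (s' * t') / B / 2 + B * (t / s * ‖c - a‖ ^ 2) := by
      intro s t s' t' a c hs ht hss htt hc ha h1 h2
      rcases hs.eq_or_lt with hs0 | hs0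
      · have h3 : ‖c‖ = 0 := le_antisymm (by linarith) (norm_nonneg _)
        have h4 : ‖a‖ = 0 := le_antisymm (by linarith) (norm_nonneg _)
        have h5 : c - a = 0 := by rw [norm_eq_zero.1 h3, norm_eq_zero.1 h4, sub_zero]
        have : 0 ≤ β ^ 2 * (s' * t') / B / 2 := by
          have := hs.trans hss; have := ht.trans htt; positivity
        rw [h5]; simpa using this
      have hs'0 : 0 < s' := hs0.trans_le hss
      have ht'0 := ht.trans htt
      have h3 : β * (‖c - a‖ * t') ≤ β ^ 2 * (s' * t') / B / 2 +
          B / 2 * (t' / s' * ‖c - a‖ ^ 2) := by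
        have h4 : β ^ 2 * (s' * t') / B / 2 + B / 2 * (t' / s' * ‖c - a‖ ^ 2) -
            β * (‖c - a‖ * t') = t' / (2 * B * s') * (β * s' - B * ‖c - a‖) ^ 2 := by
          field_simp; ring
        have h5 : 0 ≤ t' / (2 * B * s') * (β * s' - B * ‖c - a‖) ^ 2 := by positivity
        linarith
      have h4 : t' / s' ≤ 2 * (t / s) := by
        rw [div_le_iff₀ hs'0]
        have : 2 * (t / s) * s' = 2 * t * (s' / s) := by ring
        rw [this]
        have : 1 ≤ s' / s := (one_le_div hs0).2 hss
        nlinarith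
      have h5 : B / 2 * (t' / s' * ‖c - a‖ ^ 2) ≤ B / 2 * (2 * (t / s) * ‖c - a‖ ^ 2) := by
        gcongr
      linarith
    have h1 := aux hs ht hss htt hcs ha h.1 h.2
    have h2 := aux ht hs htt hss hct ha' h.2 h.1
    have h3 : ‖c * c' - a * a'‖ ≤ ‖c - a‖ * t' + ‖c' - a'‖ * s' := by
      have : c * c' - a * a' = (c - a) * c' + (c' - a') * a := by ring
      rw [this]
      refine (norm_add_le _ _).trans ?_
      rw [norm_mul, norm_mul]
      have := ha.trans hss
      gcongr
    have h4 := mul_le_mul_of_nonneg_left h3 hβ0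
    rw [mul_comm t' s'] at h2
    have h5 : 0 ≤ B * (s' * t' - s * t) := mul_nonneg hB.le (sub_nonneg.2 hW)
    linarith
  · rw [if_neg h, if_neg (fun h' => h h'.symm)]
    have h1 : s' * t' ≤ 2 * (s' * t' - s * t) := by
      rcases not_and_or.1 h with h | h
      · push Not at h
        nlinarith [mul_nonneg ht (sub_nonneg.2 hss), mul_nonneg ht'0 (sub_nonneg.2 hss)]
      · push Not at h
        nlinarith [mul_nonneg hs ht]
    have h2 : ‖c * c' - a * a'‖ ≤ 2 * (s' * t') := by
      refine (norm_sub_le _ _).trans ?_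
      rw [norm_mul, norm_mul]
      have h3 : ‖c‖ * ‖c'‖ ≤ s' * t' := by gcongr
      have h4 : ‖a‖ * ‖a'‖ ≤ s * t := by gcongr
      linarith
    have h3 : β * ‖c * c' - a * a'‖ ≤ B * (2 * (s' * t')) := by gcongr
    nlinarith

/-- The increment of b is orthogonal to f k * g k, so only increments of the product fg count, and
`increment_le` applies to them. The constant is 4 from telescoping, 1 from the Carleson embedding
and 7 from each weighted square function. -/
lemma IsMart.norm_sum_mul_mul_le (hw : ∀ x, 0 ≤ w x)
    (hr : ∀ k x y, r (k + 1) x y → r k x y) (hb : IsMart w r n b) (hf : IsMart w r n f)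
    (hg : IsMart w r n g) {B : ℝ} (hB : 0 < B) (hbB : ∀ k < n, ∀ x, ‖b (k + 1) x - b k x‖ ≤ B)
    (hc : IsCarleson w r n b B) :
    ‖∑ k ∈ Finset.range n, ∑ x, (w x : 𝕜) *
      ((b (k + 1) x - b k x) * f (k + 1) x * g (k + 1) x)‖ ≤
    19 * B * ∑ x, w x * (runMax f n x * runMax g n x) := by
  have h1 : ∑ k ∈ Finset.range n, ∑ x, (w x : 𝕜) *
      ((b (k + 1) x - b k x) * f (k + 1) x * g (k + 1) x) =
      ∑ k ∈ Finset.range n, ∑ x, (w x : 𝕜) *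
      ((b (k + 1) x - b k x) * (f (k + 1) x * g (k + 1) x - f k x * g k x)) := by
    refine Finset.sum_congr rfl fun k hk => ?_
    have hk' : k < n := by simpa using hk
    have h0 := hb.orth k hk' (fun x => f k x * g k x)
      (fun x y h => by simp only [hf.adapted k hk'.le x y h, hg.adapted k hk'.le x y h])
    rw [← sub_zero (∑ x, (w x : 𝕜) * ((b (k + 1) x - b k x) * f (k + 1) x * g (k + 1) x)), ← h0,
      ← Finset.sum_sub_distrib]
    exact Finset.sum_congr rfl fun x _ => by ring
  have hcar := hc.sum_mul_le (W := fun k x => runMax f k x * runMax g k x)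
    (fun k hk x y h => by
      simp only [runMax_adapted hr (fun j hj => hf.adapted j (hj.trans hk)) x y h,
        runMax_adapted hr (fun j hj => hg.adapted j (hj.trans hk)) x y h])
    (fun x => mul_nonneg (runMax_nonneg _ _ _) (runMax_nonneg _ _ _))
    (fun k x => mul_le_mul (runMax_le_succ f k x) (runMax_le_succ g k x) (runMax_nonneg _ _ _)
      (runMax_nonneg _ _ _)) hr
  have hsf := hf.sum_weighted_square_le hw hr hg
  have hsg := hg.sum_weighted_square_le hw hr hf
  have hW : ∑ x, w x * (runMax g n x * runMax f n x) =
      ∑ x, w x * (runMax f n x * runMax g n x) :=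
    Finset.sum_congr rfl fun x _ => by ring
  rw [hW] at hsg
  have htel : ∑ k ∈ Finset.range n, ∑ x, w x * (runMax f (k + 1) x * runMax g (k + 1) x -
      runMax f k x * runMax g k x) ≤ ∑ x, w x * (runMax f n x * runMax g n x) := by
    rw [Finset.sum_comm]
    refine Finset.sum_le_sum fun x _ => ?_
    rw [← Finset.mul_sum, Finset.sum_range_sub (fun k => runMax f k x * runMax g k x)]
    refine mul_le_mul_of_nonneg_left ?_ (hw x)
    have := mul_nonneg (runMax_nonneg f 0 x) (runMax_nonneg g 0 x)
    linarith
  rw [h1]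
  have h2 : ∀ k ∈ Finset.range n, ∀ x : α, ‖(w x : 𝕜) *
      ((b (k + 1) x - b k x) * (f (k + 1) x * g (k + 1) x - f k x * g k x))‖ ≤
      4 * B * (w x * (runMax f (k + 1) x * runMax g (k + 1) x - runMax f k x * runMax g k x)) +
      w x * (‖b (k + 1) x - b k x‖ ^ 2 * (runMax f (k + 1) x * runMax g (k + 1) x)) / B +
      B * (w x * (if runMax f (k + 1) x ≤ 2 * runMax f k x ∧
        runMax g (k + 1) x ≤ 2 * runMax g k x then
        runMax g k x / runMax f k x * ‖f (k + 1) x - f k x‖ ^ 2 else 0)) +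
      B * (w x * (if runMax g (k + 1) x ≤ 2 * runMax g k x ∧
        runMax f (k + 1) x ≤ 2 * runMax f k x then
        runMax f k x / runMax g k x * ‖g (k + 1) x - g k x‖ ^ 2 else 0)) := by
    intro k hk x
    rw [norm_mul, norm_mul, RCLike.norm_ofReal, abs_of_nonneg (hw x)]
    have h := mul_le_mul_of_nonneg_left (increment_le hB (norm_nonneg (b (k + 1) x - b k x))
      (hbB k (by simpa using hk) x) (c := f (k + 1) x) (c' := g (k + 1) x)
      (norm_le_runMax f k x) (norm_le_runMax g k x)) (hw x)
    refine h.trans (le_of_eq ?_)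
    simp only [runMax]
    ring_nf
  refine (norm_sum_le _ _).trans ((Finset.sum_le_sum fun k _ => norm_sum_le _ _).trans
    ((Finset.sum_le_sum fun k hk => Finset.sum_le_sum fun x _ => h2 k hk x).trans ?_))
  simp only [Finset.sum_add_distrib, ← Finset.mul_sum, ← Finset.sum_div]
  have h3 : (∑ k ∈ Finset.range n, ∑ x, w x * (‖b (k + 1) x - b k x‖ ^ 2 *
      (runMax f (k + 1) x * runMax g (k + 1) x))) / B ≤
      B * ∑ x, w x * (runMax f n x * runMax g n x) := by
    rw [div_le_iff₀ hB]
    refine hcar.trans (le_of_eq (by ring))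
  have h4 := mul_le_mul_of_nonneg_left htel (by positivity : 0 ≤ 4 * B)
  have h5 := mul_le_mul_of_nonneg_left hsf hB.le
  have h6 := mul_le_mul_of_nonneg_left hsg hB.le
  linarith

end FiniteMartingale

end

/-! ### Duality, the L^p bound for transforms of BMO martingales, and John–Nirenberg -/

noncomputable section

namespace FiniteMartingale

variable {α : Type*} [Fintype α] {𝕜 : Type*} [RCLike 𝕜]

open Classical in
/-- Conditional expectation with respect to the partition into classes of `r`. -/
def condE (w : α → ℝ) (r : α → α → Prop) (φ : α → 𝕜) (x : α) : 𝕜 :=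
  (∑ y, if r x y then (w y : 𝕜) * φ y else 0) / ∑ y, if r x y then (w y : 𝕜) else 0

lemma condE_congr (w : α → ℝ) {r : α → α → Prop} (hr : Equivalence r) (φ : α → 𝕜) {x y : α}
    (h : r x y) : condE w r φ x = condE w r φ y := by
  have : r x = r y := funext fun z => propext
    ⟨fun hz => hr.trans (hr.symm h) hz, fun hz => hr.trans h hz⟩
  unfold condE
  rw [this]

lemma condE_of_adapted {w : α → ℝ} (hw : ∀ x, 0 < w x) {r : α → α → Prop} (hr : Equivalence r)
    {φ : α → 𝕜} (hφ : ∀ x y, r x y → φ x = φ y) : condE w r φ = φ := by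
  classical
  funext x
  have h1 : (∑ y, if r x y then (w y : 𝕜) * φ y else 0) =
      (∑ y, if r x y then (w y : 𝕜) else 0) * φ x := by
    rw [Finset.sum_mul]
    refine Finset.sum_congr rfl fun y _ => ?_
    split_ifs with h
    · rw [hφ x y h]
    · rw [zero_mul]
  have h2 : (∑ y, if r x y then (w y : 𝕜) else 0) ≠ 0 := by
    have : 0 < ∑ y, if r x y then w y else 0 :=
      Finset.sum_pos' (fun y _ => by split_ifs <;> simp [(hw y).le])
        ⟨x, Finset.mem_univ x, by simp [hr.refl x, hw x]⟩
    have h3 : (∑ y, if r x y then (w y : 𝕜) else 0) =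
        ((∑ y, if r x y then w y else 0 : ℝ) : 𝕜) := by
      push_cast
      exact Finset.sum_congr rfl fun y _ => by split_ifs <;> simp
    rw [h3]
    exact_mod_cast this.ne'
  rw [condE, h1, mul_div_cancel_left₀ _ h2]

lemma sum_mul_condE {w : α → ℝ} (hw : ∀ x, 0 < w x) {r : α → α → Prop} (hr : Equivalence r)
    (φ : α → 𝕜) {ψ : α → 𝕜} (hψ : ∀ x y, r x y → ψ x = ψ y) :
    ∑ x, (w x : 𝕜) * (ψ x * condE w r φ x) = ∑ x, (w x : 𝕜) * (ψ x * φ x) := by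
  classical
  set W : α → 𝕜 := fun x => ∑ y, if r x y then (w y : 𝕜) else 0 with hW
  have hWr : ∀ x y, r x y → W x = W y := by
    intro x y h
    have : ∀ z, r x z ↔ r y z := fun z =>
      ⟨fun hz => hr.trans (hr.symm h) hz, fun hz => hr.trans h hz⟩
    simp only [hW, this]
  have h1 : ∀ x, (w x : 𝕜) * (ψ x * condE w r φ x) =
      ∑ y, if r y x then (w x : 𝕜) * (ψ y * ((w y : 𝕜) * φ y / W y)) else 0 := by
    intro x
    rw [condE, Finset.sum_div, Finset.mul_sum, Finset.mul_sum]
    refine Finset.sum_congr rfl fun y _ => ?_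
    by_cases h : r x y
    · rw [if_pos h, if_pos (hr.symm h), hψ x y h, ← hWr x y h]
    · rw [if_neg h, if_neg (fun h' => h (hr.symm h')), zero_div, mul_zero, mul_zero]
  simp only [h1]
  rw [Finset.sum_comm]
  refine Finset.sum_congr rfl fun y _ => ?_
  have h2 := congrFun (condE_of_adapted (𝕜 := 𝕜) hw hr (φ := fun _ => (1 : 𝕜))
    (fun _ _ _ => rfl)) y
  have h3 : W y / W y = 1 := by simpa [condE] using h2
  calc (∑ x, if r y x then (w x : 𝕜) * (ψ y * ((w y : 𝕜) * φ y / W y)) else 0)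
      = W y * (ψ y * ((w y : 𝕜) * φ y / W y)) := by
        rw [hW, Finset.sum_mul]
        exact Finset.sum_congr rfl fun x _ => by split_ifs <;> simp
    _ = (w y : 𝕜) * (ψ y * φ y) * (W y / W y) := by ring
    _ = _ := by rw [h3, mul_one]

lemma sum_mul_le_Lp_mul_Lq {w : α → ℝ} (hw : ∀ x, 0 ≤ w x) {p q : ℝ} (hpq : p.HolderConjugate q)
    {s t : α → ℝ} (hs : ∀ x, 0 ≤ s x) (ht : ∀ x, 0 ≤ t x) :
    ∑ x, w x * (s x * t x) ≤
      (∑ x, w x * s x ^ p) ^ (1 / p) * (∑ x, w x * t x ^ q) ^ (1 / q) := by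
  have h := Real.inner_le_Lp_mul_Lq_of_nonneg Finset.univ hpq
    (f := fun x => w x ^ (1 / p) * s x) (g := fun x => w x ^ (1 / q) * t x)
    (fun x _ => mul_nonneg (Real.rpow_nonneg (hw x) _) (hs x))
    (fun x _ => mul_nonneg (Real.rpow_nonneg (hw x) _) (ht x))
  have e1 : ∀ {p : ℝ} (_ : 0 < p) (x : α) (y : ℝ), 0 ≤ y →
      (w x ^ (1 / p) * y) ^ p = w x * y ^ p := fun {p} hp x y hy => by
    rw [Real.mul_rpow (Real.rpow_nonneg (hw x) _) hy, ← Real.rpow_mul (hw x),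
      one_div_mul_cancel hp.ne', Real.rpow_one]
  have e2 : ∀ x, w x ^ (1 / p) * s x * (w x ^ (1 / q) * t x) = w x * (s x * t x) := fun x => by
    have : w x ^ (1 / p) * w x ^ (1 / q) = w x := by
      rw [← Real.rpow_add_of_nonneg (hw x) (by have := hpq.pos; positivity)
        (by have := hpq.symm.pos; positivity), one_div, one_div, hpq.inv_add_inv_eq_one,
        Real.rpow_one]
    calc _ = w x ^ (1 / p) * w x ^ (1 / q) * (s x * t x) := by ring
      _ = _ := by rw [this]
  simp only [e2] at h
  simp only [e1 hpq.pos _ _ (hs _), e1 hpq.symm.pos _ _ (ht _)] at h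
  exact h

/-- The constant in the `L^p` bound for the transforms of `BMO` martingales. -/
def transformConst (p q : ℝ) : ℝ :=
  19 * ((2 * (2 * q) ^ p) ^ (1 / p) * (2 * (2 * p) ^ q) ^ (1 / q))

lemma transformConst_pos {p q : ℝ} (hpq : p.HolderConjugate q) : 0 < transformConst p q := by
  have := hpq.pos
  have := hpq.symm.pos
  unfold transformConst
  positivity

variable {w : α → ℝ} {r : ℕ → α → α → Prop} {n : ℕ} {b f : ℕ → α → 𝕜}

/-- The transform of a `BMO` martingale by an adapted `L^p` bounded martingale is bounded in
`L^p`. -/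
theorem IsMart.transform_le (hw : ∀ x, 0 < w x) (hr : ∀ k x y, r (k + 1) x y → r k x y)
    (he : ∀ k, Equivalence (r k)) {p q : ℝ} (hpq : p.HolderConjugate q)
    (hb : IsMart w r n b) (hf : IsMart w r n f) {B : ℝ} (hB : 0 < B)
    (hbB : ∀ k < n, ∀ x, ‖b (k + 1) x - b k x‖ ≤ B) (hc : IsCarleson w r n b B) :
    ∑ x, w x * ‖∑ k ∈ Finset.range n, (b (k + 1) x - b k x) * f (k + 1) x‖ ^ p ≤
      (transformConst p q * B) ^ p * ∑ x, w x * ‖f n x‖ ^ p := by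
  set H : α → 𝕜 := fun x => ∑ k ∈ Finset.range n, (b (k + 1) x - b k x) * f (k + 1) x with hH
  have hw0 : ∀ x, 0 ≤ w x := fun x => (hw x).le
  have hadm : ∀ {k : ℕ}, k ≤ n → ∀ j ≤ k, Adapted r k (f j) ∧ Adapted r k (b j) := fun hk j hj =>
    ⟨adapted_mono hr hj (hf.adapted j (hj.trans hk)),
      adapted_mono hr hj (hb.adapted j (hj.trans hk))⟩
  have hHad : Adapted r n H := by
    intro x y h
    refine Finset.sum_congr rfl fun k hk => ?_
    have hk' : k + 1 ≤ n := by simpa using hk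
    rw [(hadm le_rfl (k + 1) hk').1 x y h, (hadm le_rfl (k + 1) hk').2 x y h,
      (hadm le_rfl k (by omega)).2 x y h]
  -- The extremal function of the L^p duality: H g = ‖H‖^p and ‖g‖^q = ‖H‖^p. Where H = 0 the factor
  -- conj H makes g vanish even if p < 2.
  set g : α → 𝕜 := fun x => starRingEnd 𝕜 (H x) * ((‖H x‖ ^ (p - 2) : ℝ) : 𝕜) with hg
  have hgad : Adapted r n g := fun x y h => by simp only [hg, hHad x y h]
  set G : ℕ → α → 𝕜 := fun k => condE w (r k) g with hG
  have hGn : G n = g := condE_of_adapted hw (he n) hgad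
  have hGm : IsMart w r n G := by
    refine ⟨fun k _ x y h => condE_congr w (he k) g h, fun k _ φ hφ => ?_⟩
    simp only [mul_sub, Finset.sum_sub_distrib]
    rw [hG, sum_mul_condE hw (he (k + 1)) g (adapted_mono hr (Nat.le_succ k) hφ),
      sum_mul_condE hw (he k) g hφ, sub_self]
  have hmain := hb.norm_sum_mul_mul_le hw0 hr hf hGm hB hbB hc
  have hHg : ∀ x, H x * g x = ((‖H x‖ ^ p : ℝ) : 𝕜) := by
    intro x
    rw [hg]
    simp only
    rw [← mul_assoc, RCLike.mul_conj]
    by_cases h0 : ‖H x‖ = 0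
    · rw [h0, Real.zero_rpow hpq.pos.ne']; simp
    · rw [← RCLike.ofReal_pow, ← RCLike.ofReal_mul, ← Real.rpow_natCast,
        ← Real.rpow_add (lt_of_le_of_ne (norm_nonneg _) (Ne.symm h0))]
      norm_num
  have hgn : ∀ x, ‖g x‖ ^ q = ‖H x‖ ^ p := by
    intro x
    rw [hg]
    simp only
    rw [norm_mul, RCLike.norm_conj, RCLike.norm_ofReal, abs_of_nonneg (by positivity)]
    by_cases h0 : ‖H x‖ = 0
    · rw [h0, Real.zero_rpow hpq.pos.ne', zero_mul, Real.zero_rpow hpq.symm.pos.ne']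
    · have h1 : ‖H x‖ * ‖H x‖ ^ (p - 2) = ‖H x‖ ^ (p - 1) := by
        rw [← Real.rpow_one_add' (norm_nonneg _) (by have := hpq.sub_one_pos; intro h; linarith)]
        ring_nf
      rw [h1, ← Real.rpow_mul (norm_nonneg _), hpq.sub_one_mul_conj]
  -- The other two factors are constant on the classes of index k + 1, so the conditional
  -- expectation G (k+1) may be replaced by g, and the sum becomes the pairing of H with g.
  have hlhs : ∑ k ∈ Finset.range n, ∑ x, (w x : 𝕜) *
      ((b (k + 1) x - b k x) * f (k + 1) x * G (k + 1) x) =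
      ((∑ x, w x * ‖H x‖ ^ p : ℝ) : 𝕜) := by
    have h1 : ∀ k ∈ Finset.range n, ∑ x, (w x : 𝕜) *
        ((b (k + 1) x - b k x) * f (k + 1) x * G (k + 1) x) =
        ∑ x, (w x : 𝕜) * ((b (k + 1) x - b k x) * f (k + 1) x * g x) := by
      intro k hk
      have hk' : k + 1 ≤ n := by simpa using hk
      refine sum_mul_condE hw (he (k + 1)) g
        (ψ := fun x => (b (k + 1) x - b k x) * f (k + 1) x) fun x y h => ?_
      simp only [(hadm hk' (k + 1) le_rfl).1 x y h, (hadm hk' (k + 1) le_rfl).2 x y h,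
        (hadm hk' k (by omega)).2 x y h]
    rw [Finset.sum_congr rfl h1, Finset.sum_comm]
    push_cast
    refine Finset.sum_congr rfl fun x _ => ?_
    rw [← Finset.mul_sum, ← Finset.sum_mul]
    rw [show (∑ k ∈ Finset.range n, (b (k + 1) x - b k x) * f (k + 1) x) = H x from rfl, hHg x]
  rw [hlhs, RCLike.norm_ofReal] at hmain
  set X := ∑ x, w x * ‖H x‖ ^ p with hX
  set F := ∑ x, w x * ‖f n x‖ ^ p with hF
  have hX0 : 0 ≤ X := Finset.sum_nonneg fun x _ => mul_nonneg (hw0 x) (by positivity)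
  have hF0 : 0 ≤ F := Finset.sum_nonneg fun x _ => mul_nonneg (hw0 x) (by positivity)
  rw [abs_of_nonneg hX0] at hmain
  have hp := hpq.pos
  have hq := hpq.symm.pos
  have hD1 := hf.sum_runMax_rpow_le hw0 hr hpq
  have hD2 := hGm.sum_runMax_rpow_le hw0 hr hpq.symm
  rw [hGn] at hD2
  simp only [hgn] at hD2
  have hho := sum_mul_le_Lp_mul_Lq hw0 hpq (runMax_nonneg f n) (runMax_nonneg G n)
  have h1 : X ≤ transformConst p q * B * (F ^ (1 / p) * X ^ (1 / q)) := by
    have h2 : (∑ x, w x * runMax f n x ^ p) ^ (1 / p) * (∑ x, w x * runMax G n x ^ q) ^ (1 / q) ≤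
        (2 * (2 * q) ^ p * F) ^ (1 / p) * (2 * (2 * p) ^ q * X) ^ (1 / q) := by
      have h3 : 0 ≤ ∑ x, w x * runMax f n x ^ p := Finset.sum_nonneg fun x _ =>
        mul_nonneg (hw0 x) (Real.rpow_nonneg (runMax_nonneg f n x) _)
      have h4 : 0 ≤ ∑ x, w x * runMax G n x ^ q := Finset.sum_nonneg fun x _ =>
        mul_nonneg (hw0 x) (Real.rpow_nonneg (runMax_nonneg G n x) _)
      gcongr
    rw [Real.mul_rpow (by positivity) hF0, Real.mul_rpow (by positivity) hX0] at h2
    calc X ≤ 19 * B * _ := hmain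
      _ ≤ 19 * B * _ := mul_le_mul_of_nonneg_left (hho.trans h2) (by positivity)
      _ = _ := by unfold transformConst; ring
  rcases hX0.eq_or_lt with h0 | h0
  · rw [← h0]
    have := transformConst_pos hpq
    positivity
  have h2 : X ^ (1 / p) ≤ transformConst p q * B * F ^ (1 / p) := by
    have h3 : X = X ^ (1 / p) * X ^ (1 / q) := by
      rw [← Real.rpow_add h0, one_div, one_div, hpq.inv_add_inv_eq_one, Real.rpow_one]
    have h4 : 0 < X ^ (1 / q) := Real.rpow_pos_of_pos h0 _
    rw [← mul_assoc] at h1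
    nth_rw 1 [h3] at h1
    exact le_of_mul_le_mul_right h1 h4
  have h3 := Real.rpow_le_rpow (Real.rpow_nonneg hX0 _) h2 hp.le
  have hK := transformConst_pos hpq
  rwa [Real.mul_rpow (by positivity) (Real.rpow_nonneg hF0 _), ← Real.rpow_mul hX0,
    ← Real.rpow_mul hF0, one_div_mul_cancel hp.ne', Real.rpow_one, Real.rpow_one] at h3

lemma IsMart.sum_normSq_sub_eq (hb : IsMart w r n b) (hr : ∀ k x y, r (k + 1) x y → r k x y) :
    ∑ k ∈ Finset.range n, ∑ x, w x * ‖b (k + 1) x - b k x‖ ^ 2 =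
      ∑ x, w x * ‖b n x - b 0 x‖ ^ 2 := by
  have key : ∀ m ≤ n, ∑ k ∈ Finset.range m, ∑ x, w x * ‖b (k + 1) x - b k x‖ ^ 2 =
      ∑ x, w x * ‖b m x - b 0 x‖ ^ 2 := by
    intro m
    induction m with
    | zero => intro _; simp
    | succ m ih =>
      intro hm
      rw [Finset.sum_range_succ, ih (by omega)]
      have h0 := hb.re_orth (k := m) (by omega) (φ := fun x => starRingEnd 𝕜 (b m x - b 0 x))
        (fun x y h => by
          simp only [hb.adapted m (by omega) x y h,
            adapted_mono hr (Nat.zero_le m) (hb.adapted 0 (Nat.zero_le n)) x y h])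
      have h1 : ∀ x, w x * ‖b (m + 1) x - b 0 x‖ ^ 2 = w x * ‖b m x - b 0 x‖ ^ 2 +
          w x * ‖b (m + 1) x - b m x‖ ^ 2 +
          2 * (w x * RCLike.re (starRingEnd 𝕜 (b m x - b 0 x) * (b (m + 1) x - b m x))) := by
        intro x
        have := normSq_sub_eq (b m x - b 0 x) (b (m + 1) x - b 0 x)
        rw [sub_sub_sub_cancel_right] at this
        linear_combination (-w x) * this
      simp only [h1, Finset.sum_add_distrib, ← Finset.mul_sum, h0]
      ring
  exact key n le_rfl

/-- Abel summation expresses the square by the increments of s against its remaining growth; the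
discarded terms are -(s (k+1) - s k)². This reduces a second moment of an increasing process to
conditional first moments. -/
lemma sq_le_two_mul_sum {s : ℕ → ℝ} (h0 : s 0 = 0) (n : ℕ) :
    s n ^ 2 ≤ 2 * ∑ k ∈ Finset.range n, (s (k + 1) - s k) * (s n - s k) := by
  have h1 : ∑ k ∈ Finset.range n, (s (k + 1) - s k) = s n := by
    rw [Finset.sum_range_sub, h0, sub_zero]
  have h2 : ∑ k ∈ Finset.range n, (s (k + 1) ^ 2 - s k ^ 2) = s n ^ 2 := by
    rw [Finset.sum_range_sub (fun k => s k ^ 2), h0]; ring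
  have h3 : s n ^ 2 = 2 * s n * ∑ k ∈ Finset.range n, (s (k + 1) - s k) -
      ∑ k ∈ Finset.range n, (s (k + 1) ^ 2 - s k ^ 2) := by rw [h1, h2]; ring
  rw [h3, Finset.mul_sum, Finset.mul_sum, ← Finset.sum_sub_distrib]
  refine Finset.sum_le_sum fun k _ => ?_
  nlinarith [sq_nonneg (s (k + 1) - s k)]

/-- The John–Nirenberg inequality: a bound for the mean oscillations in `L^p` and for the jumps
gives a bound for the quadratic variation. -/
theorem IsMart.sum_sq_le_of_oscillation (hw : ∀ x, 0 ≤ w x)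
    (hr : ∀ k x y, r (k + 1) x y → r k x y) {p q : ℝ} (hpq : p.HolderConjugate q)
    (hb : IsMart w r n b) {M M' : ℝ} (hM' : 0 ≤ M')
    (hosc : ∀ j ≤ n, ∀ φ : α → ℝ, Adapted r j φ → (∀ x, 0 ≤ φ x) →
      ∑ x, w x * (φ x * ‖b n x - b j x‖ ^ p) ≤ M * ∑ x, w x * φ x)
    (hjump : ∀ k < n, ∀ x, ‖b (k + 1) x - b k x‖ ≤ M') :
    ∑ k ∈ Finset.range n, ∑ x, w x * ‖b (k + 1) x - b k x‖ ^ 2 ≤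
      2 * (M' + 1 + 2 * (2 * q) ^ p * M) ^ 2 * ∑ x, w x := by
  set s : ℕ → α → ℝ := runMax fun i x => b i x - b 0 x with hs
  set N := M' + 1 + 2 * (2 * q) ^ p * M with hN
  have hbm : ∀ {k j : ℕ}, j ≤ k → k ≤ n → Adapted r k (b j) := fun hjk hk =>
    adapted_mono hr hjk (hb.adapted _ (hjk.trans hk))
  have hsad : ∀ k ≤ n, Adapted r k (s k) := fun k hk => runMax_adapted hr fun j hj x y h => by
    simp only [hbm le_rfl (hj.trans hk) x y h, hbm (Nat.zero_le j) (hj.trans hk) x y h]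
  -- The maximum of the martingale restarted at time j has bounded conditional mean: Doob's
  -- inequality for the weight w φ bounds its p-th moment, and y ≤ 1 + y^p passes to the first
  -- moment.
  have hdoob : ∀ j ≤ n, ∀ φ : α → ℝ, Adapted r j φ → (∀ x, 0 ≤ φ x) →
      ∑ x, w x * (φ x * runMax (fun i x => b (j + i) x - b j x) (n - j) x) ≤
      (1 + 2 * (2 * q) ^ p * M) * ∑ x, w x * φ x := by
    intro j hj φ hφ hφ0
    have hsh : IsMart (fun x => w x * φ x) (fun i => r (j + i)) (n - j)
        (fun i x => b (j + i) x - b j x) := by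
      refine ⟨fun k hk x y h => ?_, fun k hk ψ hψ => ?_⟩
      · simp only [hbm le_rfl (by omega : j + k ≤ n) x y h,
          hbm (by omega : j ≤ j + k) (by omega) x y h]
      · rw [← hb.orth (j + k) (by omega) (fun x => (φ x : 𝕜) * ψ x) (fun x y h => by
          simp only [hψ x y h, adapted_mono hr (by omega : j ≤ j + k) hφ x y h])]
        refine Finset.sum_congr rfl fun x _ => ?_
        push_cast
        rw [← add_assoc]
        ring
    have h1 := hsh.sum_runMax_rpow_le (fun x => mul_nonneg (hw x) (hφ0 x))
      (fun k x y h => hr _ _ _ h) hpq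
    rw [show j + (n - j) = n by omega] at h1
    have h2 := hosc j hj φ hφ hφ0
    have h3 : ∑ x, w x * φ x * ‖b n x - b j x‖ ^ p = ∑ x, w x * (φ x * ‖b n x - b j x‖ ^ p) :=
      Finset.sum_congr rfl fun x _ => mul_assoc _ _ _
    rw [h3] at h1
    have hq := hpq.symm.pos
    have h4 := mul_le_mul_of_nonneg_left h2 (by positivity : 0 ≤ 2 * (2 * q) ^ p)
    have h5 : ∑ x, w x * (φ x * runMax (fun i x => b (j + i) x - b j x) (n - j) x) ≤
        ∑ x, w x * φ x +
          ∑ x, w x * φ x * runMax (fun i x => b (j + i) x - b j x) (n - j) x ^ p := by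
      rw [← Finset.sum_add_distrib]
      refine Finset.sum_le_sum fun x _ => ?_
      rw [← mul_assoc]
      set y := runMax (fun i x => b (j + i) x - b j x) (n - j) x
      have hy : y ≤ 1 + y ^ p := by
        have hy0 : 0 ≤ y := runMax_nonneg _ _ _
        rcases le_total y 1 with h | h
        · have : 0 ≤ y ^ p := by positivity
          linarith
        · have := Real.rpow_le_rpow_of_exponent_le h hpq.lt.le
          rw [Real.rpow_one] at this
          linarith
      have := mul_le_mul_of_nonneg_left hy (mul_nonneg (hw x) (hφ0 x))
      linarith
    linarith
  -- The weight φ is known only at time k + 1, since it will be s (k+1) - s k. The jump from k to k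
  -- + 1 costs M', and the remaining growth is governed by the martingale restarted at k + 1.
  have hinc : ∀ k < n, ∀ φ : α → ℝ, Adapted r (k + 1) φ → (∀ x, 0 ≤ φ x) →
      ∑ x, w x * (φ x * (s n x - s k x)) ≤ N * ∑ x, w x * φ x := by
    intro k hk φ hφ hφ0
    have h1 := hdoob (k + 1) hk φ hφ hφ0
    have h2 : ∀ x, s n x - s k x ≤
        M' + runMax (fun i x => b (k + 1 + i) x - b (k + 1) x) (n - (k + 1)) x := by
      intro x
      have h3 : ∀ i, s (k + 1 + i) x ≤ s k x + M' +
          runMax (fun i x => b (k + 1 + i) x - b (k + 1) x) i x := by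
        have h4 : ∀ i, ‖b (k + 1 + i) x - b 0 x‖ ≤ s k x + M' +
          runMax (fun i x => b (k + 1 + i) x - b (k + 1) x) i x := by
          intro i
          have h5 := norm_le_runMax (fun i x => b (k + 1 + i) x - b (k + 1) x) i x
          have h6 := norm_le_runMax (fun i x => b i x - b 0 x) k x
          have h7 := hjump k hk x
          have h8 : b (k + 1 + i) x - b 0 x = (b (k + 1 + i) x - b (k + 1) x) +
            ((b (k + 1) x - b k x) + (b k x - b 0 x)) := by ring
          rw [h8]
          refine (norm_add_le _ _).trans ?_
          have := norm_add_le (b (k + 1) x - b k x) (b k x - b 0 x)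
          linarith
        intro i
        induction i with
        | zero =>
          refine max_le ?_ (h4 0)
          have := runMax_nonneg (fun i x => b (k + 1 + i) x - b (k + 1) x) 0 x
          linarith
        | succ i ih =>
          refine max_le (ih.trans ?_) (h4 (i + 1))
          have := runMax_le_succ (fun i x => b (k + 1 + i) x - b (k + 1) x) i x
          linarith
      have h4 := h3 (n - (k + 1))
      rw [show k + 1 + (n - (k + 1)) = n by omega] at h4
      linarith
    have h3 : ∑ x, w x * (φ x * (s n x - s k x)) ≤ ∑ x, (M' * (w x * φ x) +
        w x * (φ x * runMax (fun i x => b (k + 1 + i) x - b (k + 1) x) (n - (k + 1)) x)) := by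
      refine Finset.sum_le_sum fun x _ => ?_
      have := mul_le_mul_of_nonneg_left (h2 x) (mul_nonneg (hw x) (hφ0 x))
      linarith
    rw [Finset.sum_add_distrib, ← Finset.mul_sum] at h3
    rw [hN]
    linarith
  have hE : ∑ x, w x * s n x ≤ N * ∑ x, w x := by
    have h := hdoob 0 (Nat.zero_le n) (fun _ => 1) (fun _ _ _ => rfl) (fun _ => zero_le_one)
    simp only [zero_add, tsub_zero, one_mul, mul_one] at h
    have h2 : 0 ≤ M' * ∑ x, w x := mul_nonneg hM' (Finset.sum_nonneg fun x _ => hw x)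
    rw [hN]
    linarith
  -- No sign of M is assumed; if N were negative, the bound for the mean of s n would force the
  -- total mass to vanish.
  have hN0 : 0 ≤ N ∨ ∑ x, w x = 0 := by
    have h2 : 0 ≤ ∑ x, w x := Finset.sum_nonneg fun x _ => hw x
    have h3 : 0 ≤ ∑ x, w x * s n x := Finset.sum_nonneg fun x _ =>
      mul_nonneg (hw x) (runMax_nonneg _ _ _)
    rcases h2.eq_or_lt with h | h
    · exact Or.inr h.symm
    · exact Or.inl (nonneg_of_mul_nonneg_left (h3.trans hE) h)
  have hsq : ∑ x, w x * s n x ^ 2 ≤ 2 * ∑ k ∈ Finset.range n,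
      ∑ x, w x * ((s (k + 1) x - s k x) * (s n x - s k x)) := by
    rw [Finset.sum_comm, Finset.mul_sum]
    refine Finset.sum_le_sum fun x _ => ?_
    rw [← Finset.mul_sum, mul_left_comm]
    refine mul_le_mul_of_nonneg_left (sq_le_two_mul_sum (s := fun k => s k x) ?_ n) (hw x)
    simp [hs, runMax]
  have hsum : ∑ k ∈ Finset.range n,
      ∑ x, w x * ((s (k + 1) x - s k x) * (s n x - s k x)) ≤ N * ∑ x, w x * s n x := by
    have h1 : ∑ k ∈ Finset.range n,
        ∑ x, w x * ((s (k + 1) x - s k x) * (s n x - s k x)) ≤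
        ∑ k ∈ Finset.range n, N * ∑ x, w x * (s (k + 1) x - s k x) := by
      refine Finset.sum_le_sum fun k hk => ?_
      have hk' : k < n := by simpa using hk
      exact hinc k hk' (fun x => s (k + 1) x - s k x)
        (fun x y h => by
          simp only [hsad (k + 1) hk' x y h, hsad k hk'.le x y (hr _ _ _ h)])
        (fun x => sub_nonneg.2 (runMax_le_succ _ k x))
    refine h1.trans (le_of_eq ?_)
    rw [← Finset.mul_sum, Finset.sum_comm]
    congr 1
    refine Finset.sum_congr rfl fun x _ => ?_
    rw [← Finset.mul_sum, Finset.sum_range_sub (fun k => s k x)]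
    simp [hs, runMax]
  rw [hb.sum_normSq_sub_eq hr]
  have h1 : ∑ x, w x * ‖b n x - b 0 x‖ ^ 2 ≤ ∑ x, w x * s n x ^ 2 := by
    refine Finset.sum_le_sum fun x _ => mul_le_mul_of_nonneg_left ?_ (hw x)
    have := norm_le_runMax (fun i x => b i x - b 0 x) n x
    exact pow_le_pow_left₀ (norm_nonneg _) this 2
  refine h1.trans (hsq.trans ?_)
  rcases hN0 with hN0 | h0
  · have := mul_le_mul_of_nonneg_left hE hN0
    linarith [hsum]
  · rw [h0, mul_zero] at hE ⊢
    have h3 : 0 ≤ ∑ x, w x * s n x := Finset.sum_nonneg fun x _ =>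
      mul_nonneg (hw x) (runMax_nonneg _ _ _)
    have h4 : ∑ x, w x * s n x = 0 := le_antisymm hE h3
    rw [h4, mul_zero] at hsum
    linarith

end FiniteMartingale

end

noncomputable section

namespace IntervalLattice

/-! ### Cells, children and limit intervals -/

variable (L : IntervalLattice)

/-- The interval of generation `k` that contains `x`; it is empty if `x` is not in the carrier. -/
def cell (k : ℤ) (x : ℝ) : Set ℝ := ⋃₀ {I ∈ L.gen k | x ∈ I}

/-- The limit interval that contains `x`. -/
def top (x : ℝ) : Set ℝ := ⋃ k, L.cell k x

variable {L}

lemma mem_carrier {k : ℤ} {I : Set ℝ} (hI : I ∈ L.gen k) {x : ℝ} (hx : x ∈ I) :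
    x ∈ L.carrier := by
  rw [← L.covers k]; exact ⟨I, hI, hx⟩

lemma cell_eq {k : ℤ} {I : Set ℝ} (hI : I ∈ L.gen k) {x : ℝ} (hx : x ∈ I) : L.cell k x = I := by
  have : {J ∈ L.gen k | x ∈ J} = {I} := by
    ext J
    simp only [mem_ofPred_eq, mem_singleton_iff]
    refine ⟨fun ⟨hJ, hxJ⟩ => ?_, fun h => h ▸ ⟨hI, hx⟩⟩
    by_contra hne
    exact Set.disjoint_left.1 (L.pairwiseDisjoint k hJ hI hne) hxJ hx
  rw [cell, this, sUnion_singleton]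

lemma cell_mem_gen (k : ℤ) {x : ℝ} (hx : x ∈ L.carrier) : L.cell k x ∈ L.gen k := by
  rw [← L.covers k] at hx
  obtain ⟨I, hI, hxI⟩ := hx
  rwa [cell_eq hI hxI]

lemma mem_cell (k : ℤ) {x : ℝ} (hx : x ∈ L.carrier) : x ∈ L.cell k x := by
  rw [← L.covers k] at hx
  obtain ⟨I, hI, hxI⟩ := hx
  rwa [cell_eq hI hxI]

lemma mem_carrier_of_mem_cell {k : ℤ} {x y : ℝ} (hy : y ∈ L.cell k x) : x ∈ L.carrier := by
  obtain ⟨I, ⟨hI, hx⟩, -⟩ := hy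
  exact mem_carrier hI hx

lemma cell_eq_of_mem {k : ℤ} {x y : ℝ} (hy : y ∈ L.cell k x) : L.cell k y = L.cell k x :=
  cell_eq (cell_mem_gen k (mem_carrier_of_mem_cell hy)) hy

lemma cell_succ_subset (k : ℤ) (x : ℝ) : L.cell (k + 1) x ⊆ L.cell k x := by
  intro y hy
  have hx := mem_carrier_of_mem_cell hy
  obtain ⟨F, hF, h⟩ := L.refines k _ (cell_mem_gen k hx)
  have hxk := mem_cell k hx
  rw [h] at hxk
  obtain ⟨J, hJ, hxJ⟩ := hxk
  rw [cell_eq (hF hJ) hxJ] at hy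
  rw [h]
  exact ⟨J, hJ, hy⟩

lemma cell_subset {k l : ℤ} (hkl : k ≤ l) (x : ℝ) : L.cell l x ⊆ L.cell k x := by
  induction l, hkl using Int.leInduction with
  | base => exact subset_rfl
  | succ l _ ih => exact (cell_succ_subset l x).trans ih

lemma cell_eq_of_mem_of_le {k l : ℤ} (hkl : k ≤ l) {x y : ℝ} (hy : y ∈ L.cell l x) :
    L.cell k y = L.cell k x := cell_eq_of_mem (cell_subset hkl x hy)

lemma Interval.mem_carrier (I : L.Interval) {x : ℝ} (hx : x ∈ (I : Set ℝ)) : x ∈ L.carrier := by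
  obtain ⟨k, hk⟩ := I.2
  exact IntervalLattice.mem_carrier hk hx

lemma Interval.subset_carrier (I : L.Interval) : (I : Set ℝ) ⊆ L.carrier := fun _ => I.mem_carrier

lemma Interval.eq_cell (I : L.Interval) : ∃ k, ∀ x ∈ (I : Set ℝ), L.cell k x = I := by
  obtain ⟨k, hk⟩ := I.2
  exact ⟨k, fun x hx => cell_eq hk hx⟩

variable (L) in
/-- The cell of a point of the carrier as an interval of the lattice. -/
def cellInterval (k : ℤ) (x : ℝ) (hx : x ∈ L.carrier) : L.Interval :=
  ⟨L.cell k x, k, cell_mem_gen k hx⟩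

lemma Interval.subset_or_subset (I J : L.Interval) {x : ℝ} (hI : x ∈ (I : Set ℝ))
    (hJ : x ∈ (J : Set ℝ)) : (I : Set ℝ) ⊆ J ∨ (J : Set ℝ) ⊆ I := by
  obtain ⟨k, hk⟩ := I.2
  obtain ⟨l, hl⟩ := J.2
  have h1 : L.cell k x = (I : Set ℝ) := cell_eq hk hI
  have h2 : L.cell l x = (J : Set ℝ) := cell_eq hl hJ
  rw [← h1, ← h2]
  rcases le_total k l with h | h
  · exact Or.inr (cell_subset h x)
  · exact Or.inl (cell_subset h x)

/-- Cells around a point shrink with the generation, so a cell that is the same at both ends is the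
same in between. -/
lemma mem_gen_of_le_of_le {I : Set ℝ} {i j k : ℤ} (hij : i ≤ j) (hjk : j ≤ k)
    (hi : I ∈ L.gen i) (hk : I ∈ L.gen k) : I ∈ L.gen j := by
  obtain ⟨a, b, hab, rfl⟩ := L.isInterval i I hi
  have hx : a ∈ Set.Ico a b := ⟨le_rfl, hab⟩
  have h1 := cell_eq hi hx
  have h2 := cell_eq hk hx
  have h3 : L.cell j a = Set.Ico a b :=
    Subset.antisymm ((cell_subset hij a).trans_eq h1) (h2 ▸ cell_subset hjk a)
  rw [← h3]
  exact cell_mem_gen j (mem_carrier hi hx)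

/-- A proper inclusion between consecutive generations already forces k to be the rank: if I
occurred later, it would occur in generation k + 1 and coincide with J. Children can thus be
recognised without computing ranks. -/
lemma mem_child_iff {I J : L.Interval} : J ∈ L.child I ↔
    ∃ k, (I : Set ℝ) ∈ L.gen k ∧ (J : Set ℝ) ∈ L.gen (k + 1) ∧ (J : Set ℝ) ⊂ I := by
  constructor
  · rintro ⟨k, hk, hJ, hJI⟩
    refine ⟨k, hk.1, hJ, hJI.ssubset_of_ne fun h => ?_⟩
    have : k + 1 ≤ k := hk.2 (show (I : Set ℝ) ∈ L.gen (k + 1) from h ▸ hJ)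
    omega
  · rintro ⟨k, hI, hJ, hJI⟩
    refine ⟨k, ⟨hI, fun j hj => ?_⟩, hJ, hJI.subset⟩
    by_contra hlt
    push Not at hlt
    obtain ⟨x, hx⟩ := J.nonempty
    have h1 := mem_gen_of_le_of_le (by omega : k ≤ k + 1) (by omega : k + 1 ≤ j) hI hj
    have h2 := cell_eq hJ hx
    rw [cell_eq h1 (hJI.subset hx)] at h2
    exact hJI.ne h2.symm

lemma child_ssubset {I J : L.Interval} (h : J ∈ L.child I) : (J : Set ℝ) ⊂ I := by
  obtain ⟨k, -, -, h⟩ := mem_child_iff.1 h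
  exact h

lemma parent_unique {I I' J : L.Interval} (h : J ∈ L.child I) (h' : J ∈ L.child I') : I = I' := by
  obtain ⟨k, hI, hJ, hJI⟩ := mem_child_iff.1 h
  obtain ⟨k', hI', hJ', hJI'⟩ := mem_child_iff.1 h'
  obtain ⟨x, hx⟩ := J.nonempty
  have key : ∀ {k k' : ℤ} {I' : L.Interval}, (J : Set ℝ) ∈ L.gen (k + 1) →
      (I' : Set ℝ) ∈ L.gen k' → (J : Set ℝ) ⊂ I' → ¬ k < k' := by
    intro k k' I' hJ hI' hJI' hlt
    have h1 := cell_subset (L := L) (by omega : k + 1 ≤ k') x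
    rw [cell_eq hJ hx, cell_eq hI' (hJI'.subset hx)] at h1
    exact hJI'.2 h1
  obtain rfl : k = k' := le_antisymm (not_lt.1 (key hJ' hI hJI)) (not_lt.1 (key hJ hI' hJI'))
  apply Subtype.ext
  rw [← show L.cell k x = I.1 from cell_eq hI (hJI.subset hx),
    ← show L.cell k x = I'.1 from cell_eq hI' (hJI'.subset hx)]

lemma cellInterval_mem_child {k : ℤ} {x : ℝ} (hx : x ∈ L.carrier)
    (h : L.cell (k + 1) x ≠ L.cell k x) :
    L.cellInterval (k + 1) x hx ∈ L.child (L.cellInterval k x hx) :=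
  mem_child_iff.2 ⟨k, cell_mem_gen k hx, cell_mem_gen (k + 1) hx,
    (cell_succ_subset k x).ssubset_of_ne h⟩

/-- The generation of I' bounds all generations containing I, so I does have a rank; the cell of a
point of I' one generation later is the child. -/
lemma exists_child_superset {I I' : L.Interval} (h : (I' : Set ℝ) ⊂ I) :
    ∃ J ∈ L.child I, (I' : Set ℝ) ⊆ J := by
  obtain ⟨x, hx⟩ := I'.nonempty
  obtain ⟨l, hl⟩ := I'.2
  have hxc := I'.mem_carrier hx
  have hl' : L.cell l x = (I' : Set ℝ) := cell_eq hl hx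
  have hbd : ∀ j : ℤ, (I : Set ℝ) ∈ L.gen j → j ≤ l := by
    intro j hj
    by_contra hlt
    have h1 := cell_subset (L := L) (by omega : l ≤ j) x
    rw [cell_eq hj (h.subset hx), hl'] at h1
    exact h.2 h1
  obtain ⟨j, hj, hmax⟩ := Int.exists_greatest_of_bdd ⟨l, hbd⟩ I.2
  have hj' : L.cell j x = (I : Set ℝ) := cell_eq hj (h.subset hx)
  have hne : L.cell (j + 1) x ≠ L.cell j x := fun he => by
    have := hmax (j + 1) (by rw [← hj', ← he]; exact cell_mem_gen _ hxc)
    omega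
  have hjl : j + 1 ≤ l := by
    have := hbd j hj
    rcases this.eq_or_lt with h1 | h1
    · subst h1; exact absurd (hl'.symm.trans hj') h.ne
    · omega
  refine ⟨L.cellInterval (j + 1) x hxc, ?_, ?_⟩
  · have := cellInterval_mem_child hxc hne
    rwa [show L.cellInterval j x hxc = I from Subtype.ext hj'] at this
  · rw [← hl']; exact cell_subset (L := L) hjl x

lemma Interval.eq_or_subset_child_or_disjoint_or_subset (I J : L.Interval) :
    J = I ∨ (∃ K ∈ L.child I, (J : Set ℝ) ⊆ K) ∨ (∃ K ∈ L.child J, (I : Set ℝ) ⊆ K) ∨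
      Disjoint (J : Set ℝ) I := by
  by_cases hd : Disjoint (J : Set ℝ) I
  · exact Or.inr (Or.inr (Or.inr hd))
  obtain ⟨x, hxJ, hxI⟩ := Set.not_disjoint_iff.1 hd
  by_cases he : J = I
  · exact Or.inl he
  have hne : (J : Set ℝ) ≠ I := fun h => he (Subtype.ext h)
  rcases J.subset_or_subset I hxJ hxI with h | h
  · exact Or.inr (Or.inl (exists_child_superset (h.ssubset_of_ne hne)))
  · exact Or.inr (Or.inr (Or.inl (exists_child_superset (h.ssubset_of_ne hne.symm))))

lemma mem_top {x : ℝ} (hx : x ∈ L.carrier) : x ∈ L.top x := mem_iUnion.2 ⟨0, mem_cell 0 hx⟩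

lemma cell_subset_top (k : ℤ) (x : ℝ) : L.cell k x ⊆ L.top x :=
  subset_iUnion (fun k => L.cell k x) k

lemma Interval.subset_top (I : L.Interval) {x : ℝ} (hx : x ∈ (I : Set ℝ)) :
    (I : Set ℝ) ⊆ L.top x := by
  obtain ⟨k, hk⟩ := I.eq_cell
  rw [← hk x hx]; exact cell_subset_top k x

lemma top_eq_iUnion_le (x : ℝ) (k : ℤ) : L.top x = ⋃ j : {j : ℤ // j ≤ k}, L.cell j x := by
  refine Subset.antisymm (iUnion_subset fun j => ?_) (iUnion_subset fun j => cell_subset_top _ x)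
  exact (cell_subset (min_le_left j k) x).trans
    (subset_iUnion (fun j : {j : ℤ // j ≤ k} => L.cell j x) ⟨min j k, min_le_right j k⟩)

lemma top_eq_of_mem {x y : ℝ} (hy : y ∈ L.top x) : L.top y = L.top x := by
  obtain ⟨k, hk⟩ := mem_iUnion.1 hy
  rw [top_eq_iUnion_le x k, top_eq_iUnion_le y k]
  exact iUnion_congr fun j => cell_eq_of_mem_of_le j.2 hk

lemma mem_limitIntervals_iff {S : Set ℝ} :
    S ∈ L.limitIntervals ↔ ∃ x ∈ L.carrier, S = L.top x := by
  constructor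
  · rintro ⟨J, hJ, rfl⟩
    obtain ⟨x, hx⟩ : (J 0).Nonempty := by
      obtain ⟨a, b, hab, h⟩ := L.isInterval 0 _ (hJ 0).1
      rw [h]; exact Set.nonempty_Ico.2 hab
    have hanti : ∀ i j : ℤ, i ≤ j → J j ⊆ J i := by
      intro i j hij
      induction j, hij using Int.leInduction with
      | base => exact subset_rfl
      | succ l _ ih =>
        have := (hJ (l + 1)).2
        rw [add_sub_cancel_right] at this
        exact this.trans ih
    refine ⟨x, mem_carrier (hJ 0).1 hx, ?_⟩
    -- The point x lies in J 0 but perhaps not in J j for positive j, so only the nonpositive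
    -- indices are compared; they exhaust both unions.
    rw [top_eq_iUnion_le x 0]
    refine Subset.antisymm (iUnion_subset fun j => ?_) (iUnion_subset fun j => ?_)
    · refine (hanti (min j 0) j (min_le_left _ _)).trans ?_
      rw [← cell_eq (hJ (min j 0)).1 (hanti _ _ (min_le_right _ _) hx)]
      exact subset_iUnion (fun j : {j : ℤ // j ≤ 0} => L.cell j x) ⟨min j 0, min_le_right j 0⟩
    · rw [cell_eq (hJ j).1 (hanti _ _ j.2 hx)]
      exact subset_iUnion J j
  · rintro ⟨x, hx, rfl⟩
    refine ⟨fun k => L.cell k x, fun k => ⟨cell_mem_gen k hx, ?_⟩, rfl⟩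
    exact cell_subset (by omega) x

lemma mem_finLimitIntervals_iff {S : Set ℝ} :
    S ∈ L.finLimitIntervals ↔ ∃ x ∈ L.carrier, S = L.top x ∧ volume (L.top x) < ∞ := by
  rw [finLimitIntervals, mem_ofPred_eq, mem_limitIntervals_iff]
  constructor
  · rintro ⟨⟨x, hx, rfl⟩, h⟩; exact ⟨x, hx, rfl, h⟩
  · rintro ⟨x, hx, rfl, h⟩; exact ⟨⟨x, hx, rfl⟩, h⟩

lemma measurableSet_cell (k : ℤ) (x : ℝ) : MeasurableSet (L.cell k x) := by
  by_cases hx : x ∈ L.carrier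
  · exact (L.cellInterval k x hx).measurableSet
  · have : L.cell k x = ∅ := by
      by_contra h
      obtain ⟨y, hy⟩ := nonempty_iff_ne_empty.2 h
      exact hx (mem_carrier_of_mem_cell hy)
    rw [this]; exact MeasurableSet.empty

lemma measurableSet_top (x : ℝ) : MeasurableSet (L.top x) :=
  MeasurableSet.iUnion fun k => measurableSet_cell k x

lemma top_subset_carrier {x : ℝ} (hx : x ∈ L.carrier) : L.top x ⊆ L.carrier :=
  iUnion_subset fun k => (L.cellInterval k x hx).subset_carrier

lemma Interval.subset_top_or_disjoint (I : L.Interval) (x : ℝ) :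
    (I : Set ℝ) ⊆ L.top x ∨ Disjoint (I : Set ℝ) (L.top x) := by
  by_cases h : Disjoint (I : Set ℝ) (L.top x)
  · exact Or.inr h
  · obtain ⟨y, hy, hyx⟩ := Set.not_disjoint_iff.1 h
    rw [← top_eq_of_mem hyx]
    exact Or.inl (I.subset_top hy)

lemma measurableSet_of_mem_finLimitIntervals {S : Set ℝ} (hS : S ∈ L.finLimitIntervals) :
    MeasurableSet S := by
  obtain ⟨x, -, rfl, -⟩ := mem_finLimitIntervals_iff.1 hS
  exact measurableSet_top x

lemma Interval.subset_or_disjoint_of_mem_finLimitIntervals (I : L.Interval) {S : Set ℝ}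
    (hS : S ∈ L.finLimitIntervals) : (I : Set ℝ) ⊆ S ∨ Disjoint (I : Set ℝ) S := by
  obtain ⟨x, -, rfl, -⟩ := mem_finLimitIntervals_iff.1 hS
  exact I.subset_top_or_disjoint x

/-- Without a parent, the cells around a point of I are equal to I in all earlier generations, so
the union of the chain is I. Conversely a parent would lie inside the limit interval that I is. -/
lemma mem_finLimitIntervals_iff_no_parent (I : L.Interval) :
    (I : Set ℝ) ∈ L.finLimitIntervals ↔ ∀ I', I ∉ L.child I' := by
  constructor
  · intro h I' hI'
    obtain ⟨x, hx, he, -⟩ := mem_finLimitIntervals_iff.1 h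
    have hxI : x ∈ (I : Set ℝ) := he ▸ mem_top hx
    have h1 := I'.subset_top (child_subset hI' hxI)
    rw [← he] at h1
    exact (child_ssubset hI').2 h1
  · intro h
    obtain ⟨x, hx⟩ := I.nonempty
    have hxc := I.mem_carrier hx
    obtain ⟨k, hk⟩ := I.2
    have key : ∀ j ≤ k, L.cell j x = I := by
      intro j hj
      induction j, hj using Int.leInductionDown with
      | base => exact cell_eq hk hx
      | pred j hj ih =>
        by_contra hne
        refine h (L.cellInterval (j - 1) x hxc) ?_
        have h1 := cellInterval_mem_child (k := j - 1) hxc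
          (by rw [sub_add_cancel, ih]; exact Ne.symm hne)
        rwa [show L.cellInterval (j - 1 + 1) x hxc = I from
          Subtype.ext (by rw [← ih]; simp [cellInterval])] at h1
    have htop : (I : Set ℝ) = L.top x := by
      rw [top_eq_iUnion_le x k]
      refine Subset.antisymm ?_ (iUnion_subset fun j => (key j j.2).le)
      rw [← key k le_rfl]
      exact subset_iUnion (fun j : {j : ℤ // j ≤ k} => L.cell j x) ⟨k, le_rfl⟩
    exact mem_finLimitIntervals_iff.2 ⟨x, hxc, htop, htop ▸ I.volume_ne_top.lt_top⟩

lemma countable_gen (k : ℤ) : (L.gen k).Countable := by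
  refine (L.pairwiseDisjoint k).countable_of_nonempty_interior fun I hI => ?_
  obtain ⟨a, b, hab, rfl⟩ := L.isInterval k I hI
  simpa using hab

instance countable_interval : Countable L.Interval := by
  have h2 : {I : Set ℝ | ∃ k, I ∈ L.gen k}.Countable := by
    rw [show {I : Set ℝ | ∃ k, I ∈ L.gen k} = ⋃ k, L.gen k by ext; simp]
    exact countable_iUnion countable_gen
  exact h2.to_subtype

end IntervalLattice

end

noncomputable section

namespace IntervalLattice

variable {L : IntervalLattice} {𝕜 : Type*} [RCLike 𝕜]

/-! ### Averages and martingale differences -/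

lemma Interval.volume_real_pos (I : L.Interval) : 0 < volume.real (I : Set ℝ) :=
  ENNReal.toReal_pos I.volume_ne_zero I.volume_ne_top

lemma setIntegral_eq_mul_average (I : L.Interval) (f : ℝ → 𝕜) :
    ∫ x in (I : Set ℝ), f x = (volume.real (I : Set ℝ) : 𝕜) * ⨍ x in (I : Set ℝ), f x := by
  rw [setAverage_eq, RCLike.real_smul_eq_coe_mul, RCLike.ofReal_inv, mul_inv_cancel_left₀]
  exact_mod_cast I.volume_real_pos.ne'

lemma average_eq (I : L.Interval) (f : ℝ → 𝕜) :
    ⨍ x in (I : Set ℝ), f x = (volume.real (I : Set ℝ) : 𝕜)⁻¹ * ∫ x in (I : Set ℝ), f x := by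
  rw [setAverage_eq, RCLike.real_smul_eq_coe_mul, RCLike.ofReal_inv]

lemma average_of_const (I : L.Interval) {f : ℝ → 𝕜} {c : 𝕜} (h : ∀ x ∈ (I : Set ℝ), f x = c) :
    ⨍ x in (I : Set ℝ), f x = c := by
  rw [average_eq, setIntegral_congr_fun I.measurableSet h, setIntegral_const,
    RCLike.real_smul_eq_coe_mul, inv_mul_cancel_left₀]
  exact_mod_cast I.volume_real_pos.ne'

lemma setIntegral_eq_sum_child {I : L.Interval} (hI : (L.child I).Nonempty) {f : ℝ → 𝕜}
    (hf : IntegrableOn f (I : Set ℝ)) :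
    ∫ x in (I : Set ℝ), f x = ∑ J ∈ (finite_child I).toFinset, ∫ x in (J : Set ℝ), f x := by
  have hU : (I : Set ℝ) = ⋃ J ∈ (finite_child I).toFinset, (J : Set ℝ) := by
    ext x
    simp only [Set.mem_iUnion, Set.Finite.mem_toFinset, exists_prop]
    exact ⟨fun h => exists_child_of_mem hI h, fun ⟨J, hJ, hx⟩ => child_subset hJ hx⟩
  conv_lhs => rw [hU]
  refine integral_biUnion_finset _ (fun J _ => J.measurableSet) ?_ fun J hJ =>
    hf.mono_set (child_subset ((finite_child I).mem_toFinset.1 hJ))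
  intro J hJ J' hJ' hne
  refine Set.disjoint_left.2 fun x hx hx' => hne ?_
  exact child_eq_of_mem ((finite_child I).mem_toFinset.1 hJ)
    ((finite_child I).mem_toFinset.1 hJ') hx hx'

lemma D_apply_of_notMem {I : L.Interval} (h : L.D 𝕜 I) {x : ℝ} (hx : x ∉ (I : Set ℝ)) :
    (h : ℝ → 𝕜) x = 0 :=
  h.2.1 x fun _ hJ hxJ => hx (child_subset hJ hxJ)

lemma D_integrable {I : L.Interval} (h : L.D 𝕜 I) : Integrable (h : ℝ → 𝕜) :=
  integrable_of_step h.2.1 h.2.2.1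

lemma D_setIntegral_eq_zero {I : L.Interval} (h : L.D 𝕜 I) {S : Set ℝ} (hS : (I : Set ℝ) ⊆ S) :
    ∫ x in S, (h : ℝ → 𝕜) x = 0 := by
  rw [setIntegral_eq_integral_of_forall_compl_eq_zero, h.2.2.2]
  exact fun x hx => D_apply_of_notMem h fun hxI => hx (hS hxI)

lemma D_ext {I : L.Interval} {h h' : L.D 𝕜 I}
    (H : ∀ K ∈ L.child I, ∀ x ∈ (K : Set ℝ), (h : ℝ → 𝕜) x = (h' : ℝ → 𝕜) x) : h = h' := by
  apply Subtype.ext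
  funext x
  by_cases hx : ∃ K ∈ L.child I, x ∈ (K : Set ℝ)
  · obtain ⟨K, hK, hxK⟩ := hx
    exact H K hK x hxK
  · push Not at hx
    rw [h.2.1 x hx, h'.2.1 x hx]

lemma D_average_child {I K : L.Interval} (h : L.D 𝕜 I) (hK : K ∈ L.child I) {x : ℝ}
    (hx : x ∈ (K : Set ℝ)) : ⨍ y in (K : Set ℝ), (h : ℝ → 𝕜) y = (h : ℝ → 𝕜) x :=
  average_of_const K fun y hy => h.2.2.1 K hK y hy x hx

lemma diff_apply {I K : L.Interval} {f : ℝ → 𝕜} (hf : IntegrableOn f (I : Set ℝ))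
    (hK : K ∈ L.child I) {x : ℝ} (hx : x ∈ (K : Set ℝ)) :
    (diff I f : ℝ → 𝕜) x = (⨍ y in (K : Set ℝ), f y) - ⨍ y in (I : Set ℝ), f y := by
  classical
  rw [diff, dif_pos hf]
  change diffFun I f x = _
  rw [diffFun, if_pos ⟨K, hK⟩, Pi.sub_apply, Finset.sum_apply, Finset.sum_eq_single K]
  · simp [expect, hx, child_subset hK hx]
  · intro K' hK' hne
    refine Set.indicator_of_notMem (fun hx' => hne ?_) _
    exact child_eq_of_mem ((finite_child I).mem_toFinset.1 hK') hK hx' hx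
  · intro hn
    exact absurd ((finite_child I).mem_toFinset.2 hK) hn

/-- Δ_I sees a function only through its integrals over the children of I. -/
lemma diff_eq_of_setIntegral {I : L.Interval} {f g : ℝ → 𝕜} (hf : IntegrableOn f (I : Set ℝ))
    (hg : IntegrableOn g (I : Set ℝ))
    (h : ∀ K ∈ L.child I, ∫ x in (K : Set ℝ), f x = ∫ x in (K : Set ℝ), g x) :
    diff I f = diff I g := by
  refine D_ext fun K hK x hx => ?_
  rw [diff_apply hf hK hx, diff_apply hg hK hx, average_eq, average_eq, average_eq, average_eq,
    h K hK, setIntegral_eq_sum_child ⟨K, hK⟩ hf, setIntegral_eq_sum_child ⟨K, hK⟩ hg,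
    Finset.sum_congr rfl fun K hK => h K ((finite_child I).mem_toFinset.1 hK)]

lemma diff_congr {I : L.Interval} {f g : ℝ → 𝕜} (h : ∀ x ∈ (I : Set ℝ), f x = g x) :
    diff I f = diff I g := by
  by_cases hf : IntegrableOn f (I : Set ℝ)
  · have hg : IntegrableOn g (I : Set ℝ) := hf.congr_fun h I.measurableSet
    exact diff_eq_of_setIntegral hf hg fun K hK =>
      setIntegral_congr_fun K.measurableSet fun x hx => h x (child_subset hK hx)
  · have hg : ¬ IntegrableOn g (I : Set ℝ) := fun hg =>
      hf (hg.congr_fun (fun x hx => (h x hx).symm) I.measurableSet)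
    rw [diff, diff, dif_neg hf, dif_neg hg]

lemma diff_of_const {I : L.Interval} {f : ℝ → 𝕜} {c : 𝕜} (h : ∀ x ∈ (I : Set ℝ), f x = c) :
    diff I f = 0 := by
  have hf : IntegrableOn f (I : Set ℝ) :=
    (integrableOn_const (C := c) I.volume_ne_top).congr_fun (fun x hx => (h x hx).symm)
      I.measurableSet
  refine D_ext fun K hK x hx => ?_
  rw [diff_apply hf hK hx, average_of_const K fun x hx => h x (child_subset hK hx),
    average_of_const I h, sub_self]
  rfl

lemma diff_add {I : L.Interval} {f g : ℝ → 𝕜} (hf : IntegrableOn f (I : Set ℝ))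
    (hg : IntegrableOn g (I : Set ℝ)) : diff I (f + g) = diff I f + diff I g := by
  refine D_ext fun K hK x hx => ?_
  have e : ∀ J : L.Interval, (J : Set ℝ) ⊆ I → ⨍ y in (J : Set ℝ), (f + g) y =
      (⨍ y in (J : Set ℝ), f y) + ⨍ y in (J : Set ℝ), g y := fun J hJ => by
    simp only [average_eq, Pi.add_apply]
    rw [integral_add (hf.mono_set hJ) (hg.mono_set hJ), mul_add]
  rw [Submodule.coe_add, Pi.add_apply, diff_apply (hf.add hg) hK hx, diff_apply hf hK hx,
    diff_apply hg hK hx, e K (child_subset hK), e I subset_rfl]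
  ring

lemma diff_smul (I : L.Interval) {f : ℝ → 𝕜} (hf : IntegrableOn f (I : Set ℝ)) (c : 𝕜) :
    diff I (c • f) = c • diff I f := by
  refine D_ext fun K hK x hx => ?_
  have e : ∀ J : L.Interval, ⨍ y in (J : Set ℝ), (c • f) y =
      c * ⨍ y in (J : Set ℝ), f y := fun J => by
    simp only [average_eq, Pi.smul_apply, smul_eq_mul]
    rw [integral_const_mul]
    ring
  rw [Submodule.coe_smul, Pi.smul_apply, diff_apply (hf.smul c) hK hx, diff_apply hf hK hx,
    e K, e I, smul_eq_mul]
  ring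

lemma diff_sub {I : L.Interval} {f g : ℝ → 𝕜} (hf : IntegrableOn f (I : Set ℝ))
    (hg : IntegrableOn g (I : Set ℝ)) : diff I (f - g) = diff I f - diff I g := by
  rw [sub_eq_add_neg, ← neg_one_smul 𝕜 g, diff_add hf (hg.smul _), diff_smul I hg,
    sub_eq_add_neg, ← neg_one_smul 𝕜 (diff I g)]

lemma diff_sum {ι : Type*} (s : Finset ι) {I : L.Interval} {f : ι → ℝ → 𝕜}
    (hf : ∀ i ∈ s, IntegrableOn (f i) (I : Set ℝ)) :
    diff I (∑ i ∈ s, f i) = ∑ i ∈ s, diff I (f i) := by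
  classical
  induction s using Finset.induction_on with
  | empty => exact diff_of_const (c := 0) fun x _ => rfl
  | insert i s hi ih =>
    rw [Finset.sum_insert hi, Finset.sum_insert hi, diff_add (hf i (Finset.mem_insert_self i s)),
      ih fun j hj => hf j (Finset.mem_insert_of_mem hj)]
    exact integrable_finsetSum' s fun j hj => hf j (Finset.mem_insert_of_mem hj)

lemma diff_coe_D {I : L.Interval} (h : L.D 𝕜 I) : diff I (h : ℝ → 𝕜) = h := by
  refine D_ext fun K hK x hx => ?_
  rw [diff_apply (D_integrable h).integrableOn hK hx, D_average_child h hK hx, average_eq I,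
    D_setIntegral_eq_zero h subset_rfl, mul_zero, sub_zero]

/-- The difference spaces are independent: h is constant on J inside a child of I, has integral zero
over each child of J when I lies in one of them, and vanishes on J when the two are disjoint. -/
lemma diff_coe_D_of_ne {I J : L.Interval} (h : L.D 𝕜 I) (hne : J ≠ I) :
    diff J (h : ℝ → 𝕜) = 0 := by
  rcases I.eq_or_subset_child_or_disjoint_or_subset J with h1 | ⟨K, hK, hJK⟩ | ⟨K, hK, hIK⟩ | hd
  · exact absurd h1 hne
  · obtain ⟨y, hy⟩ := J.nonempty
    exact diff_of_const fun x hx => h.2.2.1 K hK x (hJK hx) y (hJK hy)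
  · have h0 : diff J (h : ℝ → 𝕜) = diff J (fun _ => (0 : 𝕜)) := by
      refine diff_eq_of_setIntegral (D_integrable h).integrableOn (by simp) fun K' hK' => ?_
      rw [integral_zero]
      by_cases he : K' = K
      · rw [he]; exact D_setIntegral_eq_zero h hIK
      · refine setIntegral_eq_zero_of_forall_eq_zero fun x hx => D_apply_of_notMem h fun hxI => ?_
        exact he (child_eq_of_mem hK' hK hx (hIK hxI))
    rw [h0]; exact diff_of_const fun _ _ => rfl
  · exact diff_of_const fun x hx => D_apply_of_notMem h (Set.disjoint_left.1 hd hx)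

lemma diff_indicator_of_mem_finLimitIntervals (I : L.Interval) {S : Set ℝ}
    (hS : S ∈ L.finLimitIntervals) (c : 𝕜) : diff I (S.indicator fun _ => c) = 0 := by
  rcases I.subset_or_disjoint_of_mem_finLimitIntervals hS with h | h
  · exact diff_of_const fun x hx => Set.indicator_of_mem (h hx) _
  · exact diff_of_const fun x hx => Set.indicator_of_notMem (Set.disjoint_left.1 h hx) _

/-! ### Finite martingale sums -/

lemma integrable_indicator_of_mem_finLimitIntervals {S : Set ℝ} (hS : S ∈ L.finLimitIntervals)
    (c : 𝕜) : Integrable (S.indicator fun _ => c) := by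
  rw [integrable_indicator_iff (measurableSet_of_mem_finLimitIntervals hS)]
  exact integrableOn_const hS.2.ne

/-- A finite decomposition of `f` into martingale differences, indexed by `F`, and multiples of
indicators of limit intervals, indexed by `G`. -/
structure IsFinDecomp (f : ℝ → 𝕜) (F : Finset L.Interval) (G : Finset (Set ℝ))
    (c : Set ℝ → 𝕜) : Prop where
  mem_fin : ∀ S ∈ G, S ∈ L.finLimitIntervals
  diff_eq_zero : ∀ I ∉ F, diff I f = 0
  coeff_eq_zero : ∀ S ∉ G, c S = 0
  eq_sum : f = ∑ I ∈ F, (diff I f : ℝ → 𝕜) + ∑ S ∈ G, S.indicator fun _ => c S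

lemma IsFinDecomp.integrable {f : ℝ → 𝕜} {F : Finset L.Interval} {G : Finset (Set ℝ)}
    {c : Set ℝ → 𝕜} (h : IsFinDecomp f F G c) : Integrable f := by
  rw [h.eq_sum]
  refine Integrable.add ?_ ?_
  · exact integrable_finsetSum' F fun I _ => D_integrable (diff I f)
  · exact integrable_finsetSum' G fun S hS =>
      integrable_indicator_of_mem_finLimitIntervals (h.mem_fin S hS) (c S)

lemma isFinDecomp_D {I : L.Interval} (h : L.D 𝕜 I) :
    IsFinDecomp (L := L) (h : ℝ → 𝕜) {I} ∅ (fun _ => 0) where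
  mem_fin := by simp
  diff_eq_zero J hJ := diff_coe_D_of_ne h (by simpa using hJ)
  coeff_eq_zero := by simp
  eq_sum := by simp [diff_coe_D h]

lemma isFinDecomp_indicator [DecidableEq (Set ℝ)] {S : Set ℝ} (hS : S ∈ L.finLimitIntervals)
    (a : 𝕜) :
    IsFinDecomp (L := L) (S.indicator fun _ => a) ∅ {S} (fun S' => if S' = S then a else 0) where
  mem_fin := by simpa using hS
  diff_eq_zero J _ := diff_indicator_of_mem_finLimitIntervals J hS a
  coeff_eq_zero S' hS' := by simp at hS'; simp [hS']
  eq_sum := by simp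

lemma IsFinDecomp.add [DecidableEq L.Interval] [DecidableEq (Set ℝ)] {f f' : ℝ → 𝕜}
    {F F' : Finset L.Interval} {G G' : Finset (Set ℝ)} {c c' : Set ℝ → 𝕜}
    (h : IsFinDecomp f F G c) (h' : IsFinDecomp f' F' G' c') :
    IsFinDecomp (f + f') (F ∪ F') (G ∪ G') (c + c') := by
  have hd : ∀ I : L.Interval, diff I (f + f') = diff I f + diff I f' := fun I =>
    diff_add h.integrable.integrableOn h'.integrable.integrableOn
  refine ⟨fun S hS => ?_, fun I hI => ?_, fun S hS => ?_, ?_⟩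
  · rcases Finset.mem_union.1 hS with hS | hS
    · exact h.mem_fin S hS
    · exact h'.mem_fin S hS
  · rw [Finset.mem_union, not_or] at hI
    rw [hd, h.diff_eq_zero I hI.1, h'.diff_eq_zero I hI.2, add_zero]
  · rw [Finset.mem_union, not_or] at hS
    rw [Pi.add_apply, h.coeff_eq_zero S hS.1, h'.coeff_eq_zero S hS.2, add_zero]
  · have e1 : ∑ I ∈ F, (diff I f : ℝ → 𝕜) = ∑ I ∈ F ∪ F', (diff I f : ℝ → 𝕜) :=
      Finset.sum_subset Finset.subset_union_left fun I _ hI => by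
        rw [h.diff_eq_zero I hI]; rfl
    have e2 : ∑ I ∈ F', (diff I f' : ℝ → 𝕜) = ∑ I ∈ F ∪ F', (diff I f' : ℝ → 𝕜) :=
      Finset.sum_subset Finset.subset_union_right fun I _ hI => by
        rw [h'.diff_eq_zero I hI]; rfl
    have e3 : ∑ S ∈ G, S.indicator (fun _ => c S) = ∑ S ∈ G ∪ G', S.indicator fun _ => c S :=
      Finset.sum_subset Finset.subset_union_left fun S _ hS => by
        rw [h.coeff_eq_zero S hS]; exact Set.indicator_zero 𝕜 S
    have e4 : ∑ S ∈ G', S.indicator (fun _ => c' S) = ∑ S ∈ G ∪ G', S.indicator fun _ => c' S :=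
      Finset.sum_subset Finset.subset_union_right fun S _ hS => by
        rw [h'.coeff_eq_zero S hS]; exact Set.indicator_zero 𝕜 S
    have e5 : ∑ S ∈ G ∪ G', S.indicator (fun _ => (c + c') S) =
        ∑ S ∈ G ∪ G', S.indicator (fun _ => c S) + ∑ S ∈ G ∪ G', S.indicator fun _ => c' S := by
      rw [← Finset.sum_add_distrib]
      exact Finset.sum_congr rfl fun S _ => Set.indicator_add S _ _
    rw [e5, ← e3, ← e4]
    simp only [hd, Submodule.coe_add]
    rw [Finset.sum_add_distrib, ← e1, ← e2]
    nth_rw 1 [h.eq_sum, h'.eq_sum]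
    abel

lemma IsFinDecomp.smul {f : ℝ → 𝕜} {F : Finset L.Interval} {G : Finset (Set ℝ)} {c : Set ℝ → 𝕜}
    (h : IsFinDecomp f F G c) (a : 𝕜) : IsFinDecomp (a • f) F G (a • c) := by
  have hd : ∀ I : L.Interval, diff I (a • f) = a • diff I f := fun I =>
    diff_smul I h.integrable.integrableOn a
  refine ⟨h.mem_fin, fun I hI => by rw [hd, h.diff_eq_zero I hI, smul_zero], fun S hS => by
    rw [Pi.smul_apply, h.coeff_eq_zero S hS, smul_zero], ?_⟩
  simp only [hd, Submodule.coe_smul]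
  nth_rw 1 [h.eq_sum]
  rw [smul_add, Finset.smul_sum, Finset.smul_sum]
  congr 1
  refine Finset.sum_congr rfl fun S _ => ?_
  funext x
  by_cases hx : x ∈ S <;> simp [hx]

/-- Turns membership in an abstract span into a sum whose coefficients are the actual differences of
f, with explicit finite supports. On such functions the `finsum` defining `apply` is an honest
finite sum. -/
lemma exists_isFinDecomp {f : ℝ → 𝕜} (hf : f ∈ L.finSums 𝕜) :
    ∃ F G c, IsFinDecomp (L := L) f F G c := by
  classical
  induction hf using Submodule.span_induction with
  | mem f hf =>
    rcases hf with hf | ⟨S, hS, rfl⟩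
    · obtain ⟨I, hI⟩ := mem_iUnion.1 hf
      exact ⟨_, _, _, isFinDecomp_D ⟨f, hI⟩⟩
    · exact ⟨_, _, _, isFinDecomp_indicator hS 1⟩
  | zero =>
    refine ⟨∅, ∅, 0, by simp, fun I _ => diff_of_const fun _ _ => rfl, by simp, by simp⟩
  | add f f' _ _ ih ih' =>
    obtain ⟨F, G, c, h⟩ := ih
    obtain ⟨F', G', c', h'⟩ := ih'
    exact ⟨_, _, _, h.add h'⟩
  | smul a f _ ih =>
    obtain ⟨F, G, c, h⟩ := ih
    exact ⟨_, _, _, h.smul a⟩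

lemma D_mem_finSums {I : L.Interval} (h : L.D 𝕜 I) : (h : ℝ → 𝕜) ∈ L.finSums 𝕜 :=
  Submodule.subset_span (Or.inl (mem_iUnion.2 ⟨I, h.2⟩))

lemma indicator_mem_finSums {S : Set ℝ} (hS : S ∈ L.finLimitIntervals) (a : 𝕜) :
    (S.indicator fun _ => a) ∈ L.finSums 𝕜 := by
  have h : (S.indicator fun _ => (1 : 𝕜)) ∈ L.finSums 𝕜 :=
    Submodule.subset_span (Or.inr ⟨S, hS, rfl⟩)
  have := Submodule.smul_mem _ a h
  convert this using 1
  funext x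
  by_cases hx : x ∈ S <;> simp [hx]

namespace MartingaleTransform

variable (T : MartingaleTransform L 𝕜)

lemma apply_eq_sum {f : ℝ → 𝕜} {F : Finset L.Interval} (h : ∀ I ∉ F, diff I f = 0) :
    T.apply f = ∑ I ∈ F, (T.block I (diff I f) : ℝ → 𝕜) := by
  refine finsum_eq_sum_of_support_subset _ fun I hI => ?_
  by_contra hIF
  refine hI ?_
  simp only [h I hIF, map_zero]
  rfl

lemma apply_mem_finSums {f : ℝ → 𝕜} (hf : f ∈ L.finSums 𝕜) : T.apply f ∈ L.finSums 𝕜 := by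
  obtain ⟨F, G, c, h⟩ := exists_isFinDecomp hf
  rw [T.apply_eq_sum h.diff_eq_zero]
  exact Submodule.sum_mem _ fun I _ => D_mem_finSums _

lemma diff_apply_eq {f : ℝ → 𝕜} (hf : f ∈ L.finSums 𝕜) (I : L.Interval) :
    diff I (T.apply f) = T.block I (diff I f) := by
  classical
  obtain ⟨F, G, c, h⟩ := exists_isFinDecomp hf
  rw [T.apply_eq_sum h.diff_eq_zero, diff_sum F fun J _ => (D_integrable _).integrableOn]
  by_cases hI : I ∈ F
  · rw [Finset.sum_eq_single_of_mem I hI fun J _ hne => diff_coe_D_of_ne _ hne.symm, diff_coe_D]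
  · rw [h.diff_eq_zero I hI, map_zero]
    refine Finset.sum_eq_zero fun J hJ => diff_coe_D_of_ne _ ?_
    rintro rfl
    exact hI hJ

lemma apply_sub {f g : ℝ → 𝕜} (hf : f ∈ L.finSums 𝕜) (hg : g ∈ L.finSums 𝕜) :
    T.apply (f - g) = T.apply f - T.apply g := by
  classical
  obtain ⟨F, G, c, h⟩ := exists_isFinDecomp hf
  obtain ⟨F', G', c', h'⟩ := exists_isFinDecomp hg
  have hd : ∀ I : L.Interval, diff I (f - g) = diff I f - diff I g := fun I =>
    diff_sub h.integrable.integrableOn h'.integrable.integrableOn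
  have h1 : ∀ I ∉ F ∪ F', diff I f = 0 := fun I hI =>
    h.diff_eq_zero I fun h => hI (Finset.mem_union_left _ h)
  have h2 : ∀ I ∉ F ∪ F', diff I g = 0 := fun I hI =>
    h'.diff_eq_zero I fun h => hI (Finset.mem_union_right _ h)
  rw [T.apply_eq_sum h1, T.apply_eq_sum h2, T.apply_eq_sum (F := F ∪ F') fun I hI => by
    rw [hd, h1 I hI, h2 I hI, sub_zero], ← Finset.sum_sub_distrib]
  exact Finset.sum_congr rfl fun I _ => by rw [hd, map_sub]; rfl

lemma setIntegral_apply_eq_zero {f : ℝ → 𝕜} (hf : f ∈ L.finSums 𝕜) {S : Set ℝ}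
    (hS : S ∈ L.finLimitIntervals) : ∫ x in S, T.apply f x = 0 := by
  obtain ⟨F, G, c, h⟩ := exists_isFinDecomp hf
  rw [T.apply_eq_sum h.diff_eq_zero]
  simp only [Finset.sum_apply]
  rw [integral_finsetSum _ fun I _ => (D_integrable (T.block I (diff I f))).integrableOn]
  refine Finset.sum_eq_zero fun I _ => ?_
  rcases I.subset_or_disjoint_of_mem_finLimitIntervals hS with h | h
  · exact D_setIntegral_eq_zero _ h
  · exact setIntegral_eq_zero_of_forall_eq_zero fun x hx =>
      D_apply_of_notMem _ fun hxI => Set.disjoint_left.1 h hxI hx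

end MartingaleTransform

end IntervalLattice

end

/-! ### Transfer between the lattice and finite martingales; the two directions of the proof -/

noncomputable section

namespace FiniteMartingale

lemma isMart_condE {α : Type*} [Fintype α] {𝕜 : Type*} [RCLike 𝕜] {w : α → ℝ}
    {r : ℕ → α → α → Prop} {n : ℕ} (hw : ∀ x, 0 < w x) (hr : ∀ k x y, r (k + 1) x y → r k x y)
    (he : ∀ k, Equivalence (r k)) {g : α → 𝕜} {f : ℕ → α → 𝕜}
    (hf : ∀ k ≤ n, f k = condE w (r k) g) : IsMart w r n f := by
  refine ⟨fun k hk x y h => by rw [hf k hk]; exact condE_congr w (he k) g h, fun k hk φ hφ => ?_⟩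
  simp only [mul_sub, Finset.sum_sub_distrib]
  rw [hf k hk.le, hf (k + 1) hk,
    sum_mul_condE hw (he (k + 1)) g (adapted_mono hr (Nat.le_succ k) hφ),
    sum_mul_condE hw (he k) g hφ, sub_self]

end FiniteMartingale

namespace IntervalLattice

open FiniteMartingale

variable {L : IntervalLattice} {𝕜 : Type*} [RCLike 𝕜]

/-! ### Restriction of martingales to finitely many generations -/

variable (L) in
/-- The average of `f` over the cell of `x` in generation `k`. -/
def cellAvg (k : ℤ) (f : ℝ → 𝕜) (x : ℝ) : 𝕜 := ⨍ y in L.cell k x, f y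

lemma finite_gen_subset {k : ℤ} {K : Set ℝ} (hK : K ∈ L.gen k) :
    {J ∈ L.gen (k + 1) | J ⊆ K}.Finite := by
  obtain ⟨F, hF, hI⟩ := L.refines k K hK
  refine F.finite_toSet.subset fun J ⟨hJ, hJK⟩ => ?_
  obtain ⟨x, hx⟩ : J.Nonempty := Interval.nonempty (⟨J, _, hJ⟩ : L.Interval)
  have hxK := hJK hx
  rw [hI] at hxK
  obtain ⟨J', hJ'F, hxJ'⟩ := hxK
  rw [← cell_eq hJ hx, cell_eq (hF hJ'F) hxJ']
  exact hJ'F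

variable (L) in
/-- The intervals of generation `m + n` that are contained in `K`. -/
abbrev Atom (m : ℤ) (n : ℕ) (K : Set ℝ) : Type := {J : Set ℝ // J ∈ L.gen (m + n) ∧ J ⊆ K}

lemma finite_atom {m : ℤ} {K : Set ℝ} (hK : K ∈ L.gen m) (n : ℕ) : Finite (L.Atom m n K) := by
  have : {J | J ∈ L.gen (m + n) ∧ J ⊆ K}.Finite := by
    induction n with
    | zero =>
      refine (Set.finite_singleton K).subset fun J ⟨hJ, hJK⟩ => ?_
      obtain ⟨x, hx⟩ : J.Nonempty := Interval.nonempty (⟨J, _, hJ⟩ : L.Interval)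
      rw [Nat.cast_zero, add_zero] at hJ
      rw [mem_singleton_iff, ← cell_eq hJ hx, cell_eq hK (hJK hx)]
    | succ n ih =>
      refine (ih.biUnion (t := fun K' => {J ∈ L.gen (m + n + 1) | J ⊆ K'})
        fun K' hK' => finite_gen_subset hK'.1).subset fun J ⟨hJ, hJK⟩ => ?_
      obtain ⟨x, hx⟩ : J.Nonempty := Interval.nonempty (⟨J, _, hJ⟩ : L.Interval)
      rw [Nat.cast_succ, ← add_assoc] at hJ
      have hxc := mem_carrier hJ hx
      have h1 : J ⊆ L.cell (m + n) x := by rw [← cell_eq hJ hx]; exact cell_succ_subset _ x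
      have h2 : L.cell (m + n) x ⊆ K := by
        rw [← cell_eq hK (hJK hx)]; exact cell_subset (by omega) x
      exact mem_biUnion (⟨cell_mem_gen _ hxc, h2⟩ : _ ∧ _) ⟨hJ, h1⟩
  exact this.to_subtype

namespace Atom

variable {m : ℤ} {n : ℕ} {K : Set ℝ}

/-- The atom as an interval of the lattice. -/
def interval (J : L.Atom m n K) : L.Interval := ⟨J.1, _, J.2.1⟩

/-- A point of the atom. -/
def pt (J : L.Atom m n K) : ℝ := J.interval.nonempty.some

lemma pt_mem (J : L.Atom m n K) : J.pt ∈ J.1 := J.interval.nonempty.some_mem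

lemma pt_mem_carrier (J : L.Atom m n K) : J.pt ∈ L.carrier := mem_carrier J.2.1 J.pt_mem

lemma cell_pt (J : L.Atom m n K) : L.cell (m + n) J.pt = J.1 := cell_eq J.2.1 J.pt_mem

/-- The length of an atom. -/
def len (J : L.Atom m n K) : ℝ := volume.real J.1

lemma len_pos (J : L.Atom m n K) : 0 < J.len := J.interval.volume_real_pos

/-- Two atoms are related at level `k` if they have the same ancestor in generation `m + k`. -/
def Rel (k : ℕ) (J J' : L.Atom m n K) : Prop := L.cell (m + k) J.pt = L.cell (m + k) J'.pt

lemma rel_equivalence (k : ℕ) : Equivalence (Rel (L := L) (m := m) (n := n) (K := K) k) :=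
  ⟨fun _ => rfl, fun h => h.symm, fun h h' => h.trans h'⟩

lemma rel_of_rel_succ (k : ℕ) (J J' : L.Atom m n K) (h : Rel (k + 1) J J') : Rel k J J' := by
  have h1 : J'.pt ∈ L.cell (m + (k + 1 : ℕ)) J.pt := by
    rw [show L.cell (m + (k + 1 : ℕ)) J.pt = _ from h]; exact mem_cell _ J'.pt_mem_carrier
  exact (cell_eq_of_mem_of_le (by push_cast; omega) h1).symm

lemma subset_cell {k : ℕ} (hk : k ≤ n) (J : L.Atom m n K) : J.1 ⊆ L.cell (m + k) J.pt := by
  rw [← J.cell_pt]; exact cell_subset (by omega) _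

lemma pairwise_disjoint : Pairwise fun J J' : L.Atom m n K => Disjoint J.1 J'.1 := by
  intro J J' hne
  exact L.pairwiseDisjoint _ J.2.1 J'.2.1 fun h => hne (Subtype.ext h)

lemma cell_eq_iUnion (hK : K ∈ L.gen m) {k : ℕ} (hk : k ≤ n) (J : L.Atom m n K) :
    L.cell (m + k) J.pt = ⋃ J' : {J' : L.Atom m n K // Rel k J J'}, J'.1.1 := by
  refine Subset.antisymm (fun x hx => ?_) (iUnion_subset fun J' => ?_)
  · have hxk := cell_eq_of_mem hx
    have hxc : x ∈ L.carrier := by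
      rw [← L.covers (m + k)]; exact ⟨_, cell_mem_gen _ (mem_carrier_of_mem_cell hx), hx⟩
    have hxK : x ∈ K := by
      have h1 := cell_subset (L := L) (by omega : m ≤ m + k) J.pt hx
      rwa [cell_eq hK (J.2.2 J.pt_mem)] at h1
    have hJ' : L.cell (m + n) x ⊆ K := by
      rw [← cell_eq hK hxK]; exact cell_subset (by omega) x
    let J' : L.Atom m n K := ⟨L.cell (m + n) x, cell_mem_gen _ hxc, hJ'⟩
    have h2 : L.cell (m + k) J'.pt = L.cell (m + k) x :=
      cell_eq_of_mem_of_le (by omega : m + (k : ℤ) ≤ m + n) J'.pt_mem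
    exact mem_iUnion.2 ⟨⟨J', (h2.trans hxk).symm⟩, mem_cell _ hxc⟩
  · have h1 : L.cell (m + k) J.pt = L.cell (m + k) J'.1.pt := J'.2
    rw [h1]
    exact subset_cell hk J'.1

open Classical in
lemma sum_subtype_rel [Fintype (L.Atom m n K)] {M : Type*} [AddCommMonoid M] (k : ℕ)
    (J : L.Atom m n K) (f : L.Atom m n K → M) :
    ∑ J' : {J' : L.Atom m n K // Rel k J J'}, f J'.1 = ∑ J', if Rel k J J' then f J' else 0 := by
  rw [← Finset.sum_filter]
  exact (Finset.sum_subtype _ (by simp) f).symm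

open Classical in
lemma setIntegral_cell_eq [Fintype (L.Atom m n K)] (hK : K ∈ L.gen m) {f : ℝ → 𝕜}
    (hf : IntegrableOn f K) {k : ℕ} (hk : k ≤ n) (J : L.Atom m n K) :
    ∫ x in L.cell (m + k) J.pt, f x =
      ∑ J' : L.Atom m n K, if Rel k J J' then ∫ x in J'.1, f x else 0 := by
  rw [cell_eq_iUnion hK hk, integral_iUnion_fintype
    (fun J' => J'.1.interval.measurableSet)
    (fun J' J'' hne => pairwise_disjoint fun h => hne (Subtype.ext h))
    (fun J' => hf.mono_set J'.1.2.2)]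
  exact sum_subtype_rel k J fun J' => ∫ x in J'.1, f x

open Classical in
lemma lintegral_cell_eq [Fintype (L.Atom m n K)] (hK : K ∈ L.gen m) (f : ℝ → ℝ≥0∞) {k : ℕ}
    (hk : k ≤ n) (J : L.Atom m n K) :
    ∫⁻ x in L.cell (m + k) J.pt, f x =
      ∑ J' : L.Atom m n K, if Rel k J J' then ∫⁻ x in J'.1, f x else 0 := by
  rw [cell_eq_iUnion hK hk, lintegral_iUnion
    (fun J' => J'.1.interval.measurableSet)
    (fun J' J'' hne => pairwise_disjoint fun h => hne (Subtype.ext h)), tsum_fintype]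
  exact sum_subtype_rel k J fun J' => ∫⁻ x in J'.1, f x

lemma iUnion_eq (hK : K ∈ L.gen m) : ⋃ J : L.Atom m n K, J.1 = K := by
  refine Subset.antisymm (iUnion_subset fun J => J.2.2) fun x hx => ?_
  have hJ' : L.cell (m + n) x ⊆ K := by
    rw [← cell_eq hK hx]; exact cell_subset (by omega) x
  exact mem_iUnion.2 ⟨⟨_, cell_mem_gen _ (mem_carrier hK hx), hJ'⟩, mem_cell _ (mem_carrier hK hx)⟩

lemma lintegral_eq [Fintype (L.Atom m n K)] (hK : K ∈ L.gen m) (f : ℝ → ℝ≥0∞) :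
    ∫⁻ x in K, f x = ∑ J : L.Atom m n K, ∫⁻ x in J.1, f x := by
  conv_lhs => rw [← iUnion_eq (n := n) hK]
  rw [lintegral_iUnion (fun J => J.interval.measurableSet) pairwise_disjoint, tsum_fintype]

lemma lintegral_const_eq (J : L.Atom m n K) {f : ℝ → ℝ≥0∞} {c : ℝ}
    (h : ∀ x ∈ J.1, f x = ENNReal.ofReal c) :
    ∫⁻ x in J.1, f x = ENNReal.ofReal (J.len * c) := by
  have h1 : ∫⁻ x in J.1, f x = ∫⁻ _ in J.1, ENNReal.ofReal c :=
    setLIntegral_congr_fun J.interval.measurableSet h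
  have h2 : volume J.1 ≠ ∞ := J.interval.volume_ne_top
  rw [h1, setLIntegral_const, mul_comm, ENNReal.ofReal_mul J.len_pos.le, len, Measure.real,
    ENNReal.ofReal_toReal h2]

/-- Integrals over `K` of functions that are constant on the atoms are finite sums. -/
lemma lintegral_eq_of_const [Fintype (L.Atom m n K)] (hK : K ∈ L.gen m) {f : ℝ → ℝ≥0∞}
    {c : L.Atom m n K → ℝ} (hc : ∀ J, 0 ≤ c J)
    (h : ∀ J : L.Atom m n K, ∀ x ∈ J.1, f x = ENNReal.ofReal (c J)) :
    ∫⁻ x in K, f x = ENNReal.ofReal (∑ J, J.len * c J) := by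
  rw [lintegral_eq (n := n) hK, ENNReal.ofReal_sum_of_nonneg fun J _ =>
    mul_nonneg J.len_pos.le (hc J)]
  exact Finset.sum_congr rfl fun J _ => lintegral_const_eq J (h J)

/-- Averages over cells are conditional expectations on the finite set of atoms. -/
lemma cellAvg_eq_condE [Fintype (L.Atom m n K)] (hK : K ∈ L.gen m) {f : ℝ → 𝕜}
    (hf : IntegrableOn f K) {k : ℕ} (hk : k ≤ n) :
    (fun J : L.Atom m n K => L.cellAvg (m + k) f J.pt) =
      condE len (Rel k) fun J : L.Atom m n K => ⨍ x in J.1, f x := by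
  classical
  funext J
  have h1 := setIntegral_cell_eq hK hf hk J
  have h2 := setIntegral_cell_eq (f := fun _ => (1 : ℝ)) (n := n) hK
    (integrableOn_const (Interval.volume_ne_top (⟨K, m, hK⟩ : L.Interval))) hk J
  have h3 := average_eq (L.cellInterval (m + k) J.pt J.pt_mem_carrier) f
  rw [cellAvg, show ⨍ y in L.cell (m + k) J.pt, f y = _ from h3, condE, div_eq_inv_mul]
  simp only [cellInterval]
  congr 1
  · simp only [setIntegral_const, smul_eq_mul, mul_one] at h2
    rw [h2]
    push_cast
    congr 1
    refine Finset.sum_congr rfl fun J' _ => ?_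
    by_cases h : Rel k J J' <;> simp [h, len]
  · rw [h1]
    refine Finset.sum_congr rfl fun J' _ => ?_
    by_cases h : Rel k J J'
    · rw [if_pos h, if_pos h]; exact setIntegral_eq_mul_average J'.interval f
    · rw [if_neg h, if_neg h]

lemma isMart_cellAvg [Fintype (L.Atom m n K)] (hK : K ∈ L.gen m) {f : ℝ → 𝕜}
    (hf : IntegrableOn f K) :
    IsMart (len (L := L) (m := m) (n := n) (K := K)) Rel n fun k J => L.cellAvg (m + k) f J.pt :=
  isMart_condE len_pos rel_of_rel_succ rel_equivalence
    (g := fun J : L.Atom m n K => ⨍ x in J.1, f x) fun _ hk => cellAvg_eq_condE hK hf hk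

end Atom

lemma cellAvg_eq_of_mem {k : ℤ} {x y : ℝ} (h : y ∈ L.cell k x) (f : ℝ → 𝕜) :
    L.cellAvg k f y = L.cellAvg k f x := by rw [cellAvg, cellAvg, cell_eq_of_mem h]

lemma Atom.cellAvg_eq {m : ℤ} {n k : ℕ} {K : Set ℝ} (hk : k ≤ n) (J : L.Atom m n K) {x : ℝ}
    (hx : x ∈ J.1) (f : ℝ → 𝕜) : L.cellAvg (m + k) f x = L.cellAvg (m + k) f J.pt :=
  cellAvg_eq_of_mem (J.subset_cell hk hx) f

/-! ### Coefficients and the `BMO` norm -/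

lemma coeff_eq {δ : ∀ I : L.Interval, L.D 𝕜 I} {I K : L.Interval} (hK : K ∈ L.child I) {x : ℝ}
    (hx : x ∈ (K : Set ℝ)) : coeff δ K = (δ I : ℝ → 𝕜) x := by
  have : {I : L.Interval | K ∈ L.child I} = {I} := by
    ext I'
    exact ⟨fun h => parent_unique h hK, fun h => (mem_singleton_iff.1 h) ▸ hK⟩
  rw [coeff, this, finsum_mem_singleton, D_average_child _ hK hx]

lemma coeff_eq_zero_of_no_parent {δ : ∀ I : L.Interval, L.D 𝕜 I} {K : L.Interval}
    (h : ∀ I, K ∉ L.child I) : coeff δ K = 0 := by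
  rw [coeff]
  exact finsum_mem_eq_zero_of_forall_eq_zero fun I hI => absurd hI (h I)

lemma diff_apply_cell {b : ℝ → 𝕜} (hb : L.LocIntegrable b) {k : ℤ} {x : ℝ} (hx : x ∈ L.carrier)
    (hne : L.cell (k + 1) x ≠ L.cell k x) :
    (diff (L.cellInterval k x hx) b : ℝ → 𝕜) x = L.cellAvg (k + 1) b x - L.cellAvg k b x :=
  diff_apply (hb _) (cellInterval_mem_child hx hne) (mem_cell (k + 1) hx)

lemma coeff_diff_cell {b : ℝ → 𝕜} (hb : L.LocIntegrable b) {k : ℤ} {x : ℝ}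
    (hx : x ∈ L.carrier) (hne : L.cell (k + 1) x ≠ L.cell k x) :
    coeff (fun I => diff I b) (L.cellInterval (k + 1) x hx) =
      L.cellAvg (k + 1) b x - L.cellAvg k b x := by
  rw [coeff_eq (cellInterval_mem_child hx hne) (mem_cell (k + 1) hx), ← diff_apply_cell hb hx hne]

lemma cellAvg_succ_sub_eq_zero {b : ℝ → 𝕜} {k : ℤ} {x : ℝ} (h : L.cell (k + 1) x = L.cell k x) :
    L.cellAvg (k + 1) b x - L.cellAvg k b x = 0 := by
  rw [cellAvg, cellAvg, h, sub_self]

/-- The integral of the square function over an interval, in terms of the `BMO` norm. -/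
lemma lintegral_tsum_le_bmoNorm (δ : ∀ I : L.Interval, L.D 𝕜 I) (J : L.Interval) :
    ∫⁻ x in (J : Set ℝ), ∑' I : {I : L.Interval // (I : Set ℝ) ⊆ J},
      (I.1 : Set ℝ).indicator (fun _ => ‖coeff δ I.1‖ₑ ^ 2) x ≤
    bmoNorm δ ^ 2 * volume (J : Set ℝ) := by
  set X := ∫⁻ x in (J : Set ℝ), ∑' I : {I : L.Interval // (I : Set ℝ) ⊆ J},
      (I.1 : Set ℝ).indicator (fun _ => ‖coeff δ I.1‖ₑ ^ 2) x with hX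
  have h : ((volume (J : Set ℝ))⁻¹ * X) ^ (1 / 2 : ℝ) ≤ bmoNorm δ :=
    le_iSup (fun J : L.Interval => ((volume (J : Set ℝ))⁻¹ * ∫⁻ x in (J : Set ℝ),
    ∑' I : {I : L.Interval // (I : Set ℝ) ⊆ J},
      (I.1 : Set ℝ).indicator (fun _ => ‖coeff δ I.1‖ₑ ^ 2) x) ^ (1 / 2 : ℝ)) J
  have h2 := pow_le_pow_left' h 2
  rw [← ENNReal.rpow_natCast, ← ENNReal.rpow_mul] at h2
  norm_num at h2
  calc X = volume (J : Set ℝ) * ((volume (J : Set ℝ))⁻¹ * X) := by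
        rw [← mul_assoc, ENNReal.mul_inv_cancel J.volume_ne_zero J.volume_ne_top, one_mul]
    _ ≤ volume (J : Set ℝ) * bmoNorm δ ^ 2 := by gcongr
    _ = _ := mul_comm _ _

/-- The increments of `b` at a point, dominated by the square function of an interval. -/
lemma sum_increment_le_tsum {b : ℝ → 𝕜} (hb : L.LocIntegrable b) {J : L.Interval} {x : ℝ}
    (hx : x ∈ L.carrier) (s : Finset ℤ) (hs : ∀ k ∈ s, L.cell (k + 1) x ⊆ J) :
    ∑ k ∈ s, ‖L.cellAvg (k + 1) b x - L.cellAvg k b x‖ₑ ^ 2 ≤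
      ∑' I : {I : L.Interval // (I : Set ℝ) ⊆ J},
        (I.1 : Set ℝ).indicator (fun _ => ‖coeff (fun I => diff I b) I.1‖ₑ ^ 2) x := by
  classical
  -- Generations in which the cell of x is repeated contribute zero increments; without them the map
  -- from generations to intervals is injective.
  set s' := s.filter fun k => L.cell (k + 1) x ≠ L.cell k x with hs'
  have h1 : ∑ k ∈ s, ‖L.cellAvg (k + 1) b x - L.cellAvg k b x‖ₑ ^ 2 =
      ∑ k ∈ s', ‖L.cellAvg (k + 1) b x - L.cellAvg k b x‖ₑ ^ 2 := by
    symm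
    refine Finset.sum_subset (Finset.filter_subset _ _) fun k hk hk' => ?_
    rw [cellAvg_succ_sub_eq_zero]
    · simp
    · by_contra h
      exact hk' (Finset.mem_filter.2 ⟨hk, h⟩)
  rw [h1]
  let e : {k // k ∈ s'} → {I : L.Interval // (I : Set ℝ) ⊆ J} := fun k =>
    ⟨L.cellInterval (k.1 + 1) x hx, hs k.1 (Finset.mem_filter.1 k.2).1⟩
  have he : Function.Injective e := by
    have key : ∀ k l : {k // k ∈ s'}, e k = e l → ¬ k.1 < l.1 := by
      intro k l h hlt
      have h2 : L.cell (k.1 + 1) x = L.cell (l.1 + 1) x :=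
        congrArg (fun I : {I : L.Interval // (I : Set ℝ) ⊆ J} => (I.1 : Set ℝ)) h
      have h3 := cell_subset (L := L) (by omega : k.1 + 1 ≤ l.1) x
      rw [h2] at h3
      exact (Finset.mem_filter.1 l.2).2 (Subset.antisymm (cell_succ_subset _ x) h3)
    intro k l h
    exact Subtype.ext (le_antisymm (not_lt.1 (key l k h.symm)) (not_lt.1 (key k l h)))
  rw [← Finset.sum_attach]
  have h2 : ∑ k ∈ s'.attach, ‖L.cellAvg (k.1 + 1) b x - L.cellAvg k.1 b x‖ₑ ^ 2 =
      ∑' k : {k // k ∈ s'}, ((e k).1 : Set ℝ).indicator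
        (fun _ => ‖coeff (fun I => diff I b) (e k).1‖ₑ ^ 2) x := by
    rw [tsum_fintype]
    refine Finset.sum_congr rfl fun k _ => ?_
    have hk := Finset.mem_filter.1 k.2
    have h3 : x ∈ ((e k).1 : Set ℝ) := mem_cell (k.1 + 1) hx
    rw [Set.indicator_of_mem h3,
      show coeff (fun I => diff I b) (e k).1 = _ from coeff_diff_cell hb hx hk.2]
  rw [h2]
  exact ENNReal.tsum_comp_le_tsum_of_injective he fun I : {I : L.Interval // (I : Set ℝ) ⊆ J} =>
    (I.1 : Set ℝ).indicator (fun _ => ‖coeff (fun I => diff I b) I.1‖ₑ ^ 2) x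

namespace Atom

variable {m : ℤ} {n : ℕ} {K : Set ℝ}

open Classical in
-- A cell is the finite union of the atoms related to a given one, so an inequality between
-- integrals over a cell becomes an inequality between weighted sums over a class.
lemma sum_rel_le [Fintype (L.Atom m n K)] (hK : K ∈ L.gen m) {F : L.Atom m n K → ℝ}
    (hF : ∀ J, 0 ≤ F J) {f : ℝ → ℝ≥0∞} (hf : ∀ J, ∀ x ∈ J.1, f x = ENNReal.ofReal (F J))
    {M : ℝ} (hM : 0 ≤ M) {j : ℕ} (hj : j ≤ n) (J : L.Atom m n K)
    (h : ∫⁻ x in L.cell (m + j) J.pt, f x ≤ ENNReal.ofReal M * volume (L.cell (m + j) J.pt)) :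
    (∑ J' : L.Atom m n K, if Rel j J J' then J'.len * F J' else 0) ≤
      M * ∑ J' : L.Atom m n K, if Rel j J J' then J'.len else 0 := by
  have h2 := lintegral_cell_eq (n := n) hK f hj J
  have h3 := lintegral_cell_eq (n := n) hK (fun _ => 1) hj J
  have h4 : ∀ J' : L.Atom m n K, ∫⁻ x in J'.1, f x = ENNReal.ofReal (J'.len * F J') :=
    fun J' => lintegral_const_eq J' (hf J')
  have h5 : ∀ J' : L.Atom m n K, ∫⁻ _ in J'.1, (1 : ℝ≥0∞) = ENNReal.ofReal J'.len := by
    intro J'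
    rw [lintegral_const_eq J' (c := 1) (by simp), mul_one]
  simp only [h4] at h2
  simp only [h5] at h3
  rw [h2] at h
  rw [setLIntegral_const, one_mul] at h3
  rw [h3] at h
  have e : ∀ c : L.Atom m n K → ℝ, (∀ J', 0 ≤ c J') →
      (∑ J', if Rel j J J' then ENNReal.ofReal (c J') else 0) =
      ENNReal.ofReal (∑ J', if Rel j J J' then c J' else 0) := by
    intro c hc
    rw [ENNReal.ofReal_sum_of_nonneg fun J' _ => by split_ifs <;> simp [hc]]
    exact Finset.sum_congr rfl fun J' _ => by split_ifs <;> simp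
  rw [e _ fun J' => mul_nonneg J'.len_pos.le (hF J'), e _ fun J' => J'.len_pos.le,
    ← ENNReal.ofReal_mul hM] at h
  refine (ENNReal.ofReal_le_ofReal_iff (mul_nonneg hM (Finset.sum_nonneg fun J' _ => ?_))).1 h
  split_ifs
  · exact J'.len_pos.le
  · exact le_rfl

open Classical in
-- The hypothesis bounds the conditional expectation of F by M, and an adapted nonnegative weight
-- may be tested against the conditional expectation instead of F.
lemma sum_mul_le_of_sum_rel_le [Fintype (L.Atom m n K)] {F : L.Atom m n K → ℝ} {M : ℝ}
    (hM : 0 ≤ M) {j : ℕ} (h : ∀ J : L.Atom m n K,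
      (∑ J' : L.Atom m n K, if Rel j J J' then J'.len * F J' else 0) ≤
        M * ∑ J' : L.Atom m n K, if Rel j J J' then J'.len else 0)
    {φ : L.Atom m n K → ℝ} (hφ : Adapted Rel j φ) (hφ0 : ∀ J, 0 ≤ φ J) :
    ∑ J, len J * (φ J * F J) ≤ M * ∑ J, len J * φ J := by
  have h1 := sum_mul_condE (𝕜 := ℝ) len_pos (rel_equivalence j) F hφ
  simp only [RCLike.ofReal_real_eq_id, id_eq] at h1
  rw [← h1, Finset.mul_sum]
  refine Finset.sum_le_sum fun J _ => ?_
  rw [mul_comm M, mul_assoc]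
  refine mul_le_mul_of_nonneg_left (mul_le_mul_of_nonneg_left ?_ (hφ0 J)) J.len_pos.le
  rw [condE]
  simp only [RCLike.ofReal_real_eq_id, id_eq]
  refine div_le_of_le_mul₀ (Finset.sum_nonneg fun J' _ => ?_) hM (h J)
  split_ifs
  · exact J'.len_pos.le
  · exact le_rfl

open Classical in
-- The increments with k ≥ j - 1 belong to cells of generation at least m + j, hence to intervals
-- inside the cell C on which the BMO condition is used. For j > 0 this includes the jump into C
-- itself; for j = 0 truncated subtraction starts the sum at the first generation.
lemma sum_increment_le [Fintype (L.Atom m n K)] (hK : K ∈ L.gen m) {b : ℝ → 𝕜}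
    (hb : L.LocIntegrable b) {B : ℝ} (hB : 0 ≤ B)
    (hbB : bmoNorm (L := L) (fun I => diff I b) ≤ ENNReal.ofReal B) {j : ℕ} (hj : j ≤ n)
    (J : L.Atom m n K) :
    (∑ J' : L.Atom m n K, if Rel j J J' then J'.len * ∑ k ∈ Finset.Ico (j - 1) n,
      ‖L.cellAvg (m + (k + 1 : ℕ)) b J'.pt - L.cellAvg (m + k) b J'.pt‖ ^ 2 else 0) ≤
    B ^ 2 * ∑ J' : L.Atom m n K, if Rel j J J' then J'.len else 0 := by
  set f : ℝ → ℝ≥0∞ := fun x => ∑ k ∈ Finset.Ico (j - 1) n,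
    ‖L.cellAvg (m + (k + 1 : ℕ)) b x - L.cellAvg (m + k) b x‖ₑ ^ 2 with hf
  have hJK := J.2.2 J.pt_mem
  set C := L.cellInterval (m + j) J.pt J.pt_mem_carrier with hC
  have hCK : (C : Set ℝ) ⊆ K := by
    rw [← cell_eq hK hJK]; exact cell_subset (by omega) J.pt
  have h1 : ∫⁻ x in (C : Set ℝ), f x ≤ ENNReal.ofReal B ^ 2 * volume (C : Set ℝ) := by
    refine le_trans ?_ ((lintegral_tsum_le_bmoNorm (fun I => diff I b) C).trans (by gcongr))
    refine setLIntegral_mono' C.measurableSet fun x hx => ?_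
    have hxc := C.mem_carrier hx
    have h2 := sum_increment_le_tsum hb (J := C) hxc
      ((Finset.Ico (j - 1) n).map ⟨fun k : ℕ => m + (k : ℤ), fun a c h => by simpa using h⟩)
      (fun k hk => by
        obtain ⟨i, hi, rfl⟩ := Finset.mem_map.1 hk
        have h3 : L.cell (m + j) x = L.cell (m + j) J.pt := cell_eq_of_mem hx
        change L.cell (m + (i : ℤ) + 1) x ⊆ L.cell (m + j) J.pt
        rw [← h3]
        refine cell_subset ?_ x
        have := (Finset.mem_Ico.1 hi).1
        omega)
    rw [Finset.sum_map] at h2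
    refine le_trans (le_of_eq ?_) h2
    refine Finset.sum_congr rfl fun k _ => ?_
    change _ = ‖L.cellAvg (m + (k : ℤ) + 1) b x - L.cellAvg (m + (k : ℤ)) b x‖ₑ ^ 2
    rw [Nat.cast_succ, ← add_assoc]
  rw [← ENNReal.ofReal_pow hB] at h1
  refine sum_rel_le hK (fun J' => Finset.sum_nonneg fun k _ => by positivity) (fun J' x hx => ?_)
    (by positivity) hj J h1
  rw [ENNReal.ofReal_sum_of_nonneg fun k _ => by positivity]
  refine Finset.sum_congr rfl fun k hk => ?_
  have hk' := (Finset.mem_Ico.1 hk).2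
  rw [J'.cellAvg_eq hk' hx b, J'.cellAvg_eq hk'.le hx b, ENNReal.ofReal_pow (norm_nonneg _),
    ofReal_norm]

lemma isCarleson [Fintype (L.Atom m n K)] (hK : K ∈ L.gen m) {b : ℝ → 𝕜}
    (hb : L.LocIntegrable b) {B : ℝ} (hB : 0 ≤ B)
    (hbB : bmoNorm (L := L) (fun I => diff I b) ≤ ENNReal.ofReal B) :
    IsCarleson (len (L := L) (m := m) (n := n) (K := K)) Rel n
      (fun k J => L.cellAvg (m + k) b J.pt) B := by
  intro j hj φ hφ hφ0
  exact sum_mul_le_of_sum_rel_le (by positivity) (sum_increment_le (n := n) hK hb hB hbB hj) hφ hφ0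

/-- The jump into a cell is constant on that cell and its square is one of the terms of the BMO sum
there, so BMO alone bounds the jumps, without regularity of the lattice. -/
lemma norm_increment_le [Fintype (L.Atom m n K)] (hK : K ∈ L.gen m) {b : ℝ → 𝕜}
    (hb : L.LocIntegrable b) {B : ℝ} (hB : 0 ≤ B)
    (hbB : bmoNorm (L := L) (fun I => diff I b) ≤ ENNReal.ofReal B) {k : ℕ} (hk : k < n)
    (J : L.Atom m n K) :
    ‖L.cellAvg (m + (k + 1 : ℕ)) b J.pt - L.cellAvg (m + k) b J.pt‖ ≤ B := by
  classical
  have h := sum_increment_le (n := n) hK hb hB hbB (j := k + 1) hk J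
  have hmart := isMart_cellAvg (n := n) hK (hb ⟨K, m, hK⟩)
  set X := ‖L.cellAvg (m + (k + 1 : ℕ)) b J.pt - L.cellAvg (m + k) b J.pt‖ with hX
  have h1 : X ^ 2 * (∑ J' : L.Atom m n K, if Rel (k + 1) J J' then J'.len else 0) ≤
      ∑ J' : L.Atom m n K, if Rel (k + 1) J J' then J'.len *
        ∑ i ∈ Finset.Ico (k + 1 - 1) n,
          ‖L.cellAvg (m + (i + 1 : ℕ)) b J'.pt - L.cellAvg (m + i) b J'.pt‖ ^ 2 else 0 := by
    rw [Finset.mul_sum]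
    refine Finset.sum_le_sum fun J' _ => ?_
    split_ifs with hr
    · rw [mul_comm]
      refine mul_le_mul_of_nonneg_left ?_ J'.len_pos.le
      have h2 : X = ‖L.cellAvg (m + (k + 1 : ℕ)) b J'.pt - L.cellAvg (m + k) b J'.pt‖ := by
        have h3 := hmart.adapted (k + 1) hk J J' hr
        have h4 := hmart.adapted k hk.le J J' (rel_of_rel_succ k J J' hr)
        beta_reduce at h3 h4
        rw [hX, h3, h4]
      rw [h2]
      exact Finset.single_le_sum (f := fun i : ℕ =>
        ‖L.cellAvg (m + (i + 1 : ℕ)) b J'.pt - L.cellAvg (m + i) b J'.pt‖ ^ 2)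
        (fun i _ => by positivity) (Finset.mem_Ico.2 ⟨by omega, hk⟩)
    · simp
  have h2 : 0 < ∑ J' : L.Atom m n K, if Rel (k + 1) J J' then J'.len else 0 :=
    Finset.sum_pos' (fun J' _ => by split_ifs; exacts [J'.len_pos.le, le_rfl])
      ⟨J, Finset.mem_univ J, by rw [if_pos ((rel_equivalence (k + 1)).refl J)]; exact J.len_pos⟩
  have h3 : X ^ 2 ≤ B ^ 2 := le_of_mul_le_mul_right (h1.trans h) h2
  exact (sq_le_sq₀ (norm_nonneg _) hB).1 h3

/-- The transform of a `BMO` function by the averages of `f` on finitely many generations. -/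
lemma lintegral_transform_le (hK : K ∈ L.gen m) {b f : ℝ → 𝕜}
    (hb : L.LocIntegrable b) (hf : IntegrableOn f K) {B : ℝ} (hB : 0 ≤ B)
    (hbB : bmoNorm (L := L) (fun I => diff I b) ≤ ENNReal.ofReal B) {p q : ℝ}
    (hpq : p.HolderConjugate q) (n : ℕ) (hfn : ∀ x ∈ K, L.cellAvg (m + n) f x = f x) :
    ∫⁻ x in K, ‖∑ k ∈ Finset.range n, (L.cellAvg (m + (k + 1 : ℕ)) b x - L.cellAvg (m + k) b x) *
      L.cellAvg (m + (k + 1 : ℕ)) f x‖ₑ ^ p ≤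
    ENNReal.ofReal (transformConst p q * B) ^ p * ∫⁻ x in K, ‖f x‖ₑ ^ p := by
  have := finite_atom hK n
  have := Fintype.ofFinite (L.Atom m n K)
  have hp := hpq.pos
  -- The finite martingale theorem needs B > 0; for B = 0 all increments of b vanish.
  rcases hB.eq_or_lt with rfl | hB
  · refine le_trans (le_of_eq ?_) zero_le
    rw [← setLIntegral_const K 0 |>.trans (zero_mul _)]
    refine setLIntegral_congr_fun (Interval.measurableSet (⟨K, m, hK⟩ : L.Interval)) fun x hx => ?_
    rw [Finset.sum_eq_zero fun k hk => ?_, enorm_zero, ENNReal.zero_rpow_of_pos hp]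
    have hk' : k + 1 ≤ n := by simpa using hk
    rw [← iUnion_eq (n := n) hK] at hx
    obtain ⟨J, hJ⟩ := mem_iUnion.1 hx
    rw [J.cellAvg_eq hk' hJ, J.cellAvg_eq (by omega : k ≤ n) hJ,
      norm_le_zero_iff.1 (norm_increment_le hK hb le_rfl hbB hk' J), zero_mul]
  have h := IsMart.transform_le len_pos rel_of_rel_succ rel_equivalence hpq
    (isMart_cellAvg (n := n) hK (hb ⟨K, m, hK⟩)) (isMart_cellAvg (n := n) hK hf) hB
    (fun k hk J => norm_increment_le hK hb hB.le hbB hk J) (isCarleson hK hb hB.le hbB)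
  have hT := transformConst_pos hpq
  rw [lintegral_eq_of_const (n := n) hK (c := fun J => ‖∑ k ∈ Finset.range n,
      (L.cellAvg (m + (k + 1 : ℕ)) b J.pt - L.cellAvg (m + k) b J.pt) *
      L.cellAvg (m + (k + 1 : ℕ)) f J.pt‖ ^ p) (fun J => by positivity) ?_,
    lintegral_eq_of_const (n := n) hK (c := fun J => ‖L.cellAvg (m + n) f J.pt‖ ^ p)
      (fun J => by positivity) ?_, ENNReal.ofReal_rpow_of_nonneg (by positivity) hp.le,
    ← ENNReal.ofReal_mul (by positivity)]
  · exact ENNReal.ofReal_le_ofReal h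
  · intro J x hx
    rw [← hfn x (J.2.2 hx), J.cellAvg_eq le_rfl hx, ← ENNReal.ofReal_rpow_of_nonneg
      (norm_nonneg _) hp.le, ofReal_norm]
  · intro J x hx
    rw [← ENNReal.ofReal_rpow_of_nonneg (norm_nonneg _) hp.le, ofReal_norm]
    congr 2
    refine Finset.sum_congr rfl fun k hk => ?_
    have hk' : k + 1 ≤ n := by simpa using hk
    rw [J.cellAvg_eq hk' hx, J.cellAvg_eq hk' hx, J.cellAvg_eq (by omega : k ≤ n) hx]

end Atom

open Filter Topology

/-! ### Measurability -/

variable (L) in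
lemma sigmaInf_le : L.sigmaInf ≤ (inferInstance : MeasurableSpace ℝ) := by
  refine MeasurableSpace.generateFrom_le fun I hI => ?_
  obtain ⟨k, hk⟩ := mem_iUnion.1 hI
  exact Interval.measurableSet (⟨I, k, hk⟩ : L.Interval)

lemma Interval.measurableSet_sigmaInf (I : L.Interval) : MeasurableSet[L.sigmaInf] (I : Set ℝ) := by
  obtain ⟨k, hk⟩ := I.2
  exact MeasurableSpace.measurableSet_generateFrom (mem_iUnion.2 ⟨k, hk⟩)

variable (L) in
lemma measurableSet_carrier : MeasurableSet L.carrier := by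
  rw [← L.covers 0]
  exact MeasurableSet.sUnion (countable_gen 0) fun I hI =>
    Interval.measurableSet (⟨I, 0, hI⟩ : L.Interval)

lemma measurableSet_sigmaInf_cell (k : ℤ) (x : ℝ) : MeasurableSet[L.sigmaInf] (L.cell k x) := by
  by_cases hx : x ∈ L.carrier
  · exact (L.cellInterval k x hx).measurableSet_sigmaInf
  · have : L.cell k x = ∅ := by
      by_contra h
      obtain ⟨y, hy⟩ := nonempty_iff_ne_empty.2 h
      exact hx (mem_carrier_of_mem_cell hy)
    rw [this]; exact @MeasurableSet.empty _ L.sigmaInf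

lemma measurableSet_sigmaInf_of_mem_finLimitIntervals {S : Set ℝ}
    (hS : S ∈ L.finLimitIntervals) : MeasurableSet[L.sigmaInf] S := by
  obtain ⟨x, -, rfl, -⟩ := mem_finLimitIntervals_iff.1 hS
  exact @MeasurableSet.iUnion _ _ L.sigmaInf _ _ fun k => measurableSet_sigmaInf_cell k x

lemma restrict_measure {S : Set ℝ} (hS : MeasurableSet S) (hSc : S ⊆ L.carrier) :
    L.measure.restrict S = volume.restrict S := by
  rw [measure, Measure.restrict_restrict hS, inter_eq_left.2 hSc]

lemma measure_apply {S : Set ℝ} (hS : MeasurableSet S) (hSc : S ⊆ L.carrier) :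
    L.measure S = volume S := by
  rw [measure, Measure.restrict_apply hS, inter_eq_left.2 hSc]

lemma subset_carrier_of_mem_finLimitIntervals {S : Set ℝ} (hS : S ∈ L.finLimitIntervals) :
    S ⊆ L.carrier := by
  obtain ⟨x, hx, rfl, -⟩ := mem_finLimitIntervals_iff.1 hS
  exact top_subset_carrier hx

open Classical in
lemma D_eq_sum_indicator {I : L.Interval} (h : L.D 𝕜 I) : (h : ℝ → 𝕜) =
    ∑ J ∈ (finite_child I).toFinset,
      (J : Set ℝ).indicator (fun _ => (h : ℝ → 𝕜) J.nonempty.some) := by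
  funext x
  rw [Finset.sum_apply]
  by_cases hx : ∃ J ∈ L.child I, x ∈ (J : Set ℝ)
  · obtain ⟨J, hJ, hxJ⟩ := hx
    rw [Finset.sum_eq_single J]
    · rw [Set.indicator_of_mem hxJ]
      exact h.2.2.1 J hJ x hxJ _ J.nonempty.some_mem
    · intro J' hJ' hne
      refine Set.indicator_of_notMem (fun hx' => hne ?_) _
      exact child_eq_of_mem ((finite_child I).mem_toFinset.1 hJ') hJ hx' hxJ
    · intro hn
      exact absurd ((finite_child I).mem_toFinset.2 hJ) hn
  · push Not at hx
    rw [h.2.1 x hx, Finset.sum_eq_zero]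
    intro J hJ
    exact Set.indicator_of_notMem (hx J ((finite_child I).mem_toFinset.1 hJ)) _

variable (L 𝕜) in
/-- The linear combinations of indicators of intervals of the lattice. -/
def cellSpan : Submodule 𝕜 (ℝ → 𝕜) :=
  Submodule.span 𝕜 (Set.range fun I : L.Interval => (I : Set ℝ).indicator fun _ => (1 : 𝕜))

lemma indicator_const_eq_smul (S : Set ℝ) (a : 𝕜) :
    (S.indicator fun _ => a) = a • S.indicator fun _ => (1 : 𝕜) := by
  funext x
  by_cases hx : x ∈ S <;> simp [hx]

lemma indicator_mem_cellSpan (I : L.Interval) (a : 𝕜) :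
    ((I : Set ℝ).indicator fun _ => a) ∈ L.cellSpan 𝕜 := by
  rw [indicator_const_eq_smul]
  exact Submodule.smul_mem _ a (Submodule.subset_span ⟨I, rfl⟩)

lemma D_mem_cellSpan {I : L.Interval} (h : L.D 𝕜 I) : (h : ℝ → 𝕜) ∈ L.cellSpan 𝕜 := by
  classical
  rw [D_eq_sum_indicator h]
  exact Submodule.sum_mem _ fun J _ => indicator_mem_cellSpan J _

lemma stronglyMeasurable_indicator_const {S : Set ℝ} (hS : MeasurableSet[L.sigmaInf] S) (a : 𝕜) :
    StronglyMeasurable[L.sigmaInf] (S.indicator fun _ => a) :=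
  (@stronglyMeasurable_const _ _ L.sigmaInf _ a).indicator hS

lemma memLp_indicator_const {S : Set ℝ} (hS : MeasurableSet S) (hSf : volume S ≠ ∞) (a : 𝕜)
    (p : ℝ≥0∞) : MemLp (S.indicator fun _ => a) p L.measure := by
  refine MeasureTheory.memLp_indicator_const p hS a (Or.inr ?_)
  exact ((Measure.restrict_apply_le _ _).trans_lt hSf.lt_top).ne

lemma cellSpan_induction_props {f : ℝ → 𝕜} (hf : f ∈ L.cellSpan 𝕜) :
    StronglyMeasurable[L.sigmaInf] f ∧ ∀ p, MemLp f p L.measure := by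
  induction hf using Submodule.span_induction with
  | mem f hf =>
    obtain ⟨I, rfl⟩ := hf
    exact ⟨stronglyMeasurable_indicator_const I.measurableSet_sigmaInf 1, fun p =>
      memLp_indicator_const I.measurableSet I.volume_ne_top 1 p⟩
  | zero => exact ⟨@stronglyMeasurable_zero _ _ L.sigmaInf _ _, fun p => MemLp.zero⟩
  | add f g _ _ hf hg => exact ⟨hf.1.add hg.1, fun p => (hf.2 p).add (hg.2 p)⟩
  | smul a f _ hf => exact ⟨hf.1.const_smul a, fun p => (hf.2 p).const_smul a⟩

lemma finSums_props {f : ℝ → 𝕜} (hf : f ∈ L.finSums 𝕜) :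
    StronglyMeasurable[L.sigmaInf] f ∧ ∀ p, MemLp f p L.measure := by
  induction hf using Submodule.span_induction with
  | mem f hf =>
    rcases hf with hf | ⟨S, hS, rfl⟩
    · obtain ⟨I, hI⟩ := mem_iUnion.1 hf
      exact cellSpan_induction_props (D_mem_cellSpan ⟨f, hI⟩)
    · exact ⟨stronglyMeasurable_indicator_const
        (measurableSet_sigmaInf_of_mem_finLimitIntervals hS) 1, fun p =>
        memLp_indicator_const (measurableSet_of_mem_finLimitIntervals hS) hS.2.ne 1 p⟩
  | zero => exact ⟨@stronglyMeasurable_zero _ _ L.sigmaInf _ _, fun p => MemLp.zero⟩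
  | add f g _ _ hf hg => exact ⟨hf.1.add hg.1, fun p => (hf.2 p).add (hg.2 p)⟩
  | smul a f _ hf => exact ⟨hf.1.const_smul a, fun p => (hf.2 p).const_smul a⟩

/-! ### Density of step functions -/

/-- `g` is a limit of elements of `V` in `L^p`. -/
def InLpClosure (μ : Measure ℝ) (V : Submodule 𝕜 (ℝ → 𝕜)) (p : ℝ≥0∞) (g : ℝ → 𝕜) : Prop :=
  ∀ ε : ℝ≥0∞, ε ≠ 0 → ∃ s ∈ V, eLpNorm (g - s) p μ ≤ ε

lemma tendsto_measure_iUnion_sdiff_rpow {μ : Measure ℝ} {A : ℕ → Set ℝ} (hA : Monotone A)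
    (hAm : ∀ n, MeasurableSet (A n)) (hfin : μ (⋃ n, A n) ≠ ∞) {a : ℝ} (ha : 0 < a) :
    Tendsto (fun n => μ ((⋃ n, A n) \ A n) ^ a) atTop (𝓝 0) := by
  have h1 : Tendsto (fun n => μ ((⋃ n, A n) \ A n)) atTop (𝓝 0) := by
    have h2 := tendsto_measure_iInter_atTop (μ := μ) (s := fun n => (⋃ n, A n) \ A n)
      (fun n => ((MeasurableSet.iUnion hAm).diff (hAm n)).nullMeasurableSet)
      (fun m n hmn => sdiff_subset_sdiff_right (hA hmn))
      ⟨0, ((measure_mono sdiff_subset).trans_lt hfin.lt_top).ne⟩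
    rw [← sdiff_iUnion, sdiff_self, measure_empty] at h2
    exact h2
  have := (ENNReal.continuous_rpow_const (y := a)).tendsto (0 : ℝ≥0∞)
  rw [ENNReal.zero_rpow_of_pos ha] at this
  exact this.comp h1

section Closure

variable {μ : Measure ℝ} {V W : Submodule 𝕜 (ℝ → 𝕜)} {p : ℝ≥0∞} {f g : ℝ → 𝕜}

lemma InLpClosure.of_mem (h : g ∈ V) : InLpClosure μ V p g := fun ε _ => ⟨g, h, by simp⟩

lemma InLpClosure.of_approx (hp : 1 ≤ p) (hV : ∀ s ∈ V, AEStronglyMeasurable s μ)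
    (hg : AEStronglyMeasurable g μ) (h : ∀ ε : ℝ≥0∞, ε ≠ 0 → ∃ s, AEStronglyMeasurable s μ ∧
      InLpClosure μ V p s ∧ eLpNorm (g - s) p μ ≤ ε) : InLpClosure μ V p g := by
  intro ε hε
  have hε2 : ε / 2 ≠ 0 := (ENNReal.half_pos hε).ne'
  obtain ⟨s, hsm, hs, hgs⟩ := h (ε / 2) hε2
  obtain ⟨t, ht, hst⟩ := hs (ε / 2) hε2
  refine ⟨t, ht, ?_⟩
  rw [← sub_add_sub_cancel g s t]
  refine (eLpNorm_add_le (hg.sub hsm) (hsm.sub (hV t ht)) hp).trans ?_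
  exact (add_le_add hgs hst).trans (ENNReal.add_halves ε).le

lemma InLpClosure.add (hp : 1 ≤ p) (hV : ∀ s ∈ V, AEStronglyMeasurable s μ)
    (hfm : AEStronglyMeasurable f μ) (hgm : AEStronglyMeasurable g μ)
    (hf : InLpClosure μ V p f) (hg : InLpClosure μ V p g) : InLpClosure μ V p (f + g) := by
  intro ε hε
  have hε2 : ε / 2 ≠ 0 := (ENNReal.half_pos hε).ne'
  obtain ⟨s, hs, hfs⟩ := hf (ε / 2) hε2
  obtain ⟨t, ht, hgt⟩ := hg (ε / 2) hε2
  refine ⟨s + t, V.add_mem hs ht, ?_⟩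
  rw [add_sub_add_comm]
  refine (eLpNorm_add_le (hfm.sub (hV s hs)) (hgm.sub (hV t ht)) hp).trans ?_
  exact (add_le_add hfs hgt).trans (ENNReal.add_halves ε).le

lemma InLpClosure.smul (hf : InLpClosure μ V p f) (a : 𝕜) : InLpClosure μ V p (a • f) := by
  intro ε hε
  by_cases ha : a = 0
  · exact ⟨0, V.zero_mem, by simp [ha]⟩
  have ha' : ‖a‖ₑ ≠ 0 := by simpa using ha
  obtain ⟨s, hs, hfs⟩ := hf (ε / ‖a‖ₑ) (ENNReal.div_ne_zero.2 ⟨hε, enorm_ne_top⟩)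
  refine ⟨a • s, V.smul_mem a hs, ?_⟩
  rw [← smul_sub, eLpNorm_const_smul]
  calc ‖a‖ₑ * eLpNorm (f - s) p μ ≤ ‖a‖ₑ * (ε / ‖a‖ₑ) := by gcongr
    _ = ε := ENNReal.mul_div_cancel ha' enorm_ne_top

lemma InLpClosure.trans (hp : 1 ≤ p) (hV : ∀ s ∈ V, AEStronglyMeasurable s μ)
    (hW : ∀ s ∈ W, AEStronglyMeasurable s μ) (hg : AEStronglyMeasurable g μ)
    (h : InLpClosure μ V p g) (hVW : ∀ s ∈ V, InLpClosure μ W p s) : InLpClosure μ W p g :=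
  InLpClosure.of_approx hp hW hg fun ε hε => by
    obtain ⟨s, hs, hgs⟩ := h ε hε
    exact ⟨s, hV s hs, hVW s hs, hgs⟩

lemma InLpClosure.indicator_iUnion (hp : 1 ≤ p) (hp' : p ≠ ∞)
    (hV : ∀ s ∈ V, AEStronglyMeasurable s μ) {A : ℕ → Set ℝ} (hA : Monotone A)
    (hAm : ∀ n, MeasurableSet (A n)) (hfin : μ (⋃ n, A n) ≠ ∞)
    (h : ∀ n, InLpClosure μ V p ((A n).indicator fun _ => (1 : 𝕜))) :
    InLpClosure μ V p ((⋃ n, A n).indicator fun _ => (1 : 𝕜)) := by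
  refine InLpClosure.of_approx hp hV
    (aestronglyMeasurable_const.indicator (MeasurableSet.iUnion hAm)) fun ε hε => ?_
  have hp0 : 0 < p.toReal := ENNReal.toReal_pos (zero_lt_one.trans_le hp).ne' hp'
  have h2 := tendsto_measure_iUnion_sdiff_rpow (a := 1 / p.toReal) hA hAm hfin (by positivity)
  obtain ⟨n, hn⟩ := (h2.eventually (ge_mem_nhds (pos_iff_ne_zero.2 hε))).exists
  refine ⟨_, aestronglyMeasurable_const.indicator (hAm n), h n, ?_⟩
  have h3 : ((⋃ n, A n).indicator fun _ => (1 : 𝕜)) - ((A n).indicator fun _ => (1 : 𝕜)) =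
      ((⋃ n, A n) \ A n).indicator fun _ => (1 : 𝕜) := by
    funext x
    by_cases hx : x ∈ A n
    · have hx' : ∃ i, x ∈ A i := ⟨n, hx⟩
      simp [hx, hx']
    · by_cases hx' : ∃ i, x ∈ A i <;> simp [hx, hx']
  rw [h3, eLpNorm_indicator_const ((MeasurableSet.iUnion hAm).diff (hAm n))
    (zero_lt_one.trans_le hp).ne' hp']
  simpa using hn

end Closure

lemma cellSpan_aestronglyMeasurable {s : ℝ → 𝕜} (hs : s ∈ L.cellSpan 𝕜) :
    AEStronglyMeasurable s L.measure :=
  ((cellSpan_induction_props hs).1.mono (sigmaInf_le L)).aestronglyMeasurable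

lemma finSums_aestronglyMeasurable {s : ℝ → 𝕜} (hs : s ∈ L.finSums 𝕜) :
    AEStronglyMeasurable s L.measure :=
  ((finSums_props hs).1.mono (sigmaInf_le L)).aestronglyMeasurable

variable (L) in
lemma isPiSystem_gen : IsPiSystem (⋃ k, L.gen k) := by
  rintro s hs t ht ⟨x, hxs, hxt⟩
  obtain ⟨k, hk⟩ := mem_iUnion.1 hs
  obtain ⟨l, hl⟩ := mem_iUnion.1 ht
  rcases Interval.subset_or_subset (⟨s, k, hk⟩ : L.Interval) ⟨t, l, hl⟩ hxs hxt with h | h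
  · rwa [inter_eq_left.2 h]
  · rwa [inter_eq_right.2 h]

/-- A π-λ argument: the lattice intervals form a π-system because two of them are nested or
disjoint. Intersecting with a fixed I keeps all measures finite, as complements and countable unions
require. -/
lemma inLpClosure_indicator_inter {p : ℝ≥0∞} (hp : 1 ≤ p) (hp' : p ≠ ∞) {A : Set ℝ}
    (hA : MeasurableSet[L.sigmaInf] A) (I : L.Interval) :
    InLpClosure L.measure (L.cellSpan 𝕜) p ((A ∩ I).indicator fun _ => (1 : 𝕜)) := by
  have hV : ∀ s ∈ L.cellSpan 𝕜, AEStronglyMeasurable s L.measure :=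
    fun s hs => cellSpan_aestronglyMeasurable hs
  induction A, hA using MeasurableSpace.induction_on_inter (h_eq := rfl)
    (h_inter := isPiSystem_gen L) with
  | empty => rw [empty_inter, indicator_empty]; exact InLpClosure.of_mem (Submodule.zero_mem _)
  | basic A hA =>
    refine InLpClosure.of_mem ?_
    obtain ⟨k, hk⟩ := mem_iUnion.1 hA
    by_cases hd : Disjoint A (I : Set ℝ)
    · rw [disjoint_iff_inter_eq_empty.1 hd, indicator_empty]; exact Submodule.zero_mem _
    · obtain ⟨x, hxA, hxI⟩ := Set.not_disjoint_iff.1 hd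
      rcases Interval.subset_or_subset (⟨A, k, hk⟩ : L.Interval) I hxA hxI with h | h
      · rw [inter_eq_left.2 h]; exact indicator_mem_cellSpan ⟨A, k, hk⟩ 1
      · rw [inter_eq_right.2 h]; exact indicator_mem_cellSpan I 1
  | compl A hA ih =>
    have hAm := sigmaInf_le L A hA
    have h1 : ((Aᶜ ∩ I).indicator fun _ => (1 : 𝕜)) =
        ((I : Set ℝ).indicator fun _ => (1 : 𝕜)) +
          (-1 : 𝕜) • ((A ∩ I).indicator fun _ => (1 : 𝕜)) := by
      funext x
      by_cases hxI : x ∈ (I : Set ℝ) <;> by_cases hxA : x ∈ A <;> simp [hxI, hxA]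
    rw [h1]
    exact InLpClosure.add hp hV (aestronglyMeasurable_const.indicator I.measurableSet)
      ((aestronglyMeasurable_const.indicator (hAm.inter I.measurableSet)).const_smul _)
      (InLpClosure.of_mem (indicator_mem_cellSpan I 1)) (ih.smul _)
  | iUnion f hd hfm ih =>
    have hfm' := fun i => sigmaInf_le L _ (hfm i)
    have h1 : (⋃ i, f i) ∩ I = ⋃ n : ℕ, (⋃ i ∈ Finset.range n, f i) ∩ I := by
      ext x
      simp only [mem_inter_iff, mem_iUnion, Finset.mem_range, exists_prop]
      constructor
      · rintro ⟨⟨i, hi⟩, hx⟩; exact ⟨i + 1, ⟨i, by omega, hi⟩, hx⟩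
      · rintro ⟨n, ⟨i, -, hi⟩, hx⟩; exact ⟨⟨i, hi⟩, hx⟩
    have hm : ∀ n : ℕ, MeasurableSet ((⋃ i ∈ Finset.range n, f i) ∩ (I : Set ℝ)) := fun n =>
      (Finset.measurableSet_biUnion _ fun i _ => hfm' i).inter I.measurableSet
    rw [h1]
    refine InLpClosure.indicator_iUnion hp hp' hV ?_ hm ?_ fun n => ?_
    · intro m n hmn
      refine inter_subset_inter_left _ (biUnion_subset_biUnion_left fun i hi => ?_)
      simp at hi ⊢; omega
    · rw [← h1]
      exact ((measure_mono inter_subset_right).trans_lt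
        ((Measure.restrict_apply_le _ _).trans_lt I.volume_ne_top.lt_top)).ne
    · induction n with
      | zero =>
        refine InLpClosure.of_mem ?_
        simp only [Finset.range_zero, Finset.notMem_empty, iUnion_of_empty, iUnion_empty,
          empty_inter, indicator_empty]
        exact Submodule.zero_mem _
      | succ n ihn =>
        have h2 : ((⋃ i ∈ Finset.range (n + 1), f i) ∩ (I : Set ℝ)).indicator
            (fun _ => (1 : 𝕜)) =
            ((⋃ i ∈ Finset.range n, f i) ∩ (I : Set ℝ)).indicator (fun _ => (1 : 𝕜)) +
              (f n ∩ (I : Set ℝ)).indicator fun _ => (1 : 𝕜) := by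
          have h3 : (⋃ i ∈ Finset.range (n + 1), f i) ∩ (I : Set ℝ) =
              ((⋃ i ∈ Finset.range n, f i) ∩ (I : Set ℝ)) ∪ (f n ∩ (I : Set ℝ)) := by
            rw [Finset.range_add_one, Finset.set_biUnion_insert, union_inter_distrib_right,
              union_comm]
          rw [h3]
          exact indicator_union_of_disjoint (by
            refine Disjoint.mono inter_subset_left inter_subset_left ?_
            rw [Set.disjoint_iUnion₂_left]
            intro i hi
            exact hd (by simp at hi; omega)) _
        rw [h2]
        exact InLpClosure.add hp hV (aestronglyMeasurable_const.indicator (hm n))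
          (aestronglyMeasurable_const.indicator ((hfm' n).inter I.measurableSet)) ihn (ih n)

lemma inLpClosure_indicator {p : ℝ≥0∞} (hp : 1 ≤ p) (hp' : p ≠ ∞) {A : Set ℝ}
    (hA : MeasurableSet[L.sigmaInf] A) (hfin : L.measure A ≠ ∞) :
    InLpClosure L.measure (L.cellSpan 𝕜) p ((A ∩ L.carrier).indicator fun _ => (1 : 𝕜)) := by
  have hV : ∀ s ∈ L.cellSpan 𝕜, AEStronglyMeasurable s L.measure :=
    fun s hs => cellSpan_aestronglyMeasurable hs
  have hAm := sigmaInf_le L A hA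
  rcases (L.gen 0).eq_empty_or_nonempty with h0 | hne
  · have : L.carrier = ∅ := by rw [← L.covers 0, h0, sUnion_empty]
    rw [this, inter_empty, indicator_empty]
    exact InLpClosure.of_mem (Submodule.zero_mem _)
  obtain ⟨e, he⟩ := (countable_gen (L := L) 0).exists_eq_range hne
  have heg : ∀ i, e i ∈ L.gen 0 := fun i => he ▸ mem_range_self i
  have hem : ∀ i, MeasurableSet (e i) := fun i =>
    Interval.measurableSet (⟨e i, 0, heg i⟩ : L.Interval)
  have h1 : A ∩ L.carrier = ⋃ n : ℕ, A ∩ ⋃ i ∈ Finset.range n, e i := by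
    rw [← L.covers 0, he, sUnion_range]
    ext x
    simp only [mem_inter_iff, mem_iUnion, Finset.mem_range, exists_prop]
    constructor
    · rintro ⟨hx, i, hi⟩; exact ⟨i + 1, hx, i, by omega, hi⟩
    · rintro ⟨n, hx, i, -, hi⟩; exact ⟨hx, i, hi⟩
  have hm : ∀ n : ℕ, MeasurableSet (A ∩ ⋃ i ∈ Finset.range n, e i) := fun n =>
    hAm.inter (Finset.measurableSet_biUnion _ fun i _ => hem i)
  rw [h1]
  refine InLpClosure.indicator_iUnion hp hp' hV ?_ hm ?_ fun n => ?_
  · intro m n hmn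
    refine inter_subset_inter_right _ (biUnion_subset_biUnion_left fun i hi => ?_)
    simp at hi ⊢; omega
  · rw [← h1]
    exact ((measure_mono inter_subset_left).trans_lt hfin.lt_top).ne
  · induction n with
    | zero =>
        refine InLpClosure.of_mem ?_
        simp only [Finset.range_zero, Finset.notMem_empty, iUnion_of_empty, iUnion_empty,
          inter_empty, indicator_empty]
        exact Submodule.zero_mem _
    | succ n ihn =>
      -- The enumeration of generation 0 by natural numbers may repeat; a repeated interval adds
      -- nothing, and a new one is disjoint from the earlier ones.
      by_cases hdup : ∃ i < n, e i = e n
      · obtain ⟨i, hi, hie⟩ := hdup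
        have h2 : (⋃ i ∈ Finset.range (n + 1), e i) = ⋃ i ∈ Finset.range n, e i := by
          rw [Finset.range_add_one, Finset.set_biUnion_insert, union_eq_right, ← hie]
          exact subset_biUnion_of_mem (u := e) (by simpa using hi)
        rwa [h2]
      · push Not at hdup
        have h2 : (A ∩ ⋃ i ∈ Finset.range (n + 1), e i).indicator (fun _ => (1 : 𝕜)) =
            (A ∩ ⋃ i ∈ Finset.range n, e i).indicator (fun _ => (1 : 𝕜)) +
              (A ∩ e n).indicator fun _ => (1 : 𝕜) := by
          have h3 : (A ∩ ⋃ i ∈ Finset.range (n + 1), e i) =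
              (A ∩ ⋃ i ∈ Finset.range n, e i) ∪ (A ∩ e n) := by
            rw [Finset.range_add_one, Finset.set_biUnion_insert, ← inter_union_distrib_left,
              union_comm]
          rw [h3]
          exact indicator_union_of_disjoint (by
            refine Disjoint.mono inter_subset_right inter_subset_right ?_
            rw [Set.disjoint_iUnion₂_left]
            intro i hi
            exact L.pairwiseDisjoint 0 (heg i) (heg n) (hdup i (by simpa using hi))) _
        rw [h2]
        exact InLpClosure.add hp hV (aestronglyMeasurable_const.indicator (hm n))
          (aestronglyMeasurable_const.indicator (hAm.inter (hem n))) ihn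
          (inLpClosure_indicator_inter hp hp' hA ⟨e n, 0, heg n⟩)

/-- Step functions on intervals of the lattice are dense in `L^p`. -/
theorem inLpClosure_cellSpan {p : ℝ≥0∞} (hp : 1 ≤ p) (hp' : p ≠ ∞) {g : ℝ → 𝕜}
    (hg : AEStronglyMeasurable[L.sigmaInf] g L.measure) (hgp : MemLp g p L.measure) :
    InLpClosure L.measure (L.cellSpan 𝕜) p g := by
  intro ε hε
  have hle := sigmaInf_le L
  -- `L.sigmaInf` may be smaller than the Borel σ-algebra, so approximation by simple functions has
  -- to take place in the trimmed measure.
  set ν : @Measure ℝ L.sigmaInf := L.measure.trim hle with hν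
  have hmk := hg.stronglyMeasurable_mk
  have hgmk : MemLp (m0 := L.sigmaInf) (hg.mk g) p ν := by
    refine ⟨hmk.aestronglyMeasurable, ?_⟩
    rw [eLpNorm_trim hle hmk, ← eLpNorm_congr_ae hg.ae_eq_mk]
    exact hgp.2
  have hdense : ∀ (c : 𝕜) ⦃A : Set ℝ⦄, MeasurableSet[L.sigmaInf] A → ν A < ∞ → ∀ {δ : ℝ≥0∞}, δ ≠ 0 →
      ∃ s : ℝ → 𝕜, eLpNorm (s - A.indicator fun _ => c) p ν ≤ δ ∧ s ∈ L.cellSpan 𝕜 := by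
    intro c A hA hAf δ hδ
    rw [hν, trim_measurableSet_eq hle hA] at hAf
    obtain ⟨s, hs, hsA⟩ := (inLpClosure_indicator (𝕜 := 𝕜) hp hp' hA hAf.ne).smul c δ hδ
    refine ⟨s, ?_, hs⟩
    rw [eLpNorm_trim hle ((cellSpan_induction_props hs).1.sub
      (stronglyMeasurable_indicator_const hA c)), eLpNorm_sub_comm]
    refine le_trans (le_of_eq (eLpNorm_congr_ae ?_)) hsA
    have hc : ∀ᵐ x ∂L.measure, x ∈ L.carrier := ae_restrict_mem (measurableSet_carrier L)
    filter_upwards [hc] with x hx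
    by_cases hxA : x ∈ A <;> simp [hxA, hx]
  obtain ⟨s, hs1, hs2⟩ := @MemLp.induction_dense ℝ 𝕜 L.sigmaInf _ p ν hp'
    (fun f => f ∈ L.cellSpan 𝕜) hdense (fun f g hf hg => Submodule.add_mem _ hf hg)
    (fun f hf => (cellSpan_induction_props hf).1.aestronglyMeasurable) _ hgmk ε hε
  refine ⟨s, hs2, ?_⟩
  rw [eLpNorm_trim hle (hmk.sub (cellSpan_induction_props hs2).1)] at hs1
  rw [eLpNorm_congr_ae (hg.ae_eq_mk.sub EventuallyEq.rfl)]
  exact hs1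

/-! ### Convergence of averages -/

lemma exists_forall_eq_of_mem_cellSpan {s : ℝ → 𝕜} (hs : s ∈ L.cellSpan 𝕜) :
    ∃ n₀ : ℤ, ∀ n ≥ n₀, ∀ x, ∀ y ∈ L.cell n x, s y = s x := by
  induction hs using Submodule.span_induction with
  | mem f hf =>
    obtain ⟨I, rfl⟩ := hf
    obtain ⟨k, hk⟩ := I.2
    refine ⟨k, fun n hn x y hy => ?_⟩
    have h : x ∈ (I : Set ℝ) ↔ y ∈ (I : Set ℝ) := by
      have hy' := cell_subset hn x hy
      have hx' := cell_subset hn x (mem_cell n (mem_carrier_of_mem_cell hy))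
      constructor
      · intro hx
        rwa [← cell_eq hk hx]
      · intro hyI
        rwa [← cell_eq hk hyI, cell_eq_of_mem hy']
    by_cases hx : x ∈ (I : Set ℝ)
    · simp only [indicator_of_mem hx, indicator_of_mem (h.1 hx)]
    · simp only [indicator_of_notMem hx, indicator_of_notMem (mt h.2 hx)]
  | zero => exact ⟨0, fun _ _ _ _ _ => rfl⟩
  | add f g _ _ hf hg =>
    obtain ⟨n, hn⟩ := hf
    obtain ⟨n', hn'⟩ := hg
    refine ⟨max n n', fun k hk x y hy => ?_⟩
    rw [Pi.add_apply, Pi.add_apply, hn k (le_trans (le_max_left _ _) hk) x y hy,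
      hn' k (le_trans (le_max_right _ _) hk) x y hy]
  | smul a f _ hf =>
    obtain ⟨n, hn⟩ := hf
    exact ⟨n, fun k hk x y hy => by rw [Pi.smul_apply, Pi.smul_apply, hn k hk x y hy]⟩

lemma exists_forall_eq_of_mem_finSums {s : ℝ → 𝕜} (hs : s ∈ L.finSums 𝕜) :
    ∃ n₀ : ℤ, ∀ n ≥ n₀, ∀ x, ∀ y ∈ L.cell n x, s y = s x := by
  induction hs using Submodule.span_induction with
  | mem f hf =>
    rcases hf with hf | ⟨S, hS, rfl⟩
    · obtain ⟨I, hI⟩ := mem_iUnion.1 hf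
      exact exists_forall_eq_of_mem_cellSpan (D_mem_cellSpan ⟨f, hI⟩)
    · refine ⟨0, fun n _ x y hy => ?_⟩
      have hx := mem_cell n (mem_carrier_of_mem_cell hy)
      obtain ⟨z, -, rfl, -⟩ := mem_finLimitIntervals_iff.1 hS
      have h : x ∈ L.top z ↔ y ∈ L.top z := by
        constructor
        · intro h; rw [← top_eq_of_mem h]; exact cell_subset_top n x hy
        · intro h; rw [← top_eq_of_mem h, top_eq_of_mem (cell_subset_top n x hy)]
          exact cell_subset_top n x hx
      by_cases hx : x ∈ L.top z
      · simp only [indicator_of_mem hx, indicator_of_mem (h.1 hx)]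
      · simp only [indicator_of_notMem hx, indicator_of_notMem (mt h.2 hx)]
  | zero => exact ⟨0, fun _ _ _ _ _ => rfl⟩
  | add f g _ _ hf hg =>
    obtain ⟨n, hn⟩ := hf
    obtain ⟨n', hn'⟩ := hg
    refine ⟨max n n', fun k hk x y hy => ?_⟩
    rw [Pi.add_apply, Pi.add_apply, hn k (le_trans (le_max_left _ _) hk) x y hy,
      hn' k (le_trans (le_max_right _ _) hk) x y hy]
  | smul a f _ hf =>
    obtain ⟨n, hn⟩ := hf
    exact ⟨n, fun k hk x y hy => by rw [Pi.smul_apply, Pi.smul_apply, hn k hk x y hy]⟩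

lemma cellAvg_of_const {n : ℤ} {s : ℝ → 𝕜} {x : ℝ} (hx : x ∈ L.carrier)
    (h : ∀ y ∈ L.cell n x, s y = s x) : L.cellAvg n s x = s x :=
  average_of_const (L.cellInterval n x hx) h

lemma cellAvg_sub {n : ℤ} {f g : ℝ → 𝕜} {x : ℝ} (hf : IntegrableOn f (L.cell n x))
    (hg : IntegrableOn g (L.cell n x)) :
    L.cellAvg n (f - g) x = L.cellAvg n f x - L.cellAvg n g x := by
  by_cases hx : x ∈ L.carrier
  · have h := fun F : ℝ → 𝕜 => average_eq (L.cellInterval n x hx) F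
    change ∀ F : ℝ → 𝕜, L.cellAvg n F x = _ at h
    rw [h, h, h, ← mul_sub]
    congr 1
    exact integral_sub hf hg
  · have : L.cell n x = ∅ := by
      by_contra h
      obtain ⟨y, hy⟩ := nonempty_iff_ne_empty.2 h
      exact hx (mem_carrier_of_mem_cell hy)
    simp [cellAvg, this]

lemma volume_mul_enorm_average_le (I : L.Interval) (f : ℝ → 𝕜) :
    volume (I : Set ℝ) * ‖⨍ x in (I : Set ℝ), f x‖ₑ ≤ ∫⁻ x in (I : Set ℝ), ‖f x‖ₑ := by
  have h := setIntegral_eq_mul_average I f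
  have h2 : ‖∫ x in (I : Set ℝ), f x‖ₑ =
      volume (I : Set ℝ) * ‖⨍ x in (I : Set ℝ), f x‖ₑ := by
    rw [h, enorm_mul]
    congr 1
    rw [← ofReal_norm, RCLike.norm_ofReal, abs_of_pos I.volume_real_pos]
    exact ENNReal.ofReal_toReal I.volume_ne_top
  rw [← h2]
  exact enorm_integral_le_lintegral_enorm _

namespace Atom

variable {m : ℤ} {n : ℕ} {K : Set ℝ}

lemma lintegral_cellAvg_le (hK : K ∈ L.gen m) (n : ℕ) (f : ℝ → 𝕜) :
    ∫⁻ x in K, ‖L.cellAvg (m + n) f x‖ₑ ≤ ∫⁻ x in K, ‖f x‖ₑ := by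
  have := finite_atom hK n
  have := Fintype.ofFinite (L.Atom m n K)
  rw [lintegral_eq (n := n) hK, lintegral_eq (n := n) hK]
  refine Finset.sum_le_sum fun J _ => ?_
  refine le_trans (le_of_eq ?_) (volume_mul_enorm_average_le J.interval f)
  have h : ∀ x ∈ J.1, ‖L.cellAvg (m + n) f x‖ₑ = ‖⨍ x in J.1, f x‖ₑ := fun x hx => by
    rw [cellAvg, cell_eq J.2.1 hx]
  have h2 := setLIntegral_congr_fun (μ := volume) J.interval.measurableSet h
  rw [setLIntegral_const, mul_comm] at h2
  exact h2

lemma indicator_cellAvg_mem_cellSpan (hK : K ∈ L.gen m) (n : ℕ) (f : ℝ → 𝕜) :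
    K.indicator (L.cellAvg (m + n) f) ∈ L.cellSpan 𝕜 := by
  classical
  have := finite_atom hK n
  have := Fintype.ofFinite (L.Atom m n K)
  have h : K.indicator (L.cellAvg (m + n) f) =
      ∑ J : L.Atom m n K, (J.interval : Set ℝ).indicator fun _ => ⨍ x in J.1, f x := by
    funext x
    rw [Finset.sum_apply]
    by_cases hx : x ∈ K
    · have hx' := hx
      rw [← iUnion_eq (n := n) hK] at hx'
      obtain ⟨J, hJ⟩ := mem_iUnion.1 hx'
      rw [Finset.sum_eq_single J, indicator_of_mem hx,
        indicator_of_mem (show x ∈ (J.interval : Set ℝ) from hJ), cellAvg, cell_eq J.2.1 hJ]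
      · intro J' _ hne
        exact indicator_of_notMem (fun h => disjoint_left.1 (pairwise_disjoint hne) h hJ) _
      · simp
    · rw [indicator_of_notMem hx, Finset.sum_eq_zero]
      exact fun J _ => indicator_of_notMem (fun h => hx (J.2.2 h)) _
  rw [h]
  exact Submodule.sum_mem _ fun J _ => indicator_mem_cellSpan _ _

end Atom

/-- Averaging contracts L¹ and is eventually exact on a step function; density of step functions
does the rest. Measurability with respect to `L.sigmaInf` provides the density. -/
lemma tendsto_lintegral_cellAvg_sub {m : ℤ} {K : Set ℝ} (hK : K ∈ L.gen m) {b : ℝ → 𝕜}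
    (hb : IntegrableOn b K) (hbm : AEStronglyMeasurable[L.sigmaInf] (K.indicator b) L.measure) :
    Tendsto (fun n : ℕ => ∫⁻ x in K, ‖L.cellAvg (m + n) b x - b x‖ₑ) atTop (𝓝 0) := by
  set I : L.Interval := ⟨K, m, hK⟩
  have hKm : MeasurableSet K := I.measurableSet
  have hKc : K ⊆ L.carrier := I.subset_carrier
  have hmem : MemLp (K.indicator b) 1 L.measure := by
    rw [memLp_one_iff_integrable, integrable_indicator_iff hKm, IntegrableOn,
      restrict_measure hKm hKc]
    exact hb
  rw [ENNReal.tendsto_atTop_zero]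
  intro ε hε
  obtain ⟨s, hs, hsb⟩ := inLpClosure_cellSpan le_rfl ENNReal.one_ne_top hbm hmem (ε / 2)
    (ENNReal.half_pos hε.ne').ne'
  obtain ⟨n₀, hn₀⟩ := exists_forall_eq_of_mem_cellSpan hs
  have hsi : Integrable s L.measure :=
    memLp_one_iff_integrable.1 ((cellSpan_induction_props hs).2 1)
  have hsK : IntegrableOn s K := by
    rw [IntegrableOn, ← restrict_measure hKm hKc]
    exact hsi.integrableOn
  have h1 : ∫⁻ x in K, ‖(b - s) x‖ₑ ≤ ε / 2 := by
    refine le_trans ?_ hsb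
    rw [eLpNorm_one_eq_lintegral_enorm, ← restrict_measure hKm hKc]
    refine le_trans (le_of_eq ?_) (setLIntegral_le_lintegral K _)
    refine setLIntegral_congr_fun hKm fun x hx => ?_
    simp only [Pi.sub_apply, indicator_of_mem hx]
  refine ⟨(n₀ - m).toNat, fun n hn => ?_⟩
  have hn' : m + (n : ℤ) ≥ n₀ := by omega
  have h2 : ∀ x ∈ K, ‖L.cellAvg (m + n) b x - b x‖ₑ ≤
      ‖L.cellAvg (m + n) (b - s) x‖ₑ + ‖(b - s) x‖ₑ := by
    intro x hx
    have hsub : L.cell (m + n) x ⊆ K := by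
      rw [← cell_eq hK hx]; exact cell_subset (by omega) x
    have e : L.cellAvg (m + n) b x - b x = L.cellAvg (m + n) (b - s) x - (b - s) x := by
      rw [cellAvg_sub (hb.mono_set hsub) (hsK.mono_set hsub),
        cellAvg_of_const (hKc hx) (hn₀ _ hn' x), Pi.sub_apply]
      ring
    rw [e]
    exact enorm_sub_le
  refine (setLIntegral_mono' hKm h2).trans ?_
  rw [lintegral_add_right' _ (hb.sub hsK).aestronglyMeasurable.enorm]
  calc _ ≤ (∫⁻ x in K, ‖(b - s) x‖ₑ) + ∫⁻ x in K, ‖(b - s) x‖ₑ :=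
        add_le_add_left (Atom.lintegral_cellAvg_le hK n (b - s)) _
    _ ≤ ε / 2 + ε / 2 := add_le_add h1 h1
    _ = ε := ENNReal.add_halves ε

/-- A subsequence of the averages converges almost everywhere. -/
lemma exists_seq_tendsto_cellAvg {m : ℤ} {K : Set ℝ} (hK : K ∈ L.gen m) {b : ℝ → 𝕜}
    (hb : IntegrableOn b K) (hbm : AEStronglyMeasurable[L.sigmaInf] (K.indicator b) L.measure) :
    ∃ ns : ℕ → ℕ, StrictMono ns ∧ ∀ᵐ x ∂volume.restrict K,
      Tendsto (fun j => L.cellAvg (m + ns j) b x) atTop (𝓝 (b x)) := by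
  have hKm : MeasurableSet K := Interval.measurableSet (⟨K, m, hK⟩ : L.Interval)
  have h := tendsto_lintegral_cellAvg_sub hK hb hbm
  have hm : ∀ n : ℕ, AEStronglyMeasurable (L.cellAvg (m + n) b) (volume.restrict K) := by
    intro n
    have h2 := ((cellSpan_induction_props (Atom.indicator_cellAvg_mem_cellSpan hK n b)).1.mono
      (sigmaInf_le L)).aestronglyMeasurable (μ := volume.restrict K)
    refine h2.congr ?_
    filter_upwards [ae_restrict_mem hKm] with x hx
    rw [indicator_of_mem hx]
  refine (tendstoInMeasure_of_tendsto_eLpNorm (p := 1) one_ne_zero hm hb.aestronglyMeasurable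
    ?_).exists_seq_tendsto_ae
  simpa only [eLpNorm_one_eq_lintegral_enorm, Pi.sub_apply] using h

/-! ### Density of finite martingale sums -/

lemma child_indicator_sub_mem_D {I J : L.Interval} (hJ : J ∈ L.child I) :
    (((J : Set ℝ).indicator fun _ => (1 : 𝕜)) -
      ((volume.real (J : Set ℝ) : 𝕜) / (volume.real (I : Set ℝ) : 𝕜)) •
        (I : Set ℝ).indicator fun _ => (1 : 𝕜)) ∈ L.D 𝕜 I := by
  have hint : ∀ K : L.Interval, ∫ x, (K : Set ℝ).indicator (fun _ => (1 : 𝕜)) x =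
      (volume.real (K : Set ℝ) : 𝕜) := fun K => by
    rw [integral_indicator K.measurableSet, setIntegral_const, RCLike.real_smul_eq_coe_mul, mul_one]
  have hi : ∀ K : L.Interval, Integrable ((K : Set ℝ).indicator fun _ => (1 : 𝕜)) := fun K =>
    (integrable_indicator_iff K.measurableSet).2 (integrableOn_const K.volume_ne_top)
  refine ⟨fun x hx => ?_, fun K hK x hx y hy => ?_, ?_⟩
  · have hxI : x ∉ (I : Set ℝ) := fun h => by
      obtain ⟨K, hK, hxK⟩ := exists_child_of_mem ⟨J, hJ⟩ h
      exact hx K hK hxK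
    simp [hxI, hx J hJ]
  · have hxI := child_subset hK hx
    have hyI := child_subset hK hy
    by_cases h : K = J
    · subst h; simp [hx, hy, hxI, hyI]
    · have h1 : x ∉ (J : Set ℝ) := fun h' => h (child_eq_of_mem hK hJ hx h')
      have h2 : y ∉ (J : Set ℝ) := fun h' => h (child_eq_of_mem hK hJ hy h')
      simp [h1, h2, hxI, hyI]
  · have h0 : (volume.real (I : Set ℝ) : 𝕜) ≠ 0 := by exact_mod_cast I.volume_real_pos.ne'
    have h1 := integral_sub (hi J) ((hi I).smul
      ((volume.real (J : Set ℝ) : 𝕜) / (volume.real (I : Set ℝ) : 𝕜)))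
    simp only [Pi.smul_apply] at h1
    rw [integral_smul, hint, hint, smul_eq_mul, div_mul_cancel₀ _ h0, sub_self] at h1
    exact h1

/-- Telescoping along the chain of ancestors: each step subtracts an average over the next larger
cell, which is a difference or zero. -/
lemma cell_indicator_sub_mem_finSums (m : ℤ) {x : ℝ} (hx : x ∈ L.carrier) (j : ℕ) :
    (((L.cell m x).indicator fun _ => (1 : 𝕜)) -
      ((volume.real (L.cell m x) : 𝕜) / (volume.real (L.cell (m - j) x) : 𝕜)) •
        (L.cell (m - j) x).indicator fun _ => (1 : 𝕜)) ∈ L.finSums 𝕜 := by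
  have h0 : ∀ k, (volume.real (L.cell k x) : 𝕜) ≠ 0 := fun k => by
    exact_mod_cast (L.cellInterval k x hx).volume_real_pos.ne'
  induction j with
  | zero =>
    rw [Nat.cast_zero, sub_zero, div_self (h0 m), one_smul, sub_self]
    exact Submodule.zero_mem _
  | succ j ih =>
    set k := m - ((j + 1 : ℕ) : ℤ) with hk
    have hk1 : m - (j : ℤ) = k + 1 := by omega
    rw [hk1] at ih
    have h1 : (((L.cell (k + 1) x).indicator fun _ => (1 : 𝕜)) -
        ((volume.real (L.cell (k + 1) x) : 𝕜) / (volume.real (L.cell k x) : 𝕜)) •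
        (L.cell k x).indicator fun _ => (1 : 𝕜)) ∈ L.finSums 𝕜 := by
      by_cases hne : L.cell (k + 1) x = L.cell k x
      · rw [hne, div_self (h0 k), one_smul, sub_self]
        exact Submodule.zero_mem _
      · exact D_mem_finSums ⟨_, child_indicator_sub_mem_D (cellInterval_mem_child hx hne)⟩
    have h2 := Submodule.add_mem _ ih (Submodule.smul_mem _
      ((volume.real (L.cell m x) : 𝕜) / (volume.real (L.cell (k + 1) x) : 𝕜)) h1)
    convert h2 using 1
    rw [smul_sub, smul_smul, div_mul_div_cancel₀ (h0 (k + 1))]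
    abel

lemma monotone_cell_sub (m : ℤ) (x : ℝ) : Monotone fun j : ℕ => L.cell (m - j) x :=
  fun i j hij => cell_subset (by omega) x

lemma top_eq_iUnion_sub (m : ℤ) (x : ℝ) : L.top x = ⋃ j : ℕ, L.cell (m - j) x := by
  rw [top_eq_iUnion_le x m]
  ext y
  simp only [mem_iUnion, Subtype.exists, exists_prop]
  constructor
  · rintro ⟨k, hk, hy⟩; exact ⟨(m - k).toNat, by rwa [show m - ((m - k).toNat : ℤ) = k by omega]⟩
  · rintro ⟨j, hy⟩; exact ⟨m - j, by omega, hy⟩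

/-- Subtracting from 1_I its average over a large ancestor J leaves a finite martingale sum, with
error of norm |I| |J|^(1/p - 1). If the limit interval is infinite this tends to 0 because p > 1. If
it is finite, the error is replaced by a multiple of the indicator of the limit interval, at a cost
governed by the measure of its complement of J. -/
lemma inLpClosure_finSums_indicator {p : ℝ} (hp : 1 < p) (I : L.Interval) :
    InLpClosure L.measure (L.finSums 𝕜) (ENNReal.ofReal p)
      ((I : Set ℝ).indicator fun _ => (1 : 𝕜)) := by
  obtain ⟨m, hm⟩ := I.eq_cell
  obtain ⟨x, hxI⟩ := I.nonempty
  have hx := I.mem_carrier hxI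
  obtain rfl : I = L.cellInterval m x hx := Subtype.ext (hm x hxI).symm
  change InLpClosure L.measure (L.finSums 𝕜) (ENNReal.ofReal p)
      ((L.cell m x).indicator fun _ => (1 : 𝕜))
  have hp0 : 0 < p := by linarith
  have hpt : (ENNReal.ofReal p).toReal = p := ENNReal.toReal_ofReal hp0.le
  have hp1 : ENNReal.ofReal p ≠ 0 := by simpa using hp0
  set J : ℕ → Set ℝ := fun j => L.cell (m - j) x with hJ
  have hJm : ∀ j, MeasurableSet (J j) := fun j => measurableSet_cell _ _
  have hJmono : Monotone J := monotone_cell_sub m x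
  have hJc : ∀ j, J j ⊆ L.carrier := fun j => (L.cellInterval (m - j) x hx).subset_carrier
  have htop : ⋃ j, J j = L.top x := (top_eq_iUnion_sub m x).symm
  have hv0 : ∀ j, volume (J j) ≠ 0 := fun j => (L.cellInterval (m - j) x hx).volume_ne_zero
  have hvt : ∀ j, volume (J j) ≠ ∞ := fun j => (L.cellInterval (m - j) x hx).volume_ne_top
  have hIt : volume (L.cell m x) ≠ ∞ := (L.cellInterval m x hx).volume_ne_top
  have hIJ : ∀ j, L.cell m x ⊆ J j := fun j => cell_subset (by omega) x
  set r : ℕ → 𝕜 := fun j => (volume.real (L.cell m x) : 𝕜) / (volume.real (J j) : 𝕜) with hr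
  have hrn : ∀ j, ‖r j‖ₑ = volume (L.cell m x) / volume (J j) := by
    intro j
    rw [hr, ← ofReal_norm, norm_div, RCLike.norm_ofReal, RCLike.norm_ofReal,
      abs_of_nonneg measureReal_nonneg, abs_of_nonneg measureReal_nonneg,
      ENNReal.ofReal_div_of_pos (show 0 < volume.real (J j) from
        (L.cellInterval (m - j) x hx).volume_real_pos)]
    simp only [measureReal_def]
    rw [ENNReal.ofReal_toReal hIt, ENNReal.ofReal_toReal (hvt j)]
  have hmem : ∀ j, ((L.cell m x).indicator fun _ => (1 : 𝕜)) -
      r j • (J j).indicator (fun _ => (1 : 𝕜)) ∈ L.finSums 𝕜 :=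
    cell_indicator_sub_mem_finSums m hx
  have hnorm : ∀ (S : Set ℝ) (a : 𝕜), MeasurableSet S → S ⊆ L.carrier →
      eLpNorm (a • S.indicator fun _ => (1 : 𝕜)) (ENNReal.ofReal p) L.measure =
      ‖a‖ₑ * volume S ^ (1 / p) := by
    intro S a hS hSc
    rw [eLpNorm_const_smul, eLpNorm_indicator_const hS hp1 ENNReal.ofReal_ne_top,
      measure_apply hS hSc, hpt, enorm_one, one_mul]
  intro ε hε
  by_cases hfin : volume (L.top x) = ∞
  · have h1 : Tendsto (fun j => volume (J j)) atTop (𝓝 ∞) := by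
      have := tendsto_measure_iUnion_atTop (μ := volume) hJmono
      rwa [htop, hfin] at this
    have h2 : Tendsto (fun j => volume (L.cell m x) * (volume (J j) ^ (1 - 1 / p))⁻¹)
        atTop (𝓝 0) := by
      have h3 : Tendsto (fun j => (volume (J j) ^ (1 - 1 / p))⁻¹) atTop (𝓝 0) := by
        have h4 := ((ENNReal.continuous_rpow_const (y := 1 - 1 / p)).tendsto ∞).comp h1
        have h5 : 0 < 1 - 1 / p := by
          rw [sub_pos, div_lt_one hp0]; exact hp
        rw [ENNReal.top_rpow_of_pos h5] at h4
        simpa using h4.inv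
      have := ENNReal.Tendsto.const_mul h3 (Or.inr hIt)
      rwa [mul_zero] at this
    obtain ⟨j, hj⟩ := (h2.eventually (ge_mem_nhds (pos_iff_ne_zero.2 hε))).exists
    refine ⟨_, hmem j, ?_⟩
    rw [sub_sub_cancel, hnorm _ _ (hJm j) (hJc j), hrn]
    refine le_trans (le_of_eq ?_) hj
    rw [div_eq_mul_inv, mul_assoc, ← ENNReal.rpow_neg_one, ← ENNReal.rpow_add _ _ (hv0 j) (hvt j),
      ← ENNReal.rpow_neg]
    congr 2; ring
  · have h2 := tendsto_measure_iUnion_sdiff_rpow (μ := volume) hJmono hJm (by rwa [htop])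
      (a := 1 / p) (by positivity)
    obtain ⟨j, hj⟩ := (h2.eventually (ge_mem_nhds (pos_iff_ne_zero.2 hε))).exists
    have htopm : L.top x ∈ L.finLimitIntervals :=
      mem_finLimitIntervals_iff.2 ⟨x, hx, rfl, lt_top_iff_ne_top.2 hfin⟩
    refine ⟨_, Submodule.add_mem _ (hmem j) (Submodule.smul_mem _ (r j)
      (indicator_mem_finSums htopm (1 : 𝕜))), ?_⟩
    have h3 : ((L.cell m x).indicator fun _ => (1 : 𝕜)) -
        (((L.cell m x).indicator fun _ => (1 : 𝕜)) - r j • (J j).indicator (fun _ => (1 : 𝕜)) +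
          r j • (L.top x).indicator fun _ => (1 : 𝕜)) =
        (- r j) • (L.top x \ J j).indicator fun _ => (1 : 𝕜) := by
      have hsub : J j ⊆ L.top x := cell_subset_top _ _
      funext y
      by_cases hy : y ∈ J j
      · simp [hy, hsub hy]
      · by_cases hy' : y ∈ L.top x <;> simp [hy, hy']
    rw [h3, hnorm _ _ ((measurableSet_top x).diff (hJm j))
      (sdiff_subset.trans (top_subset_carrier hx)), enorm_neg, hrn]
    rw [htop] at hj
    refine le_trans ?_ hj
    refine mul_le_of_le_one_left' ?_
    exact ENNReal.div_le_of_le_mul (by rw [one_mul]; exact measure_mono (hIJ j))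

/-- Finite martingale sums are dense in `L^p`. -/
theorem inLpClosure_finSums {p : ℝ} (hp : 1 < p) {g : ℝ → 𝕜}
    (hg : AEStronglyMeasurable[L.sigmaInf] g L.measure)
    (hgp : MemLp g (ENNReal.ofReal p) L.measure) :
    InLpClosure L.measure (L.finSums 𝕜) (ENNReal.ofReal p) g := by
  have hp1 : 1 ≤ ENNReal.ofReal p := by
    rw [← ENNReal.ofReal_one]; exact ENNReal.ofReal_le_ofReal hp.le
  have hW : ∀ s ∈ L.finSums 𝕜, AEStronglyMeasurable s L.measure :=
    fun s hs => finSums_aestronglyMeasurable hs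
  refine InLpClosure.trans hp1 (fun s hs => cellSpan_aestronglyMeasurable hs) hW hgp.1
    (inLpClosure_cellSpan hp1 ENNReal.ofReal_ne_top hg hgp) fun s hs => ?_
  have key : AEStronglyMeasurable s L.measure ∧
      InLpClosure L.measure (L.finSums 𝕜) (ENNReal.ofReal p) s := by
    induction hs using Submodule.span_induction with
    | mem f hf =>
      obtain ⟨I, rfl⟩ := hf
      exact ⟨cellSpan_aestronglyMeasurable (indicator_mem_cellSpan I 1),
        inLpClosure_finSums_indicator hp I⟩
    | zero => exact ⟨aestronglyMeasurable_zero, InLpClosure.of_mem (Submodule.zero_mem _)⟩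
    | add f g _ _ hf hg => exact ⟨hf.1.add hg.1, InLpClosure.add hp1 hW hf.1 hg.1 hf.2 hg.2⟩
    | smul a f _ hf => exact ⟨hf.1.const_smul a, hf.2.smul a⟩
  exact key.2

/-! ### Extension of bounded martingale transforms -/

lemma enorm_setIntegral_le {p q : ℝ} (hpq : p.HolderConjugate q) (S : Set ℝ) {f : ℝ → 𝕜}
    (hf : AEStronglyMeasurable f (volume.restrict S)) :
    ‖∫ x in S, f x‖ₑ ≤
      eLpNorm f (ENNReal.ofReal p) (volume.restrict S) * volume S ^ (1 / q) := by
  refine (enorm_integral_le_lintegral_enorm _).trans ?_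
  rw [← eLpNorm_one_eq_lintegral_enorm]
  have hp1 : (1 : ℝ≥0∞) ≤ ENNReal.ofReal p := by
    rw [← ENNReal.ofReal_one]; exact ENNReal.ofReal_le_ofReal hpq.lt.le
  refine (eLpNorm_le_eLpNorm_mul_rpow_measure_univ hp1 hf).trans (le_of_eq ?_)
  rw [ENNReal.toReal_ofReal hpq.nonneg, Measure.restrict_apply_univ, ENNReal.toReal_one,
    one_div_one]
  have h := hpq.inv_add_inv_eq_one
  congr 2
  rw [one_div, one_div]
  linarith

lemma eLpNorm_restrict_le {S : Set ℝ} (hS : MeasurableSet S) (hSc : S ⊆ L.carrier) (f : ℝ → 𝕜)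
    (p : ℝ≥0∞) : eLpNorm f p (volume.restrict S) ≤ eLpNorm f p L.measure := by
  rw [← restrict_measure hS hSc]
  exact eLpNorm_mono_measure f Measure.restrict_le_self

lemma MemLp.integrableOn_of_subset_carrier {p : ℝ} (hp : 1 ≤ p) {f : ℝ → 𝕜}
    (hf : MemLp f (ENNReal.ofReal p) L.measure) {S : Set ℝ} (hS : MeasurableSet S)
    (hSc : S ⊆ L.carrier) (hSf : volume S ≠ ∞) : IntegrableOn f S := by
  have h1 : MemLp f (ENNReal.ofReal p) (volume.restrict S) := by
    rw [← restrict_measure hS hSc]; exact hf.restrict S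
  have : IsFiniteMeasure (volume.restrict S) := ⟨by simpa using hSf.lt_top⟩
  exact h1.integrable (by rw [← ENNReal.ofReal_one]; exact ENNReal.ofReal_le_ofReal hp)

variable {p q : ℝ}

lemma tendsto_setIntegral_of_eLpNorm (hpq : p.HolderConjugate q) {S : Set ℝ}
    (hS : MeasurableSet S) (hSc : S ⊆ L.carrier) (hSf : volume S ≠ ∞) {v : ℕ → ℝ → 𝕜} {w : ℝ → 𝕜}
    (hv : ∀ j, MemLp (v j) (ENNReal.ofReal p) L.measure)
    (hw : MemLp w (ENNReal.ofReal p) L.measure)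
    (h : Tendsto (fun j => eLpNorm (v j - w) (ENNReal.ofReal p) L.measure) atTop (𝓝 0)) :
    Tendsto (fun j => ∫ x in S, v j x) atTop (𝓝 (∫ x in S, w x)) := by
  rw [tendsto_iff_edist_tendsto_0]
  have hint : ∀ {f : ℝ → 𝕜}, MemLp f (ENNReal.ofReal p) L.measure → IntegrableOn f S :=
    fun hf => MemLp.integrableOn_of_subset_carrier hpq.lt.le hf hS hSc hSf
  have h1 : Tendsto (fun j => eLpNorm (v j - w) (ENNReal.ofReal p) L.measure *
      volume S ^ (1 / q)) atTop (𝓝 0) := by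
    have := ENNReal.Tendsto.mul_const (b := volume S ^ (1 / q)) h
      (Or.inr (ENNReal.rpow_ne_top_of_nonneg (one_div_nonneg.2 hpq.symm.nonneg) hSf))
    rwa [zero_mul] at this
  refine tendsto_of_tendsto_of_tendsto_of_le_of_le tendsto_const_nhds h1 (fun _ => zero_le)
    fun j => ?_
  beta_reduce
  rw [edist_eq_enorm_sub, ← integral_sub (hint (hv j)) (hint hw)]
  refine (enorm_setIntegral_le hpq S ((hint (hv j)).sub (hint hw)).aestronglyMeasurable).trans ?_
  exact mul_le_mul_left (eLpNorm_restrict_le hS hSc _ _) _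

/-- Writes Δ_I f as a combination of fixed functions with the child averages as coefficients, so
that T_I Δ_I f is continuous in those averages whatever the block T_I is. -/
lemma diff_eq_sum_average {I : L.Interval} {f : ℝ → 𝕜} (hf : IntegrableOn f (I : Set ℝ)) :
    diff I f = ∑ K ∈ (finite_child I).toFinset, (⨍ x in (K : Set ℝ), f x) •
      diff I ((K : Set ℝ).indicator fun _ => (1 : 𝕜)) := by
  have hi : ∀ K : L.Interval, IntegrableOn ((K : Set ℝ).indicator fun _ => (1 : 𝕜)) (I : Set ℝ) :=
    fun K => ((integrable_indicator_iff K.measurableSet).2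
      (integrableOn_const K.volume_ne_top)).integrableOn
  have h1 : ∀ K : L.Interval, (⨍ x in (K : Set ℝ), f x) •
      diff I ((K : Set ℝ).indicator fun _ => (1 : 𝕜)) =
      diff I ((⨍ x in (K : Set ℝ), f x) • (K : Set ℝ).indicator fun _ => (1 : 𝕜)) :=
    fun K => (diff_smul I (hi K) _).symm
  simp only [h1]
  rw [← diff_sum _ fun K _ => (hi K).smul _]
  refine diff_eq_of_setIntegral hf (integrable_finsetSum' _ fun K _ => (hi K).smul _)
    fun K hK => ?_
  have hc : ∀ x ∈ (K : Set ℝ), (∑ K' ∈ (finite_child I).toFinset, (⨍ x in (K' : Set ℝ), f x) •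
      (K' : Set ℝ).indicator fun _ => (1 : 𝕜)) x = ⨍ x in (K : Set ℝ), f x := fun x hx => ?_
  · rw [setIntegral_eq_mul_average K f, ← average_of_const K hc]
    exact (setIntegral_eq_mul_average K _).symm
  rw [Finset.sum_apply, Finset.sum_eq_single K]
  · simp [hx]
  · intro K' hK' hne
    have : x ∉ (K' : Set ℝ) := fun h =>
      hne (child_eq_of_mem ((finite_child I).mem_toFinset.1 hK') hK h hx)
    simp [this]
  · intro h; exact absurd ((finite_child I).mem_toFinset.2 hK) h

lemma tendsto_block_diff (T : MartingaleTransform L 𝕜) {I : L.Interval} {v : ℕ → ℝ → 𝕜}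
    {w : ℝ → 𝕜} (hv : ∀ j, IntegrableOn (v j) (I : Set ℝ)) (hw : IntegrableOn w (I : Set ℝ))
    (h : ∀ K ∈ L.child I, Tendsto (fun j => ∫ x in (K : Set ℝ), v j x) atTop
      (𝓝 (∫ x in (K : Set ℝ), w x))) (x : ℝ) :
    Tendsto (fun j => (T.block I (diff I (v j)) : ℝ → 𝕜) x) atTop
      (𝓝 ((T.block I (diff I w) : ℝ → 𝕜) x)) := by
  have e : ∀ {f : ℝ → 𝕜}, IntegrableOn f (I : Set ℝ) → (T.block I (diff I f) : ℝ → 𝕜) x =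
      ∑ K ∈ (finite_child I).toFinset, (⨍ x in (K : Set ℝ), f x) •
        (T.block I (diff I ((K : Set ℝ).indicator fun _ => (1 : 𝕜))) : ℝ → 𝕜) x := by
    intro f hf
    rw [diff_eq_sum_average hf, map_sum, AddSubmonoidClass.coe_finsetSum, Finset.sum_apply]
    refine Finset.sum_congr rfl fun K _ => ?_
    rw [map_smul, Submodule.coe_smul, Pi.smul_apply]
  simp only [e (hv _), e hw]
  refine tendsto_finsetSum _ fun K hK => Tendsto.smul_const ?_ _
  simp only [average_eq]
  exact (h K ((finite_child I).mem_toFinset.1 hK)).const_mul _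

/-- The identity blocks. -/
def MartingaleTransform.one : MartingaleTransform L 𝕜 := ⟨fun _ => LinearMap.id⟩

/-- Finiteness of the operator norm matters when f has norm 0: the quotient is then 0 or ∞, so
finiteness forces T f to have norm 0 too. -/
lemma MartingaleTransform.eLpNorm_apply_le (T : MartingaleTransform L 𝕜)
    (hT : T.opNorm p < ∞) {f : ℝ → 𝕜} (hf : f ∈ L.finSums 𝕜) :
    eLpNorm (T.apply f) (ENNReal.ofReal p) L.measure ≤
      T.opNorm p * eLpNorm f (ENNReal.ofReal p) L.measure := by
  have h1 : eLpNorm (T.apply f) (ENNReal.ofReal p) L.measure /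
      eLpNorm f (ENNReal.ofReal p) L.measure ≤ T.opNorm p :=
    le_iSup₂ (f := fun (f : ℝ → 𝕜) (_ : f ∈ L.finSums 𝕜) =>
      eLpNorm (T.apply f) (ENNReal.ofReal p) L.measure /
      eLpNorm f (ENNReal.ofReal p) L.measure) f hf
  rwa [ENNReal.div_le_iff_le_mul (Or.inr hT.ne) (Or.inl ((finSums_props hf).2 _).2.ne)] at h1

/-- The extension of a bounded martingale transform to `L^p`. -/
theorem MartingaleTransform.exists_extension (T : MartingaleTransform L 𝕜)
    (hpq : p.HolderConjugate q) (hT : T.opNorm p < ∞) {g : ℝ → 𝕜}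
    (hg : AEStronglyMeasurable[L.sigmaInf] g L.measure)
    (hgp : MemLp g (ENNReal.ofReal p) L.measure) :
    ∃ v : ℝ → 𝕜, T.IsImage g v ∧ MemLp v (ENNReal.ofReal p) L.measure ∧
      eLpNorm v (ENNReal.ofReal p) L.measure ≤
        T.opNorm p * eLpNorm g (ENNReal.ofReal p) L.measure := by
  have hp1 : 1 ≤ ENNReal.ofReal p := by
    rw [← ENNReal.ofReal_one]; exact ENNReal.ofReal_le_ofReal hpq.lt.le
  have hle := sigmaInf_le L
  have hε : ∀ j : ℕ, ((2 : ℝ≥0∞)⁻¹ ^ j) ≠ 0 := fun j => by simp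
  -- Approximants with error 2^(-j), so that their images are Cauchy at a summable rate.
  choose s hs hgs using fun j : ℕ => inLpClosure_finSums hpq.lt hg hgp _ (hε j)
  have hsm := fun j => finSums_aestronglyMeasurable (hs j)
  have hTs := fun j => T.apply_mem_finSums (hs j)
  have hTm := fun j => (finSums_props (hTs j)).2 (ENNReal.ofReal p)
  set N := T.opNorm p with hN
  set ν : @Measure ℝ L.sigmaInf := L.measure.trim hle with hν
  have hdist : ∀ i j, eLpNorm (T.apply (s i) - T.apply (s j)) (ENNReal.ofReal p) L.measure ≤
      N * ((2 : ℝ≥0∞)⁻¹ ^ i + (2 : ℝ≥0∞)⁻¹ ^ j) := by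
    intro i j
    rw [← T.apply_sub (hs i) (hs j)]
    refine (T.eLpNorm_apply_le hT (Submodule.sub_mem _ (hs i) (hs j))).trans ?_
    gcongr
    rw [← sub_add_sub_cancel (s i) g (s j)]
    refine (eLpNorm_add_le ((hsm i).sub hgp.1) (hgp.1.sub (hsm j)) hp1).trans ?_
    rw [eLpNorm_sub_comm]
    exact add_le_add (hgs i) (hgs j)
  -- Completeness is used for the trimmed measure, which makes the limit measurable with respect to
  -- `L.sigmaInf`. The extra 1 in the rate gives the strict inequality, also when N = 0.
  obtain ⟨v₀, hv₀, hlim₀⟩ := @Lp.cauchy_complete_eLpNorm ℝ L.sigmaInf (ENNReal.ofReal p) ν 𝕜 _ _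
    hp1 (fun j => T.apply (s j))
    (fun j => ⟨(finSums_props (hTs j)).1.aestronglyMeasurable, by
      rw [eLpNorm_trim hle (finSums_props (hTs j)).1]; exact (hTm j).2⟩)
    (fun j => (2 * N + 1) * (2 : ℝ≥0∞)⁻¹ ^ j)
    (by
      rw [ENNReal.tsum_mul_left, ENNReal.tsum_geometric, ENNReal.one_sub_inv_two, inv_inv]
      exact ENNReal.mul_ne_top (ENNReal.add_ne_top.2
        ⟨ENNReal.mul_ne_top (by simp) hT.ne, by simp⟩) (by simp))
    (fun M i j hi hj => by
      rw [eLpNorm_trim hle ((finSums_props (hTs i)).1.sub (finSums_props (hTs j)).1)]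
      have h2 : ∀ i, M ≤ i → (2 : ℝ≥0∞)⁻¹ ^ i ≤ (2 : ℝ≥0∞)⁻¹ ^ M := fun i hi =>
        pow_le_pow_right_of_le_one' (by simp) hi
      have h3 : (2 : ℝ≥0∞)⁻¹ ^ M ≠ ∞ := ENNReal.pow_ne_top (by simp)
      calc _ ≤ N * ((2 : ℝ≥0∞)⁻¹ ^ i + (2 : ℝ≥0∞)⁻¹ ^ j) := hdist i j
        _ ≤ N * ((2 : ℝ≥0∞)⁻¹ ^ M + (2 : ℝ≥0∞)⁻¹ ^ M) := by
          gcongr N * (?_ + ?_)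
          exacts [h2 i hi, h2 j hj]
        _ = 2 * N * (2 : ℝ≥0∞)⁻¹ ^ M := by ring
        _ < 2 * N * (2 : ℝ≥0∞)⁻¹ ^ M + (2 : ℝ≥0∞)⁻¹ ^ M :=
          ENNReal.lt_add_right (ENNReal.mul_ne_top (ENNReal.mul_ne_top (by simp) hT.ne) h3) (hε M)
        _ = _ := by ring)
  set v := hv₀.1.mk v₀ with hv
  have hvm : StronglyMeasurable[L.sigmaInf] v := hv₀.1.stronglyMeasurable_mk
  have hvp : MemLp v (ENNReal.ofReal p) L.measure := by
    refine ⟨(hvm.mono hle).aestronglyMeasurable, ?_⟩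
    rw [← eLpNorm_trim hle hvm, ← eLpNorm_congr_ae hv₀.1.ae_eq_mk]
    exact hv₀.2
  have hlim : Tendsto (fun j => eLpNorm (T.apply (s j) - v) (ENNReal.ofReal p) L.measure)
      atTop (𝓝 0) := by
    refine hlim₀.congr fun j => ?_
    rw [← eLpNorm_trim hle ((finSums_props (hTs j)).1.sub hvm)]
    exact eLpNorm_congr_ae (Filter.EventuallyEq.rfl.sub hv₀.1.ae_eq_mk)
  have hpow : Tendsto (fun j : ℕ => (2 : ℝ≥0∞)⁻¹ ^ j) atTop (𝓝 0) :=
    ENNReal.tendsto_pow_atTop_nhds_zero_of_lt_one (by simp)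
  have hslim : Tendsto (fun j => eLpNorm (s j - g) (ENNReal.ofReal p) L.measure) atTop (𝓝 0) := by
    refine tendsto_of_tendsto_of_tendsto_of_le_of_le tendsto_const_nhds hpow (fun _ => zero_le)
      fun j => ?_
    beta_reduce
    rw [eLpNorm_sub_comm]; exact hgs j
  have hsp := fun j => (finSums_props (hs j)).2 (ENNReal.ofReal p)
  have hint : ∀ (I : L.Interval) {f : ℝ → 𝕜}, MemLp f (ENNReal.ofReal p) L.measure →
      IntegrableOn f (I : Set ℝ) := fun I f hf =>
    MemLp.integrableOn_of_subset_carrier hpq.lt.le hf I.measurableSet I.subset_carrier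
      I.volume_ne_top
  refine ⟨v, ⟨hvm.aestronglyMeasurable, fun I => hint I hvp, fun I => ?_, fun S hS => ?_,
    fun S hS => ?_⟩, hvp, ?_⟩
  -- Both sides are limits of T_I Δ_I (s j). On the left these are Δ_I of the images, whose
  -- convergence is the case of the identity blocks.
  · apply Subtype.ext
    funext x
    have h1 := tendsto_block_diff MartingaleTransform.one (fun j => hint I (hTm j)) (hint I hvp)
      (fun K _ => tendsto_setIntegral_of_eLpNorm hpq K.measurableSet K.subset_carrier
        K.volume_ne_top hTm hvp hlim) x
    have h2 := tendsto_block_diff T (fun j => hint I (hsp j)) (hint I hgp)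
      (fun K _ => tendsto_setIntegral_of_eLpNorm hpq K.measurableSet K.subset_carrier
        K.volume_ne_top hsp hgp hslim) x
    simp only [MartingaleTransform.one, LinearMap.id_coe, id_eq, T.diff_apply_eq (hs _)] at h1
    exact tendsto_nhds_unique h1 h2
  · exact MemLp.integrableOn_of_subset_carrier hpq.lt.le hvp
      (measurableSet_of_mem_finLimitIntervals hS) (subset_carrier_of_mem_finLimitIntervals hS)
      hS.2.ne
  · have h1 := tendsto_setIntegral_of_eLpNorm hpq (measurableSet_of_mem_finLimitIntervals hS)
      (subset_carrier_of_mem_finLimitIntervals hS) hS.2.ne hTm hvp hlim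
    simp only [T.setIntegral_apply_eq_zero (hs _) hS] at h1
    exact (tendsto_nhds_unique h1 tendsto_const_nhds)
  · have h1 : Tendsto (fun j => eLpNorm (T.apply (s j) - v) (ENNReal.ofReal p) L.measure +
        N * (eLpNorm g (ENNReal.ofReal p) L.measure + (2 : ℝ≥0∞)⁻¹ ^ j)) atTop
        (𝓝 (0 + N * (eLpNorm g (ENNReal.ofReal p) L.measure + 0))) :=
      hlim.add (ENNReal.Tendsto.const_mul (tendsto_const_nhds.add hpow) (Or.inr hT.ne))
    rw [zero_add, add_zero] at h1
    refine ge_of_tendsto' h1 fun j => ?_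
    have h2 : v = (v - T.apply (s j)) + T.apply (s j) := (sub_add_cancel _ _).symm
    conv_lhs => rw [h2]
    refine (eLpNorm_add_le (hvp.1.sub (hTm j).1) (hTm j).1 hp1).trans ?_
    rw [eLpNorm_sub_comm]
    gcongr
    refine (T.eLpNorm_apply_le hT (hs j)).trans ?_
    gcongr
    have h3 : s j = (s j - g) + g := (sub_add_cancel _ _).symm
    conv_lhs => rw [h3]
    refine (eLpNorm_add_le ((hsm j).sub hgp.1) hgp.1 hp1).trans ?_
    rw [eLpNorm_sub_comm, add_comm]
    gcongr
    exact hgs j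

variable {p q : ℝ}

/-! ### Norms over pieces of the carrier -/

lemma eLpNorm_le_mul_iff_lintegral (hp : 0 < p) {μ : Measure ℝ} {f g : ℝ → 𝕜} {C : ℝ≥0∞} :
    eLpNorm g (ENNReal.ofReal p) μ ≤ C * eLpNorm f (ENNReal.ofReal p) μ ↔
      ∫⁻ x, ‖g x‖ₑ ^ p ∂μ ≤ C ^ p * ∫⁻ x, ‖f x‖ₑ ^ p ∂μ := by
  have hp1 : ENNReal.ofReal p ≠ 0 := by simpa using hp
  rw [eLpNorm_eq_lintegral_rpow_enorm_toReal hp1 ENNReal.ofReal_ne_top,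
    eLpNorm_eq_lintegral_rpow_enorm_toReal hp1 ENNReal.ofReal_ne_top,
    ENNReal.toReal_ofReal hp.le, ← ENNReal.rpow_le_rpow_iff hp,
    ENNReal.mul_rpow_of_nonneg _ _ hp.le,
    ← ENNReal.rpow_mul, ← ENNReal.rpow_mul, one_div_mul_cancel hp.ne', ENNReal.rpow_one,
    ENNReal.rpow_one]

lemma countable_limitIntervals : L.limitIntervals.Countable := by
  refine (countable_range fun I : L.Interval => L.top I.nonempty.some).mono ?_
  intro S hS
  obtain ⟨x, hx, rfl⟩ := mem_limitIntervals_iff.1 hS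
  refine ⟨L.cellInterval 0 x hx, ?_⟩
  exact top_eq_of_mem (cell_subset_top 0 x (L.cellInterval 0 x hx).nonempty.some_mem)

lemma pairwiseDisjoint_limitIntervals : L.limitIntervals.PairwiseDisjoint id := by
  intro S hS S' hS' hne
  obtain ⟨x, -, rfl⟩ := mem_limitIntervals_iff.1 hS
  obtain ⟨y, -, rfl⟩ := mem_limitIntervals_iff.1 hS'
  refine disjoint_left.2 fun z hz hz' => hne ?_
  rw [← top_eq_of_mem hz, ← top_eq_of_mem hz']

lemma biUnion_limitIntervals : ⋃ S ∈ L.limitIntervals, S = L.carrier := by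
  ext x
  simp only [mem_iUnion, exists_prop]
  constructor
  · rintro ⟨S, hS, hx⟩
    obtain ⟨y, hy, rfl⟩ := mem_limitIntervals_iff.1 hS
    exact top_subset_carrier hy hx
  · intro hx
    exact ⟨_, mem_limitIntervals_iff.2 ⟨x, hx, rfl⟩, mem_top hx⟩

/-- The limit intervals, of finite or infinite length, form a countable partition of the carrier, so
p-th powers of norms add over them. -/
lemma eLpNorm_le_of_forall_limitIntervals (hp : 0 < p) {f g : ℝ → 𝕜} {C : ℝ≥0∞}
    (h : ∀ S ∈ L.limitIntervals, eLpNorm g (ENNReal.ofReal p) (volume.restrict S) ≤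
      C * eLpNorm f (ENNReal.ofReal p) (volume.restrict S)) :
    eLpNorm g (ENNReal.ofReal p) L.measure ≤ C * eLpNorm f (ENNReal.ofReal p) L.measure := by
  have hm : ∀ S ∈ L.limitIntervals, MeasurableSet (id S) := fun S hS => by
    obtain ⟨y, hy, rfl⟩ := mem_limitIntervals_iff.1 hS
    exact measurableSet_top y
  have e : ∀ F : ℝ → ℝ≥0∞, ∫⁻ x, F x ∂L.measure =
      ∑' S : L.limitIntervals, ∫⁻ x in (S : Set ℝ), F x := by
    intro F
    rw [measure, ← biUnion_limitIntervals]
    exact lintegral_biUnion countable_limitIntervals hm pairwiseDisjoint_limitIntervals F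
  rw [eLpNorm_le_mul_iff_lintegral hp, e, e, ← ENNReal.tsum_mul_left]
  exact ENNReal.tsum_le_tsum fun S => (eLpNorm_le_mul_iff_lintegral hp).1 (h S S.2)

lemma eLpNorm_iUnion_le (hp : 0 < p) {A : ℕ → Set ℝ} (hA : Monotone A) {g : ℝ → 𝕜} {C : ℝ≥0∞}
    (h : ∀ j, eLpNorm g (ENNReal.ofReal p) (volume.restrict (A j)) ≤ C) :
    eLpNorm g (ENNReal.ofReal p) (volume.restrict (⋃ j, A j)) ≤ C := by
  have hp1 : ENNReal.ofReal p ≠ 0 := by simpa using hp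
  have e : ∀ μ : Measure ℝ, eLpNorm g (ENNReal.ofReal p) μ ≤ C ↔ ∫⁻ x, ‖g x‖ₑ ^ p ∂μ ≤ C ^ p := by
    intro μ
    rw [eLpNorm_eq_lintegral_rpow_enorm_toReal hp1 ENNReal.ofReal_ne_top,
      ENNReal.toReal_ofReal hp.le, one_div, ENNReal.rpow_inv_le_iff hp]
  rw [e, setLIntegral_iUnion_of_directed _ hA.directed_le]
  exact iSup_le fun j => (e _).1 (h j)

/-! ### The paraproduct on an interval -/

lemma sum_mul_sub_eq_sub_sum {R : Type*} [CommRing R] (β φ : ℕ → R) (n : ℕ) :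
    ∑ k ∈ Finset.range n, (β (k + 1) - β k) * φ (k + 1) =
      β n * φ n - β 0 * φ 0 - ∑ k ∈ Finset.range n, β k * (φ (k + 1) - φ k) := by
  induction n with
  | zero => simp
  | succ n ih => rw [Finset.sum_range_succ, Finset.sum_range_succ, ih]; ring

lemma aestronglyMeasurable_cellAvg {m : ℤ} {K : Set ℝ} (hK : K ∈ L.gen m) (n : ℕ) (f : ℝ → 𝕜) :
    AEStronglyMeasurable (L.cellAvg (m + n) f) (volume.restrict K) := by
  have h := ((cellSpan_induction_props (Atom.indicator_cellAvg_mem_cellSpan hK n f)).1.mono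
    (sigmaInf_le L)).aestronglyMeasurable (μ := volume.restrict K)
  refine h.congr ?_
  filter_upwards [ae_restrict_mem (Interval.measurableSet (⟨K, m, hK⟩ : L.Interval))] with x hx
  rw [indicator_of_mem hx]

lemma AEStronglyMeasurable.indicator_sigmaInf {f : ℝ → 𝕜}
    (hf : AEStronglyMeasurable[L.sigmaInf] f L.measure) {S : Set ℝ}
    (hS : MeasurableSet[L.sigmaInf] S) :
    AEStronglyMeasurable[L.sigmaInf] (S.indicator f) L.measure := by
  refine ⟨S.indicator (hf.mk f), hf.stronglyMeasurable_mk.indicator hS, ?_⟩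
  filter_upwards [hf.ae_eq_mk] with x hx
  by_cases h : x ∈ S <;> simp [h, hx]

/-- With b replaced by its averages in a late generation, Abel summation turns the left side into
the transform of `Atom.lintegral_transform_le`. These averages converge to b almost everywhere along
a subsequence, and Fatou's lemma keeps the bound. The sum stops at n₀ because f agrees with its
averages from there on. -/
lemma eLpNorm_restrict_sub_paraproduct_le {m : ℤ} {K : Set ℝ} (hK : K ∈ L.gen m) {b f : ℝ → 𝕜}
    (hbm : AEStronglyMeasurable[L.sigmaInf] b L.measure) (hb : L.LocIntegrable b)
    (hf : IntegrableOn f K) {B : ℝ} (hB : 0 ≤ B)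
    (hbB : bmoNorm (L := L) (fun I => diff I b) ≤ ENNReal.ofReal B) (hpq : p.HolderConjugate q)
    {n₀ : ℕ} (hfn : ∀ n ≥ n₀, ∀ x ∈ K, L.cellAvg (m + n) f x = f x) :
    eLpNorm (fun x => b x * f x - (L.cellAvg m b x * L.cellAvg m f x +
      ∑ k ∈ Finset.range n₀, L.cellAvg (m + k) b x *
        (L.cellAvg (m + (k + 1 : ℕ)) f x - L.cellAvg (m + k) f x)))
      (ENNReal.ofReal p) (volume.restrict K) ≤
    ENNReal.ofReal (transformConst p q * B) *
      eLpNorm f (ENNReal.ofReal p) (volume.restrict K) := by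
  set I : L.Interval := ⟨K, m, hK⟩
  have hKm : MeasurableSet K := I.measurableSet
  obtain ⟨ns, hns, hlim⟩ := exists_seq_tendsto_cellAvg hK (hb I)
    (AEStronglyMeasurable.indicator_sigmaInf hbm I.measurableSet_sigmaInf)
  set Z : ℝ → 𝕜 := fun x => L.cellAvg m b x * L.cellAvg m f x +
      ∑ k ∈ Finset.range n₀, L.cellAvg (m + k) b x *
        (L.cellAvg (m + (k + 1 : ℕ)) f x - L.cellAvg (m + k) f x) with hZ
  have hZm : AEStronglyMeasurable Z (volume.restrict K) := by
    have h0 : ∀ F : ℝ → 𝕜, AEStronglyMeasurable (L.cellAvg m F) (volume.restrict K) := fun F => by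
      have := aestronglyMeasurable_cellAvg hK 0 F
      rwa [Nat.cast_zero, add_zero] at this
    refine ((h0 b).mul (h0 f)).add ?_
    refine Finset.aestronglyMeasurable_fun_sum _ fun k _ => ?_
    exact (aestronglyMeasurable_cellAvg hK k b).mul ((aestronglyMeasurable_cellAvg hK (k + 1) f).sub
      (aestronglyMeasurable_cellAvg hK k f))
  refine Lp.eLpNorm_le_of_ae_tendsto (u := atTop)
    (f := fun j x => L.cellAvg (m + ns j) b x * f x - Z x) ?_ (fun j => ?_) ?_
  · filter_upwards [hns.tendsto_atTop.eventually (eventually_ge_atTop n₀)] with j hj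
    rw [eLpNorm_le_mul_iff_lintegral hpq.pos]
    refine le_trans (le_of_eq ?_) (Atom.lintegral_transform_le hK hb hf hB hbB hpq (ns j)
      (hfn _ hj))
    refine setLIntegral_congr_fun hKm fun x hx => ?_
    congr 2
    have h := sum_mul_sub_eq_sub_sum (fun k : ℕ => L.cellAvg (m + k) b x)
      (fun k : ℕ => L.cellAvg (m + k) f x) (ns j)
    beta_reduce at h
    rw [h, hfn _ hj x hx, Nat.cast_zero, add_zero, hZ]
    beta_reduce
    rw [sub_sub]
    congr 2
    refine Finset.sum_subset (Finset.range_subset_range.2 hj) fun k _ hk => ?_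
    have hk' : n₀ ≤ k := by simpa using hk
    rw [hfn k hk' x hx, hfn (k + 1) (by omega) x hx, sub_self, mul_zero]
  · exact ((aestronglyMeasurable_cellAvg hK (ns j) b).mul hf.aestronglyMeasurable).sub hZm
  · filter_upwards [hlim] with x hx
    exact (hx.mul_const _).sub_const _

/-! ### Sums over intervals and sums over generations -/

lemma exists_forall_isRank_le (F : Finset L.Interval) :
    ∃ M : ℕ, ∀ I ∈ F, ∀ k, L.IsRank I k → -(M : ℤ) ≤ k ∧ k < M := by
  classical
  induction F using Finset.induction_on with
  | empty => exact ⟨0, by simp⟩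
  | insert I F _ ih =>
    obtain ⟨M, hM⟩ := ih
    by_cases hI : ∃ k, L.IsRank I k
    · obtain ⟨r, hr⟩ := hI
      refine ⟨max M (r.natAbs + 1), fun J hJ k hk => ?_⟩
      rcases Finset.mem_insert.1 hJ with rfl | hJ
      · have := hk.unique hr
        omega
      · have := hM J hJ k hk
        omega
    · refine ⟨M, fun J hJ k hk => ?_⟩
      rcases Finset.mem_insert.1 hJ with rfl | hJ
      · exact absurd ⟨k, hk⟩ hI
      · exact hM J hJ k hk

/-- At a given point only cells around it contribute, each once, at its rank. Generations where the
cell does not change give zero, and the window from m to m + n contains the ranks of all intervals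
of F. -/
lemma sum_diff_eq_sum_cellAvg {f : ℝ → 𝕜} (hf : L.LocIntegrable f) {F : Finset L.Interval}
    (hF : ∀ I ∉ F, diff I f = 0) {M : ℕ} (hM : ∀ I ∈ F, ∀ k, L.IsRank I k → -(M : ℤ) ≤ k ∧ k < M)
    (β : Set ℝ → 𝕜) {m : ℤ} {n : ℕ} (hm : m ≤ -M) (hn : M ≤ m + n) {x : ℝ} (hx : x ∈ L.carrier) :
    ∑ I ∈ F, β I * (diff I f : ℝ → 𝕜) x = ∑ k ∈ Finset.range n, β (L.cell (m + k) x) *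
      (L.cellAvg (m + (k + 1 : ℕ)) f x - L.cellAvg (m + k) f x) := by
  classical
  set s := (Finset.range n).filter fun k : ℕ => L.cell (m + k + 1) x ≠ L.cell (m + k) x with hs
  set e : ℕ → L.Interval := fun k => L.cellInterval (m + k) x hx with he
  have h1 : ∑ k ∈ Finset.range n, β (L.cell (m + k) x) *
      (L.cellAvg (m + (k + 1 : ℕ)) f x - L.cellAvg (m + k) f x) =
      ∑ k ∈ s, β (e k) * (diff (e k) f : ℝ → 𝕜) x := by
    rw [hs, Finset.sum_filter]
    refine Finset.sum_congr rfl fun k _ => ?_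
    rw [Nat.cast_succ, ← add_assoc]
    split_ifs with h
    · rw [show (diff (e k) f : ℝ → 𝕜) x = _ from diff_apply_cell hf hx h]
      rfl
    · rw [cellAvg_succ_sub_eq_zero (not_not.1 h), mul_zero]
  have hinj : Set.InjOn e s := by
    have key : ∀ k ∈ s, ∀ l ∈ s, k < l → e k ≠ e l := by
      intro k hk l hl hkl h
      have h2 : L.cell (m + k) x = L.cell (m + l) x := congrArg Subtype.val h
      have h3 := (Finset.mem_filter.1 hk).2
      refine h3 (Subset.antisymm (cell_succ_subset _ x) ?_)
      rw [h2]
      exact cell_subset (by omega) x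
    intro k hk l hl h
    rcases lt_trichotomy k l with hlt | rfl | hlt
    · exact absurd h (key k hk l hl hlt)
    · rfl
    · exact absurd h.symm (key l hl k hk hlt)
  rw [h1, ← Finset.sum_image (f := fun I : L.Interval => β I * (diff I f : ℝ → 𝕜) x) hinj]
  have h4 : ∑ I ∈ F, β I * (diff I f : ℝ → 𝕜) x =
      ∑ I ∈ F ∪ s.image e, β I * (diff I f : ℝ → 𝕜) x := by
    refine Finset.sum_subset Finset.subset_union_left fun I _ hI => ?_
    rw [hF I hI]; simp
  rw [h4]
  symm
  refine Finset.sum_subset Finset.subset_union_right fun I hI hI' => ?_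
  have hIF : I ∈ F := (Finset.mem_union.1 hI).resolve_right hI'
  by_cases hxI : ∃ J ∈ L.child I, x ∈ (J : Set ℝ)
  swap
  · push Not at hxI
    rw [(diff I f).2.1 x hxI, mul_zero]
  obtain ⟨J, ⟨r, hr, hJ, hJI⟩, hxJ⟩ := hxI
  have hMr := hM I hIF r hr
  refine absurd ?_ hI'
  have hxI : x ∈ (I : Set ℝ) := hJI hxJ
  have hcI : L.cell r x = I := cell_eq hr.1 hxI
  have hne : L.cell (r + 1) x ≠ L.cell r x := by
    intro h
    have h5 : (I : Set ℝ) ∈ L.gen (r + 1) := by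
      rw [← hcI, ← h]; exact cell_mem_gen _ hx
    have := hr.2 h5
    omega
  have hrm : m + ((r - m).toNat : ℤ) = r := by omega
  refine Finset.mem_image.2 ⟨(r - m).toNat, Finset.mem_filter.2 ⟨?_, ?_⟩, Subtype.ext ?_⟩
  · rw [Finset.mem_range]; omega
  · rw [hrm]; exact hne
  · change L.cell (m + ((r - m).toNat : ℤ)) x = I
    rw [hrm, hcI]

/-! ### The diagonal part of multiplication by `b` -/

/-- The diagonal part of the multiplication of a finite martingale sum by `b`: each martingale
difference is multiplied by the average of `b`, and each multiple of the indicator of a limit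
interval `S` is multiplied by `β S`. -/
def diagPart (b : ℝ → 𝕜) (β : Set ℝ → 𝕜) (F : Finset L.Interval) (G : Finset (Set ℝ))
    (c : Set ℝ → 𝕜) (f : ℝ → 𝕜) : ℝ → 𝕜 :=
  ∑ I ∈ F, (⨍ x in (I : Set ℝ), b x) • (diff I f : ℝ → 𝕜) +
    ∑ S ∈ G, S.indicator fun _ => β S * c S

lemma diagPart_mem_finSums (b : ℝ → 𝕜) (β : Set ℝ → 𝕜) {F : Finset L.Interval}
    {G : Finset (Set ℝ)} {c : Set ℝ → 𝕜} {f : ℝ → 𝕜} (h : IsFinDecomp f F G c) :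
    diagPart b β F G c f ∈ L.finSums 𝕜 :=
  Submodule.add_mem _
    (Submodule.sum_mem _ fun _ _ => Submodule.smul_mem _ _ (D_mem_finSums _))
    (Submodule.sum_mem _ fun S hS => indicator_mem_finSums (h.mem_fin S hS) _)

/-- The diagonal part is a scalar on each difference space, hence commutes with every martingale
transform. -/
lemma diff_diagPart (b : ℝ → 𝕜) (β : Set ℝ → 𝕜) {F : Finset L.Interval}
    {G : Finset (Set ℝ)} {c : Set ℝ → 𝕜} {f : ℝ → 𝕜} (h : IsFinDecomp f F G c) (J : L.Interval) :
    diff J (diagPart b β F G c f) = (⨍ x in (J : Set ℝ), b x) • diff J f := by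
  classical
  have hiF : ∀ I ∈ F, IntegrableOn ((⨍ x in (I : Set ℝ), b x) • (diff I f : ℝ → 𝕜)) (J : Set ℝ) :=
    fun I _ => ((D_integrable (diff I f)).smul _).integrableOn
  have hiG : ∀ S ∈ G, IntegrableOn (S.indicator fun _ => β S * c S) (J : Set ℝ) :=
    fun S hS => (integrable_indicator_of_mem_finLimitIntervals (h.mem_fin S hS) _).integrableOn
  rw [diagPart, diff_add (integrable_finsetSum' _ hiF) (integrable_finsetSum' _ hiG),
    diff_sum _ hiF, diff_sum _ hiG, Finset.sum_eq_zero (s := G) fun S hS =>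
      diff_indicator_of_mem_finLimitIntervals J (h.mem_fin S hS) _, add_zero]
  have h1 : ∀ I ∈ F, diff J ((⨍ x in (I : Set ℝ), b x) • (diff I f : ℝ → 𝕜)) =
      if I = J then (⨍ x in (J : Set ℝ), b x) • diff J f else 0 := by
    intro I _
    rw [diff_smul J (D_integrable (diff I f)).integrableOn]
    split_ifs with hIJ
    · subst hIJ; rw [diff_coe_D]
    · rw [diff_coe_D_of_ne _ (Ne.symm hIJ), smul_zero]
  rw [Finset.sum_congr rfl h1, Finset.sum_ite_eq' F J]
  split_ifs with hJ
  · rfl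
  · rw [h.diff_eq_zero J hJ, smul_zero]

lemma finSums_locIntegrable {f : ℝ → 𝕜} (hf : f ∈ L.finSums 𝕜) : L.LocIntegrable f := by
  obtain ⟨F, G, c, h⟩ := exists_isFinDecomp hf
  exact fun I => h.integrable.integrableOn

/-- A locally integrable function with controlled martingale differences. -/
structure NoJumpBMO (L : IntervalLattice) (b : ℝ → 𝕜) (B : ℝ) : Prop where
  measurable : AEStronglyMeasurable[L.sigmaInf] b L.measure
  locIntegrable : L.LocIntegrable b
  nonneg : 0 ≤ B
  bmoNorm_le : bmoNorm (L := L) (fun I => diff I b) ≤ ENNReal.ofReal B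

lemma eLpNorm_const_restrict (hp : 0 < p) (a : 𝕜) (K : Set ℝ) (hK : volume K ≠ 0) :
    eLpNorm (fun _ => a) (ENNReal.ofReal p) (volume.restrict K) = ‖a‖ₑ * volume K ^ (1 / p) := by
  rw [eLpNorm_const _ (by simpa using hp) (by simpa using hK), Measure.restrict_apply_univ,
    ENNReal.toReal_ofReal hp.le]

namespace NoJumpBMO

variable {b : ℝ → 𝕜} {B : ℝ}

/-- The paraproduct estimate for f = 1 on the cell K of generation -j bounds the L^p norm of b minus
its average over K by a multiple of |S|^(1/p), where S is the limit interval, uniformly in j.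
Restricting to the cell of generation 0 bounds the averages over all K, so a subsequence converges.
-/
lemma exists_tendsto_cellAvg (hb : NoJumpBMO L b B) (hpq : p.HolderConjugate q) {x : ℝ}
    (hx : x ∈ L.carrier) (hfin : volume (L.top x) < ∞) :
    ∃ (β : 𝕜) (φ : ℕ → ℕ), StrictMono φ ∧
      Tendsto (fun j => L.cellAvg (-(φ j : ℤ)) b x) atTop (𝓝 β) := by
  set I := L.cellInterval 0 x hx with hI
  set D := ENNReal.ofReal (transformConst p q * B) * volume (L.top x) ^ (1 / p) *
    volume (I : Set ℝ) ^ (1 / q) / volume (I : Set ℝ) with hD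
  have hDt : D ≠ ∞ := by
    refine ENNReal.div_ne_top (ENNReal.mul_ne_top (ENNReal.mul_ne_top ENNReal.ofReal_ne_top
      (ENNReal.rpow_ne_top_of_nonneg (one_div_nonneg.2 hpq.nonneg) hfin.ne))
      (ENNReal.rpow_ne_top_of_nonneg (one_div_nonneg.2 hpq.symm.nonneg) I.volume_ne_top))
      I.volume_ne_zero
  have key : ∀ j : ℕ, ‖L.cellAvg 0 b x - L.cellAvg (-(j : ℤ)) b x‖ₑ ≤ D := by
    intro j
    set K := L.cell (-(j : ℤ)) x with hK
    have hKg : K ∈ L.gen (-(j : ℤ)) := cell_mem_gen _ hx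
    have hKv : volume K ≠ ∞ := (L.cellInterval (-(j : ℤ)) x hx).volume_ne_top
    have hK0 : volume K ≠ 0 := (L.cellInterval (-(j : ℤ)) x hx).volume_ne_zero
    have hIK : (I : Set ℝ) ⊆ K := cell_subset (by omega) x
    set a := L.cellAvg (-(j : ℤ)) b x with ha
    have hone : ∀ (n : ℤ), ∀ y ∈ K, L.cellAvg n (fun _ => (1 : 𝕜)) y = 1 := fun n y hy =>
      cellAvg_of_const (s := fun _ => (1 : 𝕜)) (mem_carrier hKg hy) fun _ _ => rfl
    have h1 := eLpNorm_restrict_sub_paraproduct_le hKg hb.measurable hb.locIntegrable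
      (f := fun _ => (1 : 𝕜)) (integrableOn_const hKv) hb.nonneg hb.bmoNorm_le hpq (n₀ := 0)
      fun n _ y hy => hone _ y hy
    rw [eLpNorm_const_restrict hpq.pos _ _ hK0, enorm_one, one_mul] at h1
    have h2 : eLpNorm (fun y => b y - a) (ENNReal.ofReal p) (volume.restrict (I : Set ℝ)) ≤
        ENNReal.ofReal (transformConst p q * B) * volume (L.top x) ^ (1 / p) := by
      refine (eLpNorm_mono_measure _ (Measure.restrict_mono_set _ hIK)).trans ?_
      refine le_trans (le_of_eq (eLpNorm_congr_ae ?_)) (h1.trans ?_)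
      · filter_upwards [ae_restrict_mem (measurableSet_cell _ _)] with y hy
        rw [hone _ y hy, cellAvg_eq_of_mem hy]
        simp [ha]
      · gcongr
        · exact one_div_nonneg.2 hpq.nonneg
        · exact cell_subset_top _ _
    have hbI : IntegrableOn b (I : Set ℝ) := hb.locIntegrable I
    have hint : IntegrableOn (fun y => b y - a) (I : Set ℝ) :=
      hbI.sub (integrableOn_const I.volume_ne_top)
    have h3 := enorm_setIntegral_le hpq (I : Set ℝ) hint.aestronglyMeasurable
    have h4 : ∫ y in (I : Set ℝ), (b y - a) =
        (volume.real (I : Set ℝ) : 𝕜) * (L.cellAvg 0 b x - a) := by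
      rw [integral_sub hbI (integrableOn_const I.volume_ne_top), setIntegral_const,
        setIntegral_eq_mul_average, mul_sub, RCLike.real_smul_eq_coe_mul]
      rfl
    rw [h4, enorm_mul, ← ofReal_norm (volume.real (I : Set ℝ) : 𝕜), RCLike.norm_ofReal,
      abs_of_pos I.volume_real_pos, measureReal_def, ENNReal.ofReal_toReal I.volume_ne_top] at h3
    rw [hD, ENNReal.le_div_iff_mul_le (Or.inl I.volume_ne_zero) (Or.inl I.volume_ne_top), mul_comm]
    refine h3.trans ?_
    gcongr
  obtain ⟨β, -, φ, hφ, hlim⟩ := tendsto_subseq_of_bounded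
    (Metric.isBounded_closedBall (x := L.cellAvg 0 b x) (r := D.toReal))
    (x := fun j : ℕ => L.cellAvg (-(j : ℤ)) b x) fun j => by
      rw [mem_closedBall_iff_norm']
      have := ENNReal.toReal_mono hDt (key j)
      simpa using this
  exact ⟨β, φ, hφ, hlim⟩

/-- On a large cell K the diagonal part differs from the expression in the paraproduct estimate only
by a constant, whose norm disappears as K grows along φ to the limit interval S. If S is infinite, f
has no component 1_S and the constant is already zero. -/
lemma eLpNorm_sub_diagPart_restrict_le (hb : NoJumpBMO L b B) (hpq : p.HolderConjugate q)
    {f : ℝ → 𝕜} (hf : f ∈ L.finSums 𝕜) {F : Finset L.Interval} {G : Finset (Set ℝ)}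
    {c : Set ℝ → 𝕜} (hdec : IsFinDecomp f F G c) {β : Set ℝ → 𝕜} {x : ℝ} (hx : x ∈ L.carrier)
    {φ : ℕ → ℕ} (hφ : StrictMono φ) (hβ : volume (L.top x) < ∞ →
      Tendsto (fun j => L.cellAvg (-(φ j : ℤ)) b x) atTop (𝓝 (β (L.top x)))) :
    eLpNorm (fun y => b y * f y - diagPart b β F G c f y) (ENNReal.ofReal p)
      (volume.restrict (L.top x)) ≤
    ENNReal.ofReal (transformConst p q * B) *
      eLpNorm f (ENNReal.ofReal p) (volume.restrict (L.top x)) := by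
  set S := L.top x with hS
  set A : ℕ → Set ℝ := fun j => L.cell (-(j : ℤ)) x with hA
  have hAmono : Monotone A := fun i j hij => cell_subset (by omega) x
  have hSA : S = ⋃ j, A j := by
    have := top_eq_iUnion_sub (L := L) 0 x
    simpa only [zero_sub] using this
  have hfi : L.LocIntegrable f := finSums_locIntegrable hf
  obtain ⟨M, hM⟩ := exists_forall_isRank_le F
  obtain ⟨n₁, hn₁⟩ := exists_forall_eq_of_mem_finSums hf
  set g : ℝ → 𝕜 := fun y => b y * f y - diagPart b β F G c f y with hg
  conv_lhs => rw [hSA]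
  refine eLpNorm_iUnion_le hpq.pos hAmono fun i => ?_
  set Q := ENNReal.ofReal (transformConst p q * B) *
      eLpNorm f (ENNReal.ofReal p) (volume.restrict S) with hQ
  set e : ℕ → ℝ≥0∞ := fun j => ‖L.cellAvg (-(φ j : ℤ)) b x - β S‖ₑ *
    (‖c S‖ₑ * volume S ^ (1 / p)) with he
  have he0 : Tendsto e atTop (𝓝 0) := by
    by_cases hfin : volume S < ∞
    · have h1 : Tendsto (fun j => ‖L.cellAvg (-(φ j : ℤ)) b x - β S‖ₑ) atTop (𝓝 0) := by
        have := (continuous_enorm.tendsto (0 : 𝕜)).comp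
          (tendsto_sub_nhds_zero_iff.2 (hβ hfin))
        rwa [enorm_zero] at this
      have := ENNReal.Tendsto.mul_const (b := ‖c S‖ₑ * volume S ^ (1 / p)) h1
        (Or.inr (ENNReal.mul_ne_top enorm_ne_top
          (ENNReal.rpow_ne_top_of_nonneg (one_div_nonneg.2 hpq.nonneg) hfin.ne)))
      rwa [zero_mul] at this
    · have hc : c S = 0 := hdec.coeff_eq_zero S fun h => hfin (hdec.mem_fin S h).2
      simp only [he, hc, enorm_zero, zero_mul, mul_zero]
      exact tendsto_const_nhds
  have hlim : Tendsto (fun j => Q + e j) atTop (𝓝 (Q + 0)) := tendsto_const_nhds.add he0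
  rw [add_zero] at hlim
  refine ge_of_tendsto hlim ?_
  filter_upwards [hφ.tendsto_atTop.eventually (eventually_ge_atTop (max i M))] with j hj
  set K := A (φ j) with hK
  set m : ℤ := -(φ j : ℤ) with hm
  have hKg : K ∈ L.gen m := cell_mem_gen _ hx
  have hKS : K ⊆ S := cell_subset_top _ _
  have hKv : volume K ≠ ∞ := (L.cellInterval m x hx).volume_ne_top
  have hK0 : volume K ≠ 0 := (L.cellInterval m x hx).volume_ne_zero
  have hKc : K ⊆ L.carrier := (L.cellInterval m x hx).subset_carrier
  have hjM : (M : ℤ) ≤ φ j := by exact_mod_cast (le_max_right i M).trans hj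
  set n₀ : ℕ := (max (M : ℤ) n₁ - m).toNat with hn₀
  have hmM : m ≤ -M := by omega
  have hstab : ∀ n ≥ n₀, ∀ y ∈ K, L.cellAvg (m + n) f y = f y := fun n hn y hy =>
    cellAvg_of_const (hKc hy) (hn₁ _ (by omega) y)
  have hmain := eLpNorm_restrict_sub_paraproduct_le hKg hb.measurable hb.locIntegrable
    (hfi ⟨K, m, hKg⟩) hb.nonneg hb.bmoNorm_le hpq hstab
  -- Once K contains all relevant ranks, the average of f over K is c S. So a is the gap between the
  -- top term of the paraproduct, the product of the averages of b and f over K, and the term β S *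
  -- c S of the diagonal part.
  set a : 𝕜 := (L.cellAvg m b x - β S) * c S with ha
  have hG : ∀ (u : Set ℝ → 𝕜), (∀ S' ∉ G, u S' = 0) → ∀ y ∈ K,
      (∑ S' ∈ G, S'.indicator fun _ => u S') y = u S := by
    intro u hu y hy
    rw [Finset.sum_apply, Finset.sum_eq_single S]
    · exact indicator_of_mem (hKS hy) _
    · intro S' hS' hne
      refine indicator_of_notMem (fun hy' => hne ?_) _
      obtain ⟨z, -, hz, -⟩ := mem_finLimitIntervals_iff.1 (hdec.mem_fin S' hS')
      rw [hz] at hy' ⊢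
      rw [← top_eq_of_mem hy', top_eq_of_mem (hKS hy)]
    · intro h
      rw [hu S h]; simp
  have hpt : ∀ y ∈ K, g y - a = b y * f y - (L.cellAvg m b y * L.cellAvg m f y +
      ∑ k ∈ Finset.range n₀, L.cellAvg (m + k) b y *
        (L.cellAvg (m + (k + 1 : ℕ)) f y - L.cellAvg (m + k) f y)) := by
    intro y hy
    have hyc := hKc hy
    have h1 := sum_diff_eq_sum_cellAvg hfi hdec.diff_eq_zero hM (fun S => ⨍ z in S, b z) hmM
      (n := n₀) (by omega) hyc
    have h2 := sum_diff_eq_sum_cellAvg hfi hdec.diff_eq_zero hM (fun _ => (1 : 𝕜)) hmM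
      (n := n₀) (by omega) hyc
    simp only [one_mul] at h2
    rw [Finset.sum_range_sub (fun k : ℕ => L.cellAvg (m + k) f y) n₀, hstab n₀ le_rfl y hy] at h2
    have h3 := congrFun hdec.eq_sum y
    rw [Pi.add_apply, Finset.sum_apply, h2, hG c hdec.coeff_eq_zero y hy, Nat.cast_zero,
      add_zero] at h3
    have h4 : L.cellAvg m f y = c S := by linear_combination h3
    have h5 : diagPart b β F G c f y = ∑ k ∈ Finset.range n₀, L.cellAvg (m + k) b y *
        (L.cellAvg (m + (k + 1 : ℕ)) f y - L.cellAvg (m + k) f y) + β S * c S := by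
      rw [diagPart, Pi.add_apply, hG (fun S => β S * c S) (fun S' hS' => by
        rw [hdec.coeff_eq_zero S' hS', mul_zero]) y hy, Finset.sum_apply]
      congr 1
    rw [hg]
    beta_reduce
    rw [h5, h4, ha, cellAvg_eq_of_mem (show y ∈ L.cell m x from hy)]
    ring
  have hgm : AEStronglyMeasurable g (volume.restrict K) := by
    have hbK := hb.locIntegrable ⟨K, m, hKg⟩
    exact (hbK.aestronglyMeasurable.mul (hfi ⟨K, m, hKg⟩).aestronglyMeasurable).sub
      (finSums_locIntegrable (diagPart_mem_finSums b β hdec) ⟨K, m, hKg⟩).aestronglyMeasurable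
  have hp1 : 1 ≤ ENNReal.ofReal p := by
    rw [← ENNReal.ofReal_one]; exact ENNReal.ofReal_le_ofReal hpq.lt.le
  calc eLpNorm g (ENNReal.ofReal p) (volume.restrict (A i))
      ≤ eLpNorm g (ENNReal.ofReal p) (volume.restrict K) :=
        eLpNorm_mono_measure _ (Measure.restrict_mono_set _
          (hAmono ((le_max_left i M).trans hj)))
    _ = eLpNorm ((fun y => g y - a) + fun _ => a) (ENNReal.ofReal p) (volume.restrict K) := by
        congr 1; funext y; simp
    _ ≤ eLpNorm (fun y => g y - a) (ENNReal.ofReal p) (volume.restrict K) +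
        eLpNorm (fun _ => a) (ENNReal.ofReal p) (volume.restrict K) :=
        eLpNorm_add_le (hgm.sub aestronglyMeasurable_const) aestronglyMeasurable_const hp1
    _ ≤ Q + e j := by
        refine add_le_add ?_ ?_
        · refine le_trans (le_of_eq (eLpNorm_congr_ae ?_)) (hmain.trans ?_)
          · filter_upwards [ae_restrict_mem (measurableSet_cell _ _)] with y hy
            exact hpt y hy
          · exact mul_le_mul_right (eLpNorm_mono_measure _ (Measure.restrict_mono_set _ hKS)) _
        · rw [eLpNorm_const_restrict hpq.pos _ _ hK0, ha, enorm_mul, mul_assoc]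
          refine mul_le_mul_right (mul_le_mul_right ?_ _) _
          exact ENNReal.rpow_le_rpow (measure_mono hKS) (one_div_nonneg.2 hpq.nonneg)

end NoJumpBMO

/-! ### The commutator with a symbol without jumps at limit intervals -/

namespace NoJumpBMO

variable {b : ℝ → 𝕜} {B : ℝ}

/-- The coefficients β are chosen before f, so f and T f can be compared with diagonal parts built
from the same scalars. -/
lemma exists_limit_coeff (hb : NoJumpBMO L b B) (hpq : p.HolderConjugate q) :
    ∃ β : Set ℝ → 𝕜, ∀ {f : ℝ → 𝕜}, f ∈ L.finSums 𝕜 → ∀ {F : Finset L.Interval}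
      {G : Finset (Set ℝ)} {c : Set ℝ → 𝕜}, IsFinDecomp f F G c →
      eLpNorm (fun y => b y * f y - diagPart b β F G c f y) (ENNReal.ofReal p) L.measure ≤
        ENNReal.ofReal (transformConst p q * B) * eLpNorm f (ENNReal.ofReal p) L.measure := by
  have key : ∀ S : Set ℝ, ∃ β : 𝕜, S ∈ L.limitIntervals → ∃ x ∈ L.carrier, S = L.top x ∧
      ∃ φ : ℕ → ℕ, StrictMono φ ∧ (volume (L.top x) < ∞ →
        Tendsto (fun j => L.cellAvg (-(φ j : ℤ)) b x) atTop (𝓝 β)) := by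
    intro S
    by_cases hS : S ∈ L.limitIntervals
    swap
    · exact ⟨0, fun h => absurd h hS⟩
    obtain ⟨x, hx, rfl⟩ := mem_limitIntervals_iff.1 hS
    by_cases hfin : volume (L.top x) < ∞
    · obtain ⟨β, φ, hφ, h⟩ := hb.exists_tendsto_cellAvg hpq hx hfin
      exact ⟨β, fun _ => ⟨x, hx, rfl, φ, hφ, fun _ => h⟩⟩
    · exact ⟨0, fun _ => ⟨x, hx, rfl, id, strictMono_id, fun h => absurd h hfin⟩⟩
  choose β hβ using key
  refine ⟨β, fun {f} hf {F G c} hdec => eLpNorm_le_of_forall_limitIntervals hpq.pos fun S hS => ?_⟩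
  obtain ⟨x, hx, hSx, φ, hφ, h⟩ := hβ S hS
  rw [hSx]
  exact hb.eLpNorm_sub_diagPart_restrict_le hpq hf hdec hx hφ fun hfin => hSx ▸ h hfin

/-- With P the multiplication by b minus its diagonal part, [M_b, T] f = P (T f) - T (P f). Each
term contributes one factor `transformConst`. The image of b f is the L^p extension of T at P f plus
T of the diagonal part, which is a finite martingale sum. -/
lemma exists_isImage (hb : NoJumpBMO L b B) (hpq : p.HolderConjugate q)
    (T : MartingaleTransform L 𝕜) (hT : T.opNorm p < ∞) {f : ℝ → 𝕜} (hf : f ∈ L.finSums 𝕜) :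
    ∃ u : ℝ → 𝕜, T.IsImage (fun x => b x * f x) u ∧
      AEStronglyMeasurable (fun x => b x * T.apply f x - u x) L.measure ∧
      eLpNorm (fun x => b x * T.apply f x - u x) (ENNReal.ofReal p) L.measure ≤
        2 * ENNReal.ofReal (transformConst p q) * (T.opNorm p * ENNReal.ofReal B) *
          eLpNorm f (ENNReal.ofReal p) L.measure := by
  obtain ⟨β, hβ⟩ := hb.exists_limit_coeff hpq
  obtain ⟨F, G, c, hdec⟩ := exists_isFinDecomp hf
  have hp1 : 1 ≤ ENNReal.ofReal p := by
    rw [← ENNReal.ofReal_one]; exact ENNReal.ofReal_le_ofReal hpq.lt.le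
  have hle := sigmaInf_le L
  set Z := diagPart b β F G c f with hZ
  have hZf : Z ∈ L.finSums 𝕜 := diagPart_mem_finSums b β hdec
  set Pf : ℝ → 𝕜 := fun x => b x * f x - Z x with hPf
  have hPbound := hβ hf hdec
  have hfm := (finSums_props hf).1
  have hfL := (finSums_props hf).2 (ENNReal.ofReal p)
  have hPm : AEStronglyMeasurable[L.sigmaInf] Pf L.measure :=
    (hb.measurable.mul hfm.aestronglyMeasurable).sub (finSums_props hZf).1.aestronglyMeasurable
  have hPp : MemLp Pf (ENNReal.ofReal p) L.measure :=
    ⟨hPm.mono hle, hPbound.trans_lt (ENNReal.mul_lt_top ENNReal.ofReal_lt_top hfL.2)⟩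
  obtain ⟨v, hv, hvp, hvn⟩ := T.exists_extension hpq hT hPm hPp
  set g := T.apply f with hg
  have hgf : g ∈ L.finSums 𝕜 := T.apply_mem_finSums hf
  have hTZ := T.apply_mem_finSums hZf
  have hgdec : IsFinDecomp g F ∅ (fun _ => 0) :=
    { mem_fin := fun S hS => absurd hS (Finset.notMem_empty S)
      diff_eq_zero := fun I hI => by rw [T.diff_apply_eq hf, hdec.diff_eq_zero I hI, map_zero]
      coeff_eq_zero := fun _ _ => rfl
      eq_sum := by
        rw [Finset.sum_empty, add_zero, hg, T.apply_eq_sum hdec.diff_eq_zero]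
        refine Finset.sum_congr rfl fun I _ => ?_
        rw [← T.apply_eq_sum hdec.diff_eq_zero, T.diff_apply_eq hf] }
  -- T f has no indicator terms and T annihilates those in the diagonal part of f, so the choice of
  -- β does not affect this commutation.
  have hcomm : diagPart b β F ∅ (fun _ => 0) g = T.apply Z := by
    rw [T.apply_eq_sum (F := F) fun I hI => by
      rw [hZ, diff_diagPart b β hdec, hdec.diff_eq_zero I hI, smul_zero], diagPart,
      Finset.sum_empty, add_zero]
    refine Finset.sum_congr rfl fun I _ => ?_
    rw [hZ, diff_diagPart b β hdec, map_smul, Submodule.coe_smul, hg, T.diff_apply_eq hf]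
  have hgbound := hβ hgf hgdec
  rw [hcomm] at hgbound
  set Pg : ℝ → 𝕜 := fun x => b x * g x - T.apply Z x with hPg
  have hPgm : AEStronglyMeasurable Pg L.measure :=
    AEStronglyMeasurable.mono hle
      ((hb.measurable.mul (finSums_props hgf).1.aestronglyMeasurable).sub
        (finSums_props hTZ).1.aestronglyMeasurable)
  have hw : (fun x => b x * g x - (v + T.apply Z) x) = Pg - v := by
    funext x
    simp only [hPg, Pi.add_apply, Pi.sub_apply]
    ring
  refine ⟨v + T.apply Z, ⟨hv.measurable.add (finSums_props hTZ).1.aestronglyMeasurable,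
    fun I => (hv.locIntegrable I).add (finSums_locIntegrable hTZ I), fun I => ?_, fun S hS => ?_,
    fun S hS => ?_⟩, ?_, ?_⟩
  · have hbf : (fun x => b x * f x) = Pf + Z := by
      funext x; simp [hPf]
    have hPI : IntegrableOn Pf (I : Set ℝ) := MemLp.integrableOn_of_subset_carrier hpq.lt.le hPp
      I.measurableSet I.subset_carrier I.volume_ne_top
    rw [hbf, diff_add (hv.locIntegrable I) (finSums_locIntegrable hTZ I), hv.diff_eq,
      T.diff_apply_eq hZf, diff_add hPI (finSums_locIntegrable hZf I), map_add]
  · exact (hv.integrableOn S hS).add (by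
      obtain ⟨_, _, _, h⟩ := exists_isFinDecomp hTZ
      exact h.integrable.integrableOn)
  · have hi : IntegrableOn (T.apply Z) S := by
      obtain ⟨_, _, _, h⟩ := exists_isFinDecomp hTZ
      exact h.integrable.integrableOn
    simp only [Pi.add_apply]
    rw [integral_add (hv.integrableOn S hS) hi, hv.integral_eq S hS,
      T.setIntegral_apply_eq_zero hZf hS, add_zero]
  · rw [hw]; exact hPgm.sub hvp.1
  · rw [hw]
    have hT0 := transformConst_pos hpq
    have hc : ENNReal.ofReal (transformConst p q * B) =
        ENNReal.ofReal (transformConst p q) * ENNReal.ofReal B := ENNReal.ofReal_mul hT0.le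
    rw [hc] at hgbound hPbound
    have hgn := T.eLpNorm_apply_le hT hf
    calc eLpNorm (Pg - v) (ENNReal.ofReal p) L.measure
        ≤ eLpNorm Pg (ENNReal.ofReal p) L.measure + eLpNorm v (ENNReal.ofReal p) L.measure :=
          eLpNorm_sub_le hPgm hvp.1 hp1
      _ ≤ ENNReal.ofReal (transformConst p q) * ENNReal.ofReal B *
            (T.opNorm p * eLpNorm f (ENNReal.ofReal p) L.measure) +
          T.opNorm p * (ENNReal.ofReal (transformConst p q) * ENNReal.ofReal B *
            eLpNorm f (ENNReal.ofReal p) L.measure) := by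
          refine add_le_add (hgbound.trans ?_) (hvn.trans ?_)
          · exact mul_le_mul_right hgn _
          · exact mul_le_mul_right hPbound _
      _ = _ := by ring

end NoJumpBMO

/-! ### Norm estimates on an interval -/

lemma one_le_ofReal_of_one_le (hp : 1 ≤ p) : 1 ≤ ENNReal.ofReal p := by
  rw [← ENNReal.ofReal_one]; exact ENNReal.ofReal_le_ofReal hp

lemma enorm_integral_mul_le (hpq : p.HolderConjugate q) {μ : Measure ℝ} {f g : ℝ → 𝕜}
    (hf : AEStronglyMeasurable f μ) (hg : AEStronglyMeasurable g μ) :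
    ‖∫ x, f x * g x ∂μ‖ₑ ≤ eLpNorm f (ENNReal.ofReal p) μ * eLpNorm g (ENNReal.ofReal q) μ := by
  refine (enorm_integral_le_lintegral_enorm _).trans ?_
  simp only [enorm_mul]
  refine (ENNReal.lintegral_mul_le_Lp_mul_Lq μ hpq hf.enorm hg.enorm).trans (le_of_eq ?_)
  rw [eLpNorm_eq_lintegral_rpow_enorm_toReal (by simpa using hpq.pos) ENNReal.ofReal_ne_top,
    eLpNorm_eq_lintegral_rpow_enorm_toReal (by simpa using hpq.symm.pos) ENNReal.ofReal_ne_top,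
    ENNReal.toReal_ofReal hpq.nonneg, ENNReal.toReal_ofReal hpq.symm.nonneg]

lemma enorm_volume_real (I : L.Interval) :
    ‖(volume.real (I : Set ℝ) : 𝕜)‖ₑ = volume (I : Set ℝ) := by
  rw [← ofReal_norm, RCLike.norm_ofReal, abs_of_pos I.volume_real_pos, measureReal_def,
    ENNReal.ofReal_toReal I.volume_ne_top]

lemma Interval.volume_rpow_mul_rpow (hpq : p.HolderConjugate q) (I : L.Interval) :
    volume (I : Set ℝ) ^ (1 / p) * volume (I : Set ℝ) ^ (1 / q) = volume (I : Set ℝ) := by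
  rw [← ENNReal.rpow_add _ _ I.volume_ne_zero I.volume_ne_top, one_div, one_div,
    hpq.inv_add_inv_eq_one, ENNReal.rpow_one]

lemma Interval.volume_rpow_ne_zero (I : L.Interval) (a : ℝ) : volume (I : Set ℝ) ^ a ≠ 0 := by
  simp [ENNReal.rpow_eq_zero_iff, I.volume_ne_zero, I.volume_ne_top]

lemma Interval.volume_rpow_ne_top (I : L.Interval) (a : ℝ) : volume (I : Set ℝ) ^ a ≠ ∞ := by
  simp [ENNReal.rpow_eq_top_iff, I.volume_ne_zero, I.volume_ne_top]

/-- A number whose product with `|I|` is at most `X |I|^(1/q)` has `L^p` norm at most `X` on `I`. -/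
lemma enorm_mul_rpow_le_of_volume_mul_le (hpq : p.HolderConjugate q) (I : L.Interval)
    {a X : ℝ≥0∞} (h : volume (I : Set ℝ) * a ≤ X * volume (I : Set ℝ) ^ (1 / q)) :
    a * volume (I : Set ℝ) ^ (1 / p) ≤ X := by
  rw [← ENNReal.mul_le_mul_iff_left (I.volume_rpow_ne_zero (1 / q)) (I.volume_rpow_ne_top (1 / q))]
  rwa [mul_assoc, I.volume_rpow_mul_rpow hpq, mul_comm]

lemma eLpNorm_average_le (hpq : p.HolderConjugate q) (I : L.Interval) {f : ℝ → 𝕜}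
    (hf : IntegrableOn f (I : Set ℝ)) :
    eLpNorm (fun _ => ⨍ x in (I : Set ℝ), f x) (ENNReal.ofReal p) (volume.restrict (I : Set ℝ)) ≤
      eLpNorm f (ENNReal.ofReal p) (volume.restrict (I : Set ℝ)) := by
  rw [eLpNorm_const_restrict hpq.pos _ _ I.volume_ne_zero]
  refine enorm_mul_rpow_le_of_volume_mul_le hpq I ?_
  have h := enorm_setIntegral_le hpq (I : Set ℝ) hf.aestronglyMeasurable
  rwa [setIntegral_eq_mul_average, enorm_mul, enorm_volume_real] at h

lemma lintegral_eq_sum_child {I : L.Interval} (hI : (L.child I).Nonempty) (f : ℝ → ℝ≥0∞) :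
    ∫⁻ x in (I : Set ℝ), f x =
      ∑ J ∈ (finite_child I).toFinset, ∫⁻ x in (J : Set ℝ), f x := by
  have hU : (I : Set ℝ) = ⋃ J ∈ (finite_child I).toFinset, (J : Set ℝ) := by
    ext x
    simp only [Set.mem_iUnion, Set.Finite.mem_toFinset, exists_prop]
    exact ⟨fun h => exists_child_of_mem hI h, fun ⟨J, hJ, hx⟩ => child_subset hJ hx⟩
  conv_lhs => rw [hU]
  refine lintegral_biUnion_finset (fun J hJ J' hJ' hne => ?_) (fun J _ => J.measurableSet) _
  refine Set.disjoint_left.2 fun x hx hx' => hne ?_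
  exact child_eq_of_mem ((finite_child I).mem_toFinset.1 hJ)
    ((finite_child I).mem_toFinset.1 hJ') hx hx'

lemma eLpNorm_restrict_le_of_forall_child (hp : 0 < p) {I : L.Interval}
    (hI : (L.child I).Nonempty) {f g : ℝ → 𝕜} {C : ℝ≥0∞}
    (h : ∀ K ∈ L.child I, eLpNorm g (ENNReal.ofReal p) (volume.restrict (K : Set ℝ)) ≤
      C * eLpNorm f (ENNReal.ofReal p) (volume.restrict (K : Set ℝ))) :
    eLpNorm g (ENNReal.ofReal p) (volume.restrict (I : Set ℝ)) ≤
      C * eLpNorm f (ENNReal.ofReal p) (volume.restrict (I : Set ℝ)) := by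
  rw [eLpNorm_le_mul_iff_lintegral hp, lintegral_eq_sum_child hI, lintegral_eq_sum_child hI,
    Finset.mul_sum]
  exact Finset.sum_le_sum fun K hK => (eLpNorm_le_mul_iff_lintegral hp).1
    (h K ((finite_child I).mem_toFinset.1 hK))

lemma eLpNorm_D_restrict {I : L.Interval} (h : L.D 𝕜 I) (p : ℝ≥0∞) :
    eLpNorm (h : ℝ → 𝕜) p (volume.restrict (I : Set ℝ)) = eLpNorm (h : ℝ → 𝕜) p L.measure := by
  rw [← restrict_measure I.measurableSet I.subset_carrier]
  refine eLpNorm_restrict_eq_of_support_subset fun x hx => ?_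
  by_contra hxI
  exact hx (D_apply_of_notMem h hxI)

lemma D_aestronglyMeasurable {I : L.Interval} (h : L.D 𝕜 I) (μ : Measure ℝ) :
    AEStronglyMeasurable (h : ℝ → 𝕜) μ :=
  ((finSums_props (D_mem_finSums h)).1.mono (sigmaInf_le L)).aestronglyMeasurable

/-- Averaging over the children and averaging over I are both contractions; the factor 2 is the
triangle inequality. -/
lemma eLpNorm_diff_le (hpq : p.HolderConjugate q) (I : L.Interval) {f : ℝ → 𝕜}
    (hf : IntegrableOn f (I : Set ℝ)) :
    eLpNorm (diff I f : ℝ → 𝕜) (ENNReal.ofReal p) L.measure ≤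
      2 * eLpNorm f (ENNReal.ofReal p) (volume.restrict (I : Set ℝ)) := by
  rw [← eLpNorm_D_restrict]
  have hp1 := one_le_ofReal_of_one_le hpq.lt.le
  by_cases hI : (L.child I).Nonempty
  swap
  · have h0 : (diff I f : ℝ → 𝕜) = 0 := by
      funext x
      exact (diff I f).2.1 x fun J hJ => absurd ⟨J, hJ⟩ hI
    rw [h0, eLpNorm_zero]; exact zero_le
  set a := ⨍ x in (I : Set ℝ), f x with ha
  have hm : AEStronglyMeasurable (diff I f : ℝ → 𝕜) (volume.restrict (I : Set ℝ)) :=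
    D_aestronglyMeasurable _ _
  have h1 : eLpNorm (fun x => (diff I f : ℝ → 𝕜) x + a) (ENNReal.ofReal p)
      (volume.restrict (I : Set ℝ)) ≤
      1 * eLpNorm f (ENNReal.ofReal p) (volume.restrict (I : Set ℝ)) := by
    refine eLpNorm_restrict_le_of_forall_child hpq.pos hI fun K hK => ?_
    rw [one_mul]
    refine le_trans (le_of_eq (eLpNorm_congr_ae ?_))
      (eLpNorm_average_le hpq K (hf.mono_set (child_subset hK)))
    filter_upwards [ae_restrict_mem K.measurableSet] with x hx
    rw [diff_apply hf hK hx, sub_add_cancel]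
  have h2 : (diff I f : ℝ → 𝕜) = (fun x => (diff I f : ℝ → 𝕜) x + a) - fun _ => a := by
    funext x; simp
  rw [h2]
  refine (eLpNorm_sub_le (hm.add aestronglyMeasurable_const)
    aestronglyMeasurable_const hp1).trans ?_
  rw [two_mul]
  rw [one_mul] at h1
  exact add_le_add h1 (eLpNorm_average_le hpq I hf)

/-- A step function on the children of `I` is the sum of its martingale difference and of its
average. -/
lemma diff_add_average_of_step {I : L.Interval} {k : ℝ → 𝕜}
    (h0 : ∀ x, (∀ J ∈ L.child I, x ∉ (J : Set ℝ)) → k x = 0)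
    (hc : ∀ J ∈ L.child I, ∀ x ∈ (J : Set ℝ), ∀ y ∈ (J : Set ℝ), k x = k y) {x : ℝ}
    (hx : x ∈ (I : Set ℝ)) : k x = (diff I k : ℝ → 𝕜) x + ⨍ y in (I : Set ℝ), k y := by
  by_cases hI : (L.child I).Nonempty
  · obtain ⟨K, hK, hxK⟩ := exists_child_of_mem hI hx
    rw [diff_apply (integrable_of_step h0 hc).integrableOn hK hxK, sub_add_cancel]
    exact (average_of_const K fun y hy => hc K hK y hy x hxK).symm
  · have hk : k = 0 := by
      funext y
      exact h0 y fun J hJ => absurd ⟨J, hJ⟩ hI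
    have h1 : (diff I k : ℝ → 𝕜) x = 0 := (diff I k).2.1 x fun J hJ => absurd ⟨J, hJ⟩ hI
    rw [h1, hk]
    simp

lemma D_mul_step {I : L.Interval} (g h : L.D 𝕜 I) :
    (∀ x, (∀ J ∈ L.child I, x ∉ (J : Set ℝ)) → (g : ℝ → 𝕜) x * (h : ℝ → 𝕜) x = 0) ∧
    (∀ J ∈ L.child I, ∀ x ∈ (J : Set ℝ), ∀ y ∈ (J : Set ℝ),
      (g : ℝ → 𝕜) x * (h : ℝ → 𝕜) x = (g : ℝ → 𝕜) y * (h : ℝ → 𝕜) y) :=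
  ⟨fun x hx => by rw [g.2.1 x hx, zero_mul], fun J hJ x hx y hy => by
    rw [g.2.2.1 J hJ x hx y hy, h.2.2.1 J hJ x hx y hy]⟩

lemma mul_eq_lambdaBlock_add {I : L.Interval} (b : ℝ → 𝕜) (h : L.D 𝕜 I) {x : ℝ}
    (hx : x ∈ (I : Set ℝ)) : (diff I b : ℝ → 𝕜) x * (h : ℝ → 𝕜) x =
      (lambdaBlock b I h : ℝ → 𝕜) x +
        ⨍ y in (I : Set ℝ), (diff I b : ℝ → 𝕜) y * (h : ℝ → 𝕜) y :=
  diff_add_average_of_step (D_mul_step _ h).1 (D_mul_step _ h).2 hx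

lemma D_bounded {I : L.Interval} (φ : L.D 𝕜 I) : ∃ C, ∀ x, ‖(φ : ℝ → 𝕜) x‖ ≤ C := by
  classical
  have h2 := D_eq_sum_indicator φ
  refine ⟨∑ J ∈ (finite_child I).toFinset, ‖(φ : ℝ → 𝕜) J.nonempty.some‖, fun x => ?_⟩
  conv_lhs => rw [h2]
  rw [Finset.sum_apply]
  refine (norm_sum_le _ _).trans (Finset.sum_le_sum fun J _ => ?_)
  exact norm_indicator_le_norm_self (fun _ => (φ : ℝ → 𝕜) J.nonempty.some) x

lemma finSums_bounded {f : ℝ → 𝕜} (hf : f ∈ L.finSums 𝕜) : ∃ C, ∀ x, ‖f x‖ ≤ C := by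
  obtain ⟨F, G, c, h⟩ := exists_isFinDecomp hf
  choose C hC using fun I : L.Interval => D_bounded (diff I f)
  refine ⟨∑ I ∈ F, C I + ∑ S ∈ G, ‖c S‖, fun x => ?_⟩
  rw [h.eq_sum, Pi.add_apply, Finset.sum_apply, Finset.sum_apply]
  refine (norm_add_le _ _).trans (add_le_add ((norm_sum_le _ _).trans
    (Finset.sum_le_sum fun I _ => ?_)) ((norm_sum_le _ _).trans
    (Finset.sum_le_sum fun S _ => norm_indicator_le_norm_self (fun _ => c S) x)))
  exact hC I x

lemma locIntegrable_mul_finSums {b : ℝ → 𝕜} (hb : L.LocIntegrable b) {f : ℝ → 𝕜}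
    (hf : f ∈ L.finSums 𝕜) : L.LocIntegrable fun x => b x * f x := fun I => by
  obtain ⟨C, hC⟩ := finSums_bounded hf
  exact (hb I).mul_bdd (c := C) (finSums_locIntegrable hf I).aestronglyMeasurable
    (Filter.Eventually.of_forall hC)

/-- Seen from I, the product (Δ_I b) f has only two contributions: the mean of f gives a multiple of
Δ_I b and Δ_I f gives the block of Λ_b^1. Finer parts of f have integral zero over each child, where
Δ_I b is constant. -/
lemma lambdaBlock_add_average_eq_diff {I : L.Interval} {b f : ℝ → 𝕜}
    (hf : IntegrableOn f (I : Set ℝ)) :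
    diff I (fun x => (diff I b : ℝ → 𝕜) x * f x) =
      (⨍ x in (I : Set ℝ), f x) • diff I b + lambdaBlock b I (diff I f) := by
  set c := ⨍ x in (I : Set ℝ), f x with hc
  set φ := diff I b with hφ
  have hφi : IntegrableOn (φ : ℝ → 𝕜) (I : Set ℝ) := (D_integrable φ).integrableOn
  have hφh : IntegrableOn (fun x => (φ : ℝ → 𝕜) x * (diff I f : ℝ → 𝕜) x) (I : Set ℝ) :=
    (integrable_mul I φ (diff I f)).integrableOn
  have h1 : (⨍ x in (I : Set ℝ), f x) • φ + lambdaBlock b I (diff I f) =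
      diff I (c • (φ : ℝ → 𝕜) + fun x => (φ : ℝ → 𝕜) x * (diff I f : ℝ → 𝕜) x) := by
    rw [diff_add (hφi.smul c) hφh, diff_smul I hφi, diff_coe_D]
    rfl
  rw [h1]
  by_cases hI : (L.child I).Nonempty
  swap
  · exact D_ext fun K hK => absurd ⟨K, hK⟩ hI
  refine diff_eq_of_setIntegral ?_ ((hφi.smul c).add hφh) fun K hK => ?_
  · obtain ⟨C, hC⟩ := D_bounded φ
    exact hf.bdd_mul (D_aestronglyMeasurable φ _) (Filter.Eventually.of_forall hC)
  · obtain ⟨z, hz⟩ := K.nonempty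
    have hKI := child_subset hK
    have hφK : ∀ x ∈ (K : Set ℝ), (φ : ℝ → 𝕜) x = (φ : ℝ → 𝕜) z := fun x hx =>
      φ.2.2.1 K hK x hx z hz
    have hhK : ∀ x ∈ (K : Set ℝ), (diff I f : ℝ → 𝕜) x = (⨍ y in (K : Set ℝ), f y) - c :=
      fun x hx => diff_apply hf hK hx
    rw [setIntegral_congr_fun K.measurableSet (g := fun x => (φ : ℝ → 𝕜) z * f x)
      fun x hx => by simp only [hφK x hx], integral_const_mul, setIntegral_eq_mul_average K f,
      setIntegral_congr_fun K.measurableSet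
        (g := fun _ => (φ : ℝ → 𝕜) z * ⨍ y in (K : Set ℝ), f y) fun x hx => by
          simp only [Pi.add_apply, Pi.smul_apply, smul_eq_mul, hφK x hx, hhK x hx]; ring,
      setIntegral_const, RCLike.real_smul_eq_coe_mul]
    ring

/-! ### The jumps of `b` at the limit intervals -/

variable (L) in
/-- The sum of the martingale differences of `b` over the intervals of the lattice that are limit
intervals of finite length. -/
def topJump (b : ℝ → 𝕜) (x : ℝ) : 𝕜 :=
  ∑' I : L.Interval, ((diff I b - tildeDiff b I : L.D 𝕜 I) : ℝ → 𝕜) x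

lemma diff_sub_tildeDiff_of_mem (b : ℝ → 𝕜) {I : L.Interval}
    (hI : (I : Set ℝ) ∈ L.finLimitIntervals) : diff I b - tildeDiff b I = diff I b := by
  rw [tildeDiff, if_pos hI, sub_zero]

lemma diff_sub_tildeDiff_of_notMem (b : ℝ → 𝕜) {I : L.Interval}
    (hI : (I : Set ℝ) ∉ L.finLimitIntervals) : diff I b - tildeDiff b I = 0 := by
  rw [tildeDiff, if_neg hI, sub_self]

lemma eq_of_mem_of_mem_finLimitIntervals {S S' : Set ℝ} (hS : S ∈ L.finLimitIntervals)
    (hS' : S' ∈ L.finLimitIntervals) {x : ℝ} (hx : x ∈ S) (hx' : x ∈ S') : S = S' := by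
  obtain ⟨y, -, rfl, -⟩ := mem_finLimitIntervals_iff.1 hS
  obtain ⟨z, -, rfl, -⟩ := mem_finLimitIntervals_iff.1 hS'
  rw [← top_eq_of_mem hx, ← top_eq_of_mem hx']

lemma topJump_term_eq_zero (b : ℝ → 𝕜) {I : L.Interval} {x : ℝ}
    (h : (I : Set ℝ) ∈ L.finLimitIntervals → x ∉ (I : Set ℝ)) :
    ((diff I b - tildeDiff b I : L.D 𝕜 I) : ℝ → 𝕜) x = 0 := by
  by_cases hI : (I : Set ℝ) ∈ L.finLimitIntervals
  · exact D_apply_of_notMem _ (h hI)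
  · rw [diff_sub_tildeDiff_of_notMem b hI]; rfl

lemma hasSum_topJump (b : ℝ → 𝕜) (x : ℝ) :
    HasSum (fun I : L.Interval => ((diff I b - tildeDiff b I : L.D 𝕜 I) : ℝ → 𝕜) x)
      (L.topJump b x) := by
  refine Summable.hasSum ?_
  by_cases h : ∃ I : L.Interval, (I : Set ℝ) ∈ L.finLimitIntervals ∧ x ∈ (I : Set ℝ)
  · obtain ⟨I, hI, hx⟩ := h
    refine (hasSum_single I fun I' hne => topJump_term_eq_zero b fun hI' hx' => hne ?_).summable
    exact Subtype.ext (eq_of_mem_of_mem_finLimitIntervals hI' hI hx' hx)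
  · push Not at h
    refine summable_zero.congr fun I => (topJump_term_eq_zero b (h I)).symm

lemma topJump_of_mem (b : ℝ → 𝕜) {I : L.Interval} (hI : (I : Set ℝ) ∈ L.finLimitIntervals) {x : ℝ}
    (hx : x ∈ (I : Set ℝ)) : L.topJump b x = (diff I b : ℝ → 𝕜) x := by
  rw [topJump, tsum_eq_single I fun I' hne => topJump_term_eq_zero b fun hI' hx' => hne ?_,
    diff_sub_tildeDiff_of_mem b hI]
  exact Subtype.ext (eq_of_mem_of_mem_finLimitIntervals hI' hI hx' hx)

lemma topJump_eq_zero (b : ℝ → 𝕜) {x : ℝ}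
    (h : ∀ I : L.Interval, (I : Set ℝ) ∈ L.finLimitIntervals → x ∉ (I : Set ℝ)) :
    L.topJump b x = 0 := by
  rw [topJump]
  exact (tsum_congr fun I => topJump_term_eq_zero b (h I)).trans tsum_zero

lemma stronglyMeasurable_topJump (b : ℝ → 𝕜) : StronglyMeasurable[L.sigmaInf] (L.topJump b) := by
  refine @stronglyMeasurable_of_tendsto ℝ 𝕜 (Finset L.Interval) L.sigmaInf _ _ atTop _ _
    (fun s x => ∑ I ∈ s, ((diff I b - tildeDiff b I : L.D 𝕜 I) : ℝ → 𝕜) x) _ (fun s => ?_)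
    (tendsto_pi_nhds.2 fun x => hasSum_topJump b x)
  have h : (fun x => ∑ I ∈ s, ((diff I b - tildeDiff b I : L.D 𝕜 I) : ℝ → 𝕜) x) ∈ L.finSums 𝕜 := by
    have := Submodule.sum_mem (L.finSums 𝕜) (t := s)
      (f := fun I => ((diff I b - tildeDiff b I : L.D 𝕜 I) : ℝ → 𝕜)) fun I _ => D_mem_finSums _
    convert this using 1
    funext x
    rw [Finset.sum_apply]
  exact (finSums_props h).1

/-- An interval that meets a parentless J without being J lies in a child of J, where Δ_J b is
constant; if it meets none, the jump vanishes on it. So multiplication by the jump is a scalar on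
all intervals except the parentless ones. -/
lemma exists_topJump_eq_const (b : ℝ → 𝕜) {I : L.Interval}
    (hI : (I : Set ℝ) ∉ L.finLimitIntervals) :
    ∃ a : 𝕜, ∀ x ∈ (I : Set ℝ), L.topJump b x = a := by
  by_cases h : ∃ J : L.Interval, (J : Set ℝ) ∈ L.finLimitIntervals ∧
      ¬ Disjoint (I : Set ℝ) (J : Set ℝ)
  · obtain ⟨J, hJ, hd⟩ := h
    have hIJ : (I : Set ℝ) ⊆ J :=
      (I.subset_or_disjoint_of_mem_finLimitIntervals hJ).resolve_right hd
    have hss : (I : Set ℝ) ⊂ J := hIJ.ssubset_of_ne fun h => hI (h ▸ hJ)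
    obtain ⟨K, hK, hIK⟩ := exists_child_superset hss
    obtain ⟨z, hz⟩ := K.nonempty
    refine ⟨(diff J b : ℝ → 𝕜) z, fun x hx => ?_⟩
    rw [topJump_of_mem b hJ (hIJ hx)]
    exact (diff J b).2.2.1 K hK x (hIK hx) z hz
  · push Not at h
    exact ⟨0, fun x hx => topJump_eq_zero b fun J hJ hxJ => disjoint_left.1 (h J hJ) hx hxJ⟩

lemma locIntegrable_topJump (b : ℝ → 𝕜) : L.LocIntegrable (L.topJump b) := by
  intro I
  by_cases hI : (I : Set ℝ) ∈ L.finLimitIntervals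
  · exact (D_integrable (diff I b)).integrableOn.congr_fun
      (fun x hx => (topJump_of_mem b hI hx).symm) I.measurableSet
  · obtain ⟨a, ha⟩ := exists_topJump_eq_const b hI
    exact (integrableOn_const (C := a) I.volume_ne_top).congr_fun (fun x hx => (ha x hx).symm)
      I.measurableSet

lemma diff_sub_topJump {b : ℝ → 𝕜} (hb : L.LocIntegrable b) (I : L.Interval) :
    diff I (b - L.topJump b) = tildeDiff b I := by
  rw [diff_sub (hb I) (locIntegrable_topJump b I), tildeDiff]
  split_ifs with hI
  · rw [diff_congr (f := L.topJump b) (g := (diff I b : ℝ → 𝕜)) fun x hx => topJump_of_mem b hI hx,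
      diff_coe_D, sub_self]
  · obtain ⟨a, ha⟩ := exists_topJump_eq_const b hI
    rw [diff_of_const ha, sub_zero]

lemma noJumpBMO_sub_topJump {b : ℝ → 𝕜} (hbm : AEStronglyMeasurable[L.sigmaInf] b L.measure)
    (hb : L.LocIntegrable b) (hB : bmoNorm (L := L) (tildeDiff b) < ∞) :
    NoJumpBMO L (b - L.topJump b) (bmoNorm (L := L) (tildeDiff b)).toReal where
  measurable := hbm.sub (stronglyMeasurable_topJump b).aestronglyMeasurable
  locIntegrable I := (hb I).sub (locIntegrable_topJump b I)
  nonneg := ENNReal.toReal_nonneg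
  bmoNorm_le := by
    rw [ENNReal.ofReal_toReal hB.ne]
    simp only [diff_sub_topJump hb]
    exact le_rfl

/-- On D_I the product is a scalar multiple, or, for a parentless I, an element of D_I plus its mean
times 1_I. The indicator of a limit interval becomes Δ_S b if S belongs to the lattice, and zero
otherwise. So T acts on the product directly, without extension to L^p. -/
lemma topJump_mul_mem_finSums (b : ℝ → 𝕜) {f : ℝ → 𝕜} (hf : f ∈ L.finSums 𝕜) :
    L.topJump b * f ∈ L.finSums 𝕜 := by
  induction hf using Submodule.span_induction with
  | mem f hf =>
    rcases hf with hf | ⟨S, hS, rfl⟩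
    · obtain ⟨I, hfI⟩ := mem_iUnion.1 hf
      set h : L.D 𝕜 I := ⟨f, hfI⟩ with hh
      by_cases hI : (I : Set ℝ) ∈ L.finLimitIntervals
      · have e : L.topJump b * f = (lambdaBlock b I h : ℝ → 𝕜) + (I : Set ℝ).indicator
            fun _ => ⨍ y in (I : Set ℝ), (diff I b : ℝ → 𝕜) y * (h : ℝ → 𝕜) y := by
          funext x
          by_cases hx : x ∈ (I : Set ℝ)
          · rw [Pi.mul_apply, Pi.add_apply, indicator_of_mem hx, topJump_of_mem b hI hx]
            exact mul_eq_lambdaBlock_add b h hx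
          · have h0 : f x = 0 := D_apply_of_notMem h hx
            rw [Pi.mul_apply, Pi.add_apply, indicator_of_notMem hx, h0, mul_zero,
              D_apply_of_notMem _ hx, add_zero]
        rw [e]
        exact Submodule.add_mem _ (D_mem_finSums _) (indicator_mem_finSums hI _)
      · obtain ⟨a, ha⟩ := exists_topJump_eq_const b hI
        have e : L.topJump b * f = a • f := by
          funext x
          by_cases hx : x ∈ (I : Set ℝ)
          · rw [Pi.mul_apply, ha x hx]; rfl
          · have h0 : f x = 0 := D_apply_of_notMem h hx
            simp [h0]
        rw [e]
        exact Submodule.smul_mem _ _ (D_mem_finSums h)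
    · by_cases h : ∃ I : L.Interval, (I : Set ℝ) = S
      · obtain ⟨I, rfl⟩ := h
        have e : (L.topJump b * (I : Set ℝ).indicator fun _ => (1 : 𝕜)) = (diff I b : ℝ → 𝕜) := by
          funext x
          by_cases hx : x ∈ (I : Set ℝ)
          · rw [Pi.mul_apply, indicator_of_mem hx, mul_one, topJump_of_mem b hS hx]
          · rw [Pi.mul_apply, indicator_of_notMem hx, mul_zero, D_apply_of_notMem _ hx]
        beta_reduce
        rw [e]
        exact D_mem_finSums _
      · push Not at h
        have e : (L.topJump b * S.indicator fun _ => (1 : 𝕜)) = 0 := by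
          funext x
          by_cases hx : x ∈ S
          · rw [Pi.mul_apply, topJump_eq_zero b fun I hI hxI =>
              h I (eq_of_mem_of_mem_finLimitIntervals hI hS hxI hx), zero_mul]
            rfl
          · rw [Pi.mul_apply, indicator_of_notMem hx, mul_zero]
            rfl
        beta_reduce
        rw [e]
        exact Submodule.zero_mem _
  | zero => rw [mul_zero]; exact Submodule.zero_mem _
  | add f g _ _ hf hg => rw [mul_add]; exact Submodule.add_mem _ hf hg
  | smul a f _ hf => rw [mul_smul_comm]; exact Submodule.smul_mem _ _ hf

namespace MartingaleTransform

variable (T : MartingaleTransform L 𝕜)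

lemma isImage_apply {g : ℝ → 𝕜} (hg : g ∈ L.finSums 𝕜) : T.IsImage g (T.apply g) := by
  have hTg := T.apply_mem_finSums hg
  obtain ⟨_, _, _, h⟩ := exists_isFinDecomp hTg
  exact ⟨(finSums_props hTg).1.aestronglyMeasurable, finSums_locIntegrable hTg,
    T.diff_apply_eq hg, fun S _ => h.integrable.integrableOn,
    fun S hS => T.setIntegral_apply_eq_zero hg hS⟩

lemma IsImage.add {T : MartingaleTransform L 𝕜} {h h' u u' : ℝ → 𝕜} (hu : T.IsImage h u)
    (hu' : T.IsImage h' u') (hi : L.LocIntegrable h) (hi' : L.LocIntegrable h') :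
    T.IsImage (h + h') (u + u') where
  measurable := hu.measurable.add hu'.measurable
  locIntegrable I := (hu.locIntegrable I).add (hu'.locIntegrable I)
  diff_eq I := by
    rw [diff_add (hu.locIntegrable I) (hu'.locIntegrable I), diff_add (hi I) (hi' I), hu.diff_eq,
      hu'.diff_eq, map_add]
  integrableOn S hS := (hu.integrableOn S hS).add (hu'.integrableOn S hS)
  integral_eq S hS := by
    simp only [Pi.add_apply]
    rw [integral_add (hu.integrableOn S hS) (hu'.integrableOn S hS), hu.integral_eq S hS,
      hu'.integral_eq S hS, add_zero]

/-- On a limit interval of the lattice, the commutator with the jump of `b` is given by the block of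
this interval. -/
lemma topJump_mul_apply_sub (b : ℝ → 𝕜) {f : ℝ → 𝕜} (hf : f ∈ L.finSums 𝕜) {J : L.Interval}
    (hJ : (J : Set ℝ) ∈ L.finLimitIntervals) {x : ℝ} (hx : x ∈ (J : Set ℝ)) :
    L.topJump b x * T.apply f x - T.apply (L.topJump b * f) x =
      (diff J b : ℝ → 𝕜) x * (T.block J (diff J f) : ℝ → 𝕜) x -
        (T.block J (diff J (L.topJump b * f)) : ℝ → 𝕜) x := by
  classical
  have hg := topJump_mul_mem_finSums b hf
  obtain ⟨F, _, _, hF⟩ := exists_isFinDecomp hf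
  obtain ⟨F', _, _, hF'⟩ := exists_isFinDecomp hg
  set E := insert J (F ∪ F') with hE
  have h1 : ∀ I ∉ E, diff I f = 0 := fun I hI => hF.diff_eq_zero I fun h => hI (by simp [hE, h])
  have h2 : ∀ I ∉ E, diff I (L.topJump b * f) = 0 := fun I hI =>
    hF'.diff_eq_zero I fun h => hI (by simp [hE, h])
  rw [T.apply_eq_sum h1, T.apply_eq_sum h2, Finset.sum_apply, Finset.sum_apply, Finset.mul_sum,
    ← Finset.sum_sub_distrib, Finset.sum_eq_single J, topJump_of_mem b hJ hx]
  -- Any other interval through x lies in a child of J, where the jump is a scalar and commutes with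
  -- the block.
  · intro I _ hne
    by_cases hxI : x ∈ (I : Set ℝ)
    · have hI : (I : Set ℝ) ∉ L.finLimitIntervals := fun hI =>
        hne (Subtype.ext (eq_of_mem_of_mem_finLimitIntervals hI hJ hxI hx))
      obtain ⟨a, ha⟩ := exists_topJump_eq_const b hI
      rw [diff_congr (f := L.topJump b * f) (g := a • f) fun y hy => by
        rw [Pi.mul_apply, ha y hy]; rfl, diff_smul I (finSums_locIntegrable hf I), map_smul,
        Submodule.coe_smul, Pi.smul_apply, smul_eq_mul, ha x hxI, sub_self]
    · rw [D_apply_of_notMem _ hxI, D_apply_of_notMem _ hxI, mul_zero, sub_zero]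
  · intro h
    exact absurd (Finset.mem_insert_self _ _) h

lemma topJump_mul_apply_sub_eq_zero (b : ℝ → 𝕜) {f : ℝ → 𝕜} (hf : f ∈ L.finSums 𝕜) {x : ℝ}
    (hx : ∀ J : L.Interval, (J : Set ℝ) ∈ L.finLimitIntervals → x ∉ (J : Set ℝ)) :
    L.topJump b x * T.apply f x - T.apply (L.topJump b * f) x = 0 := by
  classical
  have hg := topJump_mul_mem_finSums b hf
  obtain ⟨F', _, _, hF'⟩ := exists_isFinDecomp hg
  rw [topJump_eq_zero b hx, zero_mul, T.apply_eq_sum hF'.diff_eq_zero, Finset.sum_apply,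
    Finset.sum_eq_zero, sub_zero]
  intro I _
  by_cases hxI : x ∈ (I : Set ℝ)
  · have hI : (I : Set ℝ) ∉ L.finLimitIntervals := fun hI => hx I hI hxI
    obtain ⟨a, ha⟩ := exists_topJump_eq_const b hI
    have ha0 : a = 0 := (ha x hxI).symm.trans (topJump_eq_zero b hx)
    rw [diff_of_const (c := 0) fun y hy => by rw [Pi.mul_apply, ha y hy, ha0, zero_mul], map_zero]
    rfl
  · exact D_apply_of_notMem _ hxI

/-- Moving T_J to the other factor turns the mean into the pairing of T_J^* φ with h, and Hölder
applies; this is where the adjoint testing condition enters. -/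
lemma eLpNorm_average_mul_block_le (hpq : p.HolderConjugate q) {J : L.Interval} (φ h : L.D 𝕜 J)
    {C₁ : ℝ≥0∞} (hC₁ : eLpNorm (T.adjoint.block J φ : ℝ → 𝕜) (ENNReal.ofReal q) L.measure ≤
      C₁ * volume (J : Set ℝ) ^ (1 / q)) :
    eLpNorm (fun _ => ⨍ y in (J : Set ℝ), (φ : ℝ → 𝕜) y * (T.block J h : ℝ → 𝕜) y)
      (ENNReal.ofReal p) (volume.restrict (J : Set ℝ)) ≤
    C₁ * eLpNorm (h : ℝ → 𝕜) (ENNReal.ofReal p) L.measure := by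
  rw [eLpNorm_const_restrict hpq.pos _ _ J.volume_ne_zero]
  refine enorm_mul_rpow_le_of_volume_mul_le hpq J ?_
  have h1 := setIntegral_eq_mul_average J
    fun y => (φ : ℝ → 𝕜) y * (T.block J h : ℝ → 𝕜) y
  rw [← enorm_volume_real (𝕜 := 𝕜) J, ← enorm_mul, ← h1,
    setIntegral_eq_integral_of_forall_compl_eq_zero fun y hy => by
      rw [D_apply_of_notMem φ hy, zero_mul], ← T.integral_adjoint_mul,
    ← setIntegral_eq_integral_of_forall_compl_eq_zero (s := (J : Set ℝ)) fun y hy => by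
      rw [D_apply_of_notMem _ hy, zero_mul]]
  refine (enorm_integral_mul_le hpq.symm (D_aestronglyMeasurable _ _)
    (D_aestronglyMeasurable _ _)).trans ?_
  rw [eLpNorm_D_restrict, eLpNorm_D_restrict, enorm_volume_real]
  refine (mul_le_mul_left hC₁ _).trans (le_of_eq ?_)
  ring

/-- On a parentless J the commutator is exactly the block commutator at Δ_J f, minus the mean of f
times T_J Δ_J b, plus the mean of (Δ_J b) T_J Δ_J f. They cost 2 C₂, C₁ and 2 C₁, where each 2 is
the norm bound for Δ_J. -/
lemma eLpNorm_topJump_commutator_le (hpq : p.HolderConjugate q) (b : ℝ → 𝕜) {C₁ C₂ : ℝ≥0}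
    (h₁ : T.TestingCondition b p q C₁) (h₂ : T.BlockCommutatorCondition b p C₂) {f : ℝ → 𝕜}
    (hf : f ∈ L.finSums 𝕜) :
    eLpNorm (fun x => L.topJump b x * T.apply f x - T.apply (L.topJump b * f) x)
      (ENNReal.ofReal p) L.measure ≤
    (3 * C₁ + 2 * C₂) * eLpNorm f (ENNReal.ofReal p) L.measure := by
  refine eLpNorm_le_of_forall_limitIntervals hpq.pos fun S hS => ?_
  have hSm : MeasurableSet S := by
    obtain ⟨y, hy, rfl⟩ := mem_limitIntervals_iff.1 hS
    exact measurableSet_top y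
  by_cases hSI : ∃ J : L.Interval, (J : Set ℝ) = S
  swap
  · refine le_trans (le_of_eq ?_) zero_le
    rw [← eLpNorm_zero (p := ENNReal.ofReal p) (μ := volume.restrict S) (ε := 𝕜)]
    refine eLpNorm_congr_ae ?_
    filter_upwards [ae_restrict_mem hSm] with x hx
    refine T.topJump_mul_apply_sub_eq_zero b hf fun J hJ hxJ => hSI ⟨J, ?_⟩
    obtain ⟨y, hy, rfl⟩ := mem_limitIntervals_iff.1 hS
    obtain ⟨z, hz, hJz, -⟩ := mem_finLimitIntervals_iff.1 hJ
    rw [hJz] at hxJ ⊢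
    rw [← top_eq_of_mem hxJ, ← top_eq_of_mem hx]
  obtain ⟨J, rfl⟩ := hSI
  have hJ : (J : Set ℝ) ∈ L.finLimitIntervals := ⟨hS, J.volume_ne_top.lt_top⟩
  obtain ⟨h1, h1'⟩ := h₁ J hJ
  set h := diff J f with hh
  set φ := diff J b with hφ
  set c := ⨍ x in (J : Set ℝ), f x with hc
  set a := ⨍ y in (J : Set ℝ), (φ : ℝ → 𝕜) y * (T.block J h : ℝ → 𝕜) y with ha
  set μ := volume.restrict (J : Set ℝ) with hμ
  have hfJ := finSums_locIntegrable hf J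
  have hp1 := one_le_ofReal_of_one_le hpq.lt.le
  set k : L.D 𝕜 J := lambdaBlock b J (T.block J h) - T.block J (lambdaBlock b J h) with hk
  have hpt : ∀ x ∈ (J : Set ℝ), L.topJump b x * T.apply f x - T.apply (L.topJump b * f) x =
      ((k : ℝ → 𝕜) - c • (T.block J φ : ℝ → 𝕜) + fun _ : ℝ => a) x := by
    intro x hx
    have h3 : diff J (L.topJump b * f) = c • φ + lambdaBlock b J h := by
      rw [← lambdaBlock_add_average_eq_diff hfJ]
      exact diff_congr fun y hy => by rw [Pi.mul_apply, topJump_of_mem b hJ hy]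
    rw [T.topJump_mul_apply_sub b hf hJ hx, h3, mul_eq_lambdaBlock_add b _ hx, map_add, map_smul,
      hk]
    simp only [Submodule.coe_add, Submodule.coe_smul, Submodule.coe_sub, Pi.add_apply, Pi.sub_apply,
      Pi.smul_apply]
    ring
  have hkn : eLpNorm (k : ℝ → 𝕜) (ENNReal.ofReal p) μ ≤
      2 * C₂ * eLpNorm f (ENNReal.ofReal p) μ := by
    rw [hμ, eLpNorm_D_restrict]
    refine (h₂ J hJ h).trans ((mul_le_mul_right (eLpNorm_diff_le hpq J hfJ) _).trans (le_of_eq ?_))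
    ring
  have hφn : eLpNorm (c • (T.block J φ : ℝ → 𝕜)) (ENNReal.ofReal p) μ ≤
      C₁ * eLpNorm f (ENNReal.ofReal p) μ := by
    rw [eLpNorm_const_smul, hμ, eLpNorm_D_restrict]
    have h4 := eLpNorm_average_le hpq J hfJ
    rw [eLpNorm_const_restrict hpq.pos _ _ J.volume_ne_zero] at h4
    calc ‖c‖ₑ * eLpNorm (T.block J φ : ℝ → 𝕜) (ENNReal.ofReal p) L.measure
        ≤ ‖c‖ₑ * (C₁ * volume (J : Set ℝ) ^ (1 / p)) := mul_le_mul_right h1 _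
      _ = C₁ * (‖c‖ₑ * volume (J : Set ℝ) ^ (1 / p)) := by ring
      _ ≤ _ := mul_le_mul_right h4 _
  have han : eLpNorm (fun _ => a) (ENNReal.ofReal p) μ ≤
      2 * C₁ * eLpNorm f (ENNReal.ofReal p) μ := by
    refine (T.eLpNorm_average_mul_block_le hpq φ h h1').trans
      ((mul_le_mul_right (eLpNorm_diff_le hpq J hfJ) _).trans (le_of_eq ?_))
    ring
  have hkm := D_aestronglyMeasurable k μ
  have hTm := (D_aestronglyMeasurable (T.block J φ) μ).const_smul c
  rw [eLpNorm_congr_ae (g := (k : ℝ → 𝕜) - c • (T.block J φ : ℝ → 𝕜) + fun _ => a)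
    (by filter_upwards [ae_restrict_mem J.measurableSet] with x hx using hpt x hx)]
  refine (eLpNorm_add_le (hkm.sub hTm) aestronglyMeasurable_const hp1).trans ?_
  refine (add_le_add ((eLpNorm_sub_le hkm hTm hp1).trans (add_le_add hkn hφn)) han).trans
    (le_of_eq ?_)
  ring

end MartingaleTransform

/-- Sufficiency of the `BMO` condition, the testing condition and the block commutator condition. -/
theorem MartingaleTransform.commutatorBoundedBy_of_bmoNorm (T : MartingaleTransform L 𝕜)
    (hpq : p.HolderConjugate q) {b : ℝ → 𝕜}
    (hbm : AEStronglyMeasurable[L.sigmaInf] b L.measure) (hb : L.LocIntegrable b)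
    (hT : T.opNorm p < ∞) (hB : bmoNorm (L := L) (tildeDiff b) < ∞) {C₁ C₂ : ℝ≥0}
    (h₁ : T.TestingCondition b p q C₁) (h₂ : T.BlockCommutatorCondition b p C₂) :
    T.CommutatorBoundedBy b p ((2 * (transformConst p q).toNNReal + 3 : ℝ≥0) *
      (T.opNorm p * bmoNorm (L := L) (tildeDiff b) + C₁ + C₂)) := by
  intro f hf
  have hp1 := one_le_ofReal_of_one_le hpq.lt.le
  have hb₀ := noJumpBMO_sub_topJump hbm hb hB
  obtain ⟨u, hu, hum, hun⟩ := hb₀.exists_isImage hpq T hT hf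
  have hg := topJump_mul_mem_finSums b hf
  have hTg := T.apply_mem_finSums hg
  have hgi := finSums_locIntegrable hg
  have hun1 := T.eLpNorm_topJump_commutator_le hpq b h₁ h₂ hf
  have hbf : L.LocIntegrable fun x => (b - L.topJump b) x * f x :=
    locIntegrable_mul_finSums hb₀.locIntegrable hf
  have hadd := hu.add (T.isImage_apply hg) hbf hgi
  have e1 : ((fun x => (b - L.topJump b) x * f x) + L.topJump b * f) = fun x => b x * f x := by
    funext x
    simp only [Pi.add_apply, Pi.mul_apply, Pi.sub_apply]
    ring
  rw [e1] at hadd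
  refine ⟨_, hadd, ?_⟩
  have e2 : (fun x => b x * T.apply f x - (u + T.apply (L.topJump b * f)) x) =
      (fun x => (b - L.topJump b) x * T.apply f x - u x) +
        fun x => L.topJump b x * T.apply f x - T.apply (L.topJump b * f) x := by
    funext x
    simp only [Pi.add_apply, Pi.sub_apply]
    ring
  have hm1 : AEStronglyMeasurable
      (fun x => L.topJump b x * T.apply f x - T.apply (L.topJump b * f) x) L.measure :=
    (((stronglyMeasurable_topJump b).mono (sigmaInf_le L)).aestronglyMeasurable.mul
      (finSums_aestronglyMeasurable (T.apply_mem_finSums hf))).sub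
      (finSums_aestronglyMeasurable hTg)
  rw [e2]
  refine (eLpNorm_add_le hum hm1 hp1).trans ((add_le_add hun hun1).trans ?_)
  rw [← add_mul, ENNReal.ofReal_toReal hB.ne]
  refine mul_le_mul_left ?_ _
  set N := T.opNorm p * bmoNorm (L := L) (tildeDiff b)
  set t := ENNReal.ofReal (transformConst p q) with ht
  have ht' : ((2 * (transformConst p q).toNNReal + 3 : ℝ≥0) : ℝ≥0∞) = 2 * t + 3 := by
    push_cast
    rfl
  rw [ht']
  calc 2 * t * N + (3 * (C₁ : ℝ≥0∞) + 2 * C₂) ≤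
        2 * t * N + (3 * (C₁ : ℝ≥0∞) + 2 * C₂) + (3 * N + 2 * t * C₁ + 2 * t * C₂ + C₂) :=
        le_self_add
    _ = _ := by ring

/-! ### Duality on a martingale difference space -/

/-- Δ_I is self-adjoint for the bilinear pairing: φ is constant on children, and the average of f
over I pairs to zero with it. -/
lemma integral_D_mul_diff {I : L.Interval} (φ : L.D 𝕜 I) {f : ℝ → 𝕜}
    (hf : IntegrableOn f (I : Set ℝ)) :
    ∫ x, (φ : ℝ → 𝕜) x * (diff I f : ℝ → 𝕜) x = ∫ x in (I : Set ℝ), (φ : ℝ → 𝕜) x * f x := by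
  by_cases hI : (L.child I).Nonempty
  swap
  · have h0 : (φ : ℝ → 𝕜) = 0 := by
      funext x
      exact φ.2.1 x fun J hJ => absurd ⟨J, hJ⟩ hI
    simp [h0]
  obtain ⟨C, hC⟩ := D_bounded φ
  have hφf : IntegrableOn (fun x => (φ : ℝ → 𝕜) x * f x) (I : Set ℝ) :=
    hf.bdd_mul (D_aestronglyMeasurable φ _) (Filter.Eventually.of_forall hC)
  set c := ⨍ x in (I : Set ℝ), f x with hc
  have hφi : IntegrableOn (fun x => (φ : ℝ → 𝕜) x * c) (I : Set ℝ) :=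
    ((D_integrable φ).mul_const c).integrableOn
  have hφd : IntegrableOn (fun x => (φ : ℝ → 𝕜) x * (diff I f : ℝ → 𝕜) x) (I : Set ℝ) :=
    (integrable_mul I φ (diff I f)).integrableOn
  rw [← setIntegral_eq_integral_of_forall_compl_eq_zero (s := (I : Set ℝ)) fun y hy => by
      rw [D_apply_of_notMem _ hy, zero_mul]]
  have h0 : ∫ x in (I : Set ℝ), (φ : ℝ → 𝕜) x * c = 0 := by
    rw [integral_mul_const, D_setIntegral_eq_zero φ Subset.rfl, zero_mul]
  have h1 : ∫ x in (I : Set ℝ), ((φ : ℝ → 𝕜) x * (diff I f : ℝ → 𝕜) x + (φ : ℝ → 𝕜) x * c) =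
      ∑ K ∈ (finite_child I).toFinset,
        ∫ x in (K : Set ℝ), ((φ : ℝ → 𝕜) x * (diff I f : ℝ → 𝕜) x + (φ : ℝ → 𝕜) x * c) :=
    setIntegral_eq_sum_child hI (hφd.add hφi)
  rw [← add_zero (∫ x in (I : Set ℝ), (φ : ℝ → 𝕜) x * (diff I f : ℝ → 𝕜) x), ← h0,
    ← integral_add hφd hφi, h1, setIntegral_eq_sum_child hI hφf]
  refine Finset.sum_congr rfl fun K hK => ?_
  have hK' := (finite_child I).mem_toFinset.1 hK
  obtain ⟨z, hz⟩ := K.nonempty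
  have hφK : ∀ x ∈ (K : Set ℝ), (φ : ℝ → 𝕜) x = (φ : ℝ → 𝕜) z := fun x hx =>
    φ.2.2.1 K hK' x hx z hz
  have hA : ∫ x in (K : Set ℝ), ((φ : ℝ → 𝕜) x * (diff I f : ℝ → 𝕜) x + (φ : ℝ → 𝕜) x * c) =
      ∫ _ in (K : Set ℝ), (φ : ℝ → 𝕜) z * ⨍ y in (K : Set ℝ), f y :=
    setIntegral_congr_fun K.measurableSet fun x hx => by
      simp only [hφK x hx, diff_apply hf hK' hx]; ring
  have hB : ∫ x in (K : Set ℝ), (φ : ℝ → 𝕜) x * f x =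
      ∫ x in (K : Set ℝ), (φ : ℝ → 𝕜) z * f x :=
    setIntegral_congr_fun K.measurableSet fun x hx => by simp only [hφK x hx]
  have hC : ∫ x in (K : Set ℝ), (φ : ℝ → 𝕜) z * f x =
      (φ : ℝ → 𝕜) z * ((volume.real (K : Set ℝ) : 𝕜) * ⨍ x in (K : Set ℝ), f x) := by
    rw [integral_const_mul]
    exact congrArg _ (setIntegral_eq_mul_average K f)
  rw [hA, hB, hC, setIntegral_const, RCLike.real_smul_eq_coe_mul]
  ring

/-- The usual extremal function ψ is a step function on the children but need not have mean zero.
Testing with Δ_I ψ gives the same pairing and costs the factor 2. -/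
lemma eLpNorm_le_of_forall_integral_mul_le (hpq : p.HolderConjugate q) {I : L.Interval}
    (φ : L.D 𝕜 I) {X : ℝ≥0∞} (h : ∀ k : L.D 𝕜 I, ‖∫ x, (φ : ℝ → 𝕜) x * (k : ℝ → 𝕜) x‖ₑ ≤
      X * eLpNorm (k : ℝ → 𝕜) (ENNReal.ofReal p) L.measure) :
    eLpNorm (φ : ℝ → 𝕜) (ENNReal.ofReal q) L.measure ≤ 2 * X := by
  set ψ : ℝ → 𝕜 := fun x => (starRingEnd 𝕜) ((φ : ℝ → 𝕜) x) *
    ((‖(φ : ℝ → 𝕜) x‖ ^ (q - 2) : ℝ) : 𝕜) with hψ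
  have hψ0 : ∀ x, (∀ J ∈ L.child I, x ∉ (J : Set ℝ)) → ψ x = 0 := fun x hx => by
    simp [hψ, φ.2.1 x hx]
  have hψc : ∀ J ∈ L.child I, ∀ x ∈ (J : Set ℝ), ∀ y ∈ (J : Set ℝ), ψ x = ψ y :=
    fun J hJ x hx y hy => by simp only [hψ, φ.2.2.1 J hJ x hx y hy]
  have hψi : Integrable ψ := integrable_of_step hψ0 hψc
  have hq1 := hpq.symm.lt
  have hq0 := hpq.symm.pos
  have hmul : ∀ x, (φ : ℝ → 𝕜) x * ψ x = ((‖(φ : ℝ → 𝕜) x‖ ^ q : ℝ) : 𝕜) := by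
    intro x
    simp only [hψ]
    rw [← mul_assoc, RCLike.mul_conj]
    rcases eq_or_ne (‖(φ : ℝ → 𝕜) x‖) 0 with h0 | h0
    · rw [h0, Real.zero_rpow hq0.ne']; simp
    · have hpos : 0 < ‖(φ : ℝ → 𝕜) x‖ := lt_of_le_of_ne (norm_nonneg _) (Ne.symm h0)
      rw [← RCLike.ofReal_pow, ← RCLike.ofReal_mul, ← Real.rpow_natCast, ← Real.rpow_add hpos]
      norm_num
  have hnorm : ∀ x, ‖ψ x‖ₑ ^ p = ‖(φ : ℝ → 𝕜) x‖ₑ ^ q := by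
    intro x
    have h1 : ‖ψ x‖ ^ p = ‖(φ : ℝ → 𝕜) x‖ ^ q := by
      simp only [hψ]
      rw [norm_mul, RCLike.norm_conj, RCLike.norm_ofReal, abs_of_nonneg (by positivity)]
      rcases eq_or_ne (‖(φ : ℝ → 𝕜) x‖) 0 with h0 | h0
      · rw [h0, zero_mul, Real.zero_rpow hpq.pos.ne', Real.zero_rpow hq0.ne']
      · have hpos : 0 < ‖(φ : ℝ → 𝕜) x‖ := lt_of_le_of_ne (norm_nonneg _) (Ne.symm h0)
        conv_lhs => rw [← Real.rpow_one ‖(φ : ℝ → 𝕜) x‖, Real.rpow_one, ← Real.rpow_one_add' hpos.le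
          (by linarith), ← Real.rpow_mul hpos.le]
        congr 1
        have := hpq.symm.sub_one_mul_conj
        linarith
    rw [← ofReal_norm, ← ofReal_norm, ENNReal.ofReal_rpow_of_nonneg (norm_nonneg _) hpq.nonneg,
      ENNReal.ofReal_rpow_of_nonneg (norm_nonneg _) hq0.le, h1]
  set Y := ∫⁻ x in (I : Set ℝ), ‖(φ : ℝ → 𝕜) x‖ₑ ^ q with hY
  have hφn : eLpNorm (φ : ℝ → 𝕜) (ENNReal.ofReal q) L.measure = Y ^ (1 / q) := by
    rw [← eLpNorm_D_restrict, eLpNorm_eq_lintegral_rpow_enorm_toReal (by simpa using hq0)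
      ENNReal.ofReal_ne_top, ENNReal.toReal_ofReal hq0.le]
  have hψn : eLpNorm ψ (ENNReal.ofReal p) (volume.restrict (I : Set ℝ)) = Y ^ (1 / p) := by
    rw [eLpNorm_eq_lintegral_rpow_enorm_toReal (by simpa using hpq.pos)
      ENNReal.ofReal_ne_top, ENNReal.toReal_ofReal hpq.nonneg]
    simp only [hnorm]
    rfl
  have hYt : Y ≠ ∞ := by
    intro hY'
    have h2 := ((finSums_props (D_mem_finSums φ)).2 (ENNReal.ofReal q)).2
    rw [hφn, hY', ENNReal.top_rpow_of_pos (by positivity)] at h2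
    exact absurd h2 (lt_irrefl _)
  have hYeq : ‖∫ x in (I : Set ℝ), (φ : ℝ → 𝕜) x * ψ x‖ₑ = Y := by
    simp only [hmul]
    have hint : ∫ x in (I : Set ℝ), ((‖(φ : ℝ → 𝕜) x‖ ^ q : ℝ) : 𝕜) =
        ((∫ x in (I : Set ℝ), ‖(φ : ℝ → 𝕜) x‖ ^ q : ℝ) : 𝕜) := integral_ofReal
    rw [hint, ← ofReal_norm, RCLike.norm_ofReal,
      abs_of_nonneg (integral_nonneg fun x => by positivity),
      integral_eq_lintegral_of_nonneg_ae (Filter.Eventually.of_forall fun x => by positivity)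
      ((D_aestronglyMeasurable φ _).norm.aemeasurable.pow_const q).aestronglyMeasurable]
    have h3 : ∀ x, ENNReal.ofReal (‖(φ : ℝ → 𝕜) x‖ ^ q) = ‖(φ : ℝ → 𝕜) x‖ₑ ^ q := fun x => by
      rw [← ofReal_norm, ENNReal.ofReal_rpow_of_nonneg (norm_nonneg _) hq0.le]
    simp only [h3]
    exact ENNReal.ofReal_toReal hYt
  have h4 := h (diff I ψ)
  rw [integral_D_mul_diff φ hψi.integrableOn, hYeq] at h4
  have h5 : Y ≤ X * (2 * Y ^ (1 / p)) := by
    refine h4.trans (mul_le_mul_right ?_ _)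
    rw [← hψn]
    exact eLpNorm_diff_le hpq I hψi.integrableOn
  rw [hφn]
  rcases eq_or_ne Y 0 with hY0 | hY0
  · rw [hY0, ENNReal.zero_rpow_of_pos (by positivity)]; exact zero_le
  · have h6 : Y ^ (1 / q) * Y ^ (1 / p) = Y := by
      rw [← ENNReal.rpow_add _ _ hY0 hYt, one_div, one_div, hpq.symm.inv_add_inv_eq_one,
        ENNReal.rpow_one]
    rw [← ENNReal.mul_le_mul_iff_left (c := Y ^ (1 / p))
      (by simp [ENNReal.rpow_eq_zero_iff, hY0, hYt])
      (by simp [ENNReal.rpow_eq_top_iff, hY0, hYt]), h6]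
    refine h5.trans (le_of_eq ?_)
    ring

/-! ### Necessity of the testing condition and of the block commutator condition -/

namespace MartingaleTransform

variable {T : MartingaleTransform L 𝕜} {b : ℝ → 𝕜} {A : ℝ≥0∞}

lemma apply_D (T : MartingaleTransform L 𝕜) {I : L.Interval} (h : L.D 𝕜 I) :
    T.apply (h : ℝ → 𝕜) = (T.block I h : ℝ → 𝕜) := by
  classical
  rw [T.apply_eq_sum (F := {I}) fun J hJ => diff_coe_D_of_ne h (by simpa using hJ),
    Finset.sum_singleton, diff_coe_D]

/-- Multiplication by b compressed to D_I is a scalar plus the block of Λ_b^1; only the second part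
survives in a commutator with T_I. -/
lemma diff_mul_D (hb : L.LocIntegrable b) {I : L.Interval} (g : L.D 𝕜 I) :
    diff I (fun x => b x * (g : ℝ → 𝕜) x) =
      (⨍ x in (I : Set ℝ), b x) • g + lambdaBlock b I g := by
  have h := lambdaBlock_add_average_eq_diff (b := (g : ℝ → 𝕜)) (hb I)
  rw [diff_coe_D] at h
  have h2 : lambdaBlock (g : ℝ → 𝕜) I (diff I b) = lambdaBlock b I g := by
    rw [lambdaBlock, lambdaBlock, diff_coe_D]
    exact diff_congr fun x _ => mul_comm _ _
  rw [h2] at h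
  rw [← h]
  exact diff_congr fun x _ => mul_comm _ _

/-- Projecting [M_b, T] h to D_I gives the block commutator, the scalar parts cancelling. This works
for every I, with or without a parent, and the factor 2 is the norm bound for Δ_I. -/
lemma eLpNorm_lambda_commutator_le (hpq : p.HolderConjugate q) (hb : L.LocIntegrable b)
    (hA : T.CommutatorBoundedBy b p A) {I : L.Interval} (h : L.D 𝕜 I) :
    eLpNorm ((lambdaBlock b I (T.block I h) - T.block I (lambdaBlock b I h) : L.D 𝕜 I) : ℝ → 𝕜)
      (ENNReal.ofReal p) L.measure ≤ 2 * A * eLpNorm (h : ℝ → 𝕜) (ENNReal.ofReal p) L.measure := by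
  obtain ⟨u, hu, hw⟩ := hA h (D_mem_finSums h)
  rw [T.apply_D] at hw
  have hi1 := locIntegrable_mul_finSums hb (D_mem_finSums (T.block I h)) I
  have h1 : lambdaBlock b I (T.block I h) - T.block I (lambdaBlock b I h) =
      diff I (fun x => b x * (T.block I h : ℝ → 𝕜) x - u x) := by
    have h2 : diff I (fun x => b x * (T.block I h : ℝ → 𝕜) x - u x) =
        diff I (fun x => b x * (T.block I h : ℝ → 𝕜) x) - diff I u :=
      diff_sub hi1 (hu.locIntegrable I)
    rw [h2, hu.diff_eq, diff_mul_D hb, diff_mul_D hb, map_add, map_smul]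
    abel
  rw [h1]
  refine (eLpNorm_diff_le hpq I (hi1.sub (hu.locIntegrable I))).trans ?_
  rw [mul_assoc]
  exact mul_le_mul_right ((eLpNorm_restrict_le I.measurableSet I.subset_carrier _ _).trans hw) _

/-- On f = 1_I one has T f = 0, and projecting the commutator to D_I leaves -T_I Δ_I b. For k in D_I
the term T(b k) has integral zero over the limit interval I, so the integral of the commutator is
the pairing of Δ_I b with T_I k; duality on D_I gives the adjoint bound. -/
lemma testingCondition_of_commutatorBoundedBy (hpq : p.HolderConjugate q) (hb : L.LocIntegrable b)
    {A : ℝ≥0} (hA : T.CommutatorBoundedBy b p A) : T.TestingCondition b p q (2 * A) := by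
  intro I hI
  refine ⟨?_, ?_⟩
  · have hf := indicator_mem_finSums hI (1 : 𝕜)
    obtain ⟨u, hu, hw⟩ := hA _ hf
    have h0 : T.apply ((I : Set ℝ).indicator fun _ => (1 : 𝕜)) = 0 := by
      rw [T.apply_eq_sum (F := ∅) fun J _ => diff_indicator_of_mem_finLimitIntervals J hI 1,
        Finset.sum_empty]
    have h1 : T.block I (diff I b) = diff I u := by
      rw [hu.diff_eq]
      congr 1
      exact diff_congr fun x hx => by simp [hx]
    have h2 : eLpNorm u (ENNReal.ofReal p) L.measure ≤ A * volume (I : Set ℝ) ^ (1 / p) := by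
      rw [eLpNorm_indicator_const I.measurableSet (by simpa using hpq.pos) ENNReal.ofReal_ne_top,
        measure_apply I.measurableSet I.subset_carrier, ENNReal.toReal_ofReal hpq.nonneg, enorm_one,
        one_mul, h0] at hw
      refine le_trans (le_of_eq ?_) hw
      rw [← eLpNorm_neg]
      congr 1
      funext x
      simp
    rw [h1]
    refine (eLpNorm_diff_le hpq I (hu.locIntegrable I)).trans ?_
    push_cast
    rw [mul_assoc]
    exact mul_le_mul_right ((eLpNorm_restrict_le I.measurableSet I.subset_carrier _ _).trans h2) _
  · push_cast
    rw [mul_assoc]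
    refine eLpNorm_le_of_forall_integral_mul_le hpq _ fun k => ?_
    rw [T.integral_adjoint_mul]
    obtain ⟨u, hu, hw⟩ := hA k (D_mem_finSums k)
    rw [T.apply_D] at hw
    have hi1 := locIntegrable_mul_finSums hb (D_mem_finSums (T.block I k)) I
    have h1 : ∫ x, (diff I b : ℝ → 𝕜) x * (T.block I k : ℝ → 𝕜) x =
        ∫ x in (I : Set ℝ), (b x * (T.block I k : ℝ → 𝕜) x - u x) := by
      rw [integral_sub hi1 (hu.locIntegrable I), hu.integral_eq I hI, sub_zero]
      simp only [mul_comm _ ((T.block I k : ℝ → 𝕜) _)]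
      exact integral_D_mul_diff _ (hb I)
    rw [h1]
    refine (enorm_setIntegral_le hpq _
      (hi1.sub (hu.locIntegrable I)).aestronglyMeasurable).trans ?_
    refine (mul_le_mul_left ((eLpNorm_restrict_le I.measurableSet I.subset_carrier _ _).trans hw)
      _).trans (le_of_eq ?_)
    ring

end MartingaleTransform

/-! ### Step functions on an interval -/

namespace Atom

variable {m : ℤ} {n : ℕ} {K : Set ℝ}

lemma setIntegral_eq_sum [Fintype (L.Atom m n K)] (hK : K ∈ L.gen m) {f : ℝ → 𝕜}
    (hf : IntegrableOn f K) : ∫ x in K, f x = ∑ J : L.Atom m n K, ∫ x in J.1, f x := by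
  conv_lhs => rw [← iUnion_eq (n := n) hK]
  exact integral_iUnion_fintype (fun J => J.interval.measurableSet) pairwise_disjoint
    fun J => hf.mono_set J.2.2

lemma eLpNorm_cellAvg_le (hpq : p.HolderConjugate q) (hK : K ∈ L.gen m) (n : ℕ) {f : ℝ → 𝕜}
    (hf : IntegrableOn f K) :
    eLpNorm (L.cellAvg (m + n) f) (ENNReal.ofReal p) (volume.restrict K) ≤
      eLpNorm f (ENNReal.ofReal p) (volume.restrict K) := by
  have := finite_atom hK n
  have := Fintype.ofFinite (L.Atom m n K)
  rw [← one_mul (eLpNorm f _ _), eLpNorm_le_mul_iff_lintegral hpq.pos, ENNReal.one_rpow, one_mul,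
    lintegral_eq (n := n) hK, lintegral_eq (n := n) hK]
  refine Finset.sum_le_sum fun J _ => ?_
  have h1 := eLpNorm_average_le hpq J.interval (hf.mono_set J.2.2)
  rw [← one_mul (eLpNorm f _ _), eLpNorm_le_mul_iff_lintegral hpq.pos, ENNReal.one_rpow,
    one_mul] at h1
  refine le_trans (le_of_eq ?_) h1
  refine setLIntegral_congr_fun J.interval.measurableSet fun x hx => ?_
  have hx' : x ∈ J.1 := hx
  simp only [cellAvg, cell_eq J.2.1 hx']
  rfl

/-- Each atom indicator minus its average over K telescopes through ancestors. The subtracted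
multiples of 1_K cancel because φ has mean zero. -/
lemma indicator_mem_finSums (hK : K ∈ L.gen m) (n : ℕ) {φ : ℝ → 𝕜}
    (hφ : ∀ x ∈ K, ∀ y ∈ L.cell (m + n) x, φ y = φ x) (hi : IntegrableOn φ K)
    (h0 : ∫ x in K, φ x = 0) : K.indicator φ ∈ L.finSums 𝕜 := by
  classical
  have := finite_atom hK n
  have := Fintype.ofFinite (L.Atom m n K)
  have hφJ : ∀ J : L.Atom m n K, ∀ x ∈ J.1, φ x = φ J.pt := fun J x hx =>
    hφ _ (J.2.2 J.pt_mem) _ (by rw [J.cell_pt]; exact hx)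
  have hsum : ∑ J : L.Atom m n K, φ J.pt * (volume.real J.1 : 𝕜) = 0 := by
    rw [← h0, setIntegral_eq_sum (n := n) hK hi]
    refine Finset.sum_congr rfl fun J _ => ?_
    have h1 : ∫ x in J.1, φ x = ∫ _ in J.1, φ J.pt :=
      setIntegral_congr_fun J.interval.measurableSet (hφJ J)
    rw [h1, setIntegral_const, RCLike.real_smul_eq_coe_mul, mul_comm]
  have h : K.indicator φ = ∑ J : L.Atom m n K, φ J.pt • ((J.1.indicator fun _ => (1 : 𝕜)) -
      ((volume.real J.1 : 𝕜) / (volume.real K : 𝕜)) • K.indicator fun _ => (1 : 𝕜)) := by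
    have h2 : ∑ J : L.Atom m n K, φ J.pt • (((volume.real J.1 : 𝕜) / (volume.real K : 𝕜)) •
        K.indicator fun _ => (1 : 𝕜)) = 0 := by
      simp only [smul_smul, ← Finset.sum_smul, ← mul_div_assoc, ← Finset.sum_div, hsum, zero_div,
        zero_smul]
    simp only [smul_sub, Finset.sum_sub_distrib, h2, sub_zero]
    funext x
    rw [Finset.sum_apply]
    by_cases hx : x ∈ K
    · have hx' := hx
      rw [← iUnion_eq (n := n) hK] at hx'
      obtain ⟨J, hJ⟩ := mem_iUnion.1 hx'
      rw [Finset.sum_eq_single J, indicator_of_mem hx, Pi.smul_apply, indicator_of_mem hJ,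
        hφJ J x hJ, smul_eq_mul, mul_one]
      · intro J' _ hne
        rw [Pi.smul_apply, indicator_of_notMem, smul_zero]
        exact fun h => disjoint_left.1 (pairwise_disjoint hne) h hJ
      · simp
    · rw [indicator_of_notMem hx, Finset.sum_eq_zero]
      intro J _
      rw [Pi.smul_apply, indicator_of_notMem, smul_zero]
      exact fun h => hx (J.2.2 h)
  rw [h]
  refine Submodule.sum_mem _ fun J _ => Submodule.smul_mem _ _ ?_
  have h3 := cell_indicator_sub_mem_finSums (𝕜 := 𝕜) (m + n) J.pt_mem_carrier n
  rw [J.cell_pt, add_sub_cancel_right, cell_eq hK (J.2.2 J.pt_mem)] at h3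
  exact h3

lemma memLp_cellAvg (hK : K ∈ L.gen m) (n : ℕ) (f : ℝ → 𝕜) (p : ℝ≥0∞) :
    MemLp (L.cellAvg (m + n) f) p (volume.restrict K) := by
  set I : L.Interval := ⟨K, m, hK⟩
  have h1 := (cellSpan_induction_props (indicator_cellAvg_mem_cellSpan hK n f)).2 p
  rw [memLp_indicator_iff_restrict I.measurableSet,
    restrict_measure I.measurableSet I.subset_carrier] at h1
  exact h1

lemma setIntegral_cellAvg_mul (hK : K ∈ L.gen m) (n : ℕ) {f φ : ℝ → 𝕜}
    (hφ : ∀ x ∈ K, ∀ y ∈ L.cell (m + n) x, φ y = φ x)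
    (hfφ : IntegrableOn (fun x => f x * φ x) K)
    (hi : IntegrableOn (fun x => L.cellAvg (m + n) f x * φ x) K) :
    ∫ x in K, L.cellAvg (m + n) f x * φ x = ∫ x in K, f x * φ x := by
  have := finite_atom hK n
  have := Fintype.ofFinite (L.Atom m n K)
  rw [setIntegral_eq_sum (n := n) hK hi, setIntegral_eq_sum (n := n) hK hfφ]
  refine Finset.sum_congr rfl fun J _ => ?_
  have hφJ : ∀ x ∈ J.1, φ x = φ J.pt := fun x hx =>
    hφ _ (J.2.2 J.pt_mem) _ (by rw [J.cell_pt]; exact hx)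
  have h1 : ∫ x in J.1, L.cellAvg (m + n) f x * φ x = ∫ _ in J.1, (⨍ y in J.1, f y) * φ J.pt :=
    setIntegral_congr_fun J.interval.measurableSet fun x hx => by
      have hx' : x ∈ J.1 := hx
      simp only [hφJ x hx', cellAvg, cell_eq J.2.1 hx']
  have h2 : ∫ x in J.1, f x * φ x = ∫ x in J.1, f x * φ J.pt :=
    setIntegral_congr_fun J.interval.measurableSet fun x hx => by
      have hx' : x ∈ J.1 := hx
      simp only [hφJ x hx']
  have h3 : ∫ x in J.1, f x = (volume.real J.1 : 𝕜) * ⨍ x in J.1, f x :=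
    setIntegral_eq_mul_average J.interval f
  rw [h1, h2, setIntegral_const, RCLike.real_smul_eq_coe_mul, integral_mul_const, h3]
  ring

end Atom

namespace MartingaleTransform

variable {T : MartingaleTransform L 𝕜} {b : ℝ → 𝕜} {A : ℝ≥0∞}

/-- A function of mean zero supported in J has differences only inside J: a larger interval sees it
through integrals over children, all of which vanish. Hence T preserves such supports. -/
lemma diff_indicator_eq_zero {J : L.Interval} {φ : ℝ → 𝕜} (hi : IntegrableOn φ (J : Set ℝ))
    (h0 : ∫ x in (J : Set ℝ), φ x = 0) {K : L.Interval} (hK : ¬ (K : Set ℝ) ⊆ J) :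
    diff K ((J : Set ℝ).indicator φ) = 0 := by
  have hi' : Integrable ((J : Set ℝ).indicator φ) := (integrable_indicator_iff J.measurableSet).2 hi
  rcases K.eq_or_subset_child_or_disjoint_or_subset J with h | ⟨M, hM, hJM⟩ | ⟨M, hM, hJM⟩ | h
  · exact absurd (h ▸ Subset.rfl) hK
  · rw [diff_eq_of_setIntegral (g := fun _ => 0) hi'.integrableOn integrableOn_zero
      fun M' hM' => ?_,
      diff_of_const fun _ _ => rfl]
    rw [setIntegral_indicator J.measurableSet, integral_zero]
    rcases eq_or_ne M' M with rfl | hne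
    · rw [inter_eq_self_of_subset_right hJM, h0]
    · have h1 : (M' : Set ℝ) ∩ J = ∅ := by
        rw [← disjoint_iff_inter_eq_empty, disjoint_left]
        exact fun x hx hx' => hne (child_eq_of_mem hM' hM hx (hJM hx'))
      rw [h1, setIntegral_empty]
  · exact absurd (hJM.trans (child_subset hM)) hK
  · exact diff_of_const (c := 0) fun x hx => indicator_of_notMem (disjoint_right.1 h hx) _

lemma apply_indicator_eq_zero {J : L.Interval} {φ : ℝ → 𝕜} (hi : IntegrableOn φ (J : Set ℝ))
    (h0 : ∫ x in (J : Set ℝ), φ x = 0) (hf : (J : Set ℝ).indicator φ ∈ L.finSums 𝕜) {x : ℝ}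
    (hx : x ∉ (J : Set ℝ)) : T.apply ((J : Set ℝ).indicator φ) x = 0 := by
  obtain ⟨F, G, c, h⟩ := exists_isFinDecomp hf
  rw [T.apply_eq_sum h.diff_eq_zero, Finset.sum_apply]
  refine Finset.sum_eq_zero fun K _ => ?_
  by_cases hK : (K : Set ℝ) ⊆ J
  · exact D_apply_of_notMem _ fun h => hx (hK h)
  · rw [diff_indicator_eq_zero hi h0 hK, map_zero]; rfl

/-! ### Oscillation on a non-degenerate interval -/

lemma eLpNorm_indicator_D (hp : 0 < p) {I J : L.Interval} (hJ : J ∈ L.child I) (h : L.D 𝕜 I)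
    {z : ℝ} (hz : z ∈ (J : Set ℝ)) :
    eLpNorm ((J : Set ℝ).indicator (h : ℝ → 𝕜)) (ENNReal.ofReal p) L.measure =
      ‖(h : ℝ → 𝕜) z‖ₑ * volume (J : Set ℝ) ^ (1 / p) := by
  have h1 : (J : Set ℝ).indicator (h : ℝ → 𝕜) =
      (J : Set ℝ).indicator fun _ => (h : ℝ → 𝕜) z := by
    funext x
    by_cases hx : x ∈ (J : Set ℝ)
    · rw [indicator_of_mem hx, indicator_of_mem hx]
      exact h.2.2.1 J hJ x hx z hz
    · rw [indicator_of_notMem hx, indicator_of_notMem hx]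
  rw [h1, eLpNorm_indicator_const J.measurableSet (by simpa using hp) ENNReal.ofReal_ne_top,
    measure_apply J.measurableSet J.subset_carrier, ENNReal.toReal_ofReal hp.le]

lemma enorm_mul_rpow_le (hp : 0 < p) {I J : L.Interval} (hJ : J ∈ L.child I) (h : L.D 𝕜 I)
    {z : ℝ} (hz : z ∈ (J : Set ℝ)) : ‖(h : ℝ → 𝕜) z‖ₑ * volume (J : Set ℝ) ^ (1 / p) ≤
      eLpNorm (h : ℝ → 𝕜) (ENNReal.ofReal p) L.measure := by
  rw [← eLpNorm_indicator_D hp hJ h hz]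
  exact eLpNorm_indicator_le _

/-- Where the argument vanishes on J, all its differences inside J vanish, hence those of the image,
so the averages of the image do not change inside J. -/
lemma IsImage.cellAvg_eq {g u : ℝ → 𝕜} (hu : T.IsImage g u) {J : L.Interval}
    (hg : ∀ x ∈ (J : Set ℝ), g x = 0) {m : ℤ} (hJ : (J : Set ℝ) ∈ L.gen m) (n : ℕ) {x : ℝ}
    (hx : x ∈ (J : Set ℝ)) : L.cellAvg (m + n) u x = L.cellAvg m u x := by
  have hxc := J.mem_carrier hx
  induction n with
  | zero => simp
  | succ n ih =>
    rw [← ih, ← sub_eq_zero, Nat.cast_succ, ← add_assoc]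
    by_cases hne : L.cell (m + n + 1) x = L.cell (m + n) x
    · exact cellAvg_succ_sub_eq_zero hne
    · rw [← diff_apply_cell hu.locIntegrable hxc hne, hu.diff_eq, diff_of_const (c := 0), map_zero]
      · rfl
      · intro y hy
        have h1 : L.cell (m + n) x ⊆ J := by
          rw [← cell_eq hJ hx]; exact cell_subset (by omega) x
        exact hg y (h1 hy)

/-- On J the commutator at h equals t b - u, where t is the value of T_I h and u = T(b h) has
constant averages inside J. Taking differences of averages isolates t times the oscillation of b;
two contractions give the factor 2. -/
lemma mul_eLpNorm_oscillation_le (hpq : p.HolderConjugate q) (hb : L.LocIntegrable b)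
    (hA : T.CommutatorBoundedBy b p A) {ε K : ℝ≥0} {I J : L.Interval} (hJ : J ∈ L.child I)
    (hN : T.NonDegenerate p ε K I J) {m : ℤ} (hJm : (J : Set ℝ) ∈ L.gen m) (n : ℕ) :
    ε * eLpNorm (fun x => L.cellAvg (m + n) b x - L.cellAvg m b x) (ENNReal.ofReal p)
      (volume.restrict (J : Set ℝ)) ≤ 2 * A * volume (J : Set ℝ) ^ (1 / p) := by
  obtain ⟨h, hh1, hh0, hhε, -⟩ := hN
  obtain ⟨u, hu, hw⟩ := hA h (D_mem_finSums h)
  obtain ⟨z, hz⟩ := J.nonempty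
  rw [eLpNorm_indicator_D hpq.pos hJ _ hz] at hhε
  rw [hh1, mul_one, T.apply_D] at hw
  set t := (T.block I h : ℝ → 𝕜) z with ht
  set w : ℝ → 𝕜 := fun x => b x * (T.block I h : ℝ → 𝕜) x - u x with hwdef
  have hwJ : ∀ x ∈ (J : Set ℝ), w x = (t • b - u) x := fun x hx => by
    simp only [hwdef, Pi.sub_apply, Pi.smul_apply, smul_eq_mul,
      (T.block I h).2.2.1 J hJ x hx z hz, ← ht]
    ring
  have hwi : IntegrableOn w (J : Set ℝ) :=
    (locIntegrable_mul_finSums hb (D_mem_finSums (T.block I h)) J).sub (hu.locIntegrable J)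
  have havg : ∀ (k : ℕ), ∀ x ∈ (J : Set ℝ),
      L.cellAvg (m + k) w x = t * L.cellAvg (m + k) b x - L.cellAvg m u x := by
    intro k x hx
    have hxc := J.mem_carrier hx
    have hsub : L.cell (m + k) x ⊆ J := by
      rw [← cell_eq hJm hx]; exact cell_subset (by omega) x
    have h1 : L.cellAvg (m + k) w x = L.cellAvg (m + k) (t • b - u) x :=
      setAverage_congr_fun (measurableSet_cell _ _)
        (Filter.Eventually.of_forall fun y hy => hwJ y (hsub hy))
    rw [h1, cellAvg_sub (((hb J).mono_set hsub).smul t) ((hu.locIntegrable J).mono_set hsub),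
      hu.cellAvg_eq (fun y hy => by rw [hh0 y hy, mul_zero]) hJm k hx]
    congr 1
    simp only [cellAvg, Pi.smul_apply, smul_eq_mul]
    rw [setAverage_eq, setAverage_eq, integral_const_mul, mul_smul_comm]
  have hosc : ‖t‖ₑ * eLpNorm (fun x => L.cellAvg (m + n) b x - L.cellAvg m b x)
      (ENNReal.ofReal p) (volume.restrict (J : Set ℝ)) ≤ 2 * A := by
    have h1 : ‖t‖ₑ * eLpNorm (fun x => L.cellAvg (m + n) b x - L.cellAvg m b x)
        (ENNReal.ofReal p) (volume.restrict (J : Set ℝ)) =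
        eLpNorm (L.cellAvg (m + n) w - L.cellAvg (m + (0 : ℕ)) w) (ENNReal.ofReal p)
          (volume.restrict (J : Set ℝ)) := by
      rw [← eLpNorm_const_smul]
      refine eLpNorm_congr_ae ((ae_restrict_iff' J.measurableSet).2
        (Filter.Eventually.of_forall fun x hx => ?_))
      rw [Pi.sub_apply, havg n x hx, havg 0 x hx, Pi.smul_apply, smul_eq_mul, Nat.cast_zero,
        add_zero]
      ring
    have h2 := (eLpNorm_restrict_le J.measurableSet J.subset_carrier _ _).trans hw
    rw [h1, two_mul]
    refine (eLpNorm_sub_le (aestronglyMeasurable_cellAvg hJm n w)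
      (aestronglyMeasurable_cellAvg hJm 0 w) (one_le_ofReal_of_one_le hpq.lt.le)).trans ?_
    exact add_le_add ((Atom.eLpNorm_cellAvg_le hpq hJm n hwi).trans h2)
      ((Atom.eLpNorm_cellAvg_le hpq hJm 0 hwi).trans h2)
  refine (mul_le_mul_left hhε _).trans ?_
  rw [mul_right_comm]
  exact mul_le_mul_left hosc _

/-- For f supported in J with mean zero, T f also lives on J, where h vanishes. Pairing the
commutator with h leaves only the term T(b f), which becomes minus the constant value of T_I^* h on
J times the integral of b f. -/
lemma enorm_mul_setIntegral_le_of_adjoint (hpq : p.HolderConjugate q) (hb : L.LocIntegrable b)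
    (hA : T.CommutatorBoundedBy b p A) {I J : L.Interval} (hJ : J ∈ L.child I) (h : L.D 𝕜 I)
    (hh1 : eLpNorm (h : ℝ → 𝕜) (ENNReal.ofReal q) L.measure = 1)
    (hh0 : ∀ x ∈ (J : Set ℝ), (h : ℝ → 𝕜) x = 0) {z : ℝ} (hz : z ∈ (J : Set ℝ)) {φ : ℝ → 𝕜}
    (hi : IntegrableOn φ (J : Set ℝ)) (h0 : ∫ x in (J : Set ℝ), φ x = 0)
    (hf : (J : Set ℝ).indicator φ ∈ L.finSums 𝕜) :
    ‖(T.adjoint.block I h : ℝ → 𝕜) z‖ₑ * ‖∫ x in (J : Set ℝ), b x * φ x‖ₑ ≤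
      A * eLpNorm φ (ENNReal.ofReal p) (volume.restrict (J : Set ℝ)) := by
  obtain ⟨u, hu, hw⟩ := hA _ hf
  set f := (J : Set ℝ).indicator φ with hfdef
  set w : ℝ → 𝕜 := fun x => b x * T.apply f x - u x with hwdef
  have hbf := locIntegrable_mul_finSums hb hf
  have hfn : eLpNorm f (ENNReal.ofReal p) L.measure =
      eLpNorm φ (ENNReal.ofReal p) (volume.restrict (J : Set ℝ)) := by
    rw [hfdef, eLpNorm_indicator_eq_eLpNorm_restrict J.measurableSet,
      restrict_measure J.measurableSet J.subset_carrier]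
  have hTf : ∀ x, (h : ℝ → 𝕜) x * w x = -((h : ℝ → 𝕜) x * u x) := by
    intro x
    by_cases hx : x ∈ (J : Set ℝ)
    · rw [hh0 x hx, zero_mul, zero_mul, neg_zero]
    · simp only [hwdef, hfdef, apply_indicator_eq_zero hi h0 hf hx]; ring
  have h1 : ∫ x in (I : Set ℝ), (h : ℝ → 𝕜) x * w x =
      -((T.adjoint.block I h : ℝ → 𝕜) z * ∫ x in (J : Set ℝ), b x * φ x) := by
    simp only [hTf]
    rw [integral_neg, ← integral_D_mul_diff h (hu.locIntegrable I), hu.diff_eq,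
      ← T.integral_adjoint_mul, integral_D_mul_diff _ (hbf I), ← integral_const_mul]
    congr 1
    have h2 : ∫ x in (I : Set ℝ), (T.adjoint.block I h : ℝ → 𝕜) x * (b x * f x) =
        ∫ x in (J : Set ℝ), (T.adjoint.block I h : ℝ → 𝕜) x * (b x * f x) :=
      setIntegral_eq_of_subset_of_forall_sdiff_eq_zero I.measurableSet (child_subset hJ)
        fun x hx => by rw [hfdef, indicator_of_notMem hx.2, mul_zero, mul_zero]
    rw [h2]
    refine setIntegral_congr_fun J.measurableSet fun x hx => ?_
    rw [hfdef, indicator_of_mem hx, (T.adjoint.block I h).2.2.1 J hJ x hx z hz]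
  rw [← enorm_mul, ← enorm_neg, ← h1]
  have hwi : IntegrableOn w (I : Set ℝ) :=
    (locIntegrable_mul_finSums hb (T.apply_mem_finSums hf) I).sub (hu.locIntegrable I)
  refine (enorm_integral_mul_le hpq.symm (D_aestronglyMeasurable h _)
    hwi.aestronglyMeasurable).trans ?_
  rw [eLpNorm_D_restrict, hh1, one_mul, ← hfn]
  exact (eLpNorm_restrict_le I.measurableSet I.subset_carrier _ _).trans hw

/-- The test function is the conjugate of the oscillation d itself, so the pairing returns ‖d‖²
against one factor ‖d‖. The norm of the test function and the norm to be bounded coincide, which is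
the point of p = 2. -/
lemma mul_eLpNorm_oscillation_le_of_adjoint (hb : L.LocIntegrable b)
    (hA : T.CommutatorBoundedBy b 2 A) {ε K : ℝ≥0} {I J : L.Interval} (hJ : J ∈ L.child I)
    (hN : T.adjoint.NonDegenerate 2 ε K I J) {m : ℤ} (hJm : (J : Set ℝ) ∈ L.gen m) (n : ℕ) :
    ε * eLpNorm (fun x => L.cellAvg (m + n) b x - L.cellAvg m b x) (ENNReal.ofReal 2)
      (volume.restrict (J : Set ℝ)) ≤ A * volume (J : Set ℝ) ^ (1 / 2 : ℝ) := by
  have hpq : (2 : ℝ).HolderConjugate 2 := .two_two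
  obtain ⟨h, hh1, hh0, hhε, -⟩ := hN
  obtain ⟨z, hz⟩ := J.nonempty
  rw [eLpNorm_indicator_D two_pos hJ _ hz] at hhε
  set t := (T.adjoint.block I h : ℝ → 𝕜) z with ht
  set d : ℝ → 𝕜 := fun x => L.cellAvg (m + n) b x - L.cellAvg m b x with hd
  set φ : ℝ → 𝕜 := fun x => (starRingEnd 𝕜) (d x) with hφ
  have hcell : ∀ x ∈ (J : Set ℝ), L.cellAvg m b x = ⨍ y in (J : Set ℝ), b y := fun x hx => by
    rw [cellAvg, cell_eq hJm hx]
  have hdc : ∀ x ∈ (J : Set ℝ), ∀ y ∈ L.cell (m + n) x, d y = d x := fun x hx y hy => by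
    have h1 : L.cellAvg m b y = L.cellAvg m b x :=
      cellAvg_eq_of_mem (cell_subset (by omega) x hy) b
    simp only [hd, h1, cellAvg_eq_of_mem hy b]
  have hm0 : ∀ p, MemLp (L.cellAvg m b) p (volume.restrict (J : Set ℝ)) := fun p => by
    simpa using Atom.memLp_cellAvg hJm 0 b p
  have hdL : ∀ p, MemLp d p (volume.restrict (J : Set ℝ)) := fun p =>
    (Atom.memLp_cellAvg hJm n b p).sub (hm0 p)
  have hφL : ∀ p, MemLp φ p (volume.restrict (J : Set ℝ)) := fun p => (hdL p).star
  have hint : ∀ {g : ℝ → 𝕜}, (∀ p, MemLp g p (volume.restrict (J : Set ℝ))) →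
      IntegrableOn g (J : Set ℝ) := fun h => memLp_one_iff_integrable.1 (h 1)
  have hd0 : ∫ x in (J : Set ℝ), d x = 0 := by
    have h1 := Atom.setIntegral_cellAvg_mul (φ := fun _ => (1 : 𝕜)) hJm n (f := b)
      (fun _ _ _ _ => rfl) (by simpa using hb J)
      (by simpa using hint (Atom.memLp_cellAvg hJm n b))
    have h2 := Atom.setIntegral_cellAvg_mul (n := 0) (φ := fun _ => (1 : 𝕜)) hJm (f := b)
      (fun _ _ _ _ => rfl) (by simpa using hb J)
      (by simpa using hint hm0)
    simp only [mul_one, Nat.cast_zero, add_zero] at h1 h2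
    simp only [hd]
    rw [integral_sub (hint (Atom.memLp_cellAvg hJm n b)) (hint hm0), h1, h2, sub_self]
  have hφ0 : ∫ x in (J : Set ℝ), φ x = 0 := by
    simp only [hφ]
    rw [integral_conj, hd0, map_zero]
  have hφf : (J : Set ℝ).indicator φ ∈ L.finSums 𝕜 :=
    Atom.indicator_mem_finSums hJm n (fun x hx y hy => by simp only [hφ, hdc x hx y hy])
      (hint hφL) hφ0
  have hbφ : IntegrableOn (fun x => b x * φ x) (J : Set ℝ) :=
    (locIntegrable_mul_finSums hb hφf J).congr_fun
      (fun x hx => by simp only [indicator_of_mem hx]) J.measurableSet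
  have hmul : ∀ {g : ℝ → 𝕜}, (∀ p, MemLp g p (volume.restrict (J : Set ℝ))) →
      IntegrableOn (fun x => g x * φ x) (J : Set ℝ) := fun h => (h 2).integrable_mul (hφL 2)
  have hkey : ∫ x in (J : Set ℝ), b x * φ x = ((∫ x in (J : Set ℝ), ‖d x‖ ^ 2 : ℝ) : 𝕜) := by
    have h1 := Atom.setIntegral_cellAvg_mul (φ := φ) (f := b) hJm n
      (fun x hx y hy => by simp only [hφ, hdc x hx y hy]) hbφ (hmul (Atom.memLp_cellAvg hJm n b))
    have h2 : ∫ x in (J : Set ℝ), L.cellAvg m b x * φ x =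
        ∫ x in (J : Set ℝ), (⨍ y in (J : Set ℝ), b y) * φ x :=
      setIntegral_congr_fun J.measurableSet fun x hx => by simp only [hcell x hx]
    rw [← h1, ← integral_ofReal, ← sub_zero (∫ x in (J : Set ℝ), L.cellAvg (m + n) b x * φ x),
      ← mul_zero (⨍ y in (J : Set ℝ), b y), ← hφ0, ← integral_const_mul, ← h2,
      ← integral_sub (hmul (Atom.memLp_cellAvg hJm n b)) (hmul hm0)]
    refine integral_congr_ae (Filter.Eventually.of_forall fun x => ?_)
    simp only [hφ, ← sub_mul]
    rw [RCLike.ofReal_pow, ← RCLike.mul_conj]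
  set X := eLpNorm d (ENNReal.ofReal 2) (volume.restrict (J : Set ℝ)) with hX
  have hXt : X ≠ ∞ := (hdL _).2.ne
  have hX2 : ‖∫ x in (J : Set ℝ), b x * φ x‖ₑ = X * X := by
    have hi2 : Integrable (fun x => ‖d x‖ ^ 2) (volume.restrict (J : Set ℝ)) :=
      (hdL 2).integrable_norm_pow two_ne_zero
    rw [hkey, ← ofReal_norm, RCLike.norm_ofReal,
      abs_of_nonneg (integral_nonneg fun x => by positivity),
      ofReal_integral_eq_lintegral_ofReal hi2 (Filter.Eventually.of_forall fun x => by positivity),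
      hX, eLpNorm_eq_lintegral_rpow_enorm_toReal (by simp) ENNReal.ofReal_ne_top,
      ENNReal.toReal_ofReal zero_le_two, ← ENNReal.rpow_add_of_nonneg _ _ (by simp) (by simp)]
    norm_num
  have hφX : eLpNorm φ (ENNReal.ofReal 2) (volume.restrict (J : Set ℝ)) = X :=
    eLpNorm_congr_norm_ae (Filter.Eventually.of_forall fun x => by simp [hφ])
  have h1 := enorm_mul_setIntegral_le_of_adjoint hpq hb hA hJ h hh1 hh0 hz (hint hφL) hφ0 hφf
  rw [hX2, hφX, ← mul_assoc, ← ht] at h1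
  rcases eq_or_ne X 0 with hX0 | hX0
  · rw [hX0, mul_zero]; exact zero_le
  rw [ENNReal.mul_le_mul_iff_left hX0 hXt] at h1
  refine (mul_le_mul_left hhε _).trans ?_
  rw [mul_right_comm]
  exact mul_le_mul_left h1 _

end MartingaleTransform

/-! ### Bounds for single martingale differences -/

lemma _root_.Real.HolderConjugate.eq_two_of_left (hpq : (2 : ℝ).HolderConjugate q) : q = 2 := by
  refine inv_injective ?_
  have h := hpq.inv_add_inv_eq_one
  linarith

/-- The mean over I of the sum of the three normalised p-th powers is at most 3, so at some point
every one of them is at most 3 ≤ 3^p. -/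
lemma exists_forall_enorm_le (hp : 1 ≤ p) (I : L.Interval) {f : Fin 3 → ℝ → 𝕜} {c : Fin 3 → ℝ≥0∞}
    (hc0 : ∀ i, c i ≠ 0) (hct : ∀ i, c i ≠ ∞)
    (hf : ∀ i, AEStronglyMeasurable (f i) (volume.restrict (I : Set ℝ)))
    (h : ∀ i, eLpNorm (f i) (ENNReal.ofReal p) (volume.restrict (I : Set ℝ)) ≤
      c i * volume (I : Set ℝ) ^ (1 / p)) :
    ∃ x ∈ (I : Set ℝ), ∀ i, ‖f i x‖ₑ ≤ 3 * c i := by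
  have hp0 : 0 < p := by linarith
  have hc0' : ∀ i, (c i) ^ p ≠ 0 := fun i => by simp [ENNReal.rpow_eq_zero_iff, hc0 i, hct i]
  have hct' : ∀ i, (c i) ^ p ≠ ∞ := fun i => by simp [ENNReal.rpow_eq_top_iff, hc0 i, hct i]
  have hm : ∀ i, AEMeasurable (fun x => ‖f i x‖ₑ ^ p * (c i ^ p)⁻¹)
      (volume.restrict (I : Set ℝ)) :=
    fun i => ((hf i).enorm.pow_const p).mul_const _
  obtain ⟨x, hx, hxle⟩ := exists_le_setLAverage (μ := volume) I.volume_ne_zero I.volume_ne_top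
    (f := fun x => ∑ i, ‖f i x‖ₑ ^ p * (c i ^ p)⁻¹) (Finset.aemeasurable_fun_sum _ fun i _ => hm i)
  refine ⟨x, hx, fun i => ?_⟩
  have hint : ∀ i, ∫⁻ x in (I : Set ℝ), ‖f i x‖ₑ ^ p * (c i ^ p)⁻¹ ≤ volume (I : Set ℝ) := by
    intro i
    rw [lintegral_mul_const'' _ ((hf i).enorm.pow_const p)]
    have h1 := h i
    rw [eLpNorm_eq_lintegral_rpow_enorm_toReal (by simpa using hp0) ENNReal.ofReal_ne_top,
      ENNReal.toReal_ofReal hp0.le] at h1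
    have h2 := ENNReal.rpow_le_rpow h1 hp0.le
    rw [← ENNReal.rpow_mul, one_div_mul_cancel hp0.ne', ENNReal.rpow_one,
      ENNReal.mul_rpow_of_nonneg _ _ hp0.le, ← ENNReal.rpow_mul, one_div_mul_cancel hp0.ne',
      ENNReal.rpow_one] at h2
    refine (mul_le_mul_left h2 _).trans (le_of_eq ?_)
    rw [mul_right_comm, ENNReal.mul_inv_cancel (hc0' i) (hct' i), one_mul]
  have havg : ⨍⁻ x in (I : Set ℝ), ∑ i, ‖f i x‖ₑ ^ p * (c i ^ p)⁻¹ ∂volume ≤ 3 := by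
    rw [setLAverage_eq, ENNReal.div_le_iff I.volume_ne_zero I.volume_ne_top,
      lintegral_finsetSum' _ fun i _ => hm i]
    refine (Finset.sum_le_sum fun i _ => hint i).trans (le_of_eq ?_)
    simp
  have h3 : ‖f i x‖ₑ ^ p * (c i ^ p)⁻¹ ≤ 3 :=
    (Finset.single_le_sum (f := fun i => ‖f i x‖ₑ ^ p * (c i ^ p)⁻¹) (fun _ _ => zero_le)
      (Finset.mem_univ i)).trans (hxle.trans havg)
  rw [← div_eq_mul_inv, ENNReal.div_le_iff (hc0' i) (hct' i)] at h3
  rw [← ENNReal.rpow_le_rpow_iff hp0, ENNReal.mul_rpow_of_nonneg _ _ hp0.le]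
  refine h3.trans (mul_le_mul_left ?_ _)
  calc (3 : ℝ≥0∞) = 3 ^ (1 : ℝ) := by simp
    _ ≤ 3 ^ p := ENNReal.rpow_le_rpow_of_exponent_le (by norm_num) hp

lemma enorm_integral_D_mul_le (hpq : p.HolderConjugate q) {I : L.Interval} (f g : L.D 𝕜 I) :
    ‖∫ x, (f : ℝ → 𝕜) x * (g : ℝ → 𝕜) x‖ₑ ≤ eLpNorm (f : ℝ → 𝕜) (ENNReal.ofReal p) L.measure *
      eLpNorm (g : ℝ → 𝕜) (ENNReal.ofReal q) L.measure := by
  rw [← setIntegral_eq_integral_of_forall_compl_eq_zero (s := (I : Set ℝ)) fun y hy => by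
      rw [D_apply_of_notMem _ hy, zero_mul], ← eLpNorm_D_restrict f, ← eLpNorm_D_restrict g]
  exact enorm_integral_mul_le hpq (D_aestronglyMeasurable f _) (D_aestronglyMeasurable g _)

namespace MartingaleTransform

variable {T : MartingaleTransform L 𝕜} {b : ℝ → 𝕜}

/-- On a large child J the norm of Δ_I b on I suffices. On a small one, let τ = S_I h and write (Δ_I
b) τ = Λτ + a with a constant a. The function Λτ is small because it is the block commutator at h
plus S_I Λh, and the supremum bound of h controls Λh. Evaluating at a good point bounds a;
evaluating on J, where τ is large, bounds Δ_I b. -/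
lemma mul_enorm_diff_apply_le (hpq : p.HolderConjugate q) (S : MartingaleTransform L 𝕜)
    {ε K N A D : ℝ≥0} (hK : 0 < K) (hN0 : 0 < N) (hD0 : 0 < D) {I J : L.Interval}
    (hJ : J ∈ L.child I) (hS : S.NonDegenerate p ε K I J)
    (hN : ∀ k : L.D 𝕜 I, eLpNorm (S.block I k : ℝ → 𝕜) (ENNReal.ofReal p) L.measure ≤
      N * eLpNorm (k : ℝ → 𝕜) (ENNReal.ofReal p) L.measure)
    (hA : ∀ k : L.D 𝕜 I,
      eLpNorm ((lambdaBlock b I (S.block I k) - S.block I (lambdaBlock b I k) : L.D 𝕜 I) : ℝ → 𝕜)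
        (ENNReal.ofReal p) L.measure ≤ A * eLpNorm (k : ℝ → 𝕜) (ENNReal.ofReal p) L.measure)
    (hD : eLpNorm (diff I b : ℝ → 𝕜) (ENNReal.ofReal p) L.measure ≤
      D * volume (I : Set ℝ) ^ (1 / p)) {z : ℝ} (hz : z ∈ (J : Set ℝ)) :
    ε * ‖(diff I b : ℝ → 𝕜) z‖ₑ ≤
      ε * (D * K ^ (1 / p)) + (9 * (D * N) + 4 * (A + 2 * (N * K * D))) := by
  obtain ⟨h, hh1, hh0, hhε, hhK⟩ := hS
  have hp0 := hpq.pos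
  have hp1 : 0 ≤ 1 / p := by positivity
  set φ := diff I b with hφ
  have hV0 := I.volume_rpow_ne_zero (1 / p)
  have hVt := I.volume_rpow_ne_top (1 / p)
  by_cases hlarge : volume (J : Set ℝ) < volume (I : Set ℝ) / K
  swap
  · rw [not_lt, ENNReal.div_le_iff (by simpa using hK.ne') (by simp)] at hlarge
    refine le_add_right (mul_le_mul_right ?_ _)
    have h1 := (enorm_mul_rpow_le hp0 hJ φ hz).trans hD
    rw [← ENNReal.mul_le_mul_iff_left (J.volume_rpow_ne_zero (1 / p))
      (J.volume_rpow_ne_top (1 / p))]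
    refine h1.trans ?_
    rw [mul_assoc]
    refine mul_le_mul_right ?_ _
    refine (ENNReal.rpow_le_rpow hlarge hp1).trans (le_of_eq ?_)
    rw [ENNReal.mul_rpow_of_nonneg _ _ hp1, mul_comm]
  · refine le_add_left ?_
    have hhinf := hhK hlarge
    set τ := S.block I h with hτ
    set e := lambdaBlock b I τ with he
    set a := ⨍ y in (I : Set ℝ), (φ : ℝ → 𝕜) y * (τ : ℝ → 𝕜) y with ha
    have hpt : ∀ x ∈ (I : Set ℝ), (φ : ℝ → 𝕜) x * (τ : ℝ → 𝕜) x = (e : ℝ → 𝕜) x + a :=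
      fun x hx => mul_eq_lambdaBlock_add b τ hx
    set E : ℝ≥0 := A + 2 * (N * K * D) with hE
    have hτn : eLpNorm (τ : ℝ → 𝕜) (ENNReal.ofReal p) L.measure ≤ N := by
      simpa [hh1] using hN h
    have hΛ : eLpNorm (lambdaBlock b I h : ℝ → 𝕜) (ENNReal.ofReal p) L.measure ≤
        2 * (K * D) := by
      have hφh : IntegrableOn (fun x => (φ : ℝ → 𝕜) x * (h : ℝ → 𝕜) x) (I : Set ℝ) :=
        (integrable_mul I φ h).integrableOn
      refine (eLpNorm_diff_le hpq I hφh).trans (mul_le_mul_right ?_ _)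
      refine (eLpNorm_restrict_le I.measurableSet I.subset_carrier _ _).trans ?_
      have h1 : (fun x => (φ : ℝ → 𝕜) x * (h : ℝ → 𝕜) x) = (h : ℝ → 𝕜) • (φ : ℝ → 𝕜) := by
        funext x; rw [Pi.smul_apply', smul_eq_mul, mul_comm]
      rw [h1]
      refine (eLpNorm_smul_le_eLpNorm_top_mul_eLpNorm _ (D_aestronglyMeasurable _ _) _).trans ?_
      refine (mul_le_mul' hhinf hD).trans (le_of_eq ?_)
      rw [ENNReal.rpow_neg]
      calc (K : ℝ≥0∞) * (volume (I : Set ℝ) ^ (1 / p))⁻¹ * (D * volume (I : Set ℝ) ^ (1 / p))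
          = K * D * ((volume (I : Set ℝ) ^ (1 / p))⁻¹ * volume (I : Set ℝ) ^ (1 / p)) := by ring
        _ = K * D := by rw [ENNReal.inv_mul_cancel hV0 hVt, mul_one]
    have hen : eLpNorm (e : ℝ → 𝕜) (ENNReal.ofReal p) L.measure ≤ E := by
      have h1 : e = (lambdaBlock b I (S.block I h) - S.block I (lambdaBlock b I h)) +
          S.block I (lambdaBlock b I h) := by rw [sub_add_cancel]
      rw [h1]
      refine (eLpNorm_add_le (D_aestronglyMeasurable _ _) (D_aestronglyMeasurable _ _)
        (one_le_ofReal_of_one_le hpq.lt.le)).trans ?_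
      have h2 := hA h
      rw [hh1, mul_one] at h2
      refine (add_le_add h2 ((hN _).trans (mul_le_mul_right hΛ _))).trans (le_of_eq ?_)
      rw [hE]; push_cast; ring
    have hE0 : 0 < E := by positivity
    have hcancel : ∀ X : ℝ≥0∞, X * (volume (I : Set ℝ) ^ (1 / p))⁻¹ * volume (I : Set ℝ) ^ (1 / p) =
        X := fun X => by rw [mul_assoc, ENNReal.inv_mul_cancel hV0 hVt, mul_one]
    -- A point of I at which Δ_I b, τ and Λτ are all comparable to their means; there a is read off
    -- as the product minus Λτ, whence 9 D N + 3 E.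
    obtain ⟨x, hx, hxle⟩ := exists_forall_enorm_le hpq.lt.le I
      (f := ![(φ : ℝ → 𝕜), (τ : ℝ → 𝕜), (e : ℝ → 𝕜)])
      (c := ![(D : ℝ≥0∞), N * (volume (I : Set ℝ) ^ (1 / p))⁻¹,
        E * (volume (I : Set ℝ) ^ (1 / p))⁻¹])
      (by
        intro i
        fin_cases i
        · simpa using hD0.ne'
        · exact mul_ne_zero (by simpa using hN0.ne') (ENNReal.inv_ne_zero.2 hVt)
        · exact mul_ne_zero (by simpa using hE0.ne') (ENNReal.inv_ne_zero.2 hVt))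
      (by
        intro i
        fin_cases i
        · exact ENNReal.coe_ne_top
        · exact ENNReal.mul_ne_top ENNReal.coe_ne_top (ENNReal.inv_ne_top.2 hV0)
        · exact ENNReal.mul_ne_top ENNReal.coe_ne_top (ENNReal.inv_ne_top.2 hV0))
      (by
        intro i
        fin_cases i <;> exact D_aestronglyMeasurable _ _)
      (by
        intro i
        fin_cases i
        · exact (eLpNorm_D_restrict φ _).trans_le hD
        · refine ((eLpNorm_D_restrict τ _).trans_le hτn).trans (le_of_eq ?_)
          exact (hcancel _).symm
        · refine ((eLpNorm_D_restrict e _).trans_le hen).trans (le_of_eq ?_)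
          exact (hcancel _).symm)
    have hx0 : ‖(φ : ℝ → 𝕜) x‖ₑ ≤ 3 * D := hxle 0
    have hx1 : ‖(τ : ℝ → 𝕜) x‖ₑ ≤ 3 * (N * (volume (I : Set ℝ) ^ (1 / p))⁻¹) := hxle 1
    have hx2 : ‖(e : ℝ → 𝕜) x‖ₑ ≤ 3 * (E * (volume (I : Set ℝ) ^ (1 / p))⁻¹) := hxle 2
    have haI : ‖a‖ₑ * volume (I : Set ℝ) ^ (1 / p) ≤ 9 * (D * N) + 3 * E := by
      have h1 : a = (φ : ℝ → 𝕜) x * (τ : ℝ → 𝕜) x - (e : ℝ → 𝕜) x := by rw [hpt x hx]; ring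
      have h2 : ‖a‖ₑ ≤ 3 * D * (3 * (N * (volume (I : Set ℝ) ^ (1 / p))⁻¹)) +
          3 * (E * (volume (I : Set ℝ) ^ (1 / p))⁻¹) := by
        rw [h1]
        refine (enorm_sub_le).trans ?_
        rw [enorm_mul]
        gcongr
      refine (mul_le_mul_left h2 _).trans (le_of_eq ?_)
      have h3 : (volume (I : Set ℝ) ^ (1 / p))⁻¹ * volume (I : Set ℝ) ^ (1 / p) = 1 :=
        ENNReal.inv_mul_cancel hV0 hVt
      calc (3 * D * (3 * (N * (volume (I : Set ℝ) ^ (1 / p))⁻¹)) +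
          3 * (E * (volume (I : Set ℝ) ^ (1 / p))⁻¹)) * volume (I : Set ℝ) ^ (1 / p)
          = (9 * (D * N) + 3 * E) *
            ((volume (I : Set ℝ) ^ (1 / p))⁻¹ * volume (I : Set ℝ) ^ (1 / p)) := by ring
        _ = _ := by rw [h3, mul_one]
    rw [eLpNorm_indicator_D hp0 hJ _ hz] at hhε
    calc (ε : ℝ≥0∞) * ‖(φ : ℝ → 𝕜) z‖ₑ
        ≤ ‖(τ : ℝ → 𝕜) z‖ₑ * volume (J : Set ℝ) ^ (1 / p) * ‖(φ : ℝ → 𝕜) z‖ₑ :=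
          mul_le_mul_left hhε _
      _ = ‖(e : ℝ → 𝕜) z + a‖ₑ * volume (J : Set ℝ) ^ (1 / p) := by
          rw [← hpt z (child_subset hJ hz), enorm_mul]; ring
      _ ≤ (‖(e : ℝ → 𝕜) z‖ₑ + ‖a‖ₑ) * volume (J : Set ℝ) ^ (1 / p) :=
          mul_le_mul_left (enorm_add_le _ _) _
      _ ≤ E + (9 * (D * N) + 3 * E) := by
          rw [add_mul]
          refine add_le_add ((enorm_mul_rpow_le hp0 hJ e hz).trans hen) ?_
          refine (mul_le_mul_right ?_ _).trans haI
          exact ENNReal.rpow_le_rpow (measure_mono (child_subset hJ)) hp1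
      _ = _ := by rw [hE]; push_cast; ring

lemma eLpNorm_adjoint_block_le (hpq : p.HolderConjugate q) {N : ℝ≥0∞} {I : L.Interval}
    (hN : ∀ k : L.D 𝕜 I, eLpNorm (T.block I k : ℝ → 𝕜) (ENNReal.ofReal p) L.measure ≤
      N * eLpNorm (k : ℝ → 𝕜) (ENNReal.ofReal p) L.measure) (k : L.D 𝕜 I) :
    eLpNorm (T.adjoint.block I k : ℝ → 𝕜) (ENNReal.ofReal q) L.measure ≤
      2 * N * eLpNorm (k : ℝ → 𝕜) (ENNReal.ofReal q) L.measure := by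
  rw [mul_assoc]
  refine eLpNorm_le_of_forall_integral_mul_le hpq _ fun g => ?_
  rw [T.integral_adjoint_mul]
  refine (enorm_integral_D_mul_le hpq.symm k (T.block I g)).trans ?_
  refine (mul_le_mul_right (hN g) _).trans (le_of_eq ?_)
  ring

lemma integral_lambdaBlock_mul (b : ℝ → 𝕜) {I : L.Interval} (k g : L.D 𝕜 I) :
    ∫ x, (lambdaBlock b I k : ℝ → 𝕜) x * (g : ℝ → 𝕜) x =
      ∫ x, (k : ℝ → 𝕜) x * (lambdaBlock b I g : ℝ → 𝕜) x := by
  have h : ∀ k : L.D 𝕜 I, IntegrableOn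
      (fun x => (diff I b : ℝ → 𝕜) x * (k : ℝ → 𝕜) x) (I : Set ℝ) :=
    fun k => (integrable_mul I (diff I b) k).integrableOn
  have h1 : ∫ x, (lambdaBlock b I k : ℝ → 𝕜) x * (g : ℝ → 𝕜) x =
      ∫ x, (g : ℝ → 𝕜) x * (lambdaBlock b I k : ℝ → 𝕜) x := by simp only [mul_comm]
  rw [h1, lambdaBlock, lambdaBlock, integral_D_mul_diff g (h k), integral_D_mul_diff k (h g)]
  refine integral_congr_ae (Filter.Eventually.of_forall fun x => ?_)
  beta_reduce
  ring

lemma eLpNorm_lambda_commutator_adjoint_le (hpq : p.HolderConjugate q) {A : ℝ≥0∞}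
    {I : L.Interval} (hA : ∀ k : L.D 𝕜 I,
      eLpNorm ((lambdaBlock b I (T.block I k) - T.block I (lambdaBlock b I k) : L.D 𝕜 I) : ℝ → 𝕜)
        (ENNReal.ofReal p) L.measure ≤ A * eLpNorm (k : ℝ → 𝕜) (ENNReal.ofReal p) L.measure)
    (k : L.D 𝕜 I) :
    eLpNorm ((lambdaBlock b I (T.adjoint.block I k) - T.adjoint.block I (lambdaBlock b I k) :
        L.D 𝕜 I) : ℝ → 𝕜) (ENNReal.ofReal q) L.measure ≤
      2 * A * eLpNorm (k : ℝ → 𝕜) (ENNReal.ofReal q) L.measure := by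
  rw [mul_assoc]
  refine eLpNorm_le_of_forall_integral_mul_le hpq _ fun g => ?_
  have h1 : ∫ x, ((lambdaBlock b I (T.adjoint.block I k) -
      T.adjoint.block I (lambdaBlock b I k) : L.D 𝕜 I) : ℝ → 𝕜) x * (g : ℝ → 𝕜) x =
      -∫ x, (k : ℝ → 𝕜) x * ((lambdaBlock b I (T.block I g) -
        T.block I (lambdaBlock b I g) : L.D 𝕜 I) : ℝ → 𝕜) x := by
    simp only [Submodule.coe_sub, Pi.sub_apply, sub_mul, mul_sub]
    rw [integral_sub (integrable_mul I _ _) (integrable_mul I _ _),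
      integral_sub (integrable_mul I _ _) (integrable_mul I _ _), integral_lambdaBlock_mul,
      T.integral_adjoint_mul, T.integral_adjoint_mul, integral_lambdaBlock_mul, neg_sub]
  rw [h1, enorm_neg]
  refine (enorm_integral_D_mul_le hpq.symm k _).trans ?_
  refine (mul_le_mul_right (hA g) _).trans (le_of_eq ?_)
  ring

/-! ### Consequences of mixing -/

lemma eLpNorm_oscillation_le (hpq : p.HolderConjugate q) (hb : L.LocIntegrable b) {A ε K : ℝ≥0}
    (hε : 0 < ε) (hA : T.CommutatorBoundedBy b p A)
    (hmix : ∀ I : L.Interval, ∀ J ∈ L.child I,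
      T.NonDegenerate p ε K I J ∨ (p = 2 ∧ T.adjoint.NonDegenerate q ε K I J))
    {I J : L.Interval} (hJ : J ∈ L.child I) {m : ℤ} (hJm : (J : Set ℝ) ∈ L.gen m) (n : ℕ) :
    eLpNorm (fun x => L.cellAvg (m + n) b x - L.cellAvg m b x) (ENNReal.ofReal p)
      (volume.restrict (J : Set ℝ)) ≤ (2 * A / ε : ℝ≥0) * volume (J : Set ℝ) ^ (1 / p) := by
  have hε' : (ε : ℝ≥0∞) ≠ 0 := by simpa using hε.ne'
  have key : ε * eLpNorm (fun x => L.cellAvg (m + n) b x - L.cellAvg m b x) (ENNReal.ofReal p)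
      (volume.restrict (J : Set ℝ)) ≤ 2 * A * volume (J : Set ℝ) ^ (1 / p) := by
    rcases hmix I J hJ with h | ⟨rfl, h⟩
    · exact mul_eLpNorm_oscillation_le hpq hb hA hJ h hJm n
    · obtain rfl : q = 2 := hpq.eq_two_of_left
      refine (mul_eLpNorm_oscillation_le_of_adjoint hb hA hJ h hJm n).trans ?_
      refine mul_le_mul_left ?_ _
      rw [two_mul]; exact le_add_self
  rw [mul_comm, ← ENNReal.le_div_iff_mul_le (Or.inl hε') (Or.inl ENNReal.coe_ne_top)] at key
  refine key.trans (le_of_eq ?_)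
  rw [ENNReal.coe_div hε.ne', ENNReal.coe_mul, ENNReal.coe_ofNat, ENNReal.mul_div_right_comm]

lemma eLpNorm_diff_le_of_oscillation {C : ℝ≥0∞} (hb : L.LocIntegrable b) {I : L.Interval}
    (hosc : ∀ m : ℤ, (I : Set ℝ) ∈ L.gen m → ∀ n : ℕ,
      eLpNorm (fun x => L.cellAvg (m + n) b x - L.cellAvg m b x) (ENNReal.ofReal p)
        (volume.restrict (I : Set ℝ)) ≤ C) :
    eLpNorm (diff I b : ℝ → 𝕜) (ENNReal.ofReal p) L.measure ≤ C := by
  by_cases hI : (L.child I).Nonempty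
  swap
  · have h0 : (diff I b : ℝ → 𝕜) = 0 := by
      funext x
      exact (diff I b).2.1 x fun J hJ => absurd ⟨J, hJ⟩ hI
    rw [h0, eLpNorm_zero]; exact zero_le
  obtain ⟨-, k, hk, -, -⟩ := hI
  have h1 := hosc k hk.1 1
  rw [← eLpNorm_D_restrict]
  refine le_trans (le_of_eq ?_) h1
  refine eLpNorm_congr_ae ((ae_restrict_iff' I.measurableSet).2
    (Filter.Eventually.of_forall fun x hx => ?_))
  have hxc := I.mem_carrier hx
  have hcI : L.cell k x = I := cell_eq hk.1 hx
  have hne : L.cell (k + 1) x ≠ L.cell k x := fun h => by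
    have h2 : k + 1 ≤ k := hk.2 (by
      change (I : Set ℝ) ∈ L.gen (k + 1)
      rw [← hcI, ← h]; exact cell_mem_gen _ hxc)
    omega
  have h3 := diff_apply_cell hb hxc hne
  have h4 : L.cellInterval k x hxc = I := Subtype.ext hcI
  rw [h4] at h3
  rw [h3, Nat.cast_one]

/-- Mixing is used twice: for I as a child of its parent, to bound the oscillation of b on I, and
for each child of I, to bound the value of Δ_I b there. The first use is why parentless intervals
are excluded. -/
lemma exists_forall_enorm_diff_le (hpq : p.HolderConjugate q) (hb : L.LocIntegrable b)
    {A ε K : ℝ≥0} (hε : 0 < ε) (hK : 0 < K) (hT : T.BlocksBounded p)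
    (hA : T.CommutatorBoundedBy b p A) (hmix : ∀ I : L.Interval, ∀ J ∈ L.child I,
      T.NonDegenerate p ε K I J ∨ (p = 2 ∧ T.adjoint.NonDegenerate q ε K I J)) :
    ∃ M : ℝ≥0, ∀ I : L.Interval, (I : Set ℝ) ∉ L.finLimitIntervals →
      ∀ x, ‖(diff I b : ℝ → 𝕜) x‖ₑ ≤ M := by
  obtain ⟨N, hN⟩ := hT
  -- The constants serve both T and its adjoint: duality on D_I doubles the block bound N and the
  -- commutator bound 2 A. The added 1 keeps D and N' positive.
  set D : ℝ≥0 := 2 * A / ε + 1 with hD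
  set N' : ℝ≥0 := 2 * N + 1 with hN'
  set M : ℝ≥0 := ε * (D * K ^ (1 / p)) + (9 * (D * N') + 4 * (4 * A + 2 * (N' * K * D))) with hM
  have hp1 : 0 ≤ 1 / p := one_div_nonneg.2 hpq.nonneg
  refine ⟨M / ε, fun I hI x => ?_⟩
  by_cases hx : ∃ J ∈ L.child I, x ∈ (J : Set ℝ)
  swap
  · push Not at hx
    rw [(diff I b).2.1 x hx, enorm_zero]; exact zero_le
  obtain ⟨J, hJ, hxJ⟩ := hx
  rw [mem_finLimitIntervals_iff_no_parent] at hI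
  push Not at hI
  obtain ⟨I', hI'⟩ := hI
  have hDI : eLpNorm (diff I b : ℝ → 𝕜) (ENNReal.ofReal p) L.measure ≤
      D * volume (I : Set ℝ) ^ (1 / p) := by
    refine (eLpNorm_diff_le_of_oscillation hb fun m hm n =>
      eLpNorm_oscillation_le hpq hb hε hA hmix hI' hm n).trans (mul_le_mul_left ?_ _)
    exact_mod_cast (le_self_add : 2 * A / ε ≤ 2 * A / ε + 1)
  have hΛ := fun k => eLpNorm_lambda_commutator_le hpq hb hA (I := I) k
  have key : ε * ‖(diff I b : ℝ → 𝕜) x‖ₑ ≤ M := by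
    have hMc : (M : ℝ≥0∞) = ε * (D * K ^ (1 / p)) +
        (9 * (D * N') + 4 * ((4 * A : ℝ≥0) + 2 * (N' * K * D))) := by
      rw [hM]; push_cast [ENNReal.coe_rpow_of_nonneg _ hp1]; rfl
    rw [hMc]
    rcases hmix I J hJ with h | ⟨rfl, h⟩
    · refine mul_enorm_diff_apply_le hpq T hK (by positivity) (by positivity) hJ h (fun k => ?_)
        (fun k => ?_) hDI hxJ
      · refine (hN I k).trans (mul_le_mul_left ?_ _)
        rw [hN', two_mul]; push_cast
        exact le_self_add.trans le_self_add
      · refine (hΛ k).trans (mul_le_mul_left ?_ _)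
        push_cast
        exact mul_le_mul_left (by norm_num) _
    · obtain rfl : q = 2 := hpq.eq_two_of_left
      refine mul_enorm_diff_apply_le hpq T.adjoint hK (by positivity) (by positivity) hJ h
        (fun k => ?_) (fun k => ?_) hDI hxJ
      · refine (eLpNorm_adjoint_block_le hpq (hN I) k).trans (mul_le_mul_left ?_ _)
        rw [hN']; push_cast
        exact le_self_add
      · refine (eLpNorm_lambda_commutator_adjoint_le hpq hΛ k).trans (le_of_eq ?_)
        push_cast
        ring
  rw [mul_comm, ← ENNReal.le_div_iff_mul_le (Or.inl (by simpa using hε.ne'))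
    (Or.inl ENNReal.coe_ne_top), ← ENNReal.coe_div hε.ne'] at key
  exact key

end MartingaleTransform

/-! ### `BMO` from bounded oscillation -/

variable {b : ℝ → 𝕜} {D M : ℝ≥0}

/-- The John–Nirenberg inequality on the atoms of K: the oscillation on each intermediate cell is
the conditional p-th moment bound, and the bound for the differences is the jump bound. -/
lemma lintegral_sum_increment_le (hpq : p.HolderConjugate q) (hb : L.LocIntegrable b)
    (hosc : ∀ (J : L.Interval) (m : ℤ), (J : Set ℝ) ∈ L.gen m → ∀ n : ℕ,
      eLpNorm (fun x => L.cellAvg (m + n) b x - L.cellAvg m b x) (ENNReal.ofReal p)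
        (volume.restrict (J : Set ℝ)) ≤ D * volume (J : Set ℝ) ^ (1 / p))
    (hjump : ∀ (I : L.Interval) (x : ℝ), ‖(diff I b : ℝ → 𝕜) x‖ₑ ≤ M)
    {m : ℤ} {K : Set ℝ} (hK : K ∈ L.gen m) (n : ℕ) :
    ∫⁻ x in K, ∑ k ∈ Finset.range n,
      ‖L.cellAvg (m + (k + 1 : ℕ)) b x - L.cellAvg (m + k) b x‖ₑ ^ 2 ≤
    ENNReal.ofReal (2 * (M + 1 + 2 * (2 * q) ^ p * (D : ℝ) ^ p) ^ 2) * volume K := by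
  classical
  have := finite_atom hK n
  have := Fintype.ofFinite (L.Atom m n K)
  have hp0 := hpq.pos
  have hmart := Atom.isMart_cellAvg (n := n) hK (hb ⟨K, m, hK⟩)
  have h1 := hmart.sum_sq_le_of_oscillation (M := (D : ℝ) ^ p) (M' := M)
    (fun J => J.len_pos.le) (fun k => Atom.rel_of_rel_succ k) hpq M.coe_nonneg
    (fun j hj φ hφ hφ0 => by
      refine Atom.sum_mul_le_of_sum_rel_le (by positivity) (fun J => ?_) hφ hφ0
      refine Atom.sum_rel_le hK (fun J => by positivity)
        (f := fun x => ‖L.cellAvg (m + n) b x - L.cellAvg (m + j) b x‖ₑ ^ p)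
        (fun J' x hx => ?_) (by positivity) hj J ?_
      · rw [J'.cellAvg_eq le_rfl hx b, J'.cellAvg_eq hj hx b,
          ← ENNReal.ofReal_rpow_of_nonneg (norm_nonneg _) hp0.le, ofReal_norm]
      · have h2 := hosc (L.cellInterval (m + j) J.pt J.pt_mem_carrier) (m + j)
          (cell_mem_gen _ J.pt_mem_carrier) (n - j)
        have h3 : m + (j : ℤ) + ((n - j : ℕ) : ℤ) = m + n := by omega
        rw [h3, eLpNorm_eq_lintegral_rpow_enorm_toReal (by simpa using hp0) ENNReal.ofReal_ne_top,
          ENNReal.toReal_ofReal hp0.le] at h2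
        have h4 := ENNReal.rpow_le_rpow h2 hp0.le
        rw [ENNReal.mul_rpow_of_nonneg _ _ hp0.le, ← ENNReal.rpow_mul, ← ENNReal.rpow_mul,
          one_div_mul_cancel hp0.ne', ENNReal.rpow_one, ENNReal.rpow_one] at h4
        rw [← ENNReal.ofReal_rpow_of_nonneg D.coe_nonneg hp0.le, ENNReal.ofReal_coe_nnreal]
        exact h4)
    (fun k hk J => by
      have h2 : ‖L.cellAvg (m + (k + 1 : ℕ)) b J.pt - L.cellAvg (m + k) b J.pt‖ₑ ≤ M := by
        rw [Nat.cast_succ, ← add_assoc]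
        by_cases hne : L.cell (m + k + 1) J.pt = L.cell (m + k) J.pt
        · rw [cellAvg_succ_sub_eq_zero hne, enorm_zero]; exact zero_le
        · rw [← diff_apply_cell hb J.pt_mem_carrier hne]
          exact hjump _ _
      rw [← ofReal_norm, ← ENNReal.ofReal_coe_nnreal,
        ENNReal.ofReal_le_ofReal_iff M.coe_nonneg] at h2
      exact h2)
  rw [Atom.lintegral_eq_of_const (n := n) hK (c := fun J => ∑ k ∈ Finset.range n,
      ‖L.cellAvg (m + (k + 1 : ℕ)) b J.pt - L.cellAvg (m + k) b J.pt‖ ^ 2)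
    (fun J => Finset.sum_nonneg fun k _ => by positivity) fun J x hx => ?_]
  swap
  · rw [ENNReal.ofReal_sum_of_nonneg fun k _ => by positivity]
    refine Finset.sum_congr rfl fun k hk => ?_
    have hk' := Finset.mem_range.1 hk
    rw [J.cellAvg_eq hk' hx b, J.cellAvg_eq hk'.le hx b, ENNReal.ofReal_pow (norm_nonneg _),
      ofReal_norm]
  have h5 : volume K = ENNReal.ofReal (∑ J : L.Atom m n K, J.len) := by
    have h6 := Atom.lintegral_eq_of_const (n := n) hK (f := fun _ => 1) (c := fun _ => 1)
      (fun _ => zero_le_one) (fun J x _ => by simp)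
    simpa using h6
  rw [h5, ← ENNReal.ofReal_mul (by positivity)]
  refine ENNReal.ofReal_le_ofReal (le_trans (le_of_eq ?_) h1)
  simp only [Finset.mul_sum]
  exact Finset.sum_comm

lemma lintegral_tsum_increment_le (hpq : p.HolderConjugate q) (hb : L.LocIntegrable b)
    (hosc : ∀ (J : L.Interval) (m : ℤ), (J : Set ℝ) ∈ L.gen m → ∀ n : ℕ,
      eLpNorm (fun x => L.cellAvg (m + n) b x - L.cellAvg m b x) (ENNReal.ofReal p)
        (volume.restrict (J : Set ℝ)) ≤ D * volume (J : Set ℝ) ^ (1 / p))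
    (hjump : ∀ (I : L.Interval) (x : ℝ), ‖(diff I b : ℝ → 𝕜) x‖ₑ ≤ M)
    {m : ℤ} {K : Set ℝ} (hK : K ∈ L.gen m) :
    ∫⁻ x in K, ∑' k : ℕ, ‖L.cellAvg (m + (k + 1 : ℕ)) b x - L.cellAvg (m + k) b x‖ₑ ^ 2 ≤
    ENNReal.ofReal (2 * (M + 1 + 2 * (2 * q) ^ p * (D : ℝ) ^ p) ^ 2) * volume K := by
  have hm : ∀ k : ℕ, AEMeasurable
      (fun x => ‖L.cellAvg (m + (k + 1 : ℕ)) b x - L.cellAvg (m + k) b x‖ₑ ^ 2)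
      (volume.restrict K) := fun k =>
    (((aestronglyMeasurable_cellAvg hK (k + 1) b).sub
      (aestronglyMeasurable_cellAvg hK k b)).enorm).pow_const 2
  rw [lintegral_tsum hm]
  refine ENNReal.tsum_le_of_sum_range_le fun n => ?_
  rw [← lintegral_finsetSum' _ fun k _ => hm k]
  exact lintegral_sum_increment_le hpq hb hosc hjump hK n

/-- Apart from J, an interval inside J that contains x and has a nonzero coefficient has a parent,
and is the cell of x in a generation later than m just after a division. Its coefficient is the
corresponding increment, and distinct intervals give distinct generations. -/
lemma tsum_coeff_le (hb : L.LocIntegrable b) {J : L.Interval} {m : ℤ}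
    (hJ : (J : Set ℝ) ∈ L.gen m) {x : ℝ} (hx : x ∈ (J : Set ℝ)) :
    ∑' I : {I : L.Interval // (I : Set ℝ) ⊆ J},
      (I.1 : Set ℝ).indicator (fun _ => ‖coeff (fun I => diff I b) I.1‖ₑ ^ 2) x ≤
    ‖coeff (fun I => diff I b) J‖ₑ ^ 2 +
      ∑' k : ℕ, ‖L.cellAvg (m + (k + 1 : ℕ)) b x - L.cellAvg (m + k) b x‖ₑ ^ 2 := by
  classical
  have hxc := J.mem_carrier hx
  set f : {I : L.Interval // (I : Set ℝ) ⊆ J} → ℝ≥0∞ := fun I =>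
    (I.1 : Set ℝ).indicator (fun _ => ‖coeff (fun I => diff I b) I.1‖ₑ ^ 2) x with hf
  set g : ℕ → ℝ≥0∞ := fun k =>
    ‖L.cellAvg (m + (k + 1 : ℕ)) b x - L.cellAvg (m + k) b x‖ₑ ^ 2 with hg
  rw [ENNReal.tsum_eq_add_tsum_ite ⟨J, Subset.rfl⟩]
  refine add_le_add (le_of_eq (indicator_of_mem hx _)) ?_
  set f' : {I : L.Interval // (I : Set ℝ) ⊆ J} → ℝ≥0∞ := fun I =>
    if I = ⟨J, Subset.rfl⟩ then 0 else f I with hf'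
  have key : ∀ I : Function.support f', ∃ k : ℕ, (I.1.1 : Set ℝ) = L.cell (m + (k + 1 : ℕ)) x ∧
      f' I = g k := by
    rintro ⟨I, hI⟩
    have hIJ : I.1 ≠ J := fun h => hI (by simp only [hf']; rw [if_pos (Subtype.ext h)])
    have hfI : f' I = f I := by simp only [hf']; rw [if_neg fun h => hIJ (congrArg Subtype.val h)]
    rw [Function.mem_support, hfI] at hI
    have hxI : x ∈ (I.1 : Set ℝ) := by
      by_contra h
      exact hI (indicator_of_notMem h _)
    have hfx : f I = ‖coeff (fun I => diff I b) I.1‖ₑ ^ 2 := indicator_of_mem hxI _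
    have hpar : ∃ I', I.1 ∈ L.child I' := by
      by_contra h
      push Not at h
      rw [hfx, coeff_eq_zero_of_no_parent h] at hI
      simp at hI
    obtain ⟨I', hI'⟩ := hpar
    obtain ⟨r, hr, hr1, hss⟩ := mem_child_iff.1 hI'
    have hc1 : L.cell (r + 1) x = I.1 := cell_eq hr1 hxI
    have hc : L.cell r x = I' := cell_eq hr (hss.1 hxI)
    have hmr : m ≤ r := by
      by_contra hlt
      refine hIJ (Subtype.ext (Subset.antisymm I.2 ?_))
      rw [← hc1, ← cell_eq hJ hx]
      exact cell_subset (by omega) x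
    obtain ⟨k, rfl⟩ := Int.le.dest hmr
    refine ⟨k, by rw [Nat.cast_succ, ← add_assoc, hc1], ?_⟩
    have hne : L.cell (m + k + 1) x ≠ L.cell (m + k) x := by
      rw [hc1, hc]; exact hss.ne
    have h1 := coeff_diff_cell hb hxc hne
    have h2 : L.cellInterval (m + k + 1) x hxc = I.1 := Subtype.ext hc1
    rw [h2] at h1
    rw [hfI, hfx, h1, hg]
    beta_reduce
    rw [Nat.cast_succ, ← add_assoc]
  choose i hi hfi using key
  have hinj : Function.Injective i := fun I I' h => by
    refine Subtype.ext (Subtype.ext (Subtype.ext ?_))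
    rw [hi I, hi I', h]
  refine le_trans (le_of_eq (tsum_congr fun I => ?_)) (calc
    ∑' I, f' I = ∑' I : Function.support f', f' I := (tsum_subtype_support f').symm
    _ = ∑' I : Function.support f', g (i I) := tsum_congr hfi
    _ ≤ ∑' k, g k := ENNReal.tsum_comp_le_tsum_of_injective hinj g)
  by_cases h : I = ⟨J, Subset.rfl⟩
  · simp only [hf']; rw [if_pos h, if_pos h]
  · simp only [hf']; rw [if_neg h, if_neg h]

/-- The BMO sum over J consists of the jump into J, bounded by M, and the increments inside J,
bounded by John–Nirenberg. -/
theorem bmoNorm_lt_top_of_oscillation (hpq : p.HolderConjugate q) (hb : L.LocIntegrable b)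
    (hosc : ∀ (J : L.Interval) (m : ℤ), (J : Set ℝ) ∈ L.gen m → ∀ n : ℕ,
      eLpNorm (fun x => L.cellAvg (m + n) b x - L.cellAvg m b x) (ENNReal.ofReal p)
        (volume.restrict (J : Set ℝ)) ≤ D * volume (J : Set ℝ) ^ (1 / p))
    (hjump : ∀ (I : L.Interval) (x : ℝ), ‖(diff I b : ℝ → 𝕜) x‖ₑ ≤ M) :
    bmoNorm (L := L) (fun I => diff I b) < ∞ := by
  set C : ℝ≥0∞ := (M : ℝ≥0∞) ^ 2 +
    ENNReal.ofReal (2 * (M + 1 + 2 * (2 * q) ^ p * (D : ℝ) ^ p) ^ 2) with hC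
  have hCt : C ≠ ∞ := ENNReal.add_ne_top.2 ⟨by simp, ENNReal.ofReal_ne_top⟩
  refine lt_of_le_of_lt (iSup_le fun J => ?_) (ENNReal.rpow_lt_top_of_nonneg (y := 1 / 2)
    (by norm_num) hCt)
  refine ENNReal.rpow_le_rpow ?_ (by norm_num)
  obtain ⟨m, hm⟩ := J.2
  have hcoef : ‖coeff (fun I => diff I b) J‖ₑ ≤ M := by
    by_cases h : ∃ I, J ∈ L.child I
    · obtain ⟨I, hI⟩ := h
      obtain ⟨z, hz⟩ := J.nonempty
      rw [coeff_eq hI hz]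
      exact hjump _ _
    · push Not at h
      rw [coeff_eq_zero_of_no_parent h, enorm_zero]; exact zero_le
  have h1 : ∫⁻ x in (J : Set ℝ), ∑' I : {I : L.Interval // (I : Set ℝ) ⊆ J},
      (I.1 : Set ℝ).indicator (fun _ => ‖coeff (fun I => diff I b) I.1‖ₑ ^ 2) x ≤
      C * volume (J : Set ℝ) := by
    refine (setLIntegral_mono' J.measurableSet fun x hx =>
      (tsum_coeff_le hb hm hx).trans (add_le_add_left (pow_le_pow_left' hcoef 2) _)).trans ?_
    rw [lintegral_add_left measurable_const, setLIntegral_const, hC, add_mul]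
    exact add_le_add_right (lintegral_tsum_increment_le hpq hb hosc hjump hm) _
  refine (mul_le_mul_right h1 _).trans (le_of_eq ?_)
  rw [mul_left_comm, ENNReal.inv_mul_cancel J.volume_ne_zero J.volume_ne_top, mul_one]

end IntervalLattice

end

noncomputable section

namespace IntervalLattice

open Filter Topology FiniteMartingale

variable {L : IntervalLattice} {𝕜 : Type*} [RCLike 𝕜] {p q : ℝ}

/-! ### Removing the jumps at the limit intervals -/

lemma cellAvg_sub_topJump {b : ℝ → 𝕜} (hb : L.LocIntegrable b) {J : L.Interval}
    (hJ : (J : Set ℝ) ∉ L.finLimitIntervals) {m : ℤ} (hm : (J : Set ℝ) ∈ L.gen m) (n : ℕ) {x : ℝ}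
    (hx : x ∈ (J : Set ℝ)) :
    L.cellAvg (m + n) (b - L.topJump b) x - L.cellAvg m (b - L.topJump b) x =
      L.cellAvg (m + n) b x - L.cellAvg m b x := by
  obtain ⟨a, ha⟩ := exists_topJump_eq_const b hJ
  have hxc := J.mem_carrier hx
  have h : ∀ k : ℕ, L.cellAvg (m + k) (b - L.topJump b) x = L.cellAvg (m + k) b x - a := by
    intro k
    have hsub : L.cell (m + k) x ⊆ J := by
      rw [← cell_eq hm hx]; exact cell_subset (by omega) x
    rw [cellAvg_sub ((hb J).mono_set hsub) ((locIntegrable_topJump b J).mono_set hsub),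
      cellAvg_of_const (s := L.topJump b) hxc fun y hy => by rw [ha y (hsub hy), ha x hx], ha x hx]
  have h0 := h 0
  rw [Nat.cast_zero, add_zero] at h0
  rw [h, h0]
  ring

lemma exists_isRank_of_notMem_gen {J : L.Interval} {m k : ℤ} (hm : (J : Set ℝ) ∈ L.gen m)
    (hmk : m ≤ k) (hk : (J : Set ℝ) ∉ L.gen k) : ∃ r, L.IsRank J r ∧ m ≤ r ∧ r < k := by
  have hlt : ∀ j, (J : Set ℝ) ∈ L.gen j → j < k := fun j hj => by
    by_contra h
    exact hk (mem_gen_of_le_of_le hmk (not_lt.1 h) hm hj)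
  obtain ⟨r, hr, hmax⟩ := Int.exists_greatest_of_bdd (P := fun j => (J : Set ℝ) ∈ L.gen j)
    ⟨k, fun j hj => (hlt j hj).le⟩ ⟨m, hm⟩
  exact ⟨r, ⟨hr, fun j hj => hmax j hj⟩, hmax m hm, hlt r hr⟩

/-- Intervals with a parent inherit the oscillation bound, since the jump is constant on them. For a
parentless J the function b - `topJump b` has zero difference at J, so its oscillation on J is glued
from the oscillations on the children, which do have a parent. -/
lemma eLpNorm_oscillation_sub_topJump_le (hp : 0 < p) {b : ℝ → 𝕜} (hb : L.LocIntegrable b)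
    {D : ℝ≥0∞} (hosc : ∀ (J : L.Interval), (J : Set ℝ) ∉ L.finLimitIntervals →
      ∀ m : ℤ, (J : Set ℝ) ∈ L.gen m → ∀ n : ℕ,
      eLpNorm (fun x => L.cellAvg (m + n) b x - L.cellAvg m b x) (ENNReal.ofReal p)
        (volume.restrict (J : Set ℝ)) ≤ D * volume (J : Set ℝ) ^ (1 / p))
    (J : L.Interval) (m : ℤ) (hm : (J : Set ℝ) ∈ L.gen m) (n : ℕ) :
    eLpNorm (fun x => L.cellAvg (m + n) (b - L.topJump b) x - L.cellAvg m (b - L.topJump b) x)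
      (ENNReal.ofReal p) (volume.restrict (J : Set ℝ)) ≤ D * volume (J : Set ℝ) ^ (1 / p) := by
  have hosc' : ∀ (J : L.Interval), (J : Set ℝ) ∉ L.finLimitIntervals →
      ∀ m : ℤ, (J : Set ℝ) ∈ L.gen m → ∀ n : ℕ,
      eLpNorm (fun x => L.cellAvg (m + n) (b - L.topJump b) x - L.cellAvg m (b - L.topJump b) x)
        (ENNReal.ofReal p) (volume.restrict (J : Set ℝ)) ≤
        D * volume (J : Set ℝ) ^ (1 / p) := fun J hJ m hm n => by
    refine le_trans (le_of_eq ?_) (hosc J hJ m hm n)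
    exact eLpNorm_congr_ae ((ae_restrict_iff' J.measurableSet).2
      (Filter.Eventually.of_forall fun x hx => cellAvg_sub_topJump hb hJ hm n hx))
  by_cases hJ : (J : Set ℝ) ∈ L.finLimitIntervals
  swap
  · exact hosc' J hJ m hm n
  set b₀ := b - L.topJump b with hb₀
  have hb₀i : L.LocIntegrable b₀ := fun I => (hb I).sub (locIntegrable_topJump b I)
  by_cases hmn : (J : Set ℝ) ∈ L.gen (m + n)
  · have h0 : ∀ x ∈ (J : Set ℝ), L.cellAvg (m + n) b₀ x - L.cellAvg m b₀ x = 0 := fun x hx => by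
      rw [cellAvg, cellAvg, cell_eq hmn hx, cell_eq hm hx, sub_self]
    rw [eLpNorm_congr_ae (g := fun _ => (0 : 𝕜)) ((ae_restrict_iff' J.measurableSet).2
      (Filter.Eventually.of_forall h0))]
    simp
  obtain ⟨r, hr, hmr, hrn⟩ := exists_isRank_of_notMem_gen hm (by omega) hmn
  have hchild : (L.child J).Nonempty := by
    obtain ⟨x, hx⟩ := J.nonempty
    have hxc := J.mem_carrier hx
    have hcJ : L.cell r x = J := cell_eq hr.1 hx
    have hne : L.cell (r + 1) x ≠ L.cell r x := fun h => by
      have h2 : r + 1 ≤ r := hr.2 (by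
        change (J : Set ℝ) ∈ L.gen (r + 1)
        rw [← hcJ, ← h]; exact cell_mem_gen _ hxc)
      omega
    have h3 := cellInterval_mem_child hxc hne
    have h4 : L.cellInterval r x hxc = J := Subtype.ext hcJ
    rw [h4] at h3
    exact ⟨_, h3⟩
  have h1 : ∀ M ∈ L.child J, eLpNorm (fun x => L.cellAvg (m + n) b₀ x - L.cellAvg m b₀ x)
      (ENNReal.ofReal p) (volume.restrict (M : Set ℝ)) ≤
      D * eLpNorm (fun _ : ℝ => (1 : 𝕜)) (ENNReal.ofReal p) (volume.restrict (M : Set ℝ)) := by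
    intro M hM
    have hMfin : (M : Set ℝ) ∉ L.finLimitIntervals := fun h =>
      (mem_finLimitIntervals_iff_no_parent M).1 h J hM
    have hMr : (M : Set ℝ) ∈ L.gen (r + 1) := by
      obtain ⟨k, hk, hMk, -⟩ := hM
      rwa [hr.unique hk]
    obtain ⟨l, hl⟩ := Int.le.dest (show r + 1 ≤ m + n by omega)
    rw [eLpNorm_const_restrict hp _ _ M.volume_ne_zero, enorm_one, one_mul]
    refine le_trans (le_of_eq ?_) (hosc' M hMfin (r + 1) hMr l)
    refine eLpNorm_congr_ae ((ae_restrict_iff' M.measurableSet).2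
      (Filter.Eventually.of_forall fun x hx => ?_))
    beta_reduce
    have h2 := diff_apply (hb₀i J) hM hx
    rw [hb₀, diff_sub_topJump hb, tildeDiff, if_pos hJ, ← hb₀] at h2
    -- After removal of the jump, the average over each child of J equals the average over J.
    have h3 : L.cellAvg (r + 1) b₀ x = L.cellAvg m b₀ x := by
      rw [cellAvg, cellAvg, cell_eq hMr hx, cell_eq hm (child_subset hM hx)]
      exact (sub_eq_zero.1 h2.symm)
    rw [hl, h3]
  have h2 := eLpNorm_restrict_le_of_forall_child hp hchild h1
  rw [eLpNorm_const_restrict hp _ _ J.volume_ne_zero, enorm_one, one_mul] at h2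
  exact h2

/-- Oscillation and difference bounds are available only for intervals with a parent. Removing
`topJump b` makes them hold for all intervals, and its differences are exactly `tildeDiff b`. -/
theorem MartingaleTransform.bmoNorm_lt_top_of_commutatorBoundedBy {T : MartingaleTransform L 𝕜}
    (hpq : p.HolderConjugate q) {b : ℝ → 𝕜} (hb : L.LocIntegrable b)
    {A ε K : ℝ≥0} (hε : 0 < ε) (hK : 0 < K) (hT : T.BlocksBounded p)
    (hA : T.CommutatorBoundedBy b p A) (hmix : ∀ I : L.Interval, ∀ J ∈ L.child I,
      T.NonDegenerate p ε K I J ∨ (p = 2 ∧ T.adjoint.NonDegenerate q ε K I J)) :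
    bmoNorm (L := L) (tildeDiff b) < ∞ := by
  obtain ⟨M, hM⟩ := exists_forall_enorm_diff_le hpq hb hε hK hT hA hmix
  have h1 : (fun I : L.Interval => diff I (b - L.topJump b)) = tildeDiff b :=
    funext fun I => diff_sub_topJump hb I
  rw [← h1]
  refine bmoNorm_lt_top_of_oscillation (D := 2 * A / ε) (M := M) hpq
    (fun I => (hb I).sub (locIntegrable_topJump b I))
    (eLpNorm_oscillation_sub_topJump_le hpq.pos hb fun J hJ m hm n => ?_) fun I x => ?_
  · rw [mem_finLimitIntervals_iff_no_parent] at hJ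
    push Not at hJ
    obtain ⟨I, hI⟩ := hJ
    exact eLpNorm_oscillation_le hpq hb hε hA hmix hI hm n
  · rw [diff_sub_topJump hb, tildeDiff]
    split_ifs with hI
    · simp
    · exact hM I hI x

end IntervalLattice

end

/-! ### Assembly of sufficiency and necessity -/

theorem mainTheorem11 (𝕜 : Type*) [RCLike 𝕜] (p q : ℝ) (hpq : p.HolderConjugate q) :
    (∃ C : ℝ≥0, ∀ (L : IntervalLattice) (T : IntervalLattice.MartingaleTransform L 𝕜)
      (b : ℝ → 𝕜),
      AEStronglyMeasurable[L.sigmaInf] b L.measure → L.LocIntegrable b →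
      T.opNorm p < ∞ →
      IntervalLattice.bmoNorm (L := L) (IntervalLattice.tildeDiff b) < ∞ →
      ∀ C₁ C₂ : ℝ≥0, T.TestingCondition b p q C₁ → T.BlockCommutatorCondition b p C₂ →
        T.CommutatorBoundedBy b p
          (C * (T.opNorm p * IntervalLattice.bmoNorm (L := L) (IntervalLattice.tildeDiff b)
            + C₁ + C₂))) ∧
    (∀ (L : IntervalLattice) (T : IntervalLattice.MartingaleTransform L 𝕜) (b : ℝ → 𝕜)
      (ε K : ℝ≥0), 0 < ε → 0 < K →
      AEStronglyMeasurable[L.sigmaInf] b L.measure → L.LocIntegrable b →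
      T.BlocksBounded p →
      (T.StronglyMixing p ε K ∨ (p = 2 ∧ T.WeaklyMixing p q ε K)) →
      (∃ A : ℝ≥0, T.CommutatorBoundedBy b p A) →
        IntervalLattice.bmoNorm (L := L) (IntervalLattice.tildeDiff b) < ∞ ∧
        (∃ C₁ : ℝ≥0, T.TestingCondition b p q C₁) ∧
        (∃ C₂ : ℝ≥0, T.BlockCommutatorCondition b p C₂)) := by
  -- Twice `transformConst` comes from the two paraproduct terms; 3 dominates the constants in 3 C₁
  -- + 2 C₂ from the jump part.
  refine ⟨⟨2 * (FiniteMartingale.transformConst p q).toNNReal + 3,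
    fun L T b hbm hb hT hB C₁ C₂ h₁ h₂ => ?_⟩,
    fun L T b ε K hε hK _ hb hT hmix ⟨A, hA⟩ => ⟨?_, ⟨2 * A, ?_⟩, ⟨2 * A, fun I _ h => ?_⟩⟩⟩
  · exact T.commutatorBoundedBy_of_bmoNorm hpq hbm hb hT hB h₁ h₂
  · refine T.bmoNorm_lt_top_of_commutatorBoundedBy hpq hb hε hK hT hA fun I J hJ => ?_
    rcases hmix with h | ⟨h2, h⟩
    · exact Or.inl (h I J hJ)
    · exact (h I J hJ).imp_right fun h' => ⟨h2, h'⟩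
  · exact IntervalLattice.MartingaleTransform.testingCondition_of_commutatorBoundedBy hpq hb hA
  · have h1 := IntervalLattice.MartingaleTransform.eLpNorm_lambda_commutator_le hpq hb hA h
    push_cast
    exact h1
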